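/- Let $\mathbf{y}\in\mathbb{R}^2$, $\beta_0\in\mathbb{R}$, $\sigma\ge\tfrac12$, $\lambda>0$. Write $p=|\mathbf{p}|$, $\widehat{f}(\mathbf{p})=\frac1{2\pi}\int_{\mathbb{R}^2}e^{-i\mathbf{p}\cdot\mathbf{x}}f(\mathbf{x})\,d\mathbf{x}$, let $K_0(\sqrt\lambda|\mathbf{x}|)$ be the inverse Fourier transform of $(p^2+\lambda)^{-1}$, let $U_0(t)=e^{i\Delta t}$ be the free Schrödinger group on $L^2(\mathbb{R}^2)$, let $\gamma$ be the Euler constant, and let $$\mathcal{I}(t)=\int_0^\infty\frac{t^{\tau-1}}{\Gamma(\tau)}\,d\tau ,\qquad t>0 .$$ Let $\psi_0\in\mathscr{D}$, that is, $\psi_0\in L^2(\mathbb{R}^2)$ and $\psi_0=\phi+\frac{q_0}{2\pi}K_0(\sqrt\lambda|\cdot-\mathbf{y}|)$ for some $q_0\in\mathbb{C}$ and some $\phi\in H^1(\mathbb{R}^2)$ such that $(1+p^{\epsilon})\,\widehat{\phi}\in L^1(\mathbb{R}^2)$ for some $\epsilon>0$. For every $\tau>0$ the function $U_0(\tau)\psi_0$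 has a continuous representative, whose value at $\mathbf{y}$ is denoted $(U_0(\tau)\psi_0)(\mathbf{y})$, and $\tau\mapsto\mathcal{I}(t-\tau)(U_0(\tau)\psi_0)(\mathbf{y})$ is integrable on $(0,t)$ for every $t>0$. For $T\in(0,\infty]$, a solution of the charge equation on $[0,T)$ is a continuous function $q:[0,T)\to\mathbb{C}$ such that for all $t\in(0,T)$ $$q(t)+4\pi\beta_0\int_0^t\mathcal{I}(t-\tau)|q(\tau)|^{2\sigma}q(\tau)\,d\tau-2\Big(\log2-\gamma+\frac{i\pi}4\Big)\int_0^t\mathcal{I}(t-\tau)q(\tau)\,d\tau=4\pi\int_0^t\mathcal{I}(t-\tau)(U_0(\tau)\psi_0)(\mathbf{y})\,d\tau .$$ Then there exist $T_*\in(0,\infty]$ and a solution $q$ of the charge equation on $[0,T_*)$ such that: 1. (uniqueness and maximality) if $\widetilde q$ is a solution on $[0,T)$ for some $T\in(0,\infty]$, then $T\le T_*$ and $\widetilde q=q$ on $[0,T)$; 2. (alternative) either $T_*=+\infty$, or $T_*<+\infty$ and $\lim_{t\to T_*^-}|q(t)|=+\infty$; 3. (Sobolev regularity) $q\in H^{1/2}(0,T)$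 for every $0<T<T_*$, that is, $q\in L^2(0,T)$ and $\displaystyle\int_0^T\!\!\int_0^T\frac{|q(t)-q(s)|^2}{|t-s|^2}\,ds\,dt<\infty$. -/

import Mathlib

open MeasureTheory Filter Topology
open scoped ENNReal FourierTransform SchwartzMap

noncomputable section

namespace PointNLS

/-- The Euclidean plane. -/
abbrev Plane : Type := EuclideanSpace ℝ (Fin 2)

/-- Complex-valued `L²` functions on the plane. -/
abbrev L2Plane : Type := Lp ℂ 2 (volume : Measure Plane)

/-! ### The Volterra function of order `-1` -/

/-- `𝓘(t) = ∫₀^∞ t^(τ - 1) / Γ(τ) dτ`. -/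
def volterraKernel (t : ℝ) : ℝ :=
  ∫ τ in Set.Ioi (0 : ℝ), t ^ (τ - 1) / Real.Gamma τ

/-! ### The free Schrödinger group

Mathlib's Fourier variable is `ξ = p / (2π)`, so that `|p| = 2π‖ξ‖`. -/

/-- The symbol `e^{-i p² t}` of `e^{iΔt}`. -/
def freeSymbol (t : ℝ) (ξ : Plane) : ℂ :=
  Complex.exp (-Complex.I * ((((2 * Real.pi * ‖ξ‖) ^ 2 * t : ℝ)) : ℂ))

theorem memLp_freeSymbol (t : ℝ) : MemLp (freeSymbol t) ∞ (volume : Measure Plane) := by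
  refine memLp_top_of_bound (Continuous.aestronglyMeasurable ?_) 1 (ae_of_all _ fun ξ => ?_)
  · unfold freeSymbol
    fun_prop
  · have h : -Complex.I * ((((2 * Real.pi * ‖ξ‖) ^ 2 * t : ℝ)) : ℂ)
        = ((-((2 * Real.pi * ‖ξ‖) ^ 2 * t) : ℝ) : ℂ) * Complex.I := by
      push_cast
      ring
    rw [freeSymbol, h, Complex.norm_exp_ofReal_mul_I]

/-- The free propagator `U₀(t) = e^{iΔt}` on `L²(ℝ²)`. -/
def freePropagator (t : ℝ) (ψ : L2Plane) : L2Plane :=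
  𝓕⁻ (((memLp_freeSymbol t).toLp (freeSymbol t)) • (𝓕 ψ : L2Plane))

/-- `u` agrees almost everywhere with a continuous function. -/
def HasContinuousRep (u : Plane → ℂ) : Prop :=
  ∃ v : Plane → ℂ, Continuous v ∧ u =ᵐ[volume] v

open scoped Classical in
/-- The value at `x` of the continuous representative of `u` (it is unique; the default value `0`
is used if there is none). -/
def pointValue (u : Plane → ℂ) (x : Plane) : ℂ :=
  if h : HasContinuousRep u then h.choose x else 0

theorem pointValue_eq {u v : Plane → ℂ} (hv : Continuous v) (huv : u =ᵐ[volume] v) (x : Plane) :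
    pointValue u x = v x := by
  have h : HasContinuousRep u := ⟨v, hv, huv⟩
  have hc : h.choose = v :=
    (Continuous.ae_eq_iff_eq volume h.choose_spec.1 hv).mp (h.choose_spec.2.symm.trans huv)
  rw [pointValue, dif_pos h, hc]

/-- `(U₀(τ)ψ)(y)`. -/
def freeEvolutionAt (ψ : L2Plane) (y : Plane) (τ : ℝ) : ℂ :=
  pointValue (freePropagator τ ψ) y

/-! ### The Green function and the initial data -/

/-- The function `p ↦ (p² + lam)⁻¹`. -/
def resolventSymbol (lam : ℝ) (ξ : Plane) : ℂ :=
  (((((2 * Real.pi * ‖ξ‖) ^ 2 + lam)⁻¹ : ℝ)) : ℂ)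

theorem memLp_resolventSymbol {lam : ℝ} (hlam : 0 < lam) :
    MemLp (resolventSymbol lam) 2 (volume : Measure Plane) := by
  have hpos : ∀ ξ : Plane, 0 < (2 * Real.pi * ‖ξ‖) ^ 2 + lam := fun ξ => by positivity
  have hcont : Continuous (resolventSymbol lam) := by
    unfold resolventSymbol
    refine Complex.continuous_ofReal.comp (Continuous.inv₀ (by fun_prop) fun ξ => (hpos ξ).ne')
  rw [memLp_two_iff_integrable_sq_norm hcont.aestronglyMeasurable]
  have hbase : Integrable (fun ξ : Plane => ((1 : ℝ) + ‖ξ‖ ^ 2) ^ (-(4 : ℝ) / 2)) :=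
    integrable_rpow_neg_one_add_norm_sq (by simp; norm_num)
  set c : ℝ := min 1 lam with hc
  have hc0 : 0 < c := lt_min one_pos hlam
  refine (hbase.const_mul ((c⁻¹) ^ 2)).mono'
    (hcont.norm.pow 2).aestronglyMeasurable (ae_of_all _ fun ξ => ?_)
  have h1 : c * (1 + ‖ξ‖ ^ 2) ≤ (2 * Real.pi * ‖ξ‖) ^ 2 + lam := by
    have hpi : 1 ≤ (2 * Real.pi) ^ 2 := by nlinarith [Real.pi_gt_three]
    have := min_le_left 1 lam
    have := min_le_right 1 lam
    have hξ : 0 ≤ ‖ξ‖ ^ 2 := by positivity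
    have e : (2 * Real.pi * ‖ξ‖) ^ 2 = (2 * Real.pi) ^ 2 * ‖ξ‖ ^ 2 := by ring
    rw [e]
    nlinarith
  have h2 : ‖resolventSymbol lam ξ‖ = ((2 * Real.pi * ‖ξ‖) ^ 2 + lam)⁻¹ := by
    rw [resolventSymbol, Complex.norm_real, Real.norm_of_nonneg (inv_nonneg.mpr (hpos ξ).le)]
  have h3 : ((1 : ℝ) + ‖ξ‖ ^ 2) ^ (-(4 : ℝ) / 2) = ((1 + ‖ξ‖ ^ 2)⁻¹) ^ 2 := by
    rw [show (-(4 : ℝ) / 2) = -((2 : ℕ) : ℝ) by norm_num, Real.rpow_neg (by positivity),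
      Real.rpow_natCast, inv_pow]
  rw [h2, h3, Real.norm_of_nonneg (by positivity), ← mul_pow, ← mul_inv]
  have h4 : 0 < c * (1 + ‖ξ‖ ^ 2) := by positivity
  gcongr

/-- The function `x ↦ K₀(√lam |x|)` as an element of `L²(ℝ²)`, namely the inverse Fourier transform
of `(p² + lam)⁻¹` in the unitary convention `f(x) = (2π)⁻¹ ∫ e^{i p·x} f^(p) dp`. The substitution
`p = 2πξ` produces the factor `2π` in front of Mathlib's inverse transform. -/
def macdonald {lam : ℝ} (hlam : 0 < lam) : L2Plane :=
  ((2 * Real.pi : ℝ) : ℂ) •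
    (𝓕⁻ ((memLp_resolventSymbol hlam).toLp (resolventSymbol lam) : L2Plane) : L2Plane)

/-- `ψ = φ + (2π)⁻¹ q K₀(√lam |· - y|)` with `φ ∈ H¹(ℝ²)`: the decomposition of an element of the
form domain into its regular part and its singular part of charge `q`. -/
def IsFormDecomposition {lam : ℝ} (hlam : 0 < lam) (y : Plane) (ψ φ : L2Plane) (q : ℂ) : Prop :=
  TemperedDistribution.MemSobolev 1 2 (φ : 𝓢'(Plane, ℂ)) ∧
    (ψ : Plane → ℂ) =ᵐ[volume]
      fun x => φ x + q / ((2 * Real.pi : ℝ) : ℂ) * macdonald hlam (x - y)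

/-- The set of admissible initial data: elements of the form domain with
`(1 + p^ε) φ^(p) ∈ L¹(ℝ²)` for some `ε > 0`, where `φ` is the regular part. -/
def initialData {lam : ℝ} (hlam : 0 < lam) (y : Plane) : Set L2Plane :=
  {ψ | ∃ (φ : L2Plane) (q : ℂ), IsFormDecomposition hlam y ψ φ q ∧
    ∃ ε : ℝ, 0 < ε ∧ Integrable (fun ξ : Plane =>
      (((1 + (2 * Real.pi * ‖ξ‖) ^ ε : ℝ)) : ℂ) * (𝓕 φ : L2Plane) ξ) volume}

/-! ### The charge equation -/

/-- `κ = -2 (log 2 - γ + iπ/4)`. -/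
def kappa : ℂ :=
  -2 * ((Real.log 2 : ℂ) - (Real.eulerMascheroniConstant : ℂ)
    + Complex.I * (Real.pi : ℂ) / 4)

/-- `|z|^(2σ) z`. -/
def powerNonlinearity (σ : ℝ) (z : ℂ) : ℂ :=
  ((‖z‖ ^ (2 * σ) : ℝ) : ℂ) * z

/-- `(I g)(t) = ∫₀ᵗ 𝓘(t - τ) g(τ) dτ`. -/
def volterraOp (g : ℝ → ℂ) (t : ℝ) : ℂ :=
  ∫ τ in (0 : ℝ)..t, (volterraKernel (t - τ) : ℂ) * g τ

/-- The real times in `[0, T)`, for `T ≤ ∞`. -/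
def timeInterval (T : EReal) : Set ℝ :=
  {t : ℝ | 0 ≤ t ∧ (t : EReal) < T}

/-- `q` is a continuous solution of the charge equation on `[0, T)`. The equation is required at
positive times; at `t = 0` every integral in it is trivially `0`, whereas its right-hand side has a
limit as `t → 0⁺` which need not vanish, and `q 0` equals that limit by continuity of `q`. -/
def IsChargeSolution (β₀ σ : ℝ) (y : Plane) (ψ₀ : L2Plane) (T : EReal) (q : ℝ → ℂ) : Prop :=
  ContinuousOn q (timeInterval T) ∧
    ∀ t ∈ timeInterval T, 0 < t →
      q t + 4 * (Real.pi : ℂ) * (β₀ : ℂ) * volterraOp (fun τ => powerNonlinearity σ (q τ)) t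
          + kappa * volterraOp q t
        = 4 * (Real.pi : ℂ) * volterraOp (freeEvolutionAt ψ₀ y) t

/-! ### Fractional Sobolev spaces on an interval -/

/-- `f ∈ H^ν(a, b)`: `f ∈ L²(a, b)` and
`∬ |f(t) - f(s)|² / |t - s|^(1 + 2ν) dt ds < ∞` over `(a, b)²`. -/
def MemHFrac (ν a b : ℝ) (f : ℝ → ℂ) : Prop :=
  MemLp f 2 (volume.restrict (Set.Ioo a b)) ∧
    ∫⁻ t in Set.Ioo a b, ∫⁻ s in Set.Ioo a b,
      ENNReal.ofReal (‖f t - f s‖ ^ 2 / |t - s| ^ (1 + 2 * ν)) < ∞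

end PointNLS

end

open MeasureTheory Filter Topology
open scoped ENNReal FourierTransform SchwartzMap

noncomputable section

namespace PointNLS


/-! ### Causal convolution on the half-line -/

/-! The datum is singular only through its Green function part, whose free evolution at `y` is
explicit. Since `(p² + λ)⁻¹` is a Laplace superposition of heat symbols, the trace at `y` equals
`h/(4π)` with `h(t) = ∫₀^∞ e^{-λs}/(s + it) ds` (`greenTrace`); the regular part contributes an
absolutely convergent oscillatory integral (`exists_freeEvolutionAt_eq`). Moreover `h(t) = -γ - log
t + r₀ + iλ ∫₀ᵗ h` with `Im r₀ = -π/2` (`exists_greenTrace_eq`). The Sonine identity `𝓘 ∗ (-γ - log)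
= 1` (`cconv_volterraCexp_logKernel`), obtained by differentiating the semigroup law of fractional
integration with respect to the order, turns the logarithm into the constant `q₀`. The charge
equation is therefore equivalent to `q = q₀ + 𝓘 ∗ (g - W(q))`, with `g` continuous and of finite
`H^{1/2}` seminorm and `W` Lipschitz on bounded sets (`charge_eq_iff`).

The Laplace transform of `𝓘` at `A` is `1 / log A`, so in the weight `e^{At}` convolution with `𝓘`
has arbitrarily small norm (`norm_volterraOp_le`). This gives uniqueness, existence for truncated
fields on any interval, and a maximal solution that is unbounded if its lifespan is finite
(`exists_maximal_isVolterraSolution`). The same weight, with Young's inequality, transports `L²`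
moduli of continuity from `g` and from the primitive of `𝓘` to `q` (`diffSq_le_of_volterra`), hence
the `H^{1/2}` regularity. For the oscillatory part of `g` the input is local smoothing, which uses
that `p²` has constant density in dimension two; for the primitive of `𝓘` it is the monotonicity of
`t 𝓘(t)`.

Unboundedness alone does not exclude that `|q|` returns to moderate values on the way to the final
time. To exclude it, put `u = e^{-iλt} q` and `e = e^{-iλt} h`. Inverting `𝓘` gives `e ∗ (u - u(0))
= ∫₀ᵗ (S - w(u))`, formally `e ∗ u' = S - w(u)` (`cconv_eKer_sub`). Because `Im r₀` equals the
imaginary part of `kappa`, the field `w` is the gradient of a real potential `G`. The kernel `e(t) =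
∫_λ^∞ e^{-iωt} dω/ω` is positive definite, so pairing with `u'` yields, formally, `energy(u' on [0,
c]) + 2 (G(u(c)) - G(u(0))) = 2 Re ∫ conj(u') S`. The pairing with `S` is controlled by half the
energy plus a constant, since the weight `λ + p²` of the data is dual to the energy weight `1/ω`.
Hence the energy of the past is bounded in terms of `u(c)` and `u(0)` alone, whatever happened in
between. As `u` need not be differentiable, this is carried out for difference quotients, with
errors killed by the `H^{1/2}` regularity along suitable small steps (`exists_energy_diffQuot_le`).

Restarting at time `a`, the increment `u(a + s) - u(a)` is a convolution of the inverse kernel of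
`e` with recent values of `S - w(u)`, minus the form evaluated on that kernel and the past of `u'`
(`restart_identity`). Cauchy–Schwarz bounds the memory term by the energy of the past and the energy
of the kernel on an interval of length `s`, which tends to `0` with `s` (`energy_restartBlock_le`).
So from any late time with `|u(a)| ≤ K` the solution cannot exceed `K + 1` for a duration depending
on `K` but not on `a`. If such times accumulate at a finite end of the lifespan, the solution is
bounded there, contrary to maximality (`exists_bound_of_frequently`). -/

open Set in
/-- The causal convolution `(f ∗ g)(t) = ∫₀ᵗ f(t - τ) g(τ) dτ`. -/
def cconv (f g : ℝ → ℂ) (t : ℝ) : ℂ := ∫ τ in (0 : ℝ)..t, f (t - τ) * g τ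

theorem cconv_comm (f g : ℝ → ℂ) (t : ℝ) : cconv f g t = cconv g f t := by
  have h := intervalIntegral.integral_comp_sub_left (fun x => f x * g (t - x)) t (a := 0) (b := t)
  simp only [sub_sub_cancel, sub_self, sub_zero] at h
  rw [cconv, h, cconv]
  exact intervalIntegral.integral_congr fun x _ => mul_comm _ _

/-- Cutting both factors off to `(0, T)` makes the causal convolution a convolution on the whole
line, so that the general results on integrability and associativity apply. -/
theorem cconv_eq_convolution (f g : ℝ → ℂ) {t T : ℝ} (ht : 0 < t) (hT : t ≤ T) :
    cconv f g t = convolution ((Set.Ioo 0 T).indicator f) ((Set.Ioo 0 T).indicator g)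
      (ContinuousLinearMap.mul ℂ ℂ) volume t := by
  rw [convolution_mul, cconv_comm, cconv, intervalIntegral.integral_of_le ht.le,
    integral_Ioc_eq_integral_Ioo, ← integral_indicator measurableSet_Ioo]
  refine integral_congr_ae (ae_of_all _ fun s => ?_)
  by_cases hs : s ∈ Set.Ioo 0 t
  · have h1 : s ∈ Set.Ioo 0 T := ⟨hs.1, hs.2.trans_le hT⟩
    have h2 : t - s ∈ Set.Ioo 0 T := ⟨by linarith [hs.2], by linarith [hs.1]⟩
    simp [Set.indicator_of_mem, hs, h1, h2, mul_comm]
  · simp only [Set.indicator_of_notMem hs]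
    by_cases h1 : s ∈ Set.Ioo 0 T
    · have h2 : t - s ∉ Set.Ioo 0 T := fun h => hs ⟨h1.1, by linarith [h.1]⟩
      simp [Set.indicator_of_notMem h2]
    · simp [Set.indicator_of_notMem h1]

theorem convolution_indicator_eq_zero (f g : ℝ → ℂ) {t T : ℝ} (ht : t ≤ 0) :
    convolution ((Set.Ioo 0 T).indicator f) ((Set.Ioo 0 T).indicator g)
      (ContinuousLinearMap.mul ℂ ℂ) volume t = 0 := by
  rw [convolution_mul]
  refine integral_eq_zero_of_ae (ae_of_all _ fun s => ?_)
  by_cases h1 : s ∈ Set.Ioo 0 T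
  · have h2 : t - s ∉ Set.Ioo 0 T := fun h => by linarith [h.1, h1.1]
    simp [Set.indicator_of_notMem h2]
  · simp [Set.indicator_of_notMem h1]

theorem integrableOn_cconv {f g : ℝ → ℂ} {T : ℝ} (hf : IntegrableOn f (Set.Ioo 0 T))
    (hg : IntegrableOn g (Set.Ioo 0 T)) : IntegrableOn (cconv f g) (Set.Ioo 0 T) := by
  have h := (hf.integrable_indicator measurableSet_Ioo).integrable_convolution
    (ContinuousLinearMap.mul ℂ ℂ) (hg.integrable_indicator measurableSet_Ioo)
  exact h.integrableOn.congr_fun (fun t ht => (cconv_eq_convolution f g ht.1 ht.2.le).symm)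
    measurableSet_Ioo

theorem cconv_congr_left {f f' g : ℝ → ℂ} {t : ℝ} (ht : 0 ≤ t)
    (h : ∀ x ∈ Set.Ioo 0 t, f x = f' x) : cconv f g t = cconv f' g t := by
  rw [cconv, cconv, intervalIntegral.integral_of_le ht, intervalIntegral.integral_of_le ht,
    integral_Ioc_eq_integral_Ioo, integral_Ioc_eq_integral_Ioo]
  refine setIntegral_congr_fun measurableSet_Ioo fun x hx => ?_
  rw [h (t - x) ⟨by linarith [hx.2], by linarith [hx.1]⟩]

theorem cconv_congr_right {f g g' : ℝ → ℂ} {t : ℝ} (ht : 0 ≤ t)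
    (h : ∀ x ∈ Set.Ioo 0 t, g x = g' x) : cconv f g t = cconv f g' t := by
  rw [cconv_comm f g, cconv_comm f g', cconv_congr_left ht h]

/-- Integrability of all three factors would give associativity only at almost every time;
boundedness of the third makes the triple integral converge at the given `t`, so the identity is
pointwise. -/
theorem cconv_assoc {f g m : ℝ → ℂ} {t C : ℝ} (ht : 0 < t) (hf : IntegrableOn f (Set.Ioo 0 t))
    (hg : IntegrableOn g (Set.Ioo 0 t))
    (hm : AEStronglyMeasurable m (volume.restrict (Set.Ioo 0 t)))
    (hC : ∀ x ∈ Set.Ioo 0 t, ‖m x‖ ≤ C) :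
    cconv (cconv f g) m t = cconv f (cconv g m) t := by
  set I := Set.Ioo 0 t with hI
  have hf' := hf.integrable_indicator measurableSet_Ioo
  have hg' := hg.integrable_indicator measurableSet_Ioo
  have hC0 : 0 ≤ C := (norm_nonneg _).trans (hC (t / 2) ⟨by linarith, by linarith⟩)
  have hbd : ∀ x, ‖I.indicator m x‖ ≤ C := fun x => by
    by_cases hx : x ∈ I
    · rw [Set.indicator_of_mem hx]; exact hC x hx
    · rw [Set.indicator_of_notMem hx, norm_zero]; exact hC0
  have hmi : IntegrableOn m I :=
    Integrable.of_bound hm C ((ae_restrict_iff' measurableSet_Ioo).2 (ae_of_all _ hC))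
  have hm' := hmi.integrable_indicator measurableSet_Ioo
  have key := convolution_assoc (x₀ := t) (f := I.indicator f) (g := I.indicator g)
    (k := I.indicator m) (μ := volume) (ν := volume)
    (ContinuousLinearMap.mul ℂ ℂ) (ContinuousLinearMap.mul ℂ ℂ) (ContinuousLinearMap.mul ℂ ℂ)
    (ContinuousLinearMap.mul ℂ ℂ) (fun x y z => by simp [mul_assoc])
    hf'.aestronglyMeasurable hg'.aestronglyMeasurable hm'.aestronglyMeasurable
    (hf'.ae_convolution_exists _ hg') (hg'.norm.ae_convolution_exists _ hm'.norm) (by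
      refine (hf'.norm.mul_const ((∫ x, ‖I.indicator g x‖) * C)).mono'
        (hf'.norm.aestronglyMeasurable.convolution_integrand_snd _
          (hg'.norm.integrable_convolution _ hm'.norm).aestronglyMeasurable t)
        (ae_of_all _ fun s => ?_)
      rw [ContinuousLinearMap.mul_apply', norm_mul, norm_norm]
      refine mul_le_mul_of_nonneg_left ?_ (norm_nonneg _)
      rw [convolution_mul, ← integral_mul_const]
      refine (norm_integral_le_integral_norm _).trans (integral_mono_of_nonneg
        (ae_of_all _ fun _ => norm_nonneg _) (hg'.norm.mul_const _) (ae_of_all _ fun x => ?_))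
      simp only [norm_mul, norm_norm]
      exact mul_le_mul_of_nonneg_left (hbd _) (norm_nonneg _))
  rw [cconv_eq_convolution _ _ ht le_rfl, cconv_eq_convolution _ _ ht le_rfl, ← hI]
  -- The cutoff leaves the inner convolution unchanged before `t`; at later times it is multiplied
  -- by a factor that vanishes.
  have e2 : ∀ x < t, I.indicator (cconv g m) x =
      convolution (I.indicator g) (I.indicator m) (ContinuousLinearMap.mul ℂ ℂ) volume x := by
    intro x hx
    by_cases h0 : 0 < x
    · rw [Set.indicator_of_mem (show x ∈ I from ⟨h0, hx⟩)]
      exact cconv_eq_convolution g m h0 (le_of_lt hx)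
    · rw [Set.indicator_of_notMem (fun h : x ∈ I => h0 h.1),
        convolution_indicator_eq_zero g m (not_lt.1 h0)]
  have e1' : ∀ x < t, I.indicator (cconv f g) x =
      convolution (I.indicator f) (I.indicator g) (ContinuousLinearMap.mul ℂ ℂ) volume x := by
    intro x hx
    by_cases h0 : 0 < x
    · rw [Set.indicator_of_mem (show x ∈ I from ⟨h0, hx⟩)]
      exact cconv_eq_convolution f g h0 (le_of_lt hx)
    · rw [Set.indicator_of_notMem (fun h : x ∈ I => h0 h.1),
        convolution_indicator_eq_zero f g (not_lt.1 h0)]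
  calc _ = convolution (convolution (I.indicator f) (I.indicator g)
        (ContinuousLinearMap.mul ℂ ℂ) volume) (I.indicator m)
        (ContinuousLinearMap.mul ℂ ℂ) volume t := by
        rw [convolution_mul, convolution_mul]
        refine integral_congr_ae (ae_of_all _ fun x => ?_)
        rcases lt_or_ge x t with hx | hx
        · simp only [e1' x hx]
        · have : t - x ∉ I := fun h => by linarith [h.1]
          simp only [Set.indicator_of_notMem this, mul_zero]
    _ = _ := key
    _ = _ := by
        rw [convolution_mul, convolution_mul]
        refine integral_congr_ae (ae_of_all _ fun x => ?_)
        rcases lt_or_ge 0 x with hx | hx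
        · simp only [e2 (t - x) (by linarith)]
        · have : x ∉ I := fun h => by linarith [h.1]
          simp only [Set.indicator_of_notMem this, zero_mul]

/-- Functions on the half-line that are integrable near `0` and bounded on compact subsets of
`(0, ∞)`. -/
structure IsLocKernel (f : ℝ → ℂ) : Prop where
  meas : AEStronglyMeasurable f (volume.restrict (Set.Ioi 0))
  int : ∀ T : ℝ, IntegrableOn f (Set.Ioo 0 T)
  bdd : ∀ a b : ℝ, 0 < a → ∃ C, ∀ t ∈ Set.Icc a b, ‖f t‖ ≤ C

namespace IsLocKernel

theorem of_continuousOn {f : ℝ → ℂ} (hf : ContinuousOn f (Set.Ioi 0))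
    (hi : ∀ T : ℝ, IntegrableOn f (Set.Ioo 0 T)) : IsLocKernel f where
  meas := hf.aestronglyMeasurable measurableSet_Ioi
  int := hi
  bdd _ _ ha := isCompact_Icc.exists_bound_of_continuousOn
    (hf.mono fun _ hx => lt_of_lt_of_le ha hx.1)

theorem of_continuous {f : ℝ → ℂ} (hf : Continuous f) : IsLocKernel f :=
  of_continuousOn hf.continuousOn fun _ =>
    (hf.integrableOn_Icc).mono_set Set.Ioo_subset_Icc_self

theorem const_mul {f : ℝ → ℂ} (hf : IsLocKernel f) (c : ℂ) : IsLocKernel (fun t => c * f t) where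
  meas := hf.meas.const_mul c
  int T := (hf.int T).const_mul c
  bdd a b ha := by
    obtain ⟨C, hC⟩ := hf.bdd a b ha
    exact ⟨‖c‖ * C, fun t ht => by
      rw [norm_mul]; exact mul_le_mul_of_nonneg_left (hC t ht) (norm_nonneg _)⟩

theorem add {f g : ℝ → ℂ} (hf : IsLocKernel f) (hg : IsLocKernel g) :
    IsLocKernel (fun t => f t + g t) where
  meas := hf.meas.add hg.meas
  int T := (hf.int T).add (hg.int T)
  bdd a b ha := by
    obtain ⟨C, hC⟩ := hf.bdd a b ha
    obtain ⟨D, hD⟩ := hg.bdd a b ha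
    exact ⟨C + D, fun t ht => norm_add_le_of_le (hC t ht) (hD t ht)⟩

theorem mono {f g : ℝ → ℂ} (hf : IsLocKernel f)
    (hm : AEStronglyMeasurable g (volume.restrict (Set.Ioi 0))) (h : ∀ t, 0 < t → ‖g t‖ ≤ ‖f t‖) :
    IsLocKernel g where
  meas := hm
  int T := by
    refine Integrable.mono (hf.int T) (hm.mono_set fun x hx => hx.1) ?_
    exact (ae_restrict_iff' measurableSet_Ioo).2 (ae_of_all _ fun x hx => h x hx.1)
  bdd a b ha := by
    obtain ⟨C, hC⟩ := hf.bdd a b ha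
    exact ⟨C, fun t ht => (h t (lt_of_lt_of_le ha ht.1)).trans (hC t ht)⟩

/-- The integrand of a causal convolution of two such functions is integrable. -/
theorem intervalIntegrable_mul {f g : ℝ → ℂ} (hf : IsLocKernel f) (hg : IsLocKernel g) {t : ℝ}
    (ht : 0 < t) : IntervalIntegrable (fun τ => f (t - τ) * g τ) volume 0 t := by
  -- On the first half of the interval `f (t - τ)` stays away from its singularity and is bounded,
  -- while `g` is integrable; reflection exchanges the roles on the second half.
  have half : ∀ {f g : ℝ → ℂ}, IsLocKernel f → IsLocKernel g →
      IntervalIntegrable (fun τ => f (t - τ) * g τ) volume 0 (t / 2) := by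
    intro f g hf hg
    obtain ⟨C, hC⟩ := hf.bdd (t / 2) t (by linarith)
    rw [intervalIntegrable_iff_integrableOn_Ioo_of_le (by linarith)]
    refine Integrable.bdd_mul (c := C) (hg.int _) ?_ ?_
    · have hmp : Measure.QuasiMeasurePreserving (fun τ : ℝ => t - τ)
          (volume.restrict (Set.Ioo 0 (t / 2))) (volume.restrict (Set.Ioi 0)) := by
        refine ⟨by fun_prop, ?_⟩
        have h := (Measure.measurePreserving_sub_left (volume : Measure ℝ) t)
        rw [show Set.Ioo 0 (t / 2) = (fun τ : ℝ => t - τ) ⁻¹' (Set.Ioo (t / 2) t) by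
          ext x; simp only [Set.mem_preimage, Set.mem_Ioo]; constructor <;> rintro ⟨h1, h2⟩ <;>
            constructor <;> linarith]
        rw [(h.restrict_preimage measurableSet_Ioo).map_eq]
        exact (Measure.restrict_mono (fun x hx => by
          have := hx.1; simp only [Set.mem_Ioi]; linarith) le_rfl).absolutelyContinuous
      exact hf.meas.comp_quasiMeasurePreserving hmp
    · exact (ae_restrict_iff' measurableSet_Ioo).2 (ae_of_all _ fun x hx =>
        hC _ ⟨by linarith [hx.2], by linarith [hx.1]⟩)
  refine (half hf hg).trans ?_
  have h := (half hg hf).comp_sub_left t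
  simp only [sub_sub_cancel, sub_zero] at h
  have e : t - t / 2 = t / 2 := by ring
  rw [e] at h
  exact (h.symm).congr fun x _ => mul_comm _ _

end IsLocKernel

/-! ### Volterra functions -/

/-- `t^(a - 1) / Γ(a)`, the kernel of the fractional integral of order `a`. -/
def fracKernel (a t : ℝ) : ℝ := t ^ (a - 1) * (Real.Gamma a)⁻¹

/-- `∫₀^∞ e^{x a} t^(a - 1) / Γ(a) da`. -/
def volterraExp (x t : ℝ) : ℝ := ∫ a in Set.Ioi (0 : ℝ), Real.exp (x * a) * fracKernel a t

/-- `∫₀^∞ e^{c a} t^(a - 1) / Γ(a) da` with a complex exponent. -/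
def volterraCexp (c : ℂ) (t : ℝ) : ℂ :=
  ∫ a in Set.Ioi (0 : ℝ), Complex.exp (c * a) * (fracKernel a t : ℂ)

theorem volterraKernel_eq (t : ℝ) : volterraKernel t = volterraExp 0 t := by
  simp [volterraKernel, volterraExp, fracKernel, div_eq_mul_inv]

/-- `1/Γ` is entire, so the poles of `Γ` need no separate treatment. -/
theorem continuous_inv_Gamma : Continuous fun a : ℝ => (Real.Gamma a)⁻¹ := by
  have h : (fun a : ℝ => (Real.Gamma a)⁻¹) = fun a : ℝ => ((Complex.Gamma (a : ℂ))⁻¹).re := by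
    ext a
    rw [Complex.Gamma_ofReal, ← Complex.ofReal_inv, Complex.ofReal_re]
  rw [h]
  exact Complex.continuous_re.comp
    (Complex.differentiable_one_div_Gamma.continuous.comp Complex.continuous_ofReal)

theorem measurable_fracKernel : Measurable fun p : ℝ × ℝ => fracKernel p.1 p.2 := by
  unfold fracKernel
  exact (measurable_snd.pow (measurable_fst.sub_const 1)).mul
    (continuous_inv_Gamma.measurable.comp measurable_fst)

theorem fracKernel_pos {a t : ℝ} (ha : 0 < a) (ht : 0 < t) : 0 < fracKernel a t :=
  mul_pos (Real.rpow_pos_of_pos ht _) (inv_pos.2 (Real.Gamma_pos_of_pos ha))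

theorem fracKernel_one {t : ℝ} : fracKernel 1 t = 1 := by simp [fracKernel]

theorem lintegral_exp_neg_mul_fracKernel {a s : ℝ} (ha : 0 < a) (hs : 0 < s) :
    ∫⁻ t in Set.Ioi (0 : ℝ), ENNReal.ofReal (Real.exp (-(s * t)) * fracKernel a t)
      = ENNReal.ofReal (s ^ (-a)) := by
  have h := Real.integral_rpow_mul_exp_neg_mul_Ioi ha hs
  have hpos : (0 : ℝ) < (1 / s) ^ a * Real.Gamma a :=
    mul_pos (Real.rpow_pos_of_pos (by positivity) _) (Real.Gamma_pos_of_pos ha)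
  have hint : IntegrableOn (fun t : ℝ => t ^ (a - 1) * Real.exp (-(s * t))) (Set.Ioi 0) := by
    by_contra hc
    rw [integral_undef hc] at h
    exact hpos.ne h
  have e : ∀ t : ℝ, Real.exp (-(s * t)) * fracKernel a t =
      (Real.Gamma a)⁻¹ * (t ^ (a - 1) * Real.exp (-(s * t))) := fun t => by
    rw [fracKernel]; ring
  simp_rw [e]
  rw [← ofReal_integral_eq_lintegral_ofReal (hint.const_mul _), integral_const_mul, h]
  · congr 1
    rw [one_div, Real.inv_rpow hs.le, Real.rpow_neg hs.le]
    field_simp [(Real.Gamma_pos_of_pos ha).ne']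
  · refine (ae_restrict_iff' measurableSet_Ioi).2 (ae_of_all _ fun t (ht : 0 < t) => ?_)
    exact mul_nonneg (inv_nonneg.2 (Real.Gamma_pos_of_pos ha).le)
      (mul_nonneg (Real.rpow_nonneg ht.le _) (Real.exp_pos _).le)

/-- Tonelli: the kernel of order `a` has Laplace transform `s^(-a)`, and `e^{xa} s^{-a}` is
integrable in `a` once `x < log s`. Integrability of the Volterra functions and all contraction
constants come from this value. -/
theorem lintegral_lintegral_fracKernel {x s : ℝ} (hs : 0 < s) (hx : x < Real.log s) :
    ∫⁻ t in Set.Ioi (0 : ℝ), ∫⁻ a in Set.Ioi (0 : ℝ),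
      ENNReal.ofReal (Real.exp (-(s * t)) * (Real.exp (x * a) * fracKernel a t))
      = ENNReal.ofReal (1 / (Real.log s - x)) := by
  rw [lintegral_lintegral_swap]
  · have h1 : ∀ a ∈ Set.Ioi (0 : ℝ), ∫⁻ t in Set.Ioi (0 : ℝ),
        ENNReal.ofReal (Real.exp (-(s * t)) * (Real.exp (x * a) * fracKernel a t))
        = ENNReal.ofReal (Real.exp (-(Real.log s - x) * a)) := by
      intro a ha
      have e : ∀ t : ℝ, ENNReal.ofReal (Real.exp (-(s * t)) * (Real.exp (x * a) * fracKernel a t))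
          = ENNReal.ofReal (Real.exp (x * a)) *
            ENNReal.ofReal (Real.exp (-(s * t)) * fracKernel a t) := fun t => by
        rw [← ENNReal.ofReal_mul (Real.exp_pos _).le]; congr 1; ring
      simp_rw [e]
      rw [lintegral_const_mul' _ _ ENNReal.ofReal_ne_top, lintegral_exp_neg_mul_fracKernel ha hs,
        ← ENNReal.ofReal_mul (Real.exp_pos _).le, Real.rpow_def_of_pos hs, ← Real.exp_add]
      congr 2; ring
    rw [setLIntegral_congr_fun measurableSet_Ioi h1]
    have hneg : -(Real.log s - x) < 0 := by linarith
    rw [← ofReal_integral_eq_lintegral_ofReal (integrableOn_exp_mul_Ioi hneg 0)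
      (ae_of_all _ fun _ => (Real.exp_pos _).le), integral_exp_mul_Ioi hneg 0]
    congr 1
    simp only [mul_zero, Real.exp_zero]
    rw [neg_div_neg_eq]
  · refine (Measurable.ennreal_ofReal ?_).aemeasurable
    exact (by fun_prop : Measurable fun p : ℝ × ℝ => Real.exp (-(s * p.1))).mul
      ((by fun_prop : Measurable fun p : ℝ × ℝ => Real.exp (x * p.2)).mul
        (measurable_fracKernel.comp measurable_swap))

theorem aestronglyMeasurable_exp_mul_fracKernel (x t : ℝ) (μ : Measure ℝ) :
    AEStronglyMeasurable (fun a => Real.exp (x * a) * fracKernel a t) μ :=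
  (by fun_prop : Measurable fun a : ℝ => Real.exp (x * a)).mul
    (measurable_fracKernel.comp (by fun_prop : Measurable fun a : ℝ => (a, t)))
    |>.aestronglyMeasurable

/-- `t^(a - 1)` is monotone in `t`, in a direction decided by whether `a` exceeds `1`; the sum of
the endpoint values covers both cases. This upgrades integrability in the order from almost every
`t` to every `t > 0`. -/
theorem fracKernel_le_add {a s t b : ℝ} (ha : 0 < a) (hs : 0 < s) (hst : s ≤ t) (htb : t ≤ b) :
    fracKernel a t ≤ fracKernel a s + fracKernel a b := by
  have hG := inv_pos.2 (Real.Gamma_pos_of_pos ha)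
  rw [fracKernel, fracKernel, fracKernel, ← add_mul]
  refine mul_le_mul_of_nonneg_right ?_ hG.le
  have h1 := Real.rpow_nonneg hs.le (a - 1)
  have h2 := Real.rpow_nonneg (hs.le.trans (hst.trans htb)) (a - 1)
  rcases le_total 1 a with h | h
  · have := Real.rpow_le_rpow (hs.le.trans hst) htb (by linarith : 0 ≤ a - 1)
    linarith
  · have := Real.rpow_le_rpow_of_nonpos hs hst (by linarith : a - 1 ≤ 0)
    linarith

theorem ae_integrableOn_exp_mul_fracKernel (x : ℝ) : ∀ᵐ t ∂volume.restrict (Set.Ioi (0 : ℝ)),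
    IntegrableOn (fun a => Real.exp (x * a) * fracKernel a t) (Set.Ioi 0) := by
  -- Any `s` with `log s > x` would do; `s = e^{x+1}` makes the transform equal to `1`.
  have h := lintegral_lintegral_fracKernel (x := x) (s := Real.exp (x + 1)) (Real.exp_pos _)
    (by rw [Real.log_exp]; linarith)
  have hm : AEMeasurable (fun t : ℝ => ∫⁻ a in Set.Ioi (0 : ℝ), ENNReal.ofReal
      (Real.exp (-(Real.exp (x + 1) * t)) * (Real.exp (x * a) * fracKernel a t)))
      (volume.restrict (Set.Ioi (0 : ℝ))) := by
    refine (Measurable.lintegral_prod_right' (f := fun p : ℝ × ℝ => ENNReal.ofReal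
      (Real.exp (-(Real.exp (x + 1) * p.1)) * (Real.exp (x * p.2) * fracKernel p.2 p.1)))
      ?_).aemeasurable
    refine Measurable.ennreal_ofReal ?_
    exact (by fun_prop : Measurable fun p : ℝ × ℝ => Real.exp (-(Real.exp (x + 1) * p.1))).mul
      ((by fun_prop : Measurable fun p : ℝ × ℝ => Real.exp (x * p.2)).mul
        (measurable_fracKernel.comp measurable_swap))
  filter_upwards [ae_lt_top' hm (by rw [h]; exact ENNReal.ofReal_ne_top),
    ae_restrict_mem measurableSet_Ioi] with t ht (ht0 : 0 < t)
  have hi : IntegrableOn (fun a => Real.exp (-(Real.exp (x + 1) * t)) *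
      (Real.exp (x * a) * fracKernel a t)) (Set.Ioi 0) := by
    refine ⟨(aestronglyMeasurable_exp_mul_fracKernel x t _).const_mul _, ?_⟩
    rw [hasFiniteIntegral_iff_ofReal]
    · exact ht
    · refine (ae_restrict_iff' measurableSet_Ioi).2 (ae_of_all _ fun a (ha : 0 < a) => ?_)
      exact mul_nonneg (Real.exp_pos _).le
        (mul_nonneg (Real.exp_pos _).le (fracKernel_pos ha ht0).le)
  have := hi.const_mul (Real.exp (-(Real.exp (x + 1) * t)))⁻¹
  refine this.congr (ae_of_all _ fun a => ?_)
  simp only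
  rw [inv_mul_cancel_left₀ (Real.exp_pos _).ne']

theorem exists_integrableOn_exp_mul_fracKernel (x : ℝ) {a b : ℝ} (ha : 0 ≤ a) (hab : a < b) :
    ∃ t ∈ Set.Ioo a b, IntegrableOn (fun a => Real.exp (x * a) * fracKernel a t) (Set.Ioi 0) := by
  have h := ae_restrict_of_ae_restrict_of_subset
    (show Set.Ioo a b ⊆ Set.Ioi 0 from fun y hy => lt_of_le_of_lt ha hy.1)
    (ae_integrableOn_exp_mul_fracKernel x)
  have hne : (ae (volume.restrict (Set.Ioo a b))).NeBot := by
    rw [ae_neBot, Ne, Measure.restrict_eq_zero]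
    simp [hab]
  obtain ⟨t, h1, h2⟩ := (h.and (ae_restrict_mem measurableSet_Ioo)).exists
  exact ⟨t, h2, h1⟩

theorem integrableOn_exp_mul_fracKernel (x : ℝ) {t : ℝ} (ht : 0 < t) :
    IntegrableOn (fun a => Real.exp (x * a) * fracKernel a t) (Set.Ioi 0) := by
  obtain ⟨s, hs, hs'⟩ := exists_integrableOn_exp_mul_fracKernel x le_rfl ht
  obtain ⟨b, hb, hb'⟩ := exists_integrableOn_exp_mul_fracKernel x ht.le (lt_add_one t)
  refine (hs'.add hb').mono' (aestronglyMeasurable_exp_mul_fracKernel x t _) ?_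
  refine (ae_restrict_iff' measurableSet_Ioi).2 (ae_of_all _ fun a (ha : 0 < a) => ?_)
  rw [Real.norm_of_nonneg (mul_nonneg (Real.exp_pos _).le (fracKernel_pos ha ht).le),
    Pi.add_apply, ← mul_add]
  exact mul_le_mul_of_nonneg_left (fracKernel_le_add ha hs.1 hs.2.le hb.1.le) (Real.exp_pos _).le

theorem volterraExp_pos (x : ℝ) {t : ℝ} (ht : 0 < t) : 0 < volterraExp x t := by
  rw [volterraExp, setIntegral_pos_iff_support_of_nonneg_ae]
  · have : Function.support (fun a => Real.exp (x * a) * fracKernel a t) ∩ Set.Ioi 0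
        = Set.Ioi 0 := by
      refine Set.inter_eq_right.2 fun a ha => ?_
      exact (mul_pos (Real.exp_pos _) (fracKernel_pos ha ht)).ne'
    rw [this]; simp
  · refine (ae_restrict_iff' measurableSet_Ioi).2 (ae_of_all _ fun a (ha : 0 < a) => ?_)
    exact (mul_pos (Real.exp_pos _) (fracKernel_pos ha ht)).le
  · exact integrableOn_exp_mul_fracKernel x ht

theorem volterraExp_le_add (x : ℝ) {s t b : ℝ} (hs : 0 < s) (hst : s ≤ t) (htb : t ≤ b) :
    volterraExp x t ≤ volterraExp x s + volterraExp x b := by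
  have ht := hs.trans_le hst
  rw [volterraExp, volterraExp, volterraExp, ← integral_add (integrableOn_exp_mul_fracKernel x hs)
    (integrableOn_exp_mul_fracKernel x (ht.trans_le htb))]
  refine setIntegral_mono_on (integrableOn_exp_mul_fracKernel x ht)
    ((integrableOn_exp_mul_fracKernel x hs).add
      (integrableOn_exp_mul_fracKernel x (ht.trans_le htb))) measurableSet_Ioi fun a ha => ?_
  rw [← mul_add]
  exact mul_le_mul_of_nonneg_left (fracKernel_le_add ha hs hst htb) (Real.exp_pos _).le

/-- `t ↦ t 𝓘(t)` is nondecreasing. -/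
theorem mul_volterraExp_mono (x : ℝ) {s t : ℝ} (hs : 0 < s) (hst : s ≤ t) :
    s * volterraExp x s ≤ t * volterraExp x t := by
  have ht := hs.trans_le hst
  rw [volterraExp, volterraExp, ← integral_const_mul, ← integral_const_mul]
  refine setIntegral_mono_on ((integrableOn_exp_mul_fracKernel x hs).const_mul _)
    ((integrableOn_exp_mul_fracKernel x ht).const_mul _) measurableSet_Ioi fun a (ha : 0 < a) => ?_
  have e : ∀ r : ℝ, 0 < r → r * (Real.exp (x * a) * fracKernel a r)
      = Real.exp (x * a) * (Real.Gamma a)⁻¹ * r ^ a := fun r hr => by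
    rw [fracKernel, Real.rpow_sub_one hr.ne']; field_simp
  rw [e s hs, e t ht]
  exact mul_le_mul_of_nonneg_left (Real.rpow_le_rpow hs.le hst ha.le)
    (mul_nonneg (Real.exp_pos _).le (inv_pos.2 (Real.Gamma_pos_of_pos ha)).le)

theorem stronglyMeasurable_volterraExp (x : ℝ) : StronglyMeasurable (volterraExp x) := by
  refine StronglyMeasurable.integral_prod_right'
    (f := fun p : ℝ × ℝ => Real.exp (x * p.2) * fracKernel p.2 p.1) ?_
  exact ((by fun_prop : Measurable fun p : ℝ × ℝ => Real.exp (x * p.2)).mul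
    (measurable_fracKernel.comp measurable_swap)).stronglyMeasurable

theorem lintegral_exp_neg_mul_volterraExp {x s : ℝ} (hs : 0 < s) (hx : x < Real.log s) :
    ∫⁻ t in Set.Ioi (0 : ℝ), ENNReal.ofReal (Real.exp (-(s * t)) * volterraExp x t)
      = ENNReal.ofReal (1 / (Real.log s - x)) := by
  rw [← lintegral_lintegral_fracKernel hs hx]
  refine setLIntegral_congr_fun measurableSet_Ioi fun t (ht : 0 < t) => ?_
  rw [volterraExp, ← integral_const_mul, ofReal_integral_eq_lintegral_ofReal
    ((integrableOn_exp_mul_fracKernel x ht).const_mul _)]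
  refine (ae_restrict_iff' measurableSet_Ioi).2 (ae_of_all _ fun a (ha : 0 < a) => ?_)
  exact mul_nonneg (Real.exp_pos _).le (mul_pos (Real.exp_pos _) (fracKernel_pos ha ht)).le

theorem integrableOn_exp_neg_mul_volterraExp {x s : ℝ} (hs : 0 < s) (hx : x < Real.log s) :
    IntegrableOn (fun t => Real.exp (-(s * t)) * volterraExp x t) (Set.Ioi 0) := by
  refine ⟨((by fun_prop : Measurable fun t : ℝ => Real.exp (-(s * t))).mul
    (stronglyMeasurable_volterraExp x).measurable).aestronglyMeasurable, ?_⟩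
  rw [hasFiniteIntegral_iff_ofReal, lintegral_exp_neg_mul_volterraExp hs hx]
  · exact ENNReal.ofReal_lt_top
  · refine (ae_restrict_iff' measurableSet_Ioi).2 (ae_of_all _ fun t (ht : 0 < t) => ?_)
    exact mul_nonneg (Real.exp_pos _).le (volterraExp_pos x ht).le

theorem integrableOn_volterraExp (x T : ℝ) : IntegrableOn (volterraExp x) (Set.Ioo 0 T) := by
  have h := (integrableOn_exp_neg_mul_volterraExp (x := x) (s := Real.exp (x + 1))
    (Real.exp_pos _) (by rw [Real.log_exp]; linarith)).mono_set
    (show Set.Ioo 0 T ⊆ Set.Ioi 0 from fun y hy => hy.1)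
  refine (h.const_mul (Real.exp (Real.exp (x + 1) * T))).mono'
    (stronglyMeasurable_volterraExp x).aestronglyMeasurable ?_
  refine (ae_restrict_iff' measurableSet_Ioo).2 (ae_of_all _ fun t ht => ?_)
  have hp := volterraExp_pos x ht.1
  rw [Real.norm_of_nonneg hp.le, ← mul_assoc, ← Real.exp_add]
  refine le_mul_of_one_le_left hp.le (Real.one_le_exp ?_)
  have := mul_le_mul_of_nonneg_left ht.2.le (Real.exp_pos (x + 1)).le
  linarith

theorem isLocKernel_volterraExp (x : ℝ) : IsLocKernel fun t => (volterraExp x t : ℂ) where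
  meas := (Complex.measurable_ofReal.comp
    (stronglyMeasurable_volterraExp x).measurable).aestronglyMeasurable
  int T := (integrableOn_volterraExp x T).ofReal
  bdd a b ha := ⟨volterraExp x a + volterraExp x b, fun t ht => by
    rw [Complex.norm_real, Real.norm_of_nonneg (volterraExp_pos x (ha.trans_le ht.1)).le]
    exact volterraExp_le_add x ha ht.1 ht.2⟩

theorem norm_volterraCexp_le (c : ℂ) {t : ℝ} (ht : 0 < t) :
    ‖volterraCexp c t‖ ≤ volterraExp c.re t := by
  refine (norm_integral_le_integral_norm _).trans (le_of_eq ?_)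
  refine setIntegral_congr_fun measurableSet_Ioi fun a (ha : 0 < a) => ?_
  rw [norm_mul, Complex.norm_exp, Complex.norm_real,
    Real.norm_of_nonneg (fracKernel_pos ha ht).le]
  simp

theorem stronglyMeasurable_volterraCexp (c : ℂ) : StronglyMeasurable (volterraCexp c) := by
  refine StronglyMeasurable.integral_prod_right'
    (f := fun p : ℝ × ℝ => Complex.exp (c * p.2) * (fracKernel p.2 p.1 : ℂ)) ?_
  exact ((by fun_prop : Measurable fun p : ℝ × ℝ => Complex.exp (c * p.2)).mul
    (Complex.measurable_ofReal.comp
      (measurable_fracKernel.comp measurable_swap))).stronglyMeasurable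

theorem isLocKernel_volterraCexp (c : ℂ) : IsLocKernel (volterraCexp c) :=
  (isLocKernel_volterraExp c.re).mono
    (stronglyMeasurable_volterraCexp c).aestronglyMeasurable fun t ht => by
      rw [Complex.norm_real, Real.norm_of_nonneg (volterraExp_pos _ ht).le]
      exact norm_volterraCexp_le c ht

theorem volterraCexp_ofReal (x t : ℝ) : volterraCexp x t = volterraExp x t := by
  rw [volterraCexp, volterraExp, ← integral_complex_ofReal]
  push_cast
  rfl

/-! ### Semigroup law of the fractional kernels and the Sonine identity -/

theorem rpow_le_rpow_neg_add_rpow {e d t : ℝ} (h1 : -d ≤ e) (h2 : e ≤ d) (ht : 0 < t) :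
    t ^ e ≤ t ^ (-d) + t ^ d := by
  have a1 := Real.rpow_nonneg ht.le (-d)
  have a2 := Real.rpow_nonneg ht.le d
  rcases le_total 1 t with h | h
  · have := Real.rpow_le_rpow_of_exponent_le h h2
    linarith
  · have := Real.rpow_le_rpow_of_exponent_ge ht h h1
    linarith

theorem abs_log_le_rpow_neg_add_rpow {t d : ℝ} (ht : 0 < t) (hd : 0 < d) :
    |Real.log t| ≤ (t ^ (-d) + t ^ d) / d := by
  have a1 := Real.rpow_nonneg ht.le (-d)
  have a2 := Real.rpow_nonneg ht.le d
  have h1 := Real.log_le_rpow_div ht.le hd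
  have h2 := Real.log_le_rpow_div (inv_nonneg.2 ht.le) hd
  rw [Real.log_inv, Real.inv_rpow ht.le, ← Real.rpow_neg ht.le] at h2
  rw [add_div, abs_le]
  constructor
  · have : 0 ≤ t ^ d / d := by positivity
    linarith
  · have : 0 ≤ t ^ (-d) / d := by positivity
    linarith

theorem isLocKernel_rpow {r : ℝ} (hr : -1 < r) : IsLocKernel fun t => ((t ^ r : ℝ) : ℂ) := by
  refine .of_continuousOn (Complex.continuous_ofReal.comp_continuousOn fun t ht =>
    (Real.continuousAt_rpow_const t r (Or.inl (ne_of_gt ht))).continuousWithinAt) fun T => ?_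
  rcases le_or_gt T 0 with h | h
  · simp [Set.Ioo_eq_empty (not_lt.2 h)]
  · have := (intervalIntegral.intervalIntegrable_rpow' (a := 0) (b := T) hr)
    rw [intervalIntegrable_iff_integrableOn_Ioo_of_le h.le] at this
    exact this.ofReal

/-- The Beta integral, that is, the semigroup law of fractional integration: orders add under
convolution. -/
theorem integral_fracKernel_mul {a b t : ℝ} (ha : 0 < a) (hb : 0 < b) (ht : 0 < t) :
    ∫ τ in (0 : ℝ)..t, fracKernel a (t - τ) * fracKernel b τ = fracKernel (a + b) t := by
  have h := Complex.betaIntegral_scaled b a ht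
  have hG := Complex.Gamma_mul_Gamma_eq_betaIntegral (s := b) (t := a) (by simpa) (by simpa)
  have hne : Complex.Gamma (b + a) ≠ 0 := Complex.Gamma_ne_zero_of_re_pos (by simp; positivity)
  have e1 : ∫ τ in (0 : ℝ)..t, ((fracKernel a (t - τ) * fracKernel b τ : ℝ) : ℂ)
      = (Complex.Gamma a)⁻¹ * (Complex.Gamma b)⁻¹ *
        ∫ x in (0 : ℝ)..t, (x : ℂ) ^ ((b : ℂ) - 1) * ((t : ℂ) - x) ^ ((a : ℂ) - 1) := by
    rw [← intervalIntegral.integral_const_mul]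
    refine intervalIntegral.integral_congr_ae (ae_of_all _ fun x hx => ?_)
    rw [Set.uIoc_of_le ht.le] at hx
    have h2 : 0 ≤ t - x := by linarith [hx.2]
    simp only [fracKernel]
    push_cast
    rw [Complex.ofReal_cpow hx.1.le, Complex.ofReal_cpow h2, Complex.Gamma_ofReal,
      Complex.Gamma_ofReal]
    push_cast
    ring
  rw [← Complex.ofReal_inj, ← intervalIntegral.integral_ofReal, e1, h]
  have hga : Complex.Gamma a ≠ 0 := Complex.Gamma_ne_zero_of_re_pos (by simpa)
  have hgb : Complex.Gamma b ≠ 0 := Complex.Gamma_ne_zero_of_re_pos (by simpa)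
  simp only [fracKernel]
  push_cast
  rw [Complex.ofReal_cpow ht.le, ← Complex.Gamma_ofReal]
  push_cast
  rw [add_comm (a : ℂ) b]
  have hG' : Complex.betaIntegral b a =
      Complex.Gamma b * Complex.Gamma a * (Complex.Gamma (b + a))⁻¹ := by
    rw [hG]; field_simp
  rw [hG']
  field_simp

theorem isLocKernel_fracKernel {b : ℝ} (hb : 0 < b) :
    IsLocKernel fun t => (fracKernel b t : ℂ) := by
  have := (isLocKernel_rpow (r := b - 1) (by linarith)).const_mul ((Real.Gamma b)⁻¹ : ℝ)
  refine (funext fun t => ?_ : (fun t => (fracKernel b t : ℂ)) = _) ▸ this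
  simp [fracKernel, mul_comm]

theorem integrableOn_cexp_mul_fracKernel (c : ℂ) {t : ℝ} (ht : 0 < t) :
    IntegrableOn (fun a : ℝ => Complex.exp (c * a) * (fracKernel a t : ℂ)) (Set.Ioi 0) := by
  refine (integrableOn_exp_mul_fracKernel c.re ht).mono' ?_ ?_
  · exact ((by fun_prop : Measurable fun a : ℝ => Complex.exp (c * a)).mul
      (Complex.measurable_ofReal.comp (measurable_fracKernel.comp
        (by fun_prop : Measurable fun a : ℝ => (a, t))))).aestronglyMeasurable
  · refine (ae_restrict_iff' measurableSet_Ioi).2 (ae_of_all _ fun a (ha : 0 < a) => ?_)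
    rw [norm_mul, Complex.norm_exp, Complex.norm_real,
      Real.norm_of_nonneg (fracKernel_pos ha ht).le]
    simp

theorem preimage_add_right_Ioi_self (b : ℝ) : (fun x : ℝ => x + b) ⁻¹' Set.Ioi b = Set.Ioi 0 := by
  ext x; simp

/-- The semigroup law integrated over the first order: every order is raised by `b`, so the
convolution only moves the lower limit of the integral over orders from `0` to `b`. -/
theorem cconv_volterraCexp_fracKernel (c : ℂ) {b t : ℝ} (hb : 0 < b) (ht : 0 < t) :
    cconv (volterraCexp c) (fun τ => Complex.exp (c * b) * (fracKernel b τ : ℂ)) t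
      = ∫ u in Set.Ioi b, Complex.exp (c * u) * (fracKernel u t : ℂ) := by
  set F : ℝ × ℝ → ℂ := fun p => Complex.exp (c * (p.2 + b)) *
    ((fracKernel p.2 (t - p.1) * fracKernel b p.1 : ℝ) : ℂ) with hF
  have hFm : Measurable F := by
    refine (by fun_prop : Measurable fun p : ℝ × ℝ => Complex.exp (c * (p.2 + b))).mul
      (Complex.measurable_ofReal.comp (Measurable.mul ?_ ?_))
    · exact measurable_fracKernel.comp (by fun_prop : Measurable fun p : ℝ × ℝ => (p.2, t - p.1))
    · exact measurable_fracKernel.comp (by fun_prop : Measurable fun p : ℝ × ℝ => (b, p.1))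
  have hinner : ∀ a : ℝ, 0 < a →
      IntegrableOn (fun τ => fracKernel a (t - τ) * fracKernel b τ) (Set.Ioo 0 t) := by
    intro a ha
    have := (isLocKernel_fracKernel ha).intervalIntegrable_mul (isLocKernel_fracKernel hb) ht
    rw [intervalIntegrable_iff_integrableOn_Ioo_of_le ht.le] at this
    simpa [IntegrableOn] using this.re
  have hval : ∀ a : ℝ, 0 < a →
      ∫ τ in Set.Ioo 0 t, fracKernel a (t - τ) * fracKernel b τ = fracKernel (a + b) t := by
    intro a ha
    rw [← integral_fracKernel_mul ha hb ht, intervalIntegral.integral_of_le ht.le,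
      integral_Ioc_eq_integral_Ioo]
  have hint : Integrable F
      ((volume.restrict (Set.Ioo 0 t)).prod (volume.restrict (Set.Ioi 0))) := by
    rw [integrable_prod_iff' hFm.aestronglyMeasurable]
    constructor
    · refine (ae_restrict_iff' measurableSet_Ioi).2 (ae_of_all _ fun a (ha : 0 < a) => ?_)
      exact ((hinner a ha).ofReal (𝕜 := ℂ)).const_mul (Complex.exp (c * (a + b)))
    · have hn : ∀ a ∈ Set.Ioi (0 : ℝ), Real.exp (c.re * (a + b)) * fracKernel (a + b) t
          = ∫ τ in Set.Ioo 0 t, ‖F (τ, a)‖ := by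
        intro a (ha : 0 < a)
        rw [← hval a ha, ← integral_const_mul]
        refine setIntegral_congr_fun measurableSet_Ioo fun τ hτ => ?_
        simp only [hF]
        rw [norm_mul, Complex.norm_exp, Complex.norm_real, Real.norm_of_nonneg]
        · simp
        · exact (mul_pos (fracKernel_pos ha (by linarith [hτ.2])) (fracKernel_pos hb hτ.1)).le
      refine IntegrableOn.congr_fun ?_ hn measurableSet_Ioi
      have h0 := (integrableOn_exp_mul_fracKernel c.re ht).mono_set
        (Set.Ioi_subset_Ioi hb.le)
      rw [← preimage_add_right_Ioi_self b]
      exact ((measurePreserving_add_right volume b).integrableOn_comp_preimage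
        (measurableEmbedding_addRight b)).2 h0
  have e1 : cconv (volterraCexp c) (fun τ => Complex.exp (c * b) * (fracKernel b τ : ℂ)) t
      = ∫ τ in Set.Ioo 0 t, ∫ a in Set.Ioi (0 : ℝ), F (τ, a) := by
    rw [cconv, intervalIntegral.integral_of_le ht.le, integral_Ioc_eq_integral_Ioo]
    refine setIntegral_congr_fun measurableSet_Ioo fun τ hτ => ?_
    rw [volterraCexp, ← integral_mul_const]
    refine integral_congr_ae (ae_of_all _ fun a => ?_)
    simp only [hF]
    rw [mul_add, Complex.exp_add]
    push_cast
    ring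
  rw [e1, integral_integral_swap hint]
  have e2 : ∀ a ∈ Set.Ioi (0 : ℝ), ∫ τ in Set.Ioo 0 t, F (τ, a)
      = (fun u : ℝ => Complex.exp (c * u) * (fracKernel u t : ℂ)) (a + b) := by
    intro a (ha : 0 < a)
    simp only [hF]
    rw [integral_const_mul, integral_complex_ofReal, hval a ha]
    push_cast
    rfl
  rw [setIntegral_congr_fun measurableSet_Ioi e2]
  rw [← preimage_add_right_Ioi_self b]
  exact (measurePreserving_add_right volume b).setIntegral_preimage_emb
    (measurableEmbedding_addRight b) (fun u : ℝ => Complex.exp (c * u) * (fracKernel u t : ℂ)) _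

/-- The logarithmic kernel `-γ - log t - c`, the Sonine partner of `volterraCexp c`. -/
def logKernel (c : ℂ) (t : ℝ) : ℂ :=
  -(Real.eulerMascheroniConstant : ℂ) - (Real.log t : ℂ) - c

theorem isLocKernel_log_bound {K d : ℝ} (hd0 : 0 < d) (hd : d < 1) :
    IsLocKernel fun t => (((K * (t ^ (-d) + t ^ d) : ℝ)) : ℂ) := by
  have := ((isLocKernel_rpow (r := -d) (by linarith)).add
    (isLocKernel_rpow (r := d) (by linarith))).const_mul K
  refine (funext fun t => ?_ : (fun t => (((K * (t ^ (-d) + t ^ d) : ℝ)) : ℂ)) = _) ▸ this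
  push_cast; ring

theorem isLocKernel_logKernel (c : ℂ) : IsLocKernel (logKernel c) := by
  have h1 : IsLocKernel fun t => (Real.log t : ℂ) := by
    refine (isLocKernel_log_bound (K := 2) (d := 1 / 2) (by norm_num) (by norm_num)).mono
      (Complex.measurable_ofReal.comp Real.measurable_log).aestronglyMeasurable fun t ht => ?_
    have h := abs_log_le_rpow_neg_add_rpow ht (d := 1 / 2) (by norm_num)
    rw [Complex.norm_real, Complex.norm_real, Real.norm_eq_abs, Real.norm_eq_abs]
    refine le_trans h (le_trans (le_of_eq ?_) (le_abs_self _))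
    ring
  have h2 := (IsLocKernel.of_continuous (f := fun _ =>
    -(Real.eulerMascheroniConstant : ℂ) - c) continuous_const).add (h1.const_mul (-1))
  refine (funext fun t => ?_ : logKernel c = _) ▸ h2
  rw [logKernel]; ring

/-- The Sonine identity for the Volterra functions. -/
theorem cconv_volterraCexp_logKernel (c : ℂ) {t : ℝ} (ht : 0 < t) :
    cconv (volterraCexp c) (logKernel c) t = 1 := by
  -- The identity `cconv_volterraCexp_fracKernel` is differentiated in `b` at `b = 1`. Since
  -- `(1/Γ)'(1) = γ`, the derivative of `φ(b) τ^(b-1)` is `e^c (c + γ + log τ) = -e^c logKernel c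
  -- τ`; the integral over orders above `b` has derivative minus its integrand at `1`, which is
  -- `-e^c`.
  set φ : ℂ → ℂ := fun b => Complex.exp (c * b) * (Complex.Gamma b)⁻¹ with hφ
  have hφd : Differentiable ℂ φ := by
    refine Differentiable.mul (by fun_prop) Complex.differentiable_one_div_Gamma
  have hφ1 : φ 1 = Complex.exp c := by simp [hφ]
  have hφ1' : deriv φ 1 = Complex.exp c * (c + Real.eulerMascheroniConstant) := by
    have hG : HasDerivAt (fun b : ℂ => (Complex.Gamma b)⁻¹)
        (Real.eulerMascheroniConstant : ℂ) 1 := by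
      have := Complex.hasDerivAt_Gamma_one.inv (by simp)
      rw [Complex.Gamma_one,
        show - -(Real.eulerMascheroniConstant : ℂ) / 1 ^ 2 = Real.eulerMascheroniConstant by
          simp] at this
      exact this
    have hE : HasDerivAt (fun b : ℂ => Complex.exp (c * b)) (Complex.exp (c * 1) * (c * 1)) 1 :=
      ((hasDerivAt_id (1 : ℂ)).const_mul c).cexp
    have h := (hE.mul hG).deriv
    rw [show φ = (fun b : ℂ => Complex.exp (c * b)) * fun b : ℂ => (Complex.Gamma b)⁻¹ from rfl, h]
    simp
    ring
  obtain ⟨K, hK0, hK⟩ : ∃ K : ℝ, 0 ≤ K ∧ ∀ b ∈ Set.Icc (1 / 2 : ℝ) (3 / 2),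
      ‖φ b‖ ≤ K ∧ ‖deriv φ b‖ ≤ K := by
    have c1 : Continuous fun b : ℝ => φ b := hφd.continuous.comp Complex.continuous_ofReal
    have c2 : Continuous fun b : ℝ => deriv φ b :=
      ((hφd.contDiff (n := 1)).continuous_deriv le_rfl).comp Complex.continuous_ofReal
    obtain ⟨A, hA⟩ := isCompact_Icc.exists_bound_of_continuousOn
      (c1.continuousOn (s := Set.Icc (1 / 2 : ℝ) (3 / 2)))
    obtain ⟨B, hB⟩ := isCompact_Icc.exists_bound_of_continuousOn
      (c2.continuousOn (s := Set.Icc (1 / 2 : ℝ) (3 / 2)))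
    exact ⟨max (max A B) 0, le_max_right _ _, fun b hb =>
      ⟨(hA b hb).trans ((le_max_left _ _).trans (le_max_left _ _)),
        (hB b hb).trans ((le_max_right _ _).trans (le_max_left _ _))⟩⟩
  set F : ℝ → ℝ → ℂ := fun b τ => volterraCexp c (t - τ) *
    (φ b * ((τ ^ (b - 1) : ℝ) : ℂ)) with hF
  set F' : ℝ → ℝ → ℂ := fun b τ => volterraCexp c (t - τ) *
    (deriv φ b * ((τ ^ (b - 1) : ℝ) : ℂ) +
      φ b * ((τ ^ (b - 1) * Real.log τ : ℝ) : ℂ)) with hF'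
  have hFeq : ∀ b : ℝ, ∫ τ in (0 : ℝ)..t, F b τ = cconv (volterraCexp c)
      (fun τ => Complex.exp (c * b) * (fracKernel b τ : ℂ)) t := by
    intro b
    rw [cconv]
    refine intervalIntegral.integral_congr fun τ _ => ?_
    simp only [hF, hφ, fracKernel]
    rw [Complex.Gamma_ofReal]
    push_cast
    ring
  -- For `|b - 1| ≤ 1/2` the power costs exponent `1/2` and the logarithm, absorbed at exponent
  -- `1/4`, brings the total to `3/4 < 1`, so the majorant stays integrable at `0`.
  have hbound : ∀ τ : ℝ, 0 < τ → ∀ b ∈ Set.Icc (1 / 2 : ℝ) (3 / 2),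
      ‖deriv φ b * ((τ ^ (b - 1) : ℝ) : ℂ) + φ b * ((τ ^ (b - 1) * Real.log τ : ℝ) : ℂ)‖
        ≤ 18 * K * (τ ^ (-(3 / 4) : ℝ) + τ ^ (3 / 4 : ℝ)) := by
    intro τ hτ b hb
    obtain ⟨k1, k2⟩ := hK b hb
    have p : ∀ e : ℝ, 0 < τ ^ e := fun e => Real.rpow_pos_of_pos hτ e
    have q : ∀ e : ℝ, -(3 / 4) ≤ e → e ≤ 3 / 4 →
        τ ^ e ≤ τ ^ (-(3 / 4) : ℝ) + τ ^ (3 / 4 : ℝ) :=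
      fun e h1 h2 => rpow_le_rpow_neg_add_rpow h1 h2 hτ
    have hl := abs_log_le_rpow_neg_add_rpow hτ (d := 1 / 4) (by norm_num)
    have e1 : τ ^ (b - 1) * τ ^ (-(1 / 4) : ℝ) = τ ^ (b - 1 + -(1 / 4)) :=
      (Real.rpow_add hτ _ _).symm
    have e2 : τ ^ (b - 1) * τ ^ (1 / 4 : ℝ) = τ ^ (b - 1 + 1 / 4) := (Real.rpow_add hτ _ _).symm
    have q0 := q (b - 1) (by linarith [hb.1]) (by linarith [hb.2])
    have q1 := q (b - 1 + -(1 / 4)) (by linarith [hb.1]) (by linarith [hb.2])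
    have q2 := q (b - 1 + 1 / 4) (by linarith [hb.1]) (by linarith [hb.2])
    have hlog : τ ^ (b - 1) * |Real.log τ| ≤ 8 * (τ ^ (-(3 / 4) : ℝ) + τ ^ (3 / 4 : ℝ)) := by
      calc τ ^ (b - 1) * |Real.log τ|
          ≤ τ ^ (b - 1) * ((τ ^ (-(1 / 4) : ℝ) + τ ^ (1 / 4 : ℝ)) / (1 / 4)) :=
            mul_le_mul_of_nonneg_left hl (p _).le
        _ = 4 * (τ ^ (b - 1 + -(1 / 4)) + τ ^ (b - 1 + 1 / 4)) := by rw [← e1, ← e2]; ring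
        _ ≤ _ := by linarith
    calc _ ≤ ‖deriv φ b‖ * τ ^ (b - 1) + ‖φ b‖ * (τ ^ (b - 1) * |Real.log τ|) := by
          refine (norm_add_le _ _).trans (le_of_eq ?_)
          rw [norm_mul, norm_mul, Complex.norm_real, Complex.norm_real, norm_mul,
            Real.norm_of_nonneg (p _).le, Real.norm_eq_abs, abs_mul, abs_of_pos (p (b - 1))]
      _ ≤ K * τ ^ (b - 1) + K * (τ ^ (b - 1) * |Real.log τ|) := by
          have := p (b - 1)
          gcongr
      _ ≤ K * (τ ^ (-(3 / 4) : ℝ) + τ ^ (3 / 4 : ℝ)) +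
          K * (8 * (τ ^ (-(3 / 4) : ℝ) + τ ^ (3 / 4 : ℝ))) := by gcongr
      _ ≤ _ := by
          have := mul_nonneg hK0 (add_pos (p (-(3 / 4))) (p (3 / 4))).le
          linarith
  have hkb : IsLocKernel fun τ => (((18 * K * (τ ^ (-(3 / 4) : ℝ) + τ ^ (3 / 4 : ℝ)) : ℝ)) : ℂ) :=
    isLocKernel_log_bound (by norm_num) (by norm_num)
  have hVm : ∀ g : ℝ → ℂ, Measurable g →
      AEStronglyMeasurable (fun τ => volterraCexp c (t - τ) * g τ)
        (volume.restrict (Set.uIoc 0 t)) := fun g hg =>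
    (((stronglyMeasurable_volterraCexp c).measurable.comp
      (by fun_prop : Measurable fun τ : ℝ => t - τ)).mul hg).aestronglyMeasurable
  have hpm : ∀ b : ℝ, Measurable fun τ : ℝ => ((τ ^ (b - 1) : ℝ) : ℂ) := fun b =>
    Complex.measurable_ofReal.comp (measurable_id.pow_const _)
  have hd := intervalIntegral.hasDerivAt_integral_of_dominated_loc_of_deriv_le (F := F) (F' := F')
    (x₀ := (1 : ℝ)) (s := Set.Icc (1 / 2) (3 / 2)) (a := 0) (b := t) (μ := volume)
    (bound := fun τ => ‖volterraCexp c (t - τ)‖ *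
      (18 * K * (τ ^ (-(3 / 4) : ℝ) + τ ^ (3 / 4 : ℝ))))
    (Icc_mem_nhds (by norm_num) (by norm_num))
    (Eventually.of_forall fun b => hVm _ ((hpm b).const_mul _))
    (by
      have := (isLocKernel_volterraCexp c).intervalIntegrable_mul
        (IsLocKernel.of_continuous (f := fun _ => φ 1) continuous_const) ht
      simpa [hF] using this)
    (hVm _ (((hpm 1).const_mul _).add ((Complex.measurable_ofReal.comp
      ((measurable_id.pow_const _).mul Real.measurable_log)).const_mul _)))
    (ae_of_all _ fun τ hτ b hb => by
      rw [Set.uIoc_of_le ht.le] at hτ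
      simp only [hF']
      rw [norm_mul]
      exact mul_le_mul_of_nonneg_left (hbound τ hτ.1 b hb) (norm_nonneg _))
    (by
      have := ((isLocKernel_volterraCexp c).intervalIntegrable_mul hkb ht).norm
      refine this.congr fun τ hτ => ?_
      rw [Set.uIoc_of_le ht.le] at hτ
      rw [norm_mul, Complex.norm_real, Real.norm_of_nonneg]
      have p : ∀ e : ℝ, 0 < τ ^ e := fun e => Real.rpow_pos_of_pos hτ.1 e
      exact mul_nonneg (by positivity) (add_pos (p _) (p _)).le)
    (ae_of_all _ fun τ hτ b hb => by
      rw [Set.uIoc_of_le ht.le] at hτ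
      have h1 : HasDerivAt (fun b : ℝ => φ b) (deriv φ b) b :=
        (hφd b).hasDerivAt.comp_ofReal
      have h2 : HasDerivAt (fun b : ℝ => τ ^ (b - 1)) (τ ^ (b - 1) * Real.log τ) b := by
        have := ((hasDerivAt_id b).sub_const 1).const_rpow hτ.1
        simpa [mul_comm] using this
      exact (h1.mul h2.ofReal_comp).const_mul _)
  have hR : HasDerivAt (fun b => ∫ τ in (0 : ℝ)..t, F b τ) (-Complex.exp c) 1 := by
    set k : ℝ → ℂ := fun u => Complex.exp (c * u) * (fracKernel u t : ℂ) with hk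
    have hkc : Continuous k := by
      refine Continuous.mul (by fun_prop) (Complex.continuous_ofReal.comp ?_)
      unfold fracKernel
      refine Continuous.mul ?_ continuous_inv_Gamma
      exact Continuous.rpow continuous_const (by fun_prop) fun _ => Or.inl ht.ne'
    have h0 := integrableOn_cexp_mul_fracKernel c ht
    have h1 : HasDerivAt (fun b => (∫ u in Set.Ioi (0 : ℝ), k u) - ∫ u in (0 : ℝ)..b, k u)
        (-k 1) 1 := by
      have := (hkc.integral_hasStrictDerivAt 0 1).hasDerivAt.const_sub
        (∫ u in Set.Ioi (0 : ℝ), k u)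
      exact this
    have hk1 : k 1 = Complex.exp c := by simp [hk, fracKernel_one]
    rw [← hk1]
    refine h1.congr_of_eventuallyEq ?_
    filter_upwards [lt_mem_nhds (show (0 : ℝ) < 1 by norm_num)] with b hb
    rw [hFeq, cconv_volterraCexp_fracKernel c hb ht,
      ← intervalIntegral.integral_Ioi_sub_Ioi' (μ := volume) (f := k) h0 (h0.mono_set (Set.Ioi_subset_Ioi hb.le))]
    simp [hk]
  have huniq := hd.2.unique hR
  have e : ∫ τ in (0 : ℝ)..t, F' 1 τ = -Complex.exp c * cconv (volterraCexp c) (logKernel c) t := by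
    rw [cconv, ← intervalIntegral.integral_const_mul]
    refine intervalIntegral.integral_congr fun τ _ => ?_
    simp only [hF', Complex.ofReal_one, hφ1, hφ1', logKernel]
    simp
    ring
  rw [e] at huniq
  have hne := Complex.exp_ne_zero c
  have : -Complex.exp c * cconv (volterraCexp c) (logKernel c) t = -Complex.exp c * 1 := by
    rw [huniq, mul_one]
  exact mul_left_cancel₀ (neg_ne_zero.2 hne) this

/-! ### The diagonal of the free evolution of the Green function -/

/-- `∫_δ^∞ e^{-lam s} / (s + i t) ds`. For `δ = 0` this is `e^{i lam t} E₁(i lam t)`. -/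
def greenTrace (lam δ t : ℝ) : ℂ :=
  ∫ s in Set.Ioi δ, (Real.exp (-(lam * s)) : ℂ) / ((s : ℂ) + Complex.I * t)

/-- `∫₀^∞ e^{-lam s} s^{-3/4} ds`. -/
def greenConst (lam : ℝ) : ℝ := ∫ s in Set.Ioi (0 : ℝ), s ^ ((1 / 4 : ℝ) - 1) * Real.exp (-(lam * s))

/-- The modulus dominates both `s` and `|t|`. The geometric split leaves `s^(-3/4)`, integrable at
`0`, and `|t|^(-1/4)`, square integrable there: cruder than the true logarithm, but enough for most
purposes. -/
theorem norm_add_I_mul_ge {s t : ℝ} (hs : 0 < s) :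
    s ^ (3 / 4 : ℝ) * |t| ^ (1 / 4 : ℝ) ≤ ‖(s : ℂ) + Complex.I * t‖ := by
  have h1 : s ≤ ‖(s : ℂ) + Complex.I * t‖ := by
    have := Complex.abs_re_le_norm ((s : ℂ) + Complex.I * t)
    simp only [Complex.add_re, Complex.ofReal_re, Complex.mul_re, Complex.I_re, zero_mul,
      Complex.I_im, Complex.ofReal_im, mul_zero, sub_self, add_zero] at this
    exact (le_abs_self _).trans this
  have h2 : |t| ≤ ‖(s : ℂ) + Complex.I * t‖ := by
    have := Complex.abs_im_le_norm ((s : ℂ) + Complex.I * t)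
    simpa using this
  have hn : 0 < ‖(s : ℂ) + Complex.I * t‖ := hs.trans_le h1
  calc _ ≤ ‖(s : ℂ) + Complex.I * t‖ ^ (3 / 4 : ℝ) * ‖(s : ℂ) + Complex.I * t‖ ^ (1 / 4 : ℝ) :=
        mul_le_mul (Real.rpow_le_rpow hs.le h1 (by norm_num))
          (Real.rpow_le_rpow (abs_nonneg _) h2 (by norm_num)) (by positivity) (by positivity)
    _ = _ := by rw [← Real.rpow_add hn]; norm_num

theorem norm_greenTrace_integrand_le {lam s t : ℝ} (hs : 0 < s) (ht : t ≠ 0) :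
    ‖(Real.exp (-(lam * s)) : ℂ) / ((s : ℂ) + Complex.I * t)‖
      ≤ |t| ^ (-(1 / 4) : ℝ) * (s ^ ((1 / 4 : ℝ) - 1) * Real.exp (-(lam * s))) := by
  have ht' : 0 < |t| := abs_pos.2 ht
  have h := norm_add_I_mul_ge (t := t) hs
  have hp : 0 < s ^ (3 / 4 : ℝ) * |t| ^ (1 / 4 : ℝ) := by positivity
  rw [norm_div, Complex.norm_real, Real.norm_of_nonneg (Real.exp_pos _).le]
  calc _ ≤ Real.exp (-(lam * s)) / (s ^ (3 / 4 : ℝ) * |t| ^ (1 / 4 : ℝ)) := by gcongr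
    _ = _ := by
      rw [Real.rpow_neg ht'.le, show ((1 / 4 : ℝ) - 1) = -(3 / 4) by norm_num, Real.rpow_neg hs.le]
      field_simp

theorem integrableOn_greenConst {lam : ℝ} (hlam : 0 < lam) :
    IntegrableOn (fun s => s ^ ((1 / 4 : ℝ) - 1) * Real.exp (-(lam * s))) (Set.Ioi 0) := by
  have h := Real.integral_rpow_mul_exp_neg_mul_Ioi (show (0 : ℝ) < 1 / 4 by norm_num) hlam
  by_contra hc
  rw [integral_undef hc] at h
  have hpos : (0 : ℝ) < (1 / lam) ^ (1 / 4 : ℝ) * Real.Gamma (1 / 4) :=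
    mul_pos (Real.rpow_pos_of_pos (by positivity) _) (Real.Gamma_pos_of_pos (by norm_num))
  exact hpos.ne h

theorem greenConst_nonneg (lam : ℝ) : 0 ≤ greenConst lam :=
  setIntegral_nonneg measurableSet_Ioi fun s (hs : 0 < s) =>
    mul_nonneg (Real.rpow_nonneg hs.le _) (Real.exp_pos _).le

theorem integrableOn_greenTrace {lam : ℝ} (hlam : 0 < lam) {δ t : ℝ} (hδ : 0 ≤ δ) (ht : t ≠ 0) :
    IntegrableOn (fun s : ℝ => (Real.exp (-(lam * s)) : ℂ) / ((s : ℂ) + Complex.I * t))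
      (Set.Ioi δ) := by
  have hi : IntegrableOn (fun s => |t| ^ (-(1 / 4) : ℝ) *
      (s ^ ((1 / 4 : ℝ) - 1) * Real.exp (-(lam * s)))) (Set.Ioi 0) :=
    (integrableOn_greenConst hlam).const_mul _
  refine (hi.mono_set (Set.Ioi_subset_Ioi hδ)).mono' ?_ ?_
  · exact Measurable.aestronglyMeasurable (by fun_prop)
  · exact (ae_restrict_iff' measurableSet_Ioi).2 (ae_of_all _ fun s hs =>
      norm_greenTrace_integrand_le (lt_of_le_of_lt hδ hs) ht)

theorem norm_greenTrace_le {lam : ℝ} (hlam : 0 < lam) {δ t : ℝ} (hδ : 0 ≤ δ) (ht : t ≠ 0) :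
    ‖greenTrace lam δ t‖ ≤ greenConst lam * |t| ^ (-(1 / 4) : ℝ) := by
  have hi : IntegrableOn (fun s => |t| ^ (-(1 / 4) : ℝ) *
      (s ^ ((1 / 4 : ℝ) - 1) * Real.exp (-(lam * s)))) (Set.Ioi 0) :=
    (integrableOn_greenConst hlam).const_mul _
  calc _ ≤ ∫ s in Set.Ioi δ, |t| ^ (-(1 / 4) : ℝ) *
        (s ^ ((1 / 4 : ℝ) - 1) * Real.exp (-(lam * s))) := by
        refine norm_integral_le_of_norm_le (hi.mono_set (Set.Ioi_subset_Ioi hδ)) ?_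
        exact (ae_restrict_iff' measurableSet_Ioi).2 (ae_of_all _ fun s hs =>
          norm_greenTrace_integrand_le (lt_of_le_of_lt hδ hs) ht)
    _ ≤ ∫ s in Set.Ioi 0, |t| ^ (-(1 / 4) : ℝ) *
        (s ^ ((1 / 4 : ℝ) - 1) * Real.exp (-(lam * s))) := by
        refine setIntegral_mono_set hi ?_ (Set.Ioi_subset_Ioi hδ).eventuallyLE
        refine (ae_restrict_iff' measurableSet_Ioi).2 (ae_of_all _ fun s (hs : 0 < s) => ?_)
        exact mul_nonneg (by positivity) (mul_nonneg (Real.rpow_nonneg hs.le _) (Real.exp_pos _).le)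
    _ = _ := by rw [integral_const_mul, greenConst, mul_comm]

theorem stronglyMeasurable_greenTrace (lam δ : ℝ) : StronglyMeasurable (greenTrace lam δ) := by
  refine StronglyMeasurable.integral_prod_right'
    (f := fun p : ℝ × ℝ => (Real.exp (-(lam * p.2)) : ℂ) / ((p.2 : ℂ) + Complex.I * p.1)) ?_
  exact Measurable.stronglyMeasurable (by fun_prop)

theorem greenTrace_neg (lam δ t : ℝ) :
    greenTrace lam δ (-t) = (starRingEnd ℂ) (greenTrace lam δ t) := by
  rw [greenTrace, greenTrace, ← integral_conj]
  refine integral_congr_ae (ae_of_all _ fun s => ?_)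
  simp [← Complex.exp_conj]

/-- Differentiation under the integral produces `∫ e^{-λs}/(s + it)² ds`, and integration by parts
in `s` returns it to the original integral plus the boundary term `1/(it)`. -/
theorem hasDerivAt_greenTrace {lam : ℝ} (hlam : 0 < lam) {t : ℝ} (ht : 0 < t) :
    HasDerivAt (greenTrace lam 0) (Complex.I * lam * greenTrace lam 0 t - 1 / t) t := by
  have hne : ∀ (s : ℝ) {x : ℝ}, x ≠ 0 → (s : ℂ) + Complex.I * x ≠ 0 := fun s x hx h => by
    have := congrArg Complex.im h
    simp at this
    exact hx this
  have hnb : ∀ (s : ℝ) {x : ℝ}, t / 2 ≤ x → t / 2 ≤ ‖(s : ℂ) + Complex.I * x‖ := by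
    intro s x hx
    have := Complex.abs_im_le_norm ((s : ℂ) + Complex.I * x)
    simp at this
    exact hx.trans ((le_abs_self _).trans this)
  have hexp : IntegrableOn (fun s => Real.exp (-(lam * s))) (Set.Ioi 0) := by
    have := integrableOn_exp_mul_Ioi (a := -lam) (by linarith) 0
    simpa using this
  have hd := hasDerivAt_integral_of_dominated_loc_of_deriv_le (μ := volume.restrict (Set.Ioi 0))
    (F := fun (x : ℝ) (s : ℝ) => (Real.exp (-(lam * s)) : ℂ) / ((s : ℂ) + Complex.I * x))
    (F' := fun (x : ℝ) (s : ℝ) => -Complex.I * (Real.exp (-(lam * s)) : ℂ) /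
      ((s : ℂ) + Complex.I * x) ^ 2) (x₀ := t) (s := Set.Ioi (t / 2))
    (bound := fun s => Real.exp (-(lam * s)) / (t / 2) ^ 2)
    (Ioi_mem_nhds (by linarith))
    (Eventually.of_forall fun x => Measurable.aestronglyMeasurable (by fun_prop))
    (integrableOn_greenTrace hlam le_rfl ht.ne')
    (Measurable.aestronglyMeasurable (by fun_prop))
    (ae_of_all _ fun s x (hx : t / 2 < x) => by
      rw [norm_div, norm_mul, norm_neg, Complex.norm_I, one_mul, Complex.norm_real,
        Real.norm_of_nonneg (Real.exp_pos _).le, norm_pow]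
      have := hnb s hx.le
      gcongr)
    (hexp.div_const _)
    (ae_of_all _ fun s x (hx : t / 2 < x) => by
      have hx0 : x ≠ 0 := by linarith
      have h1 : HasDerivAt (fun x : ℝ => (s : ℂ) + Complex.I * (x : ℂ)) (Complex.I * 1) x :=
        ((hasDerivAt_id x).ofReal_comp.const_mul Complex.I).const_add _
      have h2 := (hasDerivAt_const x ((Real.exp (-(lam * s)) : ℂ))).div h1 (hne s hx0)
      exact h2.congr_deriv (by ring))
  refine hd.2.congr_deriv ?_
  have hG : ∀ s ∈ Set.Ici (0 : ℝ), HasDerivAt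
      (fun s : ℝ => (Real.exp (-(lam * s)) : ℂ) / ((s : ℂ) + Complex.I * t))
      (-(lam : ℂ) * ((Real.exp (-(lam * s)) : ℂ) / ((s : ℂ) + Complex.I * t)) -
        (Real.exp (-(lam * s)) : ℂ) / ((s : ℂ) + Complex.I * t) ^ 2) s := by
    intro s _
    have h1 : HasDerivAt (fun s : ℝ => (s : ℂ) + Complex.I * (t : ℂ)) 1 s :=
      (hasDerivAt_id s).ofReal_comp.add_const _
    have h2 : HasDerivAt (fun s : ℝ => Real.exp (-(lam * s))) (Real.exp (-(lam * s)) * -(lam * 1))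
        s := (((hasDerivAt_id s).const_mul lam).neg).exp
    have h3 := h2.ofReal_comp.div h1 (hne s ht.ne')
    refine h3.congr_deriv ?_
    have := hne s ht.ne'
    push_cast
    field_simp
  have hsq : IntegrableOn (fun s : ℝ => (Real.exp (-(lam * s)) : ℂ) /
      ((s : ℂ) + Complex.I * t) ^ 2) (Set.Ioi 0) := by
    have := hd.1.const_mul Complex.I
    refine this.congr (ae_of_all _ fun s => ?_)
    simp only
    rw [neg_mul, neg_div, mul_neg, mul_div_assoc, ← mul_assoc, Complex.I_mul_I]
    ring
  have hlim : Tendsto (fun s : ℝ => (Real.exp (-(lam * s)) : ℂ) / ((s : ℂ) + Complex.I * t)) atTop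
      (𝓝 0) := by
    rw [tendsto_zero_iff_norm_tendsto_zero]
    have h0 : Tendsto (fun s : ℝ => Real.exp (-(lam * s)) / (t / 2)) atTop (𝓝 0) := by
      rw [show (0 : ℝ) = 0 / (t / 2) by simp]
      refine Tendsto.div_const ?_ _
      exact Real.tendsto_exp_neg_atTop_nhds_zero.comp (tendsto_id.const_mul_atTop hlam)
    refine squeeze_zero (fun _ => norm_nonneg _) (fun s => ?_) h0
    rw [norm_div, Complex.norm_real, Real.norm_of_nonneg (Real.exp_pos _).le]
    have := hnb s (x := t) (by linarith)
    gcongr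
  have hint := integrableOn_greenTrace hlam le_rfl ht.ne' (δ := 0)
  have hftc := integral_Ioi_of_hasDerivAt_of_tendsto' hG ((hint.const_mul _).sub hsq) hlim
  rw [integral_sub (hint.const_mul _) hsq, integral_const_mul] at hftc
  have e1 : ∫ s in Set.Ioi (0 : ℝ), -Complex.I * (Real.exp (-(lam * s)) : ℂ) /
      ((s : ℂ) + Complex.I * t) ^ 2 = -Complex.I * ∫ s in Set.Ioi (0 : ℝ),
        (Real.exp (-(lam * s)) : ℂ) / ((s : ℂ) + Complex.I * t) ^ 2 := by
    rw [← integral_const_mul]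
    refine integral_congr_ae (ae_of_all _ fun s => ?_)
    simp only
    ring
  rw [e1]
  have e2 : ∫ s in Set.Ioi (0 : ℝ), (Real.exp (-(lam * s)) : ℂ) / ((s : ℂ) + Complex.I * t) ^ 2
      = 1 / (Complex.I * t) - lam * greenTrace lam 0 t := by
    rw [greenTrace]
    have h0 : (Real.exp (-(lam * 0)) : ℂ) / (((0 : ℝ) : ℂ) + Complex.I * t) = 1 / (Complex.I * t) := by
      simp
    rw [h0] at hftc
    linear_combination -hftc
  rw [e2]
  have : (t : ℂ) ≠ 0 := by exact_mod_cast ht.ne'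
  field_simp
  ring_nf

theorem isLocKernel_greenTrace {lam : ℝ} (hlam : 0 < lam) : IsLocKernel (greenTrace lam 0) := by
  refine ((isLocKernel_rpow (r := -(1 / 4)) (by norm_num)).const_mul (greenConst lam)).mono
    (stronglyMeasurable_greenTrace lam 0).aestronglyMeasurable fun t ht => ?_
  refine (norm_greenTrace_le hlam le_rfl ht.ne').trans (le_of_eq ?_)
  rw [abs_of_pos ht, norm_mul, Complex.norm_real, Complex.norm_real,
    Real.norm_of_nonneg (greenConst_nonneg lam), Real.norm_of_nonneg (by positivity)]

theorem IsLocKernel.intervalIntegrable {f : ℝ → ℂ} (hf : IsLocKernel f) {s t : ℝ} (hs : 0 ≤ s)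
    (hst : s ≤ t) : IntervalIntegrable f volume s t := by
  rw [intervalIntegrable_iff_integrableOn_Ioo_of_le hst]
  exact (hf.int t).mono_set fun x hx => ⟨hs.trans_lt hx.1, hx.2⟩

/-- By the derivative formula the trace, plus `log t`, minus `iλ` times its primitive, is constant
on the half-line; the constant is `r₀ - γ`. -/
theorem exists_greenTrace_eq_aux {lam : ℝ} (hlam : 0 < lam) : ∃ r₀ : ℂ, ∀ t : ℝ, 0 < t →
    greenTrace lam 0 t = logKernel (-r₀) t + Complex.I * lam *
      ∫ x in (0 : ℝ)..t, greenTrace lam 0 x := by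
  set R : ℝ → ℂ := fun t => greenTrace lam 0 t + (Real.log t : ℂ) - Complex.I * lam *
      ∫ x in (0 : ℝ)..t, greenTrace lam 0 x with hR
  have hd : ∀ t ∈ Set.Ioi (0 : ℝ), HasDerivAt R 0 t := by
    intro t (ht : 0 < t)
    have h1 := hasDerivAt_greenTrace hlam ht
    have h2 := (Real.hasDerivAt_log ht.ne').ofReal_comp
    have h3 := (intervalIntegral.integral_hasDerivAt_right
      ((isLocKernel_greenTrace hlam).intervalIntegrable le_rfl ht.le)
      ((stronglyMeasurable_greenTrace lam 0).stronglyMeasurableAtFilter) h1.continuousAt).const_mul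
      (Complex.I * lam)
    have := (h1.add h2).sub h3
    refine this.congr_deriv ?_
    push_cast
    ring
  have hconst : ∀ t ∈ Set.Ioi (0 : ℝ), R t = R 1 := by
    intro t ht
    exact isOpen_Ioi.is_const_of_deriv_eq_zero (isPreconnected_Ioi)
      (fun x hx => (hd x hx).differentiableAt.differentiableWithinAt)
      (fun x hx => (hd x hx).deriv) ht (by simp)
  refine ⟨R 1 + Real.eulerMascheroniConstant, fun t ht => ?_⟩
  have := hconst t ht
  rw [logKernel, ← this, hR]
  ring

/-- The substitution `s = t x` turns the imaginary part into `-∫₀^∞ e^{-λtx}/(1 + x²) dx`, which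
tends to `-π/2`. This value later matches the imaginary part of `kappa`. -/
theorem tendsto_im_greenTrace {lam : ℝ} (hlam : 0 < lam) :
    Tendsto (fun t => (greenTrace lam 0 t).im) (𝓝[>] 0) (𝓝 (-(Real.pi / 2))) := by
  have h1 : ∀ t : ℝ, 0 < t → (greenTrace lam 0 t).im =
      -∫ x in Set.Ioi (0 : ℝ), Real.exp (-(lam * (t * x))) * (1 + x ^ 2)⁻¹ := by
    intro t ht
    have e : (greenTrace lam 0 t).im = ∫ s in Set.Ioi (0 : ℝ),
        ((Real.exp (-(lam * s)) : ℂ) / ((s : ℂ) + Complex.I * t)).im :=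
      (integral_im (integrableOn_greenTrace hlam le_rfl ht.ne')).symm
    have hsub := integral_comp_mul_left_Ioi
      (fun s => ((Real.exp (-(lam * s)) : ℂ) / ((s : ℂ) + Complex.I * t)).im) 0 ht
    rw [mul_zero] at hsub
    rw [e, ← integral_neg]
    have : ∫ s in Set.Ioi (0 : ℝ), ((Real.exp (-(lam * s)) : ℂ) / ((s : ℂ) + Complex.I * t)).im
        = t * ∫ x in Set.Ioi (0 : ℝ),
          ((Real.exp (-(lam * (t * x))) : ℂ) / (((t * x : ℝ) : ℂ) + Complex.I * t)).im := by
      rw [hsub, smul_eq_mul, ← mul_assoc, mul_inv_cancel₀ ht.ne', one_mul]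
    rw [this, ← integral_const_mul]
    refine setIntegral_congr_fun measurableSet_Ioi fun x (hx : 0 < x) => ?_
    rw [Complex.div_im]
    simp only [Complex.normSq_apply, Complex.ofReal_re, Complex.ofReal_im, Complex.add_re,
      Complex.add_im, Complex.mul_re, Complex.mul_im, Complex.I_re, Complex.I_im]
    have : 0 < 1 + x ^ 2 := by positivity
    field_simp
    ring
  have h2 : Tendsto (fun t : ℝ => ∫ x in Set.Ioi (0 : ℝ),
      Real.exp (-(lam * (t * x))) * (1 + x ^ 2)⁻¹) (𝓝[>] 0)
      (𝓝 (∫ x in Set.Ioi (0 : ℝ), (1 + x ^ 2)⁻¹)) := by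
    refine tendsto_integral_filter_of_dominated_convergence (fun x => (1 + x ^ 2)⁻¹)
      (Eventually.of_forall fun t => Measurable.aestronglyMeasurable (by fun_prop)) ?_
      integrable_inv_one_add_sq.integrableOn (ae_of_all _ fun x => ?_)
    · filter_upwards [self_mem_nhdsWithin] with t (ht : 0 < t)
      refine (ae_restrict_iff' measurableSet_Ioi).2 (ae_of_all _ fun x (hx : 0 < x) => ?_)
      have : 0 < (1 + x ^ 2)⁻¹ := by positivity
      rw [Real.norm_of_nonneg (by positivity)]
      refine mul_le_of_le_one_left this.le (Real.exp_le_one_iff.2 ?_)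
      have : 0 < lam * (t * x) := by positivity
      linarith
    · have : Tendsto (fun t : ℝ => Real.exp (-(lam * (t * x))) * (1 + x ^ 2)⁻¹) (𝓝 0)
          (𝓝 (Real.exp (-(lam * (0 * x))) * (1 + x ^ 2)⁻¹)) :=
        Continuous.tendsto (by fun_prop) 0
      simp only [zero_mul, mul_zero, neg_zero, Real.exp_zero, one_mul] at this
      exact this.mono_left nhdsWithin_le_nhds
  rw [integral_Ioi_inv_one_add_sq, Real.arctan_zero, sub_zero] at h2
  refine h2.neg.congr' ?_
  filter_upwards [self_mem_nhdsWithin] with t ht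
  exact (h1 t ht).symm

/-- Near `0` the function `greenTrace lam 0` is a logarithm plus a constant with imaginary part
`-π/2`, up to a primitive of itself. -/
theorem exists_greenTrace_eq {lam : ℝ} (hlam : 0 < lam) : ∃ r₀ : ℂ, r₀.im = -(Real.pi / 2) ∧
    ∀ t : ℝ, 0 < t → greenTrace lam 0 t = logKernel (-r₀) t + Complex.I * lam *
      ∫ x in (0 : ℝ)..t, greenTrace lam 0 x := by
  obtain ⟨r₀, hr⟩ := exists_greenTrace_eq_aux hlam
  refine ⟨r₀, ?_, hr⟩
  have h1 : Tendsto (fun t : ℝ => Complex.I * lam * ∫ x in (0 : ℝ)..t, greenTrace lam 0 x)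
      (𝓝[>] 0) (𝓝 0) := by
    have hi := (isLocKernel_greenTrace hlam).intervalIntegrable le_rfl zero_le_one
    have hc := intervalIntegral.continuousWithinAt_primitive (b₀ := 0) (b₁ := 0) (b₂ := 1)
      (f := greenTrace lam 0) (μ := volume) (a := 0) (by simp) (by simpa using hi)
    have := hc.tendsto.const_mul (Complex.I * lam)
    simp only [intervalIntegral.integral_same, mul_zero] at this
    refine this.mono_left ?_
    rw [nhdsWithin_le_iff]
    exact Icc_mem_nhdsGT one_pos
  have h2 : Tendsto (fun t => (greenTrace lam 0 t).im) (𝓝[>] 0) (𝓝 r₀.im) := by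
    have h3 := (Complex.continuous_im.tendsto _).comp h1
    have h4 := h3.add_const r₀.im
    simp only [Complex.zero_im, zero_add] at h4
    refine h4.congr' ?_
    filter_upwards [self_mem_nhdsWithin] with t ht
    have := congrArg Complex.im (hr t ht)
    simp only [logKernel, Complex.add_im, Complex.sub_im, Complex.neg_im, Complex.ofReal_im] at this
    simp only [Function.comp]
    rw [this]; ring
  exact tendsto_nhds_unique h2 (tendsto_im_greenTrace hlam)

/-! ### The nonlinear Volterra equation -/

/-- With the shift put on the continuous factor, extended by constants, a multiple of `‖f‖`
dominates, and the integrand is continuous in `t` away from the endpoint `x = t`, a null set. -/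
theorem continuousOn_cconv {f g : ℝ → ℂ} {T : ℝ} (hf : IntegrableOn f (Set.Ioo 0 T))
    (hg : ContinuousOn g (Set.Icc 0 T)) : ContinuousOn (cconv f g) (Set.Icc 0 T) := by
  rcases lt_or_ge T 0 with hT | hT
  · simp [Set.Icc_eq_empty (not_le.2 hT)]
  set g' : ℝ → ℂ := Set.IccExtend hT ((Set.Icc 0 T).domRestrict g) with hg'
  have hc : Continuous g' := (continuousOn_iff_continuous_domRestrict.1 hg).Icc_extend'
  have heq : ∀ x ∈ Set.Icc 0 T, g' x = g x := fun x hx => by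
    rw [hg', Set.IccExtend_of_mem hT _ hx]; rfl
  obtain ⟨C, hC⟩ := isCompact_Icc.exists_bound_of_continuousOn hg
  have hb : ∀ x, ‖g' x‖ ≤ C := fun x => by
    simp only [hg', Set.IccExtend, Function.comp]
    exact hC _ (Set.projIcc 0 T hT x).2
  set G : ℝ → ℝ → ℂ := fun t x => (Set.Iio t).indicator (fun x => f x * g' (t - x)) x with hG
  have hcont : Continuous fun t => ∫ x in Set.Ioo 0 T, G t x := by
    rw [continuous_iff_continuousAt]
    intro t₀
    refine continuousAt_of_dominated (bound := fun x => ‖f x‖ * C) ?_ ?_ (hf.norm.mul_const C) ?_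
    · exact Eventually.of_forall fun t => (hf.aestronglyMeasurable.mul
        (hc.comp (continuous_const.sub continuous_id)).aestronglyMeasurable).indicator
          measurableSet_Iio
    · refine Eventually.of_forall fun t => ae_of_all _ fun x => ?_
      refine (norm_indicator_le_norm_self _ _).trans ?_
      rw [norm_mul]
      exact mul_le_mul_of_nonneg_left (hb _) (norm_nonneg _)
    · have : ∀ᵐ x ∂volume.restrict (Set.Ioo 0 T), x ≠ t₀ :=
        ae_restrict_of_ae (Measure.ae_ne volume t₀)
      filter_upwards [this] with x hx
      rcases lt_or_gt_of_ne hx with h | h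
      · have : ContinuousAt (fun t => f x * g' (t - x)) t₀ := by fun_prop
        refine this.congr ?_
        filter_upwards [lt_mem_nhds h] with t ht
        simp [hG, ht]
      · refine (continuousAt_const (y := (0 : ℂ))).congr ?_
        filter_upwards [gt_mem_nhds h] with t ht
        simp [hG, ht.le]
  refine hcont.continuousOn.congr fun t ht => ?_
  rw [cconv_congr_right ht.1 (g' := g') fun x hx =>
    (heq x ⟨hx.1.le, hx.2.le.trans ht.2⟩).symm, cconv_comm, cconv,
    intervalIntegral.integral_of_le ht.1, integral_Ioc_eq_integral_Ioo]
  simp only [hG]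
  rw [← integral_indicator measurableSet_Ioo, ← integral_indicator measurableSet_Ioo]
  refine integral_congr_ae (ae_of_all _ fun x => ?_)
  by_cases h1 : x ∈ Set.Ioo 0 t
  · have h2 : x ∈ Set.Ioo 0 T := ⟨h1.1, h1.2.trans_le ht.2⟩
    simp only [Set.indicator_of_mem h1, Set.indicator_of_mem h2,
      Set.indicator_of_mem (show x ∈ Set.Iio t from h1.2)]
    rw [mul_comm]
  · rw [Set.indicator_of_notMem h1]
    by_cases h2 : x ∈ Set.Ioo 0 T
    · have h3 : x ∉ Set.Iio t := fun h => h1 ⟨h2.1, h⟩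
      rw [Set.indicator_of_mem h2, Set.indicator_of_notMem h3]
    · rw [Set.indicator_of_notMem h2]

/-- The Volterra kernel as a complex-valued function. -/
def volterraK (t : ℝ) : ℂ := (volterraKernel t : ℂ)

theorem volterraOp_eq_cconv (g : ℝ → ℂ) (t : ℝ) : volterraOp g t = cconv volterraK g t := rfl

theorem volterraK_eq : volterraK = volterraCexp 0 := by
  ext t
  rw [volterraK, volterraKernel_eq, ← volterraCexp_ofReal, Complex.ofReal_zero]

theorem isLocKernel_volterraK : IsLocKernel volterraK := by
  rw [volterraK_eq]; exact isLocKernel_volterraCexp 0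

theorem volterraKernel_pos {t : ℝ} (ht : 0 < t) : 0 < volterraKernel t := by
  rw [volterraKernel_eq]; exact volterraExp_pos 0 ht

/-- In the weight `e^{At}` the operator norm is at most the Laplace transform of the kernel at `A`,
namely `1 / log A`, as small as desired for large `A`. Contraction arguments then need no short time
steps. -/
theorem norm_volterraOp_le {A M t : ℝ} (hA : 1 < A) (ht : 0 ≤ t) (hM : 0 ≤ M) {g : ℝ → ℂ}
    (hg : ∀ τ ∈ Set.Ioo 0 t, ‖g τ‖ ≤ M * Real.exp (A * τ)) :
    ‖volterraOp g t‖ ≤ M * Real.exp (A * t) * (1 / Real.log A) := by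
  have hA0 : 0 < A := by linarith
  have hlog : (0 : ℝ) < Real.log A := Real.log_pos hA
  have hi := integrableOn_exp_neg_mul_volterraExp hA0 hlog
  have hint : ∫ x in Set.Ioi (0 : ℝ), Real.exp (-(A * x)) * volterraExp 0 x = 1 / Real.log A := by
    rw [integral_eq_lintegral_of_nonneg_ae _ hi.aestronglyMeasurable,
      lintegral_exp_neg_mul_volterraExp hA0 hlog, sub_zero, ENNReal.toReal_ofReal (by positivity)]
    exact (ae_restrict_iff' measurableSet_Ioi).2 (ae_of_all _ fun x (hx : 0 < x) =>
      mul_nonneg (Real.exp_pos _).le (volterraExp_pos 0 hx).le)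
  rw [volterraOp_eq_cconv, cconv_comm, cconv, intervalIntegral.integral_of_le ht,
    integral_Ioc_eq_integral_Ioo]
  calc _ ≤ ∫ x in Set.Ioo 0 t, M * Real.exp (A * t) * (Real.exp (-(A * x)) * volterraExp 0 x) := by
        refine norm_integral_le_of_norm_le ((hi.mono_set fun x hx => hx.1).const_mul _) ?_
        refine (ae_restrict_iff' measurableSet_Ioo).2 (ae_of_all _ fun x hx => ?_)
        rw [norm_mul, volterraK, Complex.norm_real, Real.norm_of_nonneg (volterraKernel_pos hx.1).le,
          volterraKernel_eq]
        have h1 := hg (t - x) ⟨by linarith [hx.2], by linarith [hx.1]⟩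
        have h2 : Real.exp (A * (t - x)) = Real.exp (A * t) * Real.exp (-(A * x)) := by
          rw [← Real.exp_add]; congr 1; ring
        rw [h2] at h1
        calc _ ≤ M * (Real.exp (A * t) * Real.exp (-(A * x))) * volterraExp 0 x :=
              mul_le_mul_of_nonneg_right h1 (volterraExp_pos 0 hx.1).le
          _ = _ := by ring
    _ = M * Real.exp (A * t) * ∫ x in Set.Ioo 0 t, Real.exp (-(A * x)) * volterraExp 0 x :=
        integral_const_mul _ _
    _ ≤ _ := by
        rw [← hint]
        refine mul_le_mul_of_nonneg_left ?_ (by positivity)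
        refine setIntegral_mono_set hi ?_ (show Set.Ioo 0 t ⊆ Set.Ioi 0 from
          fun x hx => hx.1).eventuallyLE
        exact (ae_restrict_iff' measurableSet_Ioi).2 (ae_of_all _ fun x (hx : 0 < x) =>
          mul_nonneg (Real.exp_pos _).le (volterraExp_pos 0 hx).le)

theorem continuousOn_volterraOp {g : ℝ → ℂ} {T : ℝ} (hg : ContinuousOn g (Set.Icc 0 T)) :
    ContinuousOn (volterraOp g) (Set.Icc 0 T) :=
  continuousOn_cconv (isLocKernel_volterraK.int T) hg

theorem intervalIntegrable_volterra {g : ℝ → ℂ} {t : ℝ} (ht : 0 ≤ t)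
    (hg : ContinuousOn g (Set.Icc 0 t)) :
    IntervalIntegrable (fun τ => volterraK (t - τ) * g τ) volume 0 t := by
  have h1 : IntervalIntegrable (fun τ => volterraK (t - τ)) volume 0 t := by
    have := (isLocKernel_volterraK.intervalIntegrable le_rfl ht).comp_sub_left t
    simpa using this.symm
  exact h1.mul_continuousOn (by rwa [Set.uIcc_of_le ht])

theorem volterraOp_sub {g g' : ℝ → ℂ} {t : ℝ} (ht : 0 ≤ t) (hg : ContinuousOn g (Set.Icc 0 t))
    (hg' : ContinuousOn g' (Set.Icc 0 t)) :
    volterraOp (fun τ => g τ - g' τ) t = volterraOp g t - volterraOp g' t := by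
  rw [volterraOp_eq_cconv, volterraOp_eq_cconv, volterraOp_eq_cconv, cconv, cconv, cconv,
    ← intervalIntegral.integral_sub (intervalIntegrable_volterra ht hg)
      (intervalIntegrable_volterra ht hg')]
  simp_rw [mul_sub]

/-- `q` is a continuous solution on `[0, T]` of `q(t) = F(t) - ∫₀ᵗ 𝓘(t - τ) W(q(τ)) dτ`. -/
structure IsVolterraSolution (F : ℝ → ℂ) (W : ℂ → ℂ) (T : ℝ) (q : ℝ → ℂ) : Prop where
  cont : ContinuousOn q (Set.Icc 0 T)
  eq : ∀ t ∈ Set.Icc 0 T, q t = F t - volterraOp (fun τ => W (q τ)) t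

/-- Lipschitz continuity on bounded sets. -/
def IsLipschitzOnBounded (W : ℂ → ℂ) : Prop :=
  ∀ M : ℝ, ∃ L : ℝ, 0 ≤ L ∧ ∀ z w : ℂ, ‖z‖ ≤ M → ‖w‖ ≤ M → ‖W z - W w‖ ≤ L * ‖z - w‖

theorem IsLipschitzOnBounded.continuous {W : ℂ → ℂ} (hW : IsLipschitzOnBounded W) :
    Continuous W := by
  rw [continuous_iff_continuousAt]
  intro z
  obtain ⟨L, hL0, hL⟩ := hW (‖z‖ + 1)
  rw [ContinuousAt, tendsto_iff_norm_sub_tendsto_zero]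
  have h1 : Tendsto (fun w => L * ‖w - z‖) (𝓝 z) (𝓝 0) := by
    have : Continuous fun w : ℂ => L * ‖w - z‖ := by fun_prop
    simpa using this.tendsto z
  refine squeeze_zero' (Eventually.of_forall fun _ => norm_nonneg _) ?_ h1
  filter_upwards [Metric.ball_mem_nhds z one_pos] with w hw
  refine hL w z ?_ (by linarith)
  have := norm_add_le (w - z) z
  rw [sub_add_cancel] at this
  rw [mem_ball_iff_norm] at hw
  linarith

theorem IsVolterraSolution.mono {F : ℝ → ℂ} {W : ℂ → ℂ} {T T' : ℝ} {q : ℝ → ℂ}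
    (h : IsVolterraSolution F W T q) (hT : T' ≤ T) : IsVolterraSolution F W T' q where
  cont := h.cont.mono (Set.Icc_subset_Icc_right hT)
  eq t ht := h.eq t ⟨ht.1, ht.2.trans hT⟩

theorem IsVolterraSolution.unique {F : ℝ → ℂ} {W : ℂ → ℂ} (hW : IsLipschitzOnBounded W) {T : ℝ}
    {q q' : ℝ → ℂ} (h : IsVolterraSolution F W T q) (h' : IsVolterraSolution F W T q') :
    Set.EqOn q q' (Set.Icc 0 T) := by
  rcases lt_or_ge T 0 with hT | hT
  · simp [Set.Icc_eq_empty (not_le.2 hT)]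
  obtain ⟨C, hC⟩ := isCompact_Icc.exists_bound_of_continuousOn h.cont
  obtain ⟨C', hC'⟩ := isCompact_Icc.exists_bound_of_continuousOn h'.cont
  obtain ⟨L, hL0, hL⟩ := hW (max C C')
  -- With this weight `L / log A = L / (L + 1) < 1`.
  set A := Real.exp (L + 1) with hA
  have hlogA : Real.log A = L + 1 := Real.log_exp _
  have hA1 : 1 < A := Real.one_lt_exp_iff.2 (by linarith)
  have hdc : ContinuousOn (fun t => Real.exp (-(A * t)) * ‖q t - q' t‖) (Set.Icc 0 T) :=
    (by fun_prop : Continuous fun t : ℝ => Real.exp (-(A * t))).continuousOn.mul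
      (h.cont.sub h'.cont).norm
  obtain ⟨t₀, ht₀, hmax⟩ := isCompact_Icc.exists_isMaxOn ⟨0, le_rfl, hT⟩ hdc
  set m := Real.exp (-(A * t₀)) * ‖q t₀ - q' t₀‖ with hm
  have hm0 : 0 ≤ m := by positivity
  have hle : ∀ t ∈ Set.Icc 0 T, ‖q t - q' t‖ ≤ m * Real.exp (A * t) := by
    intro t ht
    have := hmax ht
    simp only [Set.mem_ofPred_eq] at this
    calc _ = Real.exp (A * t) * (Real.exp (-(A * t)) * ‖q t - q' t‖) := by
          rw [← mul_assoc, ← Real.exp_add]; simp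
      _ ≤ Real.exp (A * t) * m := by gcongr
      _ = _ := mul_comm _ _
  have hsub : ∀ {x}, x ≤ T → Set.Icc 0 x ⊆ Set.Icc 0 T := fun hx => Set.Icc_subset_Icc_right hx
  have hdiff : q t₀ - q' t₀ = -volterraOp (fun τ => W (q τ) - W (q' τ)) t₀ := by
    rw [volterraOp_sub (g := fun τ => W (q τ)) (g' := fun τ => W (q' τ)) ht₀.1 (hW.continuous.comp_continuousOn (h.cont.mono (hsub ht₀.2)))
      (hW.continuous.comp_continuousOn (h'.cont.mono (hsub ht₀.2))), h.eq t₀ ht₀, h'.eq t₀ ht₀]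
    ring
  have hb : ‖q t₀ - q' t₀‖ ≤ L * m * Real.exp (A * t₀) * (1 / Real.log A) := by
    rw [hdiff, norm_neg]
    refine norm_volterraOp_le hA1 ht₀.1 (by positivity) fun τ hτ => ?_
    have hτ' : τ ∈ Set.Icc 0 T := ⟨hτ.1.le, hτ.2.le.trans ht₀.2⟩
    refine (hL _ _ ((hC τ hτ').trans (le_max_left _ _))
      ((hC' τ hτ').trans (le_max_right _ _))).trans ?_
    rw [mul_assoc]
    exact mul_le_mul_of_nonneg_left (hle τ hτ') hL0
  have hmle : m ≤ L / (L + 1) * m := by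
    calc m ≤ Real.exp (-(A * t₀)) * (L * m * Real.exp (A * t₀) * (1 / Real.log A)) := by
          rw [hm]; gcongr
      _ = (Real.exp (-(A * t₀)) * Real.exp (A * t₀)) * (L * m * (1 / Real.log A)) := by ring
      _ = _ := by rw [← Real.exp_add, hlogA]; simp; ring
  have hm1 : m = 0 := by
    have h1 : L / (L + 1) < 1 := by rw [div_lt_one (by linarith)]; linarith
    nlinarith
  intro t ht
  have := hle t ht
  rw [hm1, zero_mul] at this
  exact sub_eq_zero.1 (norm_le_zero_iff.1 this)

/-- Banach's fixed point theorem for the weighted unknown `e^{-At} q(t)`; a globally Lipschitz field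
thus has a solution on any prescribed interval. -/
theorem exists_isVolterraSolution_of_lipschitz {F : ℝ → ℂ} {W : ℂ → ℂ} {L T : ℝ} (hL0 : 0 ≤ L)
    (hL : ∀ z w : ℂ, ‖W z - W w‖ ≤ L * ‖z - w‖) (hT : 0 ≤ T) (hF : ContinuousOn F (Set.Icc 0 T)) :
    ∃ q, IsVolterraSolution F W T q := by
  set A := Real.exp (L + 1) with hA
  have hlogA : Real.log A = L + 1 := Real.log_exp _
  have hA1 : 1 < A := Real.one_lt_exp_iff.2 (by linarith)
  have hWc : Continuous W := IsLipschitzOnBounded.continuous fun _ => ⟨L, hL0, fun z w _ _ => hL z w⟩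
  set ext : C(Set.Icc 0 T, ℂ) → ℝ → ℂ := fun u τ =>
    (Real.exp (A * τ) : ℂ) * Set.IccExtend hT u τ with hext
  have hextc : ∀ u, Continuous (ext u) := fun u => by
    have h1 := (map_continuous u).Icc_extend' (h := hT)
    have h2 : Continuous fun τ : ℝ => (Real.exp (A * τ) : ℂ) := by fun_prop
    exact h2.mul h1
  have hcont : ∀ u : C(Set.Icc 0 T, ℂ), ContinuousOn (fun t => (Real.exp (-(A * t)) : ℂ) *
      (F t - volterraOp (fun τ => W (ext u τ)) t)) (Set.Icc 0 T) := fun u => by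
    have h2 : Continuous fun τ : ℝ => (Real.exp (-(A * τ)) : ℂ) := by fun_prop
    exact h2.continuousOn.mul (hF.sub (continuousOn_volterraOp
      (hWc.comp (hextc u)).continuousOn))
  set Φ : C(Set.Icc 0 T, ℂ) → C(Set.Icc 0 T, ℂ) := fun u =>
    ⟨(Set.Icc 0 T).domRestrict fun t => (Real.exp (-(A * t)) : ℂ) *
      (F t - volterraOp (fun τ => W (ext u τ)) t),
      continuousOn_iff_continuous_domRestrict.1 (hcont u)⟩ with hΦ
  have hΦa : ∀ u (t : Set.Icc 0 T), Φ u t = (Real.exp (-(A * t)) : ℂ) *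
      (F t - volterraOp (fun τ => W (ext u τ)) t) := fun u t => rfl
  have hk : L / (L + 1) < 1 := by rw [div_lt_one (by linarith)]; linarith
  have hk0 : 0 ≤ L / (L + 1) := by positivity
  have hcontr : ContractingWith ⟨L / (L + 1), hk0⟩ Φ := by
    refine ⟨by exact_mod_cast hk, LipschitzWith.of_dist_le_mul fun u v => ?_⟩
    rw [ContinuousMap.dist_le (by positivity)]
    intro t
    rw [dist_eq_norm, hΦa, hΦa, ← mul_sub, norm_mul, Complex.norm_real,
      Real.norm_of_nonneg (Real.exp_pos _).le, sub_sub_sub_cancel_left,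
      ← volterraOp_sub (g := fun τ => W (ext v τ)) (g' := fun τ => W (ext u τ)) t.2.1 (hWc.comp (hextc v)).continuousOn (hWc.comp (hextc u)).continuousOn]
    have hb : ‖volterraOp (fun τ => W (ext v τ) - W (ext u τ)) t‖
        ≤ L * dist u v * Real.exp (A * t) * (1 / Real.log A) := by
      refine norm_volterraOp_le hA1 t.2.1 (by positivity) fun τ hτ => (hL _ _).trans ?_
      rw [mul_assoc]
      refine mul_le_mul_of_nonneg_left ?_ hL0
      simp only [hext]
      rw [← mul_sub, norm_mul, Complex.norm_real, Real.norm_of_nonneg (Real.exp_pos _).le, mul_comm]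
      refine mul_le_mul_of_nonneg_right ?_ (Real.exp_pos _).le
      rw [Set.IccExtend, Set.IccExtend, ← dist_eq_norm, dist_comm]
      exact ContinuousMap.dist_apply_le_dist _
    calc _ ≤ Real.exp (-(A * t)) * (L * dist u v * Real.exp (A * t) * (1 / Real.log A)) := by
          gcongr
      _ = (Real.exp (-(A * t)) * Real.exp (A * t)) * (L * dist u v * (1 / Real.log A)) := by ring
      _ = L / (L + 1) * dist u v := by rw [← Real.exp_add, hlogA]; simp; ring
      _ = _ := rfl
  have : Nonempty C(Set.Icc 0 T, ℂ) := ⟨0⟩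
  set u := ContractingWith.fixedPoint Φ hcontr with hu
  have hfix : Φ u = u := hcontr.fixedPoint_isFixedPt
  refine ⟨ext u, (hextc u).continuousOn, fun t ht => ?_⟩
  have h1 := hΦa u ⟨t, ht⟩
  rw [hfix] at h1
  have h2 : ext u t = (Real.exp (A * t) : ℂ) * u ⟨t, ht⟩ := by
    simp only [hext]; rw [Set.IccExtend_of_mem hT _ ht]
  rw [h2, h1, ← mul_assoc, ← Complex.ofReal_mul, ← Real.exp_add]
  simp

/-- Truncation of both coordinates to `[-M, M]`. -/
def clampC (M : ℝ) (z : ℂ) : ℂ := ⟨max (-M) (min M z.re), max (-M) (min M z.im)⟩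

theorem clampC_of_norm_le {M : ℝ} {z : ℂ} (hz : ‖z‖ ≤ M) : clampC M z = z := by
  have h1 := abs_le.1 ((Complex.abs_re_le_norm z).trans hz)
  have h2 := abs_le.1 ((Complex.abs_im_le_norm z).trans hz)
  apply Complex.ext
  · simp [clampC, h1.1, h1.2]
  · simp [clampC, h2.1, h2.2]

theorem norm_clampC_le {M : ℝ} (hM : 0 ≤ M) (z : ℂ) : ‖clampC M z‖ ≤ 2 * M := by
  have key : ∀ x : ℝ, |max (-M) (min M x)| ≤ M := fun x =>
    abs_le.2 ⟨le_max_left _ _, max_le (by linarith) (min_le_left _ _)⟩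
  refine (Complex.norm_le_abs_re_add_abs_im _).trans ?_
  have h1 := key z.re
  have h2 := key z.im
  simp only [clampC]
  linarith

theorem norm_clampC_sub_le (M : ℝ) (z w : ℂ) : ‖clampC M z - clampC M w‖ ≤ ‖z - w‖ := by
  have key : ∀ x y : ℝ, |max (-M) (min M x) - max (-M) (min M y)| ≤ |x - y| := fun x y =>
    (abs_max_sub_max_le_abs _ _ _ |>.trans' (by simp only [max_comm (-M)]; exact le_rfl)).trans
      (by simpa [min_comm] using abs_min_sub_min_le_max M x M y)
  rw [← sq_le_sq₀ (norm_nonneg _) (norm_nonneg _), Complex.sq_norm, Complex.sq_norm,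
    Complex.normSq_apply, Complex.normSq_apply]
  have h1 := sq_le_sq.2 (key z.re w.re)
  have h2 := sq_le_sq.2 (key z.im w.im)
  simp only [clampC, Complex.sub_re, Complex.sub_im]
  nlinarith

/-- A solution that stays bounded up to time `T` extends past `T`. -/
theorem exists_extension {F : ℝ → ℂ} {W : ℂ → ℂ} (hF : ContinuousOn F (Set.Ici 0))
    (hW : IsLipschitzOnBounded W) {T M : ℝ} (hT : 0 ≤ T) {q : ℝ → ℂ}
    (hq : ∀ T' ∈ Set.Ico 0 T, IsVolterraSolution F W T' q) (hM : ∀ t ∈ Set.Ico 0 T, ‖q t‖ ≤ M) :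
    ∃ T₁ > T, ∃ q₁, IsVolterraSolution F W T₁ q₁ := by
  -- `‖F 0‖` takes care of `T = 0`, where `M` bounds nothing and the initial value is `F 0`.
  set N := max M ‖F 0‖ with hN
  have hN0 : 0 ≤ N := (norm_nonneg _).trans (le_max_right _ _)
  -- Truncating both coordinates at `N + 1` gives norm at most `2 (N + 1)`; the truncated field is
  -- globally Lipschitz and agrees with `W` up to norm `N + 1`.
  obtain ⟨L, hL0, hL⟩ := hW (2 * (N + 1))
  set V : ℂ → ℂ := fun z => W (clampC (N + 1) z) with hV
  have hVL : ∀ z w, ‖V z - V w‖ ≤ L * ‖z - w‖ := fun z w =>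
    (hL _ _ (norm_clampC_le (by linarith) z) (norm_clampC_le (by linarith) w)).trans
      (mul_le_mul_of_nonneg_left (norm_clampC_sub_le _ _ _) hL0)
  have hVb : IsLipschitzOnBounded V := fun _ => ⟨L, hL0, fun z w _ _ => hVL z w⟩
  have hVW : ∀ z, ‖z‖ ≤ N + 1 → V z = W z := fun z hz => by
    simp only [hV]; rw [clampC_of_norm_le hz]
  have transfer : ∀ {U U' : ℂ → ℂ} {p : ℝ → ℂ} {T' : ℝ}, (∀ t ∈ Set.Icc 0 T', U (p t) = U' (p t)) →
      IsVolterraSolution F U T' p → IsVolterraSolution F U' T' p := by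
    intro U U' p T' hU h
    refine ⟨h.cont, fun t ht => ?_⟩
    rw [h.eq t ht, volterraOp_eq_cconv, volterraOp_eq_cconv,
      cconv_congr_right ht.1 fun x hx => hU x ⟨hx.1.le, hx.2.le.trans ht.2⟩]
  obtain ⟨p, hp⟩ := exists_isVolterraSolution_of_lipschitz hL0 hVL (show 0 ≤ T + 1 by linarith)
    (hF.mono fun x hx => hx.1)
  -- By uniqueness for the truncated field its solution coincides with `q` before `T`. Hence it is
  -- bounded by `N` up to `T` and, by continuity, by `N + 1` slightly beyond, where the truncation
  -- is still inactive.
  have hpb : ∀ t ∈ Set.Ico 0 T, ‖p t‖ ≤ N := by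
    intro t ht
    have h1 : IsVolterraSolution F V t q := by
      refine transfer (fun s hs => (hVW _ ?_).symm) (hq t ht)
      have := hM s ⟨hs.1, hs.2.trans_lt ht.2⟩
      have := le_max_left M ‖F 0‖
      linarith
    have h2 := (hp.mono (by linarith [ht.2] : t ≤ T + 1)).unique hVb h1 ⟨ht.1, le_rfl⟩
    rw [h2]
    exact (hM t ht).trans (le_max_left _ _)
  have hpT : ‖p T‖ ≤ N := by
    rcases hT.eq_or_lt with h | h
    · rw [← h, hp.eq 0 ⟨le_rfl, by linarith⟩, volterraOp_eq_cconv, cconv,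
        intervalIntegral.integral_same, sub_zero]
      exact le_max_right _ _
    · have hc : ContinuousWithinAt p (Set.Ico 0 T) T :=
        (hp.cont T ⟨hT, by linarith⟩).mono fun x hx => ⟨hx.1, by linarith [hx.2]⟩
      have hne : (𝓝[Set.Ico 0 T] T).NeBot := by
        rw [← mem_closure_iff_nhdsWithin_neBot, closure_Ico h.ne]
        exact ⟨hT, le_rfl⟩
      exact le_of_tendsto hc.norm (eventually_mem_nhdsWithin.mono fun x hx => hpb x hx)
  have hev : ∀ᶠ t in 𝓝[Set.Icc 0 (T + 1)] T, ‖p t‖ < N + 1 :=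
    (hp.cont T ⟨hT, by linarith⟩).norm.eventually_lt continuousWithinAt_const (by simp; linarith)
  obtain ⟨ε, hε, hball⟩ := Metric.mem_nhdsWithin_iff.1 hev
  set η := min (ε / 2) 1 with hη
  have hη0 : 0 < η := lt_min (by linarith) one_pos
  refine ⟨T + η, by linarith, p, transfer (fun t ht => hVW _ ?_)
    (hp.mono (by linarith [min_le_right (ε / 2) 1]))⟩
  rcases lt_or_ge t T with h | h
  · linarith [hpb t ⟨ht.1, h⟩]
  · refine (hball ⟨?_, ht.1, by linarith [ht.2, min_le_right (ε / 2) 1]⟩).le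
    rw [Metric.mem_ball, Real.dist_eq, abs_of_nonneg (by linarith)]
    linarith [ht.2, min_le_left (ε / 2) 1]

/-- Uniqueness glues all solutions into one, and `Tstar` is the supremum of the existence times. It
is not attained, since a solution on a closed interval is bounded and so extends; for the same
reason a bounded `q` cannot stop at a finite time. -/
theorem exists_maximal_isVolterraSolution {F : ℝ → ℂ} {W : ℂ → ℂ}
    (hF : ContinuousOn F (Set.Ici 0)) (hW : IsLipschitzOnBounded W) :
    ∃ (Tstar : EReal) (q : ℝ → ℂ), 0 < Tstar ∧
      (∀ T : ℝ, (T : EReal) < Tstar → IsVolterraSolution F W T q) ∧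
      (∀ (T : ℝ) (q' : ℝ → ℂ), 0 ≤ T → IsVolterraSolution F W T q' →
        (T : EReal) < Tstar ∧ Set.EqOn q' q (Set.Icc 0 T)) ∧
      (∀ T : ℝ, Tstar = (T : EReal) → ¬ ∃ M, ∀ t ∈ Set.Ico 0 T, ‖q t‖ ≤ M) := by
  set S : Set ℝ := {T | 0 ≤ T ∧ ∃ q, IsVolterraSolution F W T q} with hS
  classical
  -- At time `t` any solution living on `[0, t]` is used; uniqueness makes the choice immaterial.
  set q : ℝ → ℂ := fun t => if h : t ∈ S then h.2.choose t else 0 with hq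
  set Tstar : EReal := sSup ((fun x : ℝ => (x : EReal)) '' S) with hTs
  have hagree : ∀ (T : ℝ) (q' : ℝ → ℂ), IsVolterraSolution F W T q' →
      Set.EqOn q' q (Set.Icc 0 T) := by
    intro T q' h t ht
    have hm := h.mono ht.2
    have htS : t ∈ S := ⟨ht.1, q', hm⟩
    simp only [hq]
    rw [dif_pos htS]
    exact hm.unique hW htS.2.choose_spec ⟨ht.1, le_rfl⟩
  have hext : ∀ T ∈ S, ∃ T₁ ∈ S, T < T₁ := by
    rintro T ⟨hT0, q', h⟩
    obtain ⟨C, hC⟩ := isCompact_Icc.exists_bound_of_continuousOn h.cont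
    obtain ⟨T₁, hT₁, q₁, h₁⟩ := exists_extension hF hW hT0 (fun T' hT' => h.mono hT'.2.le)
      (fun t ht => hC t ⟨ht.1, ht.2.le⟩)
    exact ⟨T₁, ⟨by linarith, q₁, h₁⟩, hT₁⟩
  have hlt : ∀ T ∈ S, (T : EReal) < Tstar := by
    intro T hT
    obtain ⟨T₁, h1, h2⟩ := hext T hT
    exact lt_of_lt_of_le (EReal.coe_lt_coe_iff.2 h2) (le_sSup ⟨T₁, h1, rfl⟩)
  have hsol : ∀ T : ℝ, (T : EReal) < Tstar → IsVolterraSolution F W T q := by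
    intro T hT
    obtain ⟨_, ⟨T₁, ⟨hT₁0, q₁, h₁⟩, rfl⟩, hlt'⟩ := lt_sSup_iff.1 hT
    have hT1 : T ≤ T₁ := (EReal.coe_lt_coe_iff.1 hlt').le
    have he := hagree T₁ q₁ h₁
    have hm := h₁.mono hT1
    refine ⟨hm.cont.congr fun t ht => (he ⟨ht.1, ht.2.trans hT1⟩).symm, fun t ht => ?_⟩
    rw [← he ⟨ht.1, ht.2.trans hT1⟩, hm.eq t ht, volterraOp_eq_cconv, volterraOp_eq_cconv,
      cconv_congr_right ht.1 fun x hx => ?_]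
    rw [he ⟨hx.1.le, hx.2.le.trans (ht.2.trans hT1)⟩]
  have h0S : (0 : ℝ) ∈ S := by
    refine ⟨le_rfl, F, hF.mono fun x hx => hx.1, fun t ht => ?_⟩
    have : t = 0 := le_antisymm ht.2 ht.1
    rw [this, volterraOp_eq_cconv, cconv, intervalIntegral.integral_same, sub_zero]
  refine ⟨Tstar, q, by simpa using hlt 0 h0S, hsol,
    fun T q' hT0 h => ⟨hlt T ⟨hT0, q', h⟩, hagree T q' h⟩, ?_⟩
  rintro T hT ⟨M, hM⟩
  have hT0 : 0 ≤ T := by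
    have := hlt 0 h0S
    rw [hT] at this
    exact (EReal.coe_lt_coe_iff.1 this).le
  obtain ⟨T₁, hT₁, q₁, h₁⟩ := exists_extension hF hW hT0
    (fun T' hT' => hsol T' (by rw [hT]; exact EReal.coe_lt_coe_iff.2 hT'.2)) hM
  have := hlt T₁ ⟨by linarith, q₁, h₁⟩
  rw [hT] at this
  exact absurd (EReal.coe_lt_coe_iff.1 this) (not_lt.2 hT₁.le)

/-! ### Fractional regularity of Volterra integrals -/

/-- `∫₀^{T-k} |f(s + k) - f(s)|² ds`. -/
def diffSq (f : ℝ → ℂ) (T k : ℝ) : ℝ≥0∞ := ∫⁻ s in Set.Ioo 0 (T - k), ‖f (s + k) - f s‖ₑ ^ 2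

/-- Half of the squared Gagliardo seminorm of order `1/2` on `(0, T)`. -/
def halfSeminorm (f : ℝ → ℂ) (T : ℝ) : ℝ≥0∞ :=
  ∫⁻ k in Set.Ioo 0 T, ENNReal.ofReal (1 / k ^ 2) * diffSq f T k

theorem ennreal_add_sq_le (a b : ℝ≥0∞) : (a + b) ^ 2 ≤ 4 * a ^ 2 + 4 * b ^ 2 := by
  rcases le_total a b with h | h
  · calc (a + b) ^ 2 ≤ (2 * b) ^ 2 := by rw [two_mul]; gcongr
      _ = 4 * b ^ 2 := by rw [mul_pow]; norm_num
      _ ≤ _ := le_add_self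
  · calc (a + b) ^ 2 ≤ (2 * a) ^ 2 := by rw [two_mul]; gcongr
      _ = 4 * a ^ 2 := by rw [mul_pow]; norm_num
      _ ≤ _ := le_self_add

/-- Young's inequality `‖κ ∗ φ‖₂ ≤ ‖κ‖₁ ‖φ‖₂` for nonnegative functions. -/
theorem lintegral_conv_sq_le {κ φ : ℝ → ℝ≥0∞} (hκ : Measurable κ) (hφ : Measurable φ) :
    ∫⁻ s, (∫⁻ x, κ x * φ (s - x)) ^ 2 ≤ (∫⁻ x, κ x) ^ 2 * ∫⁻ s, φ s ^ 2 := by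
  have h1 : ∀ s, (∫⁻ x, κ x * φ (s - x)) ^ 2 ≤ (∫⁻ x, κ x) * ∫⁻ x, κ x * φ (s - x) ^ 2 := by
    intro s
    have hm : Measurable fun x => φ (s - x) := hφ.comp (by fun_prop)
    -- Cauchy–Schwarz after splitting `κ φ = κ^{1/2} (κ^{1/2} φ)`.
    have h := ENNReal.lintegral_mul_le_Lp_mul_Lq volume (Real.HolderConjugate.two_two)
      (f := fun x => κ x ^ (1 / 2 : ℝ)) (g := fun x => κ x ^ (1 / 2 : ℝ) * φ (s - x))
      (hκ.pow_const _).aemeasurable ((hκ.pow_const _).mul hm).aemeasurable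
    have e0 : ∀ x, κ x ^ (1 / 2 : ℝ) * κ x ^ (1 / 2 : ℝ) = κ x := fun x => by
      rw [← ENNReal.rpow_add_of_nonneg _ _ (by norm_num) (by norm_num)]; norm_num
    have e1 : ∀ x, ((fun x => κ x ^ (1 / 2 : ℝ)) * fun x => κ x ^ (1 / 2 : ℝ) * φ (s - x)) x
        = κ x * φ (s - x) := fun x => by
      simp only [Pi.mul_apply]; rw [← mul_assoc, e0]
    have e2 : ∀ x, (κ x ^ (1 / 2 : ℝ)) ^ (2 : ℝ) = κ x := fun x => by
      rw [← ENNReal.rpow_mul]; norm_num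
    have e3 : ∀ x, (κ x ^ (1 / 2 : ℝ) * φ (s - x)) ^ (2 : ℝ) = κ x * φ (s - x) ^ 2 := fun x => by
      rw [ENNReal.mul_rpow_of_nonneg _ _ (by norm_num), e2, ENNReal.rpow_two]
    simp_rw [e1, e2, e3] at h
    calc _ ≤ ((∫⁻ x, κ x) ^ (1 / 2 : ℝ) * (∫⁻ x, κ x * φ (s - x) ^ 2) ^ (1 / 2 : ℝ)) ^ 2 := by
          gcongr
      _ = _ := by
          rw [mul_pow, ← ENNReal.rpow_natCast, ← ENNReal.rpow_natCast, ← ENNReal.rpow_mul,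
            ← ENNReal.rpow_mul]
          norm_num
  calc _ ≤ ∫⁻ s, (∫⁻ x, κ x) * ∫⁻ x, κ x * φ (s - x) ^ 2 := lintegral_mono h1
    _ = (∫⁻ x, κ x) * ∫⁻ s, ∫⁻ x, κ x * φ (s - x) ^ 2 := by
        refine lintegral_const_mul _ (Measurable.lintegral_prod_right'
          (f := fun p : ℝ × ℝ => κ p.2 * φ (p.1 - p.2) ^ 2) ?_)
        exact (hκ.comp measurable_snd).mul ((hφ.comp (by fun_prop)).pow_const 2)
    _ = (∫⁻ x, κ x) * ∫⁻ x, ∫⁻ s, κ x * φ (s - x) ^ 2 := by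
        rw [lintegral_lintegral_swap]
        exact ((hκ.comp measurable_snd).mul
          ((hφ.comp (by fun_prop : Measurable fun p : ℝ × ℝ => p.1 - p.2)).pow_const 2)).aemeasurable
    _ = (∫⁻ x, κ x) * ∫⁻ x, κ x * ∫⁻ s, φ s ^ 2 := by
        congr 1
        refine lintegral_congr fun x => ?_
        have hm : Measurable fun s => φ (s - x) ^ 2 := (hφ.comp (measurable_id.sub_const x)).pow_const 2
        rw [lintegral_const_mul _ hm]
        congr 1
        exact lintegral_sub_right_eq_self (fun s => φ s ^ 2) x
    _ = _ := by rw [lintegral_mul_const _ hκ, sq, mul_assoc]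

/-- The Volterra kernel extended by `0` to the negative half-line. -/
def volterraPos (t : ℝ) : ℝ := (Set.Ioi (0 : ℝ)).indicator volterraKernel t

theorem volterraPos_nonneg (t : ℝ) : 0 ≤ volterraPos t :=
  Set.indicator_nonneg (fun _ h => (volterraKernel_pos h).le) t

theorem measurable_volterraPos : Measurable volterraPos := by
  have : volterraKernel = volterraExp 0 := funext volterraKernel_eq
  unfold volterraPos
  rw [this]
  exact (stronglyMeasurable_volterraExp 0).measurable.indicator measurableSet_Ioi

theorem intervalIntegrable_volterraPos (a b : ℝ) : IntervalIntegrable volterraPos volume a b := by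
  have h : ∀ T, IntegrableOn volterraPos (Set.Iic T) := fun T => by
    unfold volterraPos
    rw [IntegrableOn, integrable_indicator_iff measurableSet_Ioi, IntegrableOn,
      Measure.restrict_restrict measurableSet_Ioi]
    have := (integrableOn_volterraExp 0 (T + 1)).congr_fun
      (fun x _ => (volterraKernel_eq x).symm) measurableSet_Ioo
    exact this.mono_set fun x hx => ⟨hx.1, by linarith [show x ≤ T from hx.2]⟩
  rw [intervalIntegrable_iff]
  exact (h (max a b)).mono_set fun x hx => hx.2

/-- The primitive of the Volterra kernel, vanishing on the negative half-line. -/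
def volterraPrim (t : ℝ) : ℝ := ∫ x in (0 : ℝ)..t, volterraPos x

theorem continuous_volterraPrim : Continuous volterraPrim :=
  intervalIntegral.continuous_primitive intervalIntegrable_volterraPos 0

theorem volterraPrim_sub (s t : ℝ) :
    volterraPrim t - volterraPrim s = ∫ x in s..t, volterraPos x :=
  intervalIntegral.integral_interval_sub_left (intervalIntegrable_volterraPos 0 t)
    (intervalIntegrable_volterraPos 0 s)

/-- As `x 𝓘(x)` is nondecreasing, `𝓘(x) ≤ t 𝓘(t)/x` on `[s, t]`, so the increment is at most `t 𝓘(t)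
log(t/s)`. Then `log(t/s) ≤ 4 ((t/s)^{1/4} - 1)` trades the logarithm for a factor `t - s` with a
square integrable singularity in `s`. -/
theorem volterraPrim_sub_le {s t : ℝ} (hs : 0 < s) (hst : s ≤ t) :
    volterraPrim t - volterraPrim s ≤
      4 * (t * volterraKernel t) * (s ^ (-(1 / 4) : ℝ) * t ^ (-(3 / 4) : ℝ) * (t - s)) := by
  have ht := hs.trans_le hst
  have hK : 0 ≤ t * volterraKernel t := (mul_pos ht (volterraKernel_pos ht)).le
  have h1 : volterraPrim t - volterraPrim s ≤ ∫ x in s..t, t * volterraKernel t * x⁻¹ := by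
    rw [volterraPrim_sub]
    refine intervalIntegral.integral_mono_on hst (intervalIntegrable_volterraPos s t) ?_
      fun x hx => ?_
    · refine (intervalIntegral.intervalIntegrable_inv (fun x hx => ?_) continuousOn_id).const_mul _
      rw [Set.uIcc_of_le hst] at hx
      exact (hs.trans_le hx.1).ne'
    · have hx0 := hs.trans_le hx.1
      rw [volterraPos, Set.indicator_of_mem (show x ∈ Set.Ioi 0 from hx0)]
      have := mul_volterraExp_mono 0 hx0 hx.2
      rw [← volterraKernel_eq, ← volterraKernel_eq] at this
      rw [← div_eq_mul_inv, le_div_iff₀ hx0, mul_comm]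
      exact this
  rw [intervalIntegral.integral_const_mul, integral_inv_of_pos hs ht] at h1
  refine h1.trans ?_
  rw [show ∀ a b c : ℝ, 4 * (a * b) * c = a * b * (4 * c) from fun a b c => by ring]
  refine mul_le_mul_of_nonneg_left ?_ hK
  have hlog : Real.log (t / s) = 4 * Real.log ((t / s) ^ (1 / 4 : ℝ)) := by
    rw [Real.log_rpow (by positivity)]; ring
  have h2 := Real.log_le_sub_one_of_pos (show 0 < (t / s) ^ (1 / 4 : ℝ) by positivity)
  rw [hlog]
  refine mul_le_mul_of_nonneg_left (h2.trans ?_) (by norm_num)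
  rw [Real.div_rpow ht.le hs.le, Real.rpow_neg hs.le, Real.rpow_neg ht.le]
  have p1 : 0 < s ^ (1 / 4 : ℝ) := by positivity
  have p2 : 0 < t ^ (3 / 4 : ℝ) := by positivity
  have e1 : t ^ (1 / 4 : ℝ) * t ^ (3 / 4 : ℝ) = t := by
    rw [← Real.rpow_add ht]; norm_num
  have e2 : s ^ (1 / 4 : ℝ) * s ^ (3 / 4 : ℝ) = s := by
    rw [← Real.rpow_add hs]; norm_num
  have e3 : s ^ (3 / 4 : ℝ) ≤ t ^ (3 / 4 : ℝ) := Real.rpow_le_rpow hs.le hst (by norm_num)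
  rw [div_sub_one p1.ne', ← mul_inv, div_le_iff₀ p1, ← div_eq_inv_mul]
  rw [div_mul_eq_mul_div, le_div_iff₀ (by positivity)]
  nlinarith [mul_le_mul_of_nonneg_left e3 p1.le]

/-- Change of variables `(t, s) ↦ (t - s, s)`. -/
theorem lintegral_diff_eq {G : ℝ × ℝ → ℝ≥0∞} (hG : Measurable G) :
    ∫⁻ k in Set.Ioi (0 : ℝ), ∫⁻ s, G (s + k, s) = ∫⁻ t, ∫⁻ s in Set.Iio t, G (t, s) := by
  have hm : MeasurableSet {p : ℝ × ℝ | p.2 < p.1} := measurableSet_lt measurable_snd measurable_fst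
  set H : ℝ × ℝ → ℝ≥0∞ := Set.indicator {p : ℝ × ℝ | p.2 < p.1} G with hH
  have hHm : Measurable H := hG.indicator hm
  have h1 : ∀ t, ∫⁻ s in Set.Iio t, G (t, s) = ∫⁻ s, H (t, s) := fun t => by
    rw [← lintegral_indicator measurableSet_Iio]
    refine lintegral_congr fun s => ?_
    by_cases h : s < t
    · simp [hH, Set.indicator, h]
    · simp [hH, Set.indicator, h]
  simp_rw [h1]
  rw [lintegral_lintegral_swap (f := fun t s => H (t, s)) hHm.aemeasurable]
  have h2 : ∀ s, ∫⁻ t, H (t, s) = ∫⁻ k, H (s + k, s) := fun s =>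
    (lintegral_add_left_eq_self (fun t => H (t, s)) s).symm
  simp_rw [h2]
  rw [lintegral_lintegral_swap (f := fun s k => H (s + k, s)) (hHm.comp (by fun_prop :
    Measurable fun p : ℝ × ℝ => (p.1 + p.2, p.1))).aemeasurable,
    ← lintegral_indicator measurableSet_Ioi]
  refine lintegral_congr fun k => ?_
  by_cases h : 0 < k
  · simp [hH, Set.indicator, h]
  · simp [hH, Set.indicator, h]

theorem halfSeminorm_eq {f : ℝ → ℂ} (hf : Continuous f) (T : ℝ) :
    halfSeminorm f T = ∫⁻ t in Set.Ioo 0 T, ∫⁻ s in Set.Ioo 0 t,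
      ENNReal.ofReal (1 / (t - s) ^ 2) * ‖f t - f s‖ₑ ^ 2 := by
  set G : ℝ × ℝ → ℝ≥0∞ := (Set.Ioo 0 T ×ˢ Set.Ioo 0 T).indicator
    fun p => ENNReal.ofReal (1 / (p.1 - p.2) ^ 2) * ‖f p.1 - f p.2‖ₑ ^ 2 with hG
  have hGm : Measurable G := by
    refine Measurable.indicator (Measurable.mul (by fun_prop :
      Measurable fun p : ℝ × ℝ => ENNReal.ofReal (1 / (p.1 - p.2) ^ 2)) ?_)
      (measurableSet_Ioo.prod measurableSet_Ioo)
    have : Continuous fun p : ℝ × ℝ => f p.1 - f p.2 := by fun_prop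
    exact this.measurable.enorm.pow_const 2
  have h := lintegral_diff_eq hGm
  have h1 : halfSeminorm f T = ∫⁻ k in Set.Ioi (0 : ℝ), ∫⁻ s, G (s + k, s) := by
    rw [halfSeminorm, ← lintegral_indicator measurableSet_Ioo,
      ← lintegral_indicator measurableSet_Ioi]
    refine lintegral_congr fun k => ?_
    by_cases hk : k ∈ Set.Ioo 0 T
    · rw [Set.indicator_of_mem hk, Set.indicator_of_mem (show k ∈ Set.Ioi 0 from hk.1), diffSq,
        ← lintegral_const_mul' _ _ ENNReal.ofReal_ne_top, ← lintegral_indicator measurableSet_Ioo]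
      refine lintegral_congr fun s => ?_
      by_cases hs : s ∈ Set.Ioo 0 (T - k)
      · rw [Set.indicator_of_mem hs, hG, Set.indicator_of_mem]
        · simp
        · exact ⟨⟨by linarith [hs.1, hk.1], by linarith [hs.2]⟩, hs.1, by linarith [hs.2, hk.1]⟩
      · rw [Set.indicator_of_notMem hs, hG, Set.indicator_of_notMem]
        rintro ⟨h1, h2⟩
        exact hs ⟨h2.1, by linarith [h1.2]⟩
    · rw [Set.indicator_of_notMem hk]
      by_cases h0 : 0 < k
      · rw [Set.indicator_of_mem (show k ∈ Set.Ioi 0 from h0)]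
        symm
        refine lintegral_eq_zero_of_ae_eq_zero (ae_of_all _ fun s => ?_)
        refine Set.indicator_of_notMem ?_ _
        rintro ⟨h1, h2⟩
        exact hk ⟨h0, by linarith [h1.2, h2.1]⟩
      · rw [Set.indicator_of_notMem (by simpa using h0)]
  rw [h1, h, ← lintegral_indicator measurableSet_Ioo]
  refine lintegral_congr fun t => ?_
  by_cases ht : t ∈ Set.Ioo 0 T
  · rw [Set.indicator_of_mem ht, ← lintegral_indicator measurableSet_Iio,
      ← lintegral_indicator measurableSet_Ioo]
    refine lintegral_congr fun s => ?_
    by_cases hs : s ∈ Set.Ioo 0 t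
    · rw [Set.indicator_of_mem hs, Set.indicator_of_mem (show s ∈ Set.Iio t from hs.2), hG,
        Set.indicator_of_mem]
      exact ⟨ht, hs.1, hs.2.trans ht.2⟩
    · rw [Set.indicator_of_notMem hs]
      by_cases hst : s < t
      · rw [Set.indicator_of_mem (show s ∈ Set.Iio t from hst), hG, Set.indicator_of_notMem]
        rintro ⟨_, h2⟩
        exact hs ⟨h2.1, hst⟩
      · rw [Set.indicator_of_notMem (by simpa using hst)]
  · rw [Set.indicator_of_notMem ht]
    refine lintegral_eq_zero_of_ae_eq_zero (ae_of_all _ fun s => ?_)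
    refine Set.indicator_of_notMem ?_ _
    rintro ⟨h1, _⟩
    exact ht h1

/-- Finiteness of `halfSeminorm` gives membership in `H^{1/2}(0, T)`. -/
theorem memHFrac_of_halfSeminorm_lt_top {f : ℝ → ℂ} (hf : Continuous f) {T : ℝ}
    (h : halfSeminorm f T < ∞) : MemHFrac (1 / 2) 0 T f := by
  constructor
  · obtain ⟨C, hC⟩ := isCompact_Icc.exists_bound_of_continuousOn
      (hf.continuousOn (s := Set.Icc 0 T))
    exact MemLp.of_bound hf.aestronglyMeasurable C ((ae_restrict_iff' measurableSet_Ioo).2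
      (ae_of_all _ fun t ht => hC t ⟨ht.1.le, ht.2.le⟩))
  set g : ℝ × ℝ → ℝ≥0∞ := fun p => ENNReal.ofReal (1 / (p.1 - p.2) ^ 2) * ‖f p.1 - f p.2‖ₑ ^ 2
    with hg
  have hgm : Measurable g := by
    refine Measurable.mul (by fun_prop :
      Measurable fun p : ℝ × ℝ => ENNReal.ofReal (1 / (p.1 - p.2) ^ 2)) ?_
    have : Continuous fun p : ℝ × ℝ => f p.1 - f p.2 := by fun_prop
    exact this.measurable.enorm.pow_const 2
  have hgs : ∀ t s, g (t, s) = g (s, t) := fun t s => by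
    simp only [hg]
    rw [enorm_sub_rev, show (t - s) ^ 2 = (s - t) ^ 2 by ring]
  have e : ∀ t s, ENNReal.ofReal (‖f t - f s‖ ^ 2 / |t - s| ^ (1 + 2 * (1 / 2 : ℝ))) = g (t, s) := by
    intro t s
    simp only [hg]
    rw [show (1 + 2 * (1 / 2 : ℝ)) = ((2 : ℕ) : ℝ) by norm_num, Real.rpow_natCast, sq_abs,
      div_eq_mul_one_div, mul_comm, ENNReal.ofReal_mul (by positivity), ENNReal.ofReal_pow
      (norm_nonneg _), ofReal_norm]
  simp_rw [e]
  rw [halfSeminorm_eq hf] at h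
  have hsplit : ∀ t ∈ Set.Ioo 0 T, ∫⁻ s in Set.Ioo 0 T, g (t, s) ≤
      (∫⁻ s in Set.Ioo 0 t, g (t, s)) + ∫⁻ s in Set.Ioo t T, g (t, s) := by
    intro t ht
    have hz : ∫⁻ s in ({t} : Set ℝ), g (t, s) = 0 := by simp
    calc _ ≤ ∫⁻ s in (Set.Ioo 0 t ∪ {t}) ∪ Set.Ioo t T, g (t, s) := by
          refine lintegral_mono_set fun s hs => ?_
          rcases lt_trichotomy s t with h | h | h
          · exact Or.inl (Or.inl ⟨hs.1, h⟩)
          · exact Or.inl (Or.inr h)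
          · exact Or.inr ⟨h, hs.2⟩
      _ ≤ ((∫⁻ s in Set.Ioo 0 t, g (t, s)) + ∫⁻ s in ({t} : Set ℝ), g (t, s)) +
          ∫⁻ s in Set.Ioo t T, g (t, s) :=
          (lintegral_union_le _ _ _).trans (add_le_add (lintegral_union_le _ _ _) le_rfl)
      _ = _ := by rw [hz, add_zero]
  have hm1 : Measurable fun t => ∫⁻ s in Set.Ioo 0 t, g (t, s) := by
    have : ∀ t, ∫⁻ s in Set.Ioo 0 t, g (t, s) =
        ∫⁻ s, Set.indicator {p : ℝ × ℝ | 0 < p.2 ∧ p.2 < p.1} g (t, s) := fun t => by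
      rw [← lintegral_indicator measurableSet_Ioo]; rfl
    simp_rw [this]
    exact Measurable.lintegral_prod_right' (hgm.indicator
      ((measurableSet_lt measurable_const measurable_snd).inter
        (measurableSet_lt measurable_snd measurable_fst)))
  have hswap : ∫⁻ t in Set.Ioo 0 T, ∫⁻ s in Set.Ioo t T, g (t, s) =
      ∫⁻ t in Set.Ioo 0 T, ∫⁻ s in Set.Ioo 0 t, g (t, s) := by
    set D : Set (ℝ × ℝ) := {p | 0 < p.1 ∧ p.1 < p.2 ∧ p.2 < T} with hD
    have hDm : MeasurableSet D := (measurableSet_lt measurable_const measurable_fst).inter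
      ((measurableSet_lt measurable_fst measurable_snd).inter
        (measurableSet_lt measurable_snd measurable_const))
    have l : ∫⁻ t in Set.Ioo 0 T, ∫⁻ s in Set.Ioo t T, g (t, s) = ∫⁻ t, ∫⁻ s, D.indicator g (t, s) := by
      rw [← lintegral_indicator measurableSet_Ioo]
      refine lintegral_congr fun t => ?_
      by_cases ht : t ∈ Set.Ioo 0 T
      · rw [Set.indicator_of_mem ht, ← lintegral_indicator measurableSet_Ioo]
        refine lintegral_congr fun s => ?_
        simp only [Set.indicator, hD, Set.mem_Ioo, Set.mem_ofPred_eq, ht.1, true_and]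
      · rw [Set.indicator_of_notMem ht]
        symm
        refine lintegral_eq_zero_of_ae_eq_zero (ae_of_all _ fun s => ?_)
        exact Set.indicator_of_notMem (fun h => ht ⟨h.1, h.2.1.trans h.2.2⟩) _
    have r : ∫⁻ t in Set.Ioo 0 T, ∫⁻ s in Set.Ioo 0 t, g (t, s) = ∫⁻ t, ∫⁻ s, D.indicator g (s, t) := by
      rw [← lintegral_indicator measurableSet_Ioo]
      refine lintegral_congr fun t => ?_
      by_cases ht : t ∈ Set.Ioo 0 T
      · rw [Set.indicator_of_mem ht, ← lintegral_indicator measurableSet_Ioo]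
        refine lintegral_congr fun s => ?_
        simp only [Set.indicator, hD, Set.mem_Ioo, Set.mem_ofPred_eq, ht.2, and_true, hgs]
      · rw [Set.indicator_of_notMem ht]
        symm
        refine lintegral_eq_zero_of_ae_eq_zero (ae_of_all _ fun s => ?_)
        exact Set.indicator_of_notMem (fun h => ht ⟨h.1.trans h.2.1, h.2.2⟩) _
    rw [l, r, lintegral_lintegral_swap (f := fun t s => D.indicator g (t, s))
      (hgm.indicator hDm).aemeasurable]
  calc _ ≤ ∫⁻ t in Set.Ioo 0 T, ((∫⁻ s in Set.Ioo 0 t, g (t, s)) + ∫⁻ s in Set.Ioo t T, g (t, s)) :=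
        setLIntegral_mono' measurableSet_Ioo hsplit
    _ = (∫⁻ t in Set.Ioo 0 T, ∫⁻ s in Set.Ioo 0 t, g (t, s)) +
        ∫⁻ t in Set.Ioo 0 T, ∫⁻ s in Set.Ioo t T, g (t, s) := lintegral_add_left hm1 _
    _ < ∞ := by rw [hswap]; exact ENNReal.add_lt_top.2 ⟨h, h⟩

/-- The primitive of the Volterra kernel belongs to `H^{1/2}`. -/
theorem halfSeminorm_volterraPrim_lt_top {T : ℝ} (hT : 0 < T) :
    halfSeminorm (fun t => (volterraPrim t : ℂ)) T < ∞ := by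
  rw [halfSeminorm_eq (f := fun t => (volterraPrim t : ℂ))
    (Complex.continuous_ofReal.comp continuous_volterraPrim)]
  set C := 16 * (T * volterraKernel T) with hC
  have hC0 : 0 < C := by have := volterraKernel_pos hT; positivity
  -- In the squared bound one of the two factors `t 𝓘(t)` is replaced by its value at `T`. The
  -- integral of `s^{-1/2}` then cancels `t^{-1/2}` and leaves a multiple of the integrable function
  -- `𝓘(t)`.
  have hb : ∀ t ∈ Set.Ioo 0 T, ∀ s ∈ Set.Ioo 0 t, ENNReal.ofReal (1 / (t - s) ^ 2) *
      ‖(volterraPrim t : ℂ) - (volterraPrim s : ℂ)‖ₑ ^ 2 ≤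
      ENNReal.ofReal (C * (volterraKernel t * t ^ (-(1 / 2) : ℝ))) *
        ENNReal.ofReal (s ^ (-(1 / 2) : ℝ)) := by
    intro t ht s hs
    have hts : 0 < t - s := by linarith [hs.2]
    have hK := volterraKernel_pos ht.1
    have h0 : 0 ≤ volterraPrim t - volterraPrim s := by
      rw [volterraPrim_sub]
      exact intervalIntegral.integral_nonneg hs.2.le fun x _ => volterraPos_nonneg x
    have h1 := volterraPrim_sub_le hs.1 hs.2.le
    have h2 := mul_volterraExp_mono 0 ht.1 ht.2.le
    rw [← volterraKernel_eq, ← volterraKernel_eq] at h2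
    rw [← Complex.ofReal_sub, ← ofReal_norm, Complex.norm_real, Real.norm_of_nonneg h0,
      ← ENNReal.ofReal_pow h0, ← ENNReal.ofReal_mul (by positivity),
      ← ENNReal.ofReal_mul (by have := ht.1; positivity)]
    refine ENNReal.ofReal_le_ofReal ?_
    have ht0 := ht.1
    have hs0 := hs.1
    have p1 : (s ^ (-(1 / 4) : ℝ)) ^ 2 = s ^ (-(1 / 2) : ℝ) := by
      rw [← Real.rpow_natCast, ← Real.rpow_mul hs0.le]; norm_num
    have p2 : (t ^ (-(3 / 4) : ℝ)) ^ 2 * t = t ^ (-(1 / 2) : ℝ) := by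
      rw [← Real.rpow_natCast, ← Real.rpow_mul ht0.le]
      nth_rewrite 2 [← Real.rpow_one t]
      rw [← Real.rpow_add ht0]; norm_num
    calc _ ≤ 1 / (t - s) ^ 2 * (4 * (t * volterraKernel t) *
          (s ^ (-(1 / 4) : ℝ) * t ^ (-(3 / 4) : ℝ) * (t - s))) ^ 2 := by gcongr
      _ = 16 * (t * volterraKernel t) * (volterraKernel t * ((t ^ (-(3 / 4) : ℝ)) ^ 2 * t)) *
          (s ^ (-(1 / 4) : ℝ)) ^ 2 := by field_simp; ring
      _ ≤ 16 * (T * volterraKernel T) * (volterraKernel t * ((t ^ (-(3 / 4) : ℝ)) ^ 2 * t)) *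
          (s ^ (-(1 / 4) : ℝ)) ^ 2 := by gcongr
      _ = _ := by rw [p1, p2, hC]
  have hin : ∀ t ∈ Set.Ioo 0 T, ∫⁻ s in Set.Ioo 0 t, ENNReal.ofReal (1 / (t - s) ^ 2) *
      ‖(volterraPrim t : ℂ) - (volterraPrim s : ℂ)‖ₑ ^ 2 ≤
      ENNReal.ofReal (2 * C * volterraKernel t) := by
    intro t ht
    have ht0 := ht.1
    have hK := volterraKernel_pos ht.1
    have hi : IntegrableOn (fun s : ℝ => s ^ (-(1 / 2) : ℝ)) (Set.Ioo 0 t) := by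
      have := intervalIntegral.intervalIntegrable_rpow' (a := 0) (b := t)
        (show (-1 : ℝ) < -(1 / 2) by norm_num)
      rwa [intervalIntegrable_iff_integrableOn_Ioo_of_le ht0.le] at this
    have hval : ∫ s in Set.Ioo 0 t, s ^ (-(1 / 2) : ℝ) = 2 * t ^ (1 / 2 : ℝ) := by
      rw [← integral_Ioc_eq_integral_Ioo, ← intervalIntegral.integral_of_le ht0.le,
        integral_rpow (Or.inl (by norm_num))]
      norm_num
      ring
    calc _ ≤ ∫⁻ s in Set.Ioo 0 t, ENNReal.ofReal (C * (volterraKernel t * t ^ (-(1 / 2) : ℝ))) *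
        ENNReal.ofReal (s ^ (-(1 / 2) : ℝ)) := setLIntegral_mono' measurableSet_Ioo (hb t ht)
      _ = ENNReal.ofReal (C * (volterraKernel t * t ^ (-(1 / 2) : ℝ))) *
          ENNReal.ofReal (2 * t ^ (1 / 2 : ℝ)) := by
        rw [lintegral_const_mul' _ _ ENNReal.ofReal_ne_top, ← ofReal_integral_eq_lintegral_ofReal hi,
          hval]
        exact (ae_restrict_iff' measurableSet_Ioo).2 (ae_of_all _ fun s hs =>
          Real.rpow_nonneg hs.1.le _)
      _ = _ := by
        rw [← ENNReal.ofReal_mul (by positivity)]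
        congr 1
        have : t ^ (-(1 / 2) : ℝ) * t ^ (1 / 2 : ℝ) = 1 := by
          rw [← Real.rpow_add ht0]; norm_num
        calc _ = 2 * C * volterraKernel t * (t ^ (-(1 / 2) : ℝ) * t ^ (1 / 2 : ℝ)) := by ring
          _ = _ := by rw [this, mul_one]
  refine lt_of_le_of_lt (setLIntegral_mono' measurableSet_Ioo hin) ?_
  have hi : IntegrableOn (fun t => 2 * C * volterraKernel t) (Set.Ioo 0 T) :=
    ((integrableOn_volterraExp 0 T).congr_fun
      (fun x _ => (volterraKernel_eq x).symm) measurableSet_Ioo).const_mul _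
  exact hi.lintegral_lt_top

/-! ### Increments of Volterra integrals -/

theorem volterraOp_eq_integral_volterraPos (G : ℝ → ℂ) {t : ℝ} (ht : 0 ≤ t) :
    volterraOp G t = ∫ x in (0 : ℝ)..t, G (t - x) * (volterraPos x : ℂ) := by
  rw [volterraOp_eq_cconv, cconv_congr_left (f' := fun x => (volterraPos x : ℂ)) ht, cconv_comm]
  · rfl
  · intro x hx
    rw [volterraPos, Set.indicator_of_mem (show x ∈ Set.Ioi 0 from hx.1)]
    rfl

/-- Convolution commutes with shifts except for a fresh piece of length `k`: over `[0, s]` the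
kernel meets the increment of `G`, over `[s, s + k]` it meets `G` itself, whose bound `M` costs an
increment of the primitive of the kernel. -/
theorem norm_sub_volterraOp_le {G : ℝ → ℂ} (hG : Continuous G) {T M : ℝ}
    (hM : ∀ t ∈ Set.Icc 0 T, ‖G t‖ ≤ M) {k s : ℝ} (hk : 0 < k) (hs : s ∈ Set.Ioo 0 (T - k)) :
    ‖volterraOp G (s + k) - volterraOp G s‖ₑ ≤
      (∫⁻ x, ENNReal.ofReal (volterraPos x) *
        (Set.Ioo 0 (T - k)).indicator (fun u => ‖G (u + k) - G u‖ₑ) (s - x)) +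
      ENNReal.ofReal M * ‖(volterraPrim (s + k) : ℂ) - (volterraPrim s : ℂ)‖ₑ := by
  have hs0 := hs.1
  have hi : ∀ (v a b : ℝ), IntervalIntegrable (fun x => G (v - x) * (volterraPos x : ℂ))
      volume a b := fun v a b =>
    (show IntervalIntegrable (fun x => (volterraPos x : ℂ)) volume a b from
      ⟨(intervalIntegrable_volterraPos a b).1.ofReal,
        (intervalIntegrable_volterraPos a b).2.ofReal⟩).continuousOn_mul
      (by fun_prop : Continuous fun x => G (v - x)).continuousOn
  rw [volterraOp_eq_integral_volterraPos G hs0.le,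
    volterraOp_eq_integral_volterraPos G (by linarith : 0 ≤ s + k),
    ← intervalIntegral.integral_add_adjacent_intervals (hi (s + k) 0 s) (hi (s + k) s (s + k)),
    add_sub_right_comm, ← intervalIntegral.integral_sub (hi _ _ _) (hi _ _ _)]
  refine (enorm_add_le _ _).trans (add_le_add ?_ ?_)
  · rw [intervalIntegral.integral_of_le hs0.le, integral_Ioc_eq_integral_Ioo]
    refine (enorm_integral_le_lintegral_enorm _).trans ?_
    rw [← lintegral_indicator measurableSet_Ioo]
    refine lintegral_mono fun x => ?_
    by_cases hx : x ∈ Set.Ioo 0 s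
    · have hm : s - x ∈ Set.Ioo 0 (T - k) := ⟨by linarith [hx.2], by linarith [hx.1, hs.2]⟩
      rw [Set.indicator_of_mem hx, Set.indicator_of_mem hm, ← sub_mul, enorm_mul, mul_comm]
      refine mul_le_mul' (le_of_eq ?_) (le_of_eq ?_)
      · rw [← ofReal_norm, Complex.norm_real, Real.norm_of_nonneg (volterraPos_nonneg x)]
      · congr 3; ring
    · rw [Set.indicator_of_notMem hx]
      exact zero_le
  · have h0 : 0 ≤ volterraPrim (s + k) - volterraPrim s := by
      rw [volterraPrim_sub]
      exact intervalIntegral.integral_nonneg (by linarith) fun x _ => volterraPos_nonneg x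
    have hM0 : 0 ≤ M := (norm_nonneg _).trans (hM s ⟨hs0.le, by linarith [hs.2]⟩)
    rw [← Complex.ofReal_sub, ← ofReal_norm, ← ofReal_norm, ← ENNReal.ofReal_mul hM0,
      Complex.norm_real, Real.norm_of_nonneg h0]
    refine ENNReal.ofReal_le_ofReal ?_
    rw [volterraPrim_sub, ← intervalIntegral.integral_const_mul]
    refine intervalIntegral.norm_integral_le_of_norm_le (by linarith)
      (ae_of_all _ fun x hx => ?_) ((intervalIntegrable_volterraPos _ _).const_mul _)
    rw [norm_mul, Complex.norm_real, Real.norm_of_nonneg (volterraPos_nonneg x)]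
    exact mul_le_mul_of_nonneg_right (hM _ ⟨by linarith [hx.2], by linarith [hx.1, hs.2]⟩)
      (volterraPos_nonneg x)

theorem ennreal_le_two_mul_of_le_add_half {X R : ℝ≥0∞} (hX : X ≠ ∞) (h : X ≤ R + X * 2⁻¹) :
    X ≤ 2 * R := by
  rcases eq_or_ne R ∞ with rfl | hR
  · simp
  have h2 : X.toReal ≤ R.toReal + X.toReal * 2⁻¹ := by
    have := ENNReal.toReal_mono (ENNReal.add_ne_top.2 ⟨hR, ENNReal.mul_ne_top hX (by simp)⟩) h
    rwa [ENNReal.toReal_add hR (ENNReal.mul_ne_top hX (by simp)), ENNReal.toReal_mul,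
      ENNReal.toReal_inv, ENNReal.toReal_ofNat] at this
  rw [← ENNReal.toReal_le_toReal hX (ENNReal.mul_ne_top (by simp) hR), ENNReal.toReal_mul,
    ENNReal.toReal_ofNat]
  linarith

/-- Transfer of regularity through the Volterra operator. -/
theorem diffSq_le_of_volterra {g q G : ℝ → ℂ} (hg : Continuous g) (hq : Continuous q)
    (hG : Continuous G) {T L : ℝ} (hL0 : 0 ≤ L) {q₀ : ℂ}
    (hL : ∀ u ∈ Set.Icc 0 T, ∀ v ∈ Set.Icc 0 T, ‖G u - G v‖ ≤ ‖g u - g v‖ + L * ‖q u - q v‖)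
    (heq : ∀ t ∈ Set.Icc 0 T, q t = q₀ + volterraOp G t) :
    ∃ C : ℝ≥0∞, C ≠ ∞ ∧ ∀ k ∈ Set.Ioo 0 T, diffSq q T k ≤
      C * (diffSq g T k + diffSq (fun t => (volterraPrim t : ℂ)) T k) := by
  obtain ⟨M, hM⟩ := isCompact_Icc.exists_bound_of_continuousOn (hG.continuousOn (s := Set.Icc 0 T))
  obtain ⟨Q, hQ⟩ := isCompact_Icc.exists_bound_of_continuousOn (hq.continuousOn (s := Set.Icc 0 T))
  -- `ρ` is the mass of the kernel weighted by `e^{-As}` with `log A = 8 (L + 1)`; then `16 ρ² L² ≤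
  -- 1/4`, small enough to absorb the Lipschitz term.
  set ρ : ℝ := 1 / (8 * (L + 1)) with hρ
  have hρ0 : 0 < ρ := by positivity
  set A : ℝ := Real.exp (8 * (L + 1)) with hA
  have hlogA : 1 / (Real.log A - 0) = ρ := by rw [hA, Real.log_exp, sub_zero]
  set e : ℝ → ℝ≥0∞ := fun s => ENNReal.ofReal (Real.exp (-(A * s))) with he
  have hem : Measurable e := by
    exact (by fun_prop : Measurable fun s => Real.exp (-(A * s))).ennreal_ofReal
  have hemul : ∀ x s, e s = e x * e (s - x) := fun x s => by
    simp only [he]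
    rw [← ENNReal.ofReal_mul (Real.exp_pos _).le, ← Real.exp_add]
    congr 2; ring
  have hA0 : 0 < A := Real.exp_pos _
  have he1 : ∀ s, 0 ≤ s → e s ≤ 1 := fun s hs => by
    simp only [he]
    rw [← ENNReal.ofReal_one]
    refine ENNReal.ofReal_le_ofReal (Real.exp_le_one_iff.2 ?_)
    have := mul_nonneg hA0.le hs
    linarith
  set κ : ℝ → ℝ≥0∞ := fun x => e x * ENNReal.ofReal (volterraPos x) with hκ
  have hκm : Measurable κ := hem.mul measurable_volterraPos.ennreal_ofReal
  have hκi : ∫⁻ x, κ x = ENNReal.ofReal ρ := by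
    rw [← hlogA, ← lintegral_exp_neg_mul_volterraExp hA0 (by rw [hA, Real.log_exp]; positivity),
      ← lintegral_indicator measurableSet_Ioi]
    refine lintegral_congr fun x => ?_
    by_cases hx : x ∈ Set.Ioi (0 : ℝ)
    · rw [Set.indicator_of_mem hx, ENNReal.ofReal_mul (Real.exp_pos _).le]
      simp only [hκ, he, volterraPos]
      rw [Set.indicator_of_mem hx, volterraKernel_eq]
    · rw [Set.indicator_of_notMem hx]
      simp only [hκ, volterraPos]
      rw [Set.indicator_of_notMem hx]; simp
  refine ⟨(e T)⁻¹ ^ 2 * (2 * (1 + 4 * ENNReal.ofReal M ^ 2)), ?_, fun k hk => ?_⟩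
  · refine ENNReal.mul_ne_top (ENNReal.pow_ne_top (ENNReal.inv_ne_top.2 ?_)) ?_
    · simp only [he]
      exact (ENNReal.ofReal_pos.2 (Real.exp_pos _)).ne'
    · exact ENNReal.mul_ne_top (by simp) (ENNReal.add_ne_top.2 ⟨by simp,
        ENNReal.mul_ne_top (by simp) (by simp)⟩)
  set Y := diffSq g T k with hY
  set Z := diffSq (fun t => (volterraPrim t : ℂ)) T k with hZ
  set X := ∫⁻ s in Set.Ioo 0 (T - k), (e s * ‖q (s + k) - q s‖ₑ) ^ 2 with hX
  set φ : ℝ → ℝ≥0∞ := fun u => e u *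
    (Set.Ioo 0 (T - k)).indicator (fun u => ‖G (u + k) - G u‖ₑ) u with hφ
  have hmem : ∀ s ∈ Set.Ioo 0 (T - k), s ∈ Set.Icc 0 T ∧ s + k ∈ Set.Icc 0 T := fun s hs =>
    ⟨⟨hs.1.le, by linarith [hs.2, hk.1]⟩, by linarith [hs.1, hk.1], by linarith [hs.2]⟩
  have hcm : ∀ f : ℝ → ℂ, Continuous f → Measurable fun s => ‖f (s + k) - f s‖ₑ := fun f hf =>
    (by fun_prop : Continuous fun s => f (s + k) - f s).measurable.enorm
  have hφm : Measurable φ := hem.mul ((hcm G hG).indicator measurableSet_Ioo)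
  have hqs : ∀ s ∈ Set.Ioo 0 (T - k), e s * ‖q (s + k) - q s‖ₑ ≤
      (∫⁻ x, κ x * φ (s - x)) + ENNReal.ofReal M *
        ‖(volterraPrim (s + k) : ℂ) - (volterraPrim s : ℂ)‖ₑ := by
    intro s hs
    rw [heq _ (hmem s hs).1, heq _ (hmem s hs).2, add_sub_add_left_eq_sub]
    calc _ ≤ e s * _ := mul_le_mul' le_rfl (norm_sub_volterraOp_le hG hM hk.1 hs)
      _ ≤ _ := by
        rw [mul_add]
        refine add_le_add ?_ ((mul_le_mul' (he1 s hs.1.le) le_rfl).trans (one_mul _).le)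
        rw [← lintegral_const_mul' _ _ (by simp [he])]
        refine lintegral_mono fun x => le_of_eq ?_
        simp only [hκ, hφ]
        rw [hemul x s]; ring
  have hXle : X ≤ 4 * (ENNReal.ofReal ρ ^ 2 * (4 * Y + 4 * (ENNReal.ofReal L ^ 2 * X))) +
      4 * (ENNReal.ofReal M ^ 2 * Z) := by
    have h1 : X ≤ ∫⁻ s in Set.Ioo 0 (T - k), (4 * (∫⁻ x, κ x * φ (s - x)) ^ 2 +
        4 * (ENNReal.ofReal M * ‖(volterraPrim (s + k) : ℂ) - (volterraPrim s : ℂ)‖ₑ) ^ 2) := by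
      refine setLIntegral_mono' measurableSet_Ioo fun s hs => ?_
      exact (pow_le_pow_left' (hqs s hs) 2).trans (ennreal_add_sq_le _ _)
    have h2 : ∫⁻ s, φ s ^ 2 ≤ 4 * Y + 4 * (ENNReal.ofReal L ^ 2 * X) := by
      have h3 : ∫⁻ s, φ s ^ 2 ≤ ∫⁻ s in Set.Ioo 0 (T - k), (4 * ‖g (s + k) - g s‖ₑ ^ 2 +
          4 * (ENNReal.ofReal L ^ 2 * (e s * ‖q (s + k) - q s‖ₑ) ^ 2)) := by
        rw [← lintegral_indicator measurableSet_Ioo]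
        refine lintegral_mono fun s => ?_
        simp only [hφ]
        by_cases hs : s ∈ Set.Ioo 0 (T - k)
        · rw [Set.indicator_of_mem hs, Set.indicator_of_mem hs, ← mul_pow]
          refine le_trans (pow_le_pow_left' ?_ 2) (ennreal_add_sq_le _ _)
          have h4 : ‖G (s + k) - G s‖ₑ ≤ ‖g (s + k) - g s‖ₑ +
              ENNReal.ofReal L * ‖q (s + k) - q s‖ₑ := by
            rw [← ofReal_norm, ← ofReal_norm, ← ofReal_norm, ← ENNReal.ofReal_mul hL0,
              ← ENNReal.ofReal_add (norm_nonneg _) (by positivity)]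
            exact ENNReal.ofReal_le_ofReal (hL _ (hmem s hs).2 _ (hmem s hs).1)
          calc _ ≤ e s * _ := mul_le_mul' le_rfl h4
            _ = e s * ‖g (s + k) - g s‖ₑ + ENNReal.ofReal L * (e s * ‖q (s + k) - q s‖ₑ) := by
              ring
            _ ≤ _ := add_le_add ((mul_le_mul' (he1 s hs.1.le) le_rfl).trans (one_mul _).le) le_rfl
        · rw [Set.indicator_of_notMem hs, Set.indicator_of_notMem hs]; simp
      refine h3.trans (le_of_eq ?_)
      rw [lintegral_add_left (((hcm g hg).pow_const 2).const_mul _),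
        lintegral_const_mul _ ((hcm g hg).pow_const 2),
        lintegral_const_mul' _ _ (by simp),
        lintegral_const_mul' _ _ (by simp)]
      rfl
    refine h1.trans ?_
    rw [lintegral_add_right _ (((((hcm (fun t => (volterraPrim t : ℂ))
      (Complex.continuous_ofReal.comp continuous_volterraPrim))).const_mul _).pow_const 2).const_mul
        _), lintegral_const_mul' _ _ (by simp), lintegral_const_mul' _ _ (by simp)]
    refine add_le_add (mul_le_mul' le_rfl ?_) (mul_le_mul' le_rfl (le_of_eq ?_))
    · calc _ ≤ ∫⁻ s, (∫⁻ x, κ x * φ (s - x)) ^ 2 := setLIntegral_le_lintegral _ _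
        _ ≤ _ := lintegral_conv_sq_le hκm hφm
        _ ≤ _ := by rw [hκi]; exact mul_le_mul' le_rfl h2
    · simp_rw [mul_pow]
      rw [lintegral_const_mul' _ _ (by simp)]
      rfl
  -- Absorbing `X / 2` into the left side requires `X` to be finite beforehand; boundedness of `q`
  -- provides this.
  have hXt : X ≠ ∞ := by
    have : X ≤ ∫⁻ s in Set.Ioo 0 (T - k), ENNReal.ofReal (2 * Q) ^ 2 := by
      refine setLIntegral_mono' measurableSet_Ioo fun s hs => pow_le_pow_left' ?_ 2
      refine (mul_le_mul' (he1 s hs.1.le) le_rfl).trans ?_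
      rw [one_mul, ← ofReal_norm]
      refine ENNReal.ofReal_le_ofReal ((norm_sub_le _ _).trans ?_)
      linarith [hQ _ (hmem s hs).1, hQ _ (hmem s hs).2]
    refine ne_top_of_le_ne_top ?_ this
    rw [setLIntegral_const]
    exact ENNReal.mul_ne_top (ENNReal.pow_ne_top ENNReal.ofReal_ne_top) (by simp)
  have hρ1 : 16 * ENNReal.ofReal ρ ^ 2 ≤ 1 := by
    rw [← ENNReal.ofReal_pow hρ0.le, show (16 : ℝ≥0∞) = ENNReal.ofReal 16 by simp,
      ← ENNReal.ofReal_mul (by norm_num), ← ENNReal.ofReal_one]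
    refine ENNReal.ofReal_le_ofReal ?_
    have : ρ ≤ 1 / 8 := by
      rw [hρ]; gcongr; linarith
    nlinarith
  have hρ2 : 16 * ENNReal.ofReal ρ ^ 2 * ENNReal.ofReal L ^ 2 ≤ 2⁻¹ := by
    rw [← ENNReal.ofReal_pow hρ0.le, ← ENNReal.ofReal_pow hL0,
      show (16 : ℝ≥0∞) = ENNReal.ofReal 16 by simp,
      ← ENNReal.ofReal_mul (by norm_num), ← ENNReal.ofReal_mul (by positivity),
      show (2⁻¹ : ℝ≥0∞) = ENNReal.ofReal (1 / 2) by
        rw [one_div, ENNReal.ofReal_inv_of_pos (by norm_num)]; simp]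
    refine ENNReal.ofReal_le_ofReal ?_
    have h1 : ρ * L ≤ 1 / 8 := by
      rw [hρ, div_mul_eq_mul_div, div_le_div_iff₀ (by positivity) (by norm_num)]; nlinarith
    have h2 : 0 ≤ ρ * L := by positivity
    calc 16 * ρ ^ 2 * L ^ 2 = 16 * (ρ * L) ^ 2 := by ring
      _ ≤ 16 * (1 / 8) ^ 2 := by gcongr
      _ ≤ _ := by norm_num
  have hX2 : X ≤ 2 * (Y + 4 * (ENNReal.ofReal M ^ 2 * Z)) := by
    refine ennreal_le_two_mul_of_le_add_half hXt (hXle.trans ?_)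
    calc _ = 16 * ENNReal.ofReal ρ ^ 2 * Y + 4 * (ENNReal.ofReal M ^ 2 * Z) +
          16 * ENNReal.ofReal ρ ^ 2 * ENNReal.ofReal L ^ 2 * X := by ring
      _ ≤ 1 * Y + 4 * (ENNReal.ofReal M ^ 2 * Z) + 2⁻¹ * X := by gcongr
      _ = _ := by rw [one_mul, mul_comm X]
  have heT0 : e T ≠ 0 := by
    simp only [he]
    exact (ENNReal.ofReal_pos.2 (Real.exp_pos _)).ne'
  have hqX : diffSq q T k ≤ (e T)⁻¹ ^ 2 * X := by
    rw [hX, ← lintegral_const_mul' _ _ (by simpa using heT0)]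
    refine setLIntegral_mono' measurableSet_Ioo fun s hs => ?_
    rw [← mul_pow]
    refine pow_le_pow_left' ?_ 2
    have : e T ≤ e s := by
      refine ENNReal.ofReal_le_ofReal (Real.exp_le_exp.2 ?_)
      have := mul_le_mul_of_nonneg_left (hmem s hs).1.2 hA0.le
      linarith
    calc ‖q (s + k) - q s‖ₑ = (e T)⁻¹ * (e T * ‖q (s + k) - q s‖ₑ) := by
          rw [← mul_assoc, ENNReal.inv_mul_cancel heT0 (by simp [he]), one_mul]
      _ ≤ _ := by gcongr
  refine hqX.trans ?_
  rw [mul_assoc]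
  refine mul_le_mul' le_rfl (hX2.trans ?_)
  rw [mul_assoc]
  refine mul_le_mul' le_rfl ?_
  calc Y + 4 * (ENNReal.ofReal M ^ 2 * Z) = 1 * Y + (4 * ENNReal.ofReal M ^ 2) * Z := by ring
    _ ≤ (1 + 4 * ENNReal.ofReal M ^ 2) * Y + (1 + 4 * ENNReal.ofReal M ^ 2) * Z := by
      gcongr
      · exact le_self_add
      · exact le_add_self
    _ = _ := by ring

theorem measurable_diffSq {f : ℝ → ℂ} (hf : Continuous f) (T : ℝ) : Measurable (diffSq f T) := by
  have h : diffSq f T = fun k => ∫⁻ s, Set.indicator {p : ℝ × ℝ | 0 < p.2 ∧ p.2 < T - p.1}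
      (fun p => ‖f (p.2 + p.1) - f p.2‖ₑ ^ 2) (k, s) := by
    ext k
    rw [diffSq, ← lintegral_indicator measurableSet_Ioo]
    rfl
  rw [h]
  refine Measurable.lintegral_prod_right' (Measurable.indicator ?_
    ((measurableSet_lt measurable_const measurable_snd).inter
      (measurableSet_lt measurable_snd (by fun_prop))))
  exact (by fun_prop : Continuous fun p : ℝ × ℝ => f (p.2 + p.1) - f p.2).measurable.enorm.pow_const 2

theorem halfSeminorm_lt_top_of_diffSq_le {q g f : ℝ → ℂ} (hg : Continuous g) {T : ℝ} {C : ℝ≥0∞}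
    (hC : C ≠ ∞) (h : ∀ k ∈ Set.Ioo 0 T, diffSq q T k ≤ C * (diffSq g T k + diffSq f T k))
    (h1 : halfSeminorm g T < ∞) (h2 : halfSeminorm f T < ∞) : halfSeminorm q T < ∞ := by
  calc halfSeminorm q T ≤ ∫⁻ k in Set.Ioo 0 T, C * (ENNReal.ofReal (1 / k ^ 2) * diffSq g T k +
        ENNReal.ofReal (1 / k ^ 2) * diffSq f T k) := by
        refine setLIntegral_mono' measurableSet_Ioo fun k hk => ?_
        calc _ ≤ ENNReal.ofReal (1 / k ^ 2) * (C * (diffSq g T k + diffSq f T k)) :=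
              mul_le_mul' le_rfl (h k hk)
          _ = _ := by ring
    _ = C * (halfSeminorm g T + halfSeminorm f T) := by
        rw [lintegral_const_mul' _ _ hC, lintegral_add_left]
        · rfl
        · exact (by fun_prop : Measurable fun k : ℝ => ENNReal.ofReal (1 / k ^ 2)).mul
            (measurable_diffSq hg T)
    _ < ∞ := ENNReal.mul_lt_top hC.lt_top (ENNReal.add_lt_top.2 ⟨h1, h2⟩)

/-- Solutions of Volterra equations inherit `H^{1/2}` regularity from the source term. -/
theorem halfSeminorm_lt_top_of_volterra {g q G : ℝ → ℂ} (hg : Continuous g) (hq : Continuous q)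
    (hG : Continuous G) {T L : ℝ} (hT : 0 < T) (hL0 : 0 ≤ L) {q₀ : ℂ}
    (hL : ∀ u ∈ Set.Icc 0 T, ∀ v ∈ Set.Icc 0 T, ‖G u - G v‖ ≤ ‖g u - g v‖ + L * ‖q u - q v‖)
    (heq : ∀ t ∈ Set.Icc 0 T, q t = q₀ + volterraOp G t) (h : halfSeminorm g T < ∞) :
    halfSeminorm q T < ∞ := by
  obtain ⟨C, hC, hCle⟩ := diffSq_le_of_volterra hg hq hG hL0 hL heq
  exact halfSeminorm_lt_top_of_diffSq_le hg hC hCle h (halfSeminorm_volterraPrim_lt_top hT)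

/-! ### The distribution of `p²` on the plane and local smoothing -/

/-- `p² = (2π|ξ|)²`. -/
def psq (ξ : Plane) : ℝ := (2 * Real.pi * ‖ξ‖) ^ 2

theorem psq_nonneg (ξ : Plane) : 0 ≤ psq ξ := sq_nonneg _

theorem continuous_psq : Continuous psq := by unfold psq; fun_prop

theorem freeSymbol_eq (t : ℝ) (ξ : Plane) :
    freeSymbol t ξ = Complex.exp (Complex.I * ((-(psq ξ * t) : ℝ) : ℂ)) := by
  unfold freeSymbol psq
  congr 1
  push_cast
  ring

theorem norm_freeSymbol (t : ℝ) (ξ : Plane) : ‖freeSymbol t ξ‖ = 1 := by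
  rw [freeSymbol_eq, Complex.norm_exp_I_mul_ofReal]

theorem freeSymbol_add (s t : ℝ) (ξ : Plane) :
    freeSymbol (s + t) ξ = freeSymbol s ξ * freeSymbol t ξ := by
  rw [freeSymbol_eq, freeSymbol_eq, freeSymbol_eq, ← Complex.exp_add]
  congr 1
  push_cast
  ring

theorem continuous_freeSymbol_uncurry : Continuous fun p : ℝ × Plane => freeSymbol p.1 p.2 := by
  unfold freeSymbol
  fun_prop

theorem continuous_freeSymbol (t : ℝ) : Continuous (freeSymbol t) := by
  unfold freeSymbol
  fun_prop

theorem continuous_freeSymbol_comp {X : Type*} [TopologicalSpace X] {f : X → ℝ} {g : X → Plane}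
    (hf : Continuous f) (hg : Continuous g) : Continuous fun x => freeSymbol (f x) (g x) := by
  unfold freeSymbol
  fun_prop

theorem volume_psq_lt (c : ℝ) :
    volume {ξ : Plane | psq ξ < c} = ENNReal.ofReal (max c 0 / (4 * Real.pi)) := by
  have hpi := Real.pi_pos
  have h : {ξ : Plane | psq ξ < c} = Metric.ball 0 (Real.sqrt c / (2 * Real.pi)) := by
    ext ξ
    rw [Metric.mem_ball, dist_zero_right, lt_div_iff₀ (by positivity),
      Real.lt_sqrt (by positivity), mul_comm]
    rfl
  rw [h, EuclideanSpace.volume_ball_fin_two, ← ENNReal.ofReal_pow (by positivity),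
    ← ENNReal.ofReal_mul (by positivity)]
  congr 1
  rw [div_pow]
  rcases le_total c 0 with hc | hc
  · rw [Real.sqrt_eq_zero_of_nonpos hc, max_eq_right hc]; simp
  · rw [Real.sq_sqrt hc, max_eq_left hc]; field_simp; ring

/-- In dimension two the disc `{p² < c}` has area linear in `c`, so `p²` has constant density on the
half-line. This lets integrals over the plane be read as integrals over a time frequency. -/
theorem map_psq :
    Measure.map psq volume = ENNReal.ofReal (1 / (4 * Real.pi)) • volume.restrict (Set.Ici 0) := by
  have hpi := Real.pi_pos
  have hm : Measurable psq := continuous_psq.measurable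
  have hval : ∀ a b : ℝ, a < b → Measure.map psq volume (Set.Ico a b) =
      ENNReal.ofReal ((max b 0 - max a 0) / (4 * Real.pi)) := by
    intro a b hab
    rw [Measure.map_apply hm measurableSet_Ico]
    have : psq ⁻¹' Set.Ico a b = {ξ | psq ξ < b} \ {ξ | psq ξ < a} := by
      ext ξ; simp [and_comm]
    rw [this, measure_sdiff (show {ξ | psq ξ < a} ⊆ {ξ | psq ξ < b} from fun ξ hξ => lt_trans hξ hab)
      (measurableSet_lt hm measurable_const).nullMeasurableSet (by rw [volume_psq_lt]; simp),
      volume_psq_lt, volume_psq_lt, sub_div, ENNReal.ofReal_sub]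
    positivity
  refine Measure.ext_of_Ico' _ _ (fun a b hab => by rw [hval a b hab]; simp) fun a b hab => ?_
  rw [hval a b hab, Measure.smul_apply, Measure.restrict_apply measurableSet_Ico, smul_eq_mul]
  have : Set.Ico a b ∩ Set.Ici 0 = Set.Ico (max a 0) b := by
    ext x; simp only [Set.mem_inter_iff, Set.mem_Ico, Set.mem_Ici, max_le_iff]; tauto
  rw [this, Real.volume_Ico, ← ENNReal.ofReal_mul (by positivity)]
  rcases le_total b 0 with hb | hb
  · rw [max_eq_right hb, max_eq_right (hab.le.trans hb), sub_self, zero_div, ENNReal.ofReal_zero,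
      ENNReal.ofReal_of_nonpos]
    exact mul_nonpos_of_nonneg_of_nonpos (by positivity) (by linarith)
  · rw [max_eq_left hb, one_div_mul_eq_div]

theorem lintegral_comp_psq {g : ℝ → ℝ≥0∞} (hg : Measurable g) :
    ∫⁻ ξ, g (psq ξ) = ENNReal.ofReal (1 / (4 * Real.pi)) * ∫⁻ x in Set.Ici 0, g x := by
  rw [← lintegral_map hg continuous_psq.measurable, map_psq, lintegral_smul_measure, smul_eq_mul]

/-- The oscillatory integral `∫ e^{-i p² t} m(ξ) dξ`. -/
def oscIntegral (m : Plane → ℂ) (t : ℝ) : ℂ := ∫ ξ, freeSymbol t ξ * m ξ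

theorem integrable_freeSymbol_mul {m : Plane → ℂ} (hm : Integrable m) (t : ℝ) :
    Integrable fun ξ => freeSymbol t ξ * m ξ :=
  hm.bdd_mul (continuous_freeSymbol t).aestronglyMeasurable
    (ae_of_all _ fun ξ => (norm_freeSymbol t ξ).le)

theorem continuous_oscIntegral {m : Plane → ℂ} (hm : Integrable m) :
    Continuous (oscIntegral m) := by
  refine continuous_of_dominated (bound := fun ξ => ‖m ξ‖)
    (fun t => (integrable_freeSymbol_mul hm t).aestronglyMeasurable)
    (fun t => ae_of_all _ fun ξ => ?_) hm.norm (ae_of_all _ fun ξ => ?_)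
  · rw [norm_mul, norm_freeSymbol, one_mul]
  · exact ((continuous_freeSymbol_uncurry.comp (by fun_prop :
      Continuous fun t : ℝ => (t, ξ)))).mul continuous_const

theorem norm_oscIntegral_le (m : Plane → ℂ) (t : ℝ) :
    ‖oscIntegral m t‖ ≤ ∫ ξ, ‖m ξ‖ := by
  refine (norm_integral_le_integral_norm _).trans (le_of_eq ?_)
  simp_rw [norm_mul, norm_freeSymbol, one_mul]

theorem ennreal_mul_le_sq_add_sq (a b : ℝ≥0∞) : a * b ≤ a ^ 2 + b ^ 2 := by
  rcases le_total a b with h | h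
  · calc a * b ≤ b * b := mul_le_mul' h le_rfl
      _ = b ^ 2 := (sq b).symm
      _ ≤ _ := le_add_self
  · calc a * b ≤ a * a := mul_le_mul' le_rfl h
      _ = a ^ 2 := (sq a).symm
      _ ≤ _ := le_self_add

/-- A Gaussian window in time becomes a Gaussian in the frequency gap `p²(ξ) - p²(η)`: waves with
distant values of `p²` are almost orthogonal on the window. -/
theorem integral_gaussian_mul_freeSymbol (ξ η : Plane) :
    ∫ t : ℝ, (Real.exp (-t ^ 2) : ℂ) * (freeSymbol t ξ * (starRingEnd ℂ) (freeSymbol t η)) =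
      (Real.sqrt Real.pi * Real.exp (-(psq ξ - psq η) ^ 2 / 4) : ℝ) := by
  have h := fourierIntegral_gaussian (b := 1) (by simp) (-((psq ξ - psq η : ℝ) : ℂ))
  have e : ∀ t : ℝ, (Real.exp (-t ^ 2) : ℂ) * (freeSymbol t ξ * (starRingEnd ℂ) (freeSymbol t η)) =
      Complex.exp (Complex.I * -((psq ξ - psq η : ℝ) : ℂ) * t) * Complex.exp (-1 * (t : ℂ) ^ 2) := by
    intro t
    rw [freeSymbol_eq, freeSymbol_eq, ← Complex.exp_conj, map_mul, Complex.conj_I,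
      Complex.conj_ofReal, Complex.ofReal_exp, ← Complex.exp_add, ← Complex.exp_add,
      ← Complex.exp_add]
    congr 1
    push_cast
    ring
  simp_rw [e]
  rw [h]
  have h2 : ((Real.pi : ℂ) / 1) ^ (1 / 2 : ℂ) = (Real.sqrt Real.pi : ℂ) := by
    rw [Real.sqrt_eq_rpow, Complex.ofReal_cpow Real.pi_pos.le]; norm_num
  rw [h2, Complex.ofReal_mul, Complex.ofReal_exp]
  congr 2
  push_cast
  ring

/-- The constant of the local smoothing estimate. -/
def smoothingConst : ℝ≥0∞ := ENNReal.ofReal (1 / (4 * Real.pi)) *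
  ∫⁻ x : ℝ, ENNReal.ofReal (Real.sqrt Real.pi * Real.exp (-x ^ 2 / 4))

theorem smoothingConst_ne_top : smoothingConst ≠ ∞ := by
  refine ENNReal.mul_ne_top (by simp) ?_
  have h : Integrable fun x : ℝ => Real.sqrt Real.pi * Real.exp (-x ^ 2 / 4) := by
    have := (integrable_exp_neg_mul_sq (show (0 : ℝ) < 1 / 4 by norm_num)).const_mul
      (Real.sqrt Real.pi)
    refine this.congr (ae_of_all _ fun x => ?_)
    simp only
    congr 2
    ring
  exact h.lintegral_lt_top.ne

theorem lintegral_gaussian_psq_le (c : ℝ) :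
    ∫⁻ ξ, ENNReal.ofReal (Real.sqrt Real.pi * Real.exp (-(c - psq ξ) ^ 2 / 4)) ≤
      smoothingConst := by
  have hm : Measurable fun x : ℝ =>
      ENNReal.ofReal (Real.sqrt Real.pi * Real.exp (-(c - x) ^ 2 / 4)) := by fun_prop
  rw [lintegral_comp_psq (g := fun x : ℝ =>
      ENNReal.ofReal (Real.sqrt Real.pi * Real.exp (-(c - x) ^ 2 / 4))) hm]
  refine mul_le_mul' le_rfl ((setLIntegral_le_lintegral _ _).trans (le_of_eq ?_))
  exact lintegral_sub_left_eq_self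
    (fun x => ENNReal.ofReal (Real.sqrt Real.pi * Real.exp (-x ^ 2 / 4))) c

/-- Schur's test. -/
theorem lintegral_prod_add_mul_le {α : Type*} [MeasurableSpace α] {μ : Measure α} [SFinite μ]
    {k : α × α → ℝ≥0∞} {a : α → ℝ≥0∞} {K : ℝ≥0∞} (ha : AEMeasurable a μ) (hk : Measurable k)
    (h1 : ∀ x, ∫⁻ y, k (x, y) ∂μ ≤ K) (h2 : ∀ y, ∫⁻ x, k (x, y) ∂μ ≤ K) :
    ∫⁻ p, (a p.1 + a p.2) * k p ∂(μ.prod μ) ≤ 2 * K * ∫⁻ x, a x ∂μ := by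
  have hm1 : AEMeasurable (fun p : α × α => a p.1 * k p) (μ.prod μ) :=
    ha.comp_fst.mul hk.aemeasurable
  have hm2 : AEMeasurable (fun p : α × α => a p.2 * k p) (μ.prod μ) :=
    ha.comp_snd.mul hk.aemeasurable
  simp_rw [add_mul]
  rw [lintegral_add_left' hm1, lintegral_prod _ hm1, lintegral_prod_symm _ hm2]
  calc _ ≤ (∫⁻ x, a x * K ∂μ) + ∫⁻ x, a x * K ∂μ := by
        refine add_le_add (lintegral_mono fun x => ?_) (lintegral_mono fun x => ?_)
        · simp only
          rw [lintegral_const_mul _ (show Measurable fun y => k (x, y) from hk.comp (by fun_prop))]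
          exact mul_le_mul' le_rfl (h1 x)
        · simp only
          rw [lintegral_const_mul _ (show Measurable fun y => k (y, x) from hk.comp (by fun_prop))]
          exact mul_le_mul' le_rfl (h2 x)
    _ = _ := by
        rw [lintegral_mul_const'' _ ha]
        ring

/-- Local smoothing for `oscIntegral`. -/
theorem lintegral_sq_oscIntegral_le {m : Plane → ℂ} (hm : Integrable m) :
    ∫⁻ t, ENNReal.ofReal (Real.exp (-t ^ 2)) * ‖oscIntegral m t‖ₑ ^ 2 ≤
      2 * smoothingConst * ∫⁻ ξ, ‖m ξ‖ₑ ^ 2 := by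
  have hg : Integrable fun t : ℝ => Real.exp (-t ^ 2) := by
    simpa using integrable_exp_neg_mul_sq (show (0 : ℝ) < 1 by norm_num)
  have hmc : Integrable fun ξ => (starRingEnd ℂ) (m ξ) :=
    (Complex.conjCLE : ℂ →L[ℝ] ℂ).integrable_comp hm
  have hgc : Integrable fun t : ℝ => (Real.exp (-t ^ 2) : ℂ) := hg.ofReal
  -- The square of `oscIntegral` is expanded into a double integral over `(ξ, η)` and the time
  -- integral is done first. Schur's test then applies, because the resulting Gaussian in `p²` has
  -- uniformly bounded mass over the plane.
  set M : Plane × Plane → ℂ := fun p => m p.1 * (starRingEnd ℂ) (m p.2) with hM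
  have hMi : Integrable M (volume.prod volume) := hm.mul_prod hmc
  set f : ℝ → Plane × Plane → ℂ := fun t p =>
    (Real.exp (-t ^ 2) : ℂ) * (freeSymbol t p.1 * (starRingEnd ℂ) (freeSymbol t p.2)) * M p with hf
  have hfi : Integrable (Function.uncurry f) (volume.prod volume) := by
    have h1 : Integrable (fun z : ℝ × (Plane × Plane) => (Real.exp (-z.1 ^ 2) : ℂ) * M z.2)
        (volume.prod volume) := Integrable.mul_prod (f := fun t : ℝ => (Real.exp (-t ^ 2) : ℂ)) hgc hMi
    have h2 : Continuous fun z : ℝ × (Plane × Plane) =>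
        freeSymbol z.1 z.2.1 * (starRingEnd ℂ) (freeSymbol z.1 z.2.2) :=
      (continuous_freeSymbol_comp continuous_fst (continuous_fst.comp continuous_snd)).mul
        (continuous_freeSymbol_comp continuous_fst (continuous_snd.comp continuous_snd)).star
    have h3 := h1.bdd_mul (c := 1) h2.aestronglyMeasurable (ae_of_all _ fun z => by
      rw [norm_mul, RCLike.norm_conj, norm_freeSymbol, norm_freeSymbol, one_mul])
    refine h3.congr (ae_of_all _ fun z => ?_)
    simp only [hf, Function.uncurry]
    ring
  have hinner : ∀ t, ∫ p, f t p = ((Real.exp (-t ^ 2) * ‖oscIntegral m t‖ ^ 2 : ℝ) : ℂ) := by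
    intro t
    have h1 : ∀ p, f t p = (Real.exp (-t ^ 2) : ℂ) * ((freeSymbol t p.1 * m p.1) *
        (fun η => (starRingEnd ℂ) (freeSymbol t η * m η)) p.2) := fun p => by
      simp only [hf, hM, map_mul]; ring
    simp_rw [h1]
    have h2 := integral_prod_mul (μ := (volume : Measure Plane)) (ν := (volume : Measure Plane))
      (fun ξ => freeSymbol t ξ * m ξ) (fun η => (starRingEnd ℂ) (freeSymbol t η * m η))
    rw [integral_const_mul, Measure.volume_eq_prod, h2, integral_conj]
    rw [show (∫ ξ, freeSymbol t ξ * m ξ) = oscIntegral m t from rfl, Complex.mul_conj,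
      Complex.normSq_eq_norm_sq, Complex.ofReal_mul]
  have hreal : Integrable fun t : ℝ => Real.exp (-t ^ 2) * ‖oscIntegral m t‖ ^ 2 := by
    refine hg.mul_bdd (c := (∫ ξ, ‖m ξ‖) ^ 2)
      ((continuous_oscIntegral hm).norm.pow 2).aestronglyMeasurable (ae_of_all _ fun t => ?_)
    rw [norm_pow, norm_norm]
    exact pow_le_pow_left₀ (norm_nonneg _) (norm_oscIntegral_le m t) 2
  have hL : ∫⁻ t, ENNReal.ofReal (Real.exp (-t ^ 2)) * ‖oscIntegral m t‖ₑ ^ 2 =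
      ‖∫ t, ∫ p, f t p‖ₑ := by
    simp_rw [hinner]
    rw [integral_complex_ofReal, ← ofReal_norm, Complex.norm_real, Real.norm_of_nonneg
      (integral_nonneg fun t => by positivity), ofReal_integral_eq_lintegral_ofReal hreal
      (ae_of_all _ fun t => by positivity)]
    refine lintegral_congr fun t => ?_
    rw [ENNReal.ofReal_mul (Real.exp_pos _).le, ENNReal.ofReal_pow (norm_nonneg _), ofReal_norm]
  rw [hL, integral_integral_swap hfi]
  set k : Plane × Plane → ℝ≥0∞ := fun p =>
    ENNReal.ofReal (Real.sqrt Real.pi * Real.exp (-(psq p.1 - psq p.2) ^ 2 / 4)) with hk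
  have hkm : Measurable k := by
    have h1 := continuous_psq
    exact (by fun_prop : Continuous fun p : Plane × Plane =>
      Real.sqrt Real.pi * Real.exp (-(psq p.1 - psq p.2) ^ 2 / 4)).measurable.ennreal_ofReal
  have hp : ∀ p, ‖∫ t, f t p‖ₑ ≤ (‖m p.1‖ₑ ^ 2 + ‖m p.2‖ₑ ^ 2) * k p := by
    intro p
    simp only [hf]
    rw [integral_mul_const, integral_gaussian_mul_freeSymbol, enorm_mul, mul_comm]
    refine mul_le_mul' ?_ (le_of_eq ?_)
    · simp only [hM]
      rw [enorm_mul, ← ofReal_norm ((starRingEnd ℂ) (m p.2)), RCLike.norm_conj, ofReal_norm]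
      exact ennreal_mul_le_sq_add_sq _ _
    · rw [← ofReal_norm, Complex.norm_real, Real.norm_of_nonneg (by positivity)]
  have hschur : ∫⁻ p : Plane × Plane, (‖m p.1‖ₑ ^ 2 + ‖m p.2‖ₑ ^ 2) * k p
      ∂((volume : Measure Plane).prod volume) ≤ 2 * smoothingConst * ∫⁻ ξ, ‖m ξ‖ₑ ^ 2 := by
    refine lintegral_prod_add_mul_le (a := fun ξ => ‖m ξ‖ₑ ^ 2)
      (hm.aestronglyMeasurable.enorm.pow_const 2) hkm (fun ξ => ?_) fun η => ?_
    · exact lintegral_gaussian_psq_le (psq ξ)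
    · refine le_trans (le_of_eq (lintegral_congr fun ξ => ?_)) (lintegral_gaussian_psq_le (psq η))
      simp only [hk]
      rw [show (psq ξ - psq η) ^ 2 = (psq η - psq ξ) ^ 2 by ring]
  exact (enorm_integral_le_lintegral_enorm _).trans ((lintegral_mono hp).trans hschur)

/-- `∫₀^∞ min((xk)², 4) k⁻² dk ≤ 5x`. -/
theorem lintegral_inv_sq_mul_min_le {x : ℝ} (hx : 0 ≤ x) :
    ∫⁻ k in Set.Ioi (0 : ℝ), ENNReal.ofReal (1 / k ^ 2 * min ((x * k) ^ 2) 4) ≤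
      ENNReal.ofReal (5 * x) := by
  rcases hx.eq_or_lt with rfl | hx
  · simp
  -- The integral is split at `k = 1/x`: below it the quadratic bound contributes `x`, above it the
  -- constant bound contributes `4x`.
  have h1 : ∫⁻ k in Set.Ioc (0 : ℝ) x⁻¹, ENNReal.ofReal (1 / k ^ 2 * min ((x * k) ^ 2) 4) ≤
      ENNReal.ofReal x := by
    calc _ ≤ ∫⁻ k in Set.Ioc (0 : ℝ) x⁻¹, ENNReal.ofReal (x ^ 2) := by
          refine setLIntegral_mono' measurableSet_Ioc fun k hk => ENNReal.ofReal_le_ofReal ?_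
          have hk0 := hk.1
          calc _ ≤ 1 / k ^ 2 * (x * k) ^ 2 := by gcongr; exact min_le_left _ _
            _ = x ^ 2 := by field_simp
      _ = ENNReal.ofReal x := by
          rw [setLIntegral_const, Real.volume_Ioc, ← ENNReal.ofReal_mul (by positivity)]
          congr 1; field_simp; ring
  have h2 : ∫⁻ k in Set.Ioi x⁻¹, ENNReal.ofReal (1 / k ^ 2 * min ((x * k) ^ 2) 4) ≤
      ENNReal.ofReal (4 * x) := by
    have hx' : 0 < x⁻¹ := inv_pos.2 hx
    have hi := (integrableOn_Ioi_rpow_of_lt (show (-2 : ℝ) < -1 by norm_num) hx').const_mul 4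
    have hv := integral_Ioi_rpow_of_lt (show (-2 : ℝ) < -1 by norm_num) hx'
    calc _ ≤ ∫⁻ k in Set.Ioi x⁻¹, ENNReal.ofReal (4 * k ^ (-2 : ℝ)) := by
          refine setLIntegral_mono' measurableSet_Ioi fun k hk => ENNReal.ofReal_le_ofReal ?_
          have hk0 : 0 < k := hx'.trans hk
          rw [Real.rpow_neg hk0.le, Real.rpow_two, mul_comm, one_div]
          gcongr; exact min_le_right _ _
      _ = ENNReal.ofReal (4 * x) := by
          rw [← ofReal_integral_eq_lintegral_ofReal hi, integral_const_mul, hv]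
          · congr 1
            norm_num
            rw [Real.rpow_neg_one, inv_inv]
          · refine (ae_restrict_iff' measurableSet_Ioi).2 (ae_of_all _ fun k hk => ?_)
            have hk0 : 0 < k := hx'.trans hk
            positivity
  calc _ ≤ ∫⁻ k in Set.Ioc (0 : ℝ) x⁻¹ ∪ Set.Ioi x⁻¹,
        ENNReal.ofReal (1 / k ^ 2 * min ((x * k) ^ 2) 4) := by
        refine lintegral_mono_set fun k hk => ?_
        rcases le_or_gt k x⁻¹ with h | h
        · exact Or.inl ⟨hk, h⟩
        · exact Or.inr h
    _ ≤ _ := lintegral_union_le _ _ _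
    _ ≤ ENNReal.ofReal x + ENNReal.ofReal (4 * x) := add_le_add h1 h2
    _ = _ := by rw [← ENNReal.ofReal_add hx.le (by positivity)]; congr 1; ring

theorem enorm_sq_freeSymbol_sub_one_le (k : ℝ) (ξ : Plane) :
    ‖freeSymbol k ξ - 1‖ₑ ^ 2 ≤ ENNReal.ofReal (min ((psq ξ * k) ^ 2) 4) := by
  rw [← ofReal_norm, ← ENNReal.ofReal_pow (norm_nonneg _)]
  refine ENNReal.ofReal_le_ofReal (le_min ?_ ?_)
  · have h : ‖freeSymbol k ξ - 1‖ ≤ ‖-(psq ξ * k)‖ := by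
      rw [freeSymbol_eq]; exact Real.norm_exp_I_mul_ofReal_sub_one_le
    calc _ ≤ ‖-(psq ξ * k)‖ ^ 2 := by gcongr
      _ = _ := by rw [norm_neg, Real.norm_eq_abs, sq_abs]
  · have h : ‖freeSymbol k ξ - 1‖ ≤ 2 := (norm_sub_le _ _).trans (by
      rw [norm_freeSymbol]; norm_num)
    calc _ ≤ (2 : ℝ) ^ 2 := by gcongr
      _ = 4 := by norm_num

/-- A shift by `k` multiplies `m` by `e^{-ip²k} - 1`, of size at most `min(p²k, 2)`. Local smoothing
turns the time increment into an `L²` norm in `ξ`, and integrating `k^{-2} min((p²k)², 4)` in `k`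
leaves the `H¹` weight `p²`. -/
theorem halfSeminorm_oscIntegral_lt_top {m : Plane → ℂ} (hm : Integrable m)
    (h2 : ∫⁻ ξ, ENNReal.ofReal (psq ξ) * ‖m ξ‖ₑ ^ 2 < ∞) (T : ℝ) :
    halfSeminorm (oscIntegral m) T < ∞ := by
  -- The first factor is the inverse of the Gaussian window at `T`, its smallest value on `(0, T)`.
  set C : ℝ≥0∞ := (ENNReal.ofReal (Real.exp (-T ^ 2)))⁻¹ * (2 * smoothingConst) with hC
  have hCt : C ≠ ∞ := ENNReal.mul_ne_top
    (ENNReal.inv_ne_top.2 (ENNReal.ofReal_pos.2 (Real.exp_pos _)).ne')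
    (ENNReal.mul_ne_top (by simp) smoothingConst_ne_top)
  have hd : ∀ k ∈ Set.Ioo 0 T, diffSq (oscIntegral m) T k ≤
      C * ∫⁻ ξ, ENNReal.ofReal (min ((psq ξ * k) ^ 2) 4) * ‖m ξ‖ₑ ^ 2 := by
    intro k hk
    set n : Plane → ℂ := fun ξ => (freeSymbol k ξ - 1) * m ξ with hn
    have hni : Integrable n := by
      have : n = fun ξ => freeSymbol k ξ * m ξ - m ξ := by ext ξ; simp only [hn]; ring
      rw [this]; exact (integrable_freeSymbol_mul hm k).sub hm
    have e : ∀ s, oscIntegral m (s + k) - oscIntegral m s = oscIntegral n s := by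
      intro s
      rw [oscIntegral, oscIntegral, ← integral_sub (integrable_freeSymbol_mul hm _)
        (integrable_freeSymbol_mul hm _)]
      refine integral_congr_ae (ae_of_all _ fun ξ => ?_)
      simp only [hn]
      rw [freeSymbol_add]; ring
    have hE0 : ENNReal.ofReal (Real.exp (-T ^ 2)) ≠ 0 := (ENNReal.ofReal_pos.2 (Real.exp_pos _)).ne'
    calc diffSq (oscIntegral m) T k ≤ ∫⁻ s in Set.Ioo 0 (T - k),
          (ENNReal.ofReal (Real.exp (-T ^ 2)))⁻¹ *
            (ENNReal.ofReal (Real.exp (-s ^ 2)) * ‖oscIntegral n s‖ₑ ^ 2) := by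
          refine setLIntegral_mono' measurableSet_Ioo fun s hs => ?_
          rw [e, ← mul_assoc]
          refine le_mul_of_one_le_left' ?_
          rw [← ENNReal.inv_mul_cancel hE0 ENNReal.ofReal_ne_top]
          refine mul_le_mul' le_rfl (ENNReal.ofReal_le_ofReal (Real.exp_le_exp.2 ?_))
          have := hs.1
          have := hs.2
          have := hk.1
          nlinarith
      _ ≤ (ENNReal.ofReal (Real.exp (-T ^ 2)))⁻¹ *
            ∫⁻ s, ENNReal.ofReal (Real.exp (-s ^ 2)) * ‖oscIntegral n s‖ₑ ^ 2 := by
          rw [lintegral_const_mul' _ _ (ENNReal.inv_ne_top.2 hE0)]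
          exact mul_le_mul' le_rfl (setLIntegral_le_lintegral _ _)
      _ ≤ (ENNReal.ofReal (Real.exp (-T ^ 2)))⁻¹ *
            (2 * smoothingConst * ∫⁻ ξ, ‖n ξ‖ₑ ^ 2) :=
          mul_le_mul' le_rfl (lintegral_sq_oscIntegral_le hni)
      _ ≤ _ := by
          rw [← mul_assoc]
          refine mul_le_mul' le_rfl (lintegral_mono fun ξ => ?_)
          simp only [hn]
          rw [enorm_mul, mul_pow]
          exact mul_le_mul' (enorm_sq_freeSymbol_sub_one_le k ξ) le_rfl
  have hmm : AEMeasurable (fun ξ => ‖m ξ‖ₑ ^ 2) := hm.aestronglyMeasurable.enorm.pow_const 2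
  set H : ℝ → Plane → ℝ≥0∞ := fun k ξ =>
    ENNReal.ofReal (1 / k ^ 2 * min ((psq ξ * k) ^ 2) 4) * ‖m ξ‖ₑ ^ 2 with hH
  have hHm : AEMeasurable (Function.uncurry H)
      ((volume.restrict (Set.Ioi (0 : ℝ))).prod volume) := by
    have h1 := continuous_psq.measurable
    have h3 : Measurable fun z : ℝ × Plane =>
        ENNReal.ofReal (1 / z.1 ^ 2 * min ((psq z.2 * z.1) ^ 2) 4) := by fun_prop
    exact h3.aemeasurable.mul (hm.aestronglyMeasurable.comp_snd.enorm.pow_const 2)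
  calc halfSeminorm (oscIntegral m) T ≤ ∫⁻ k in Set.Ioo 0 T, C * ∫⁻ ξ, H k ξ := by
        refine setLIntegral_mono' measurableSet_Ioo fun k hk => ?_
        calc _ ≤ ENNReal.ofReal (1 / k ^ 2) *
              (C * ∫⁻ ξ, ENNReal.ofReal (min ((psq ξ * k) ^ 2) 4) * ‖m ξ‖ₑ ^ 2) :=
              mul_le_mul' le_rfl (hd k hk)
          _ = C * (ENNReal.ofReal (1 / k ^ 2) *
              ∫⁻ ξ, ENNReal.ofReal (min ((psq ξ * k) ^ 2) 4) * ‖m ξ‖ₑ ^ 2) := by ring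
          _ = _ := by
              rw [← lintegral_const_mul' _ _ ENNReal.ofReal_ne_top]
              congr 1
              refine lintegral_congr fun ξ => ?_
              simp only [hH]
              rw [ENNReal.ofReal_mul (by positivity), mul_assoc]
    _ ≤ C * ∫⁻ k in Set.Ioi (0 : ℝ), ∫⁻ ξ, H k ξ := by
        rw [lintegral_const_mul' _ _ hCt]
        exact mul_le_mul' le_rfl (lintegral_mono_set fun k hk => hk.1)
    _ = C * ∫⁻ ξ, ∫⁻ k in Set.Ioi (0 : ℝ), H k ξ := by rw [lintegral_lintegral_swap hHm]
    _ ≤ C * ∫⁻ ξ, 5 * (ENNReal.ofReal (psq ξ) * ‖m ξ‖ₑ ^ 2) := by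
        refine mul_le_mul' le_rfl (lintegral_mono fun ξ => ?_)
        simp only [hH]
        rw [lintegral_mul_const' _ _ (by simp), ← mul_assoc]
        refine mul_le_mul' ((lintegral_inv_sq_mul_min_le (psq_nonneg ξ)).trans (le_of_eq ?_)) le_rfl
        rw [ENNReal.ofReal_mul (by norm_num)]; simp
    _ < ∞ := by
        rw [lintegral_const_mul' _ _ (by simp)]
        exact ENNReal.mul_lt_top hCt.lt_top (ENNReal.mul_lt_top (by simp) h2)

/-! ### Stability of the half seminorm, and the primitive of the Green trace -/

theorem halfSeminorm_add_lt_top {f g : ℝ → ℂ} (hf : Continuous f) {T : ℝ}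
    (h1 : halfSeminorm f T < ∞) (h2 : halfSeminorm g T < ∞) :
    halfSeminorm (fun t => f t + g t) T < ∞ := by
  refine halfSeminorm_lt_top_of_diffSq_le (C := 4) hf (by simp) (fun k hk => ?_) h1 h2
  rw [diffSq, diffSq, diffSq, ← lintegral_add_left
    ((by fun_prop : Continuous fun s => f (s + k) - f s).measurable.enorm.pow_const 2),
    ← lintegral_const_mul' _ _ (by simp)]
  refine lintegral_mono fun s => ?_
  rw [mul_add]
  refine le_trans ?_ (ennreal_add_sq_le _ _)
  rw [show f (s + k) + g (s + k) - (f s + g s) = f (s + k) - f s + (g (s + k) - g s) by ring]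
  exact pow_le_pow_left' (enorm_add_le _ _) 2

theorem halfSeminorm_const_mul_lt_top {f : ℝ → ℂ} (c : ℂ) {T : ℝ} (h : halfSeminorm f T < ∞) :
    halfSeminorm (fun t => c * f t) T < ∞ := by
  have e : halfSeminorm (fun t => c * f t) T = ‖c‖ₑ ^ 2 * halfSeminorm f T := by
    rw [halfSeminorm, halfSeminorm, ← lintegral_const_mul' _ _ (by simp)]
    refine lintegral_congr fun k => ?_
    rw [mul_left_comm, diffSq, diffSq, ← lintegral_const_mul' (‖c‖ₑ ^ 2) _ (by simp)]
    congr 1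
    refine lintegral_congr fun s => ?_
    rw [← mul_sub, enorm_mul, mul_pow]
  rw [e]
  exact ENNReal.mul_lt_top (by simp) h

/-- For a step `k = t - s` the squared increment is at most `C² s^{-1/2} k²`: the weight `k^{-2}`
cancels, and `s^{-1/2}` is integrable, uniformly in the step. -/
theorem halfSeminorm_lt_top_of_le {f : ℝ → ℂ} {T C : ℝ}
    (h : ∀ s t : ℝ, 0 < s → s ≤ t → t ≤ T → ‖f t - f s‖ ≤ C * s ^ (-(1 / 4) : ℝ) * (t - s)) :
    halfSeminorm f T < ∞ := by
  set J : ℝ≥0∞ := ∫⁻ s in Set.Ioo 0 T, ENNReal.ofReal (C ^ 2 * s ^ (-(1 / 2) : ℝ)) with hJ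
  have hJt : J < ∞ := by
    rcases le_or_gt T 0 with hT | hT
    · rw [hJ, Set.Ioo_eq_empty (by simpa using hT)]; simp
    have hi : IntegrableOn (fun s : ℝ => s ^ (-(1 / 2) : ℝ)) (Set.Ioo 0 T) := by
      have := intervalIntegral.intervalIntegrable_rpow' (a := 0) (b := T)
        (show (-1 : ℝ) < -(1 / 2) by norm_num)
      rwa [intervalIntegrable_iff_integrableOn_Ioo_of_le hT.le] at this
    exact (hi.const_mul (C ^ 2)).lintegral_lt_top
  have hd : ∀ k ∈ Set.Ioo 0 T, ENNReal.ofReal (1 / k ^ 2) * diffSq f T k ≤ J := by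
    intro k hk
    rw [diffSq, ← lintegral_const_mul' _ _ ENNReal.ofReal_ne_top]
    refine le_trans (setLIntegral_mono' measurableSet_Ioo fun s hs => ?_)
      (lintegral_mono_set (fun s hs => ⟨hs.1, by linarith [hs.2, hk.1]⟩) :
        ∫⁻ s in Set.Ioo 0 (T - k), ENNReal.ofReal (C ^ 2 * s ^ (-(1 / 2) : ℝ)) ≤ J)
    have hs0 := hs.1
    have hk0 := hk.1
    have h1 := h s (s + k) hs0 (by linarith) (by linarith [hs.2])
    rw [← ofReal_norm, ← ENNReal.ofReal_pow (norm_nonneg _), ← ENNReal.ofReal_mul (by positivity)]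
    refine ENNReal.ofReal_le_ofReal ?_
    have p1 : (s ^ (-(1 / 4) : ℝ)) ^ 2 = s ^ (-(1 / 2) : ℝ) := by
      rw [← Real.rpow_natCast, ← Real.rpow_mul hs0.le]; norm_num
    calc _ ≤ 1 / k ^ 2 * (C * s ^ (-(1 / 4) : ℝ) * (s + k - s)) ^ 2 := by gcongr
      _ = C ^ 2 * (s ^ (-(1 / 4) : ℝ)) ^ 2 := by field_simp; ring
      _ = _ := by rw [p1]
  refine lt_of_le_of_lt (setLIntegral_mono' measurableSet_Ioo hd) ?_
  rw [setLIntegral_const]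
  exact ENNReal.mul_lt_top hJt (by simp)

/-- The primitive of the boundary trace of the Green function, vanishing for negative times. -/
def greenPrim (lam t : ℝ) : ℂ :=
  ∫ x in (0 : ℝ)..t, (Set.Ioi (0 : ℝ)).indicator (greenTrace lam 0) x

theorem intervalIntegrable_indicator_greenTrace {lam : ℝ} (hlam : 0 < lam) (a b : ℝ) :
    IntervalIntegrable ((Set.Ioi (0 : ℝ)).indicator (greenTrace lam 0)) volume a b := by
  have h : ∀ T, IntegrableOn ((Set.Ioi (0 : ℝ)).indicator (greenTrace lam 0)) (Set.Iic T) :=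
    fun T => by
      rw [IntegrableOn, integrable_indicator_iff measurableSet_Ioi, IntegrableOn,
        Measure.restrict_restrict measurableSet_Ioi]
      exact ((isLocKernel_greenTrace hlam).int (T + 1)).mono_set
        fun x hx => ⟨hx.1, by linarith [show x ≤ T from hx.2]⟩
  rw [intervalIntegrable_iff]
  exact (h (max a b)).mono_set fun x hx => hx.2

theorem continuous_greenPrim {lam : ℝ} (hlam : 0 < lam) : Continuous (greenPrim lam) :=
  intervalIntegral.continuous_primitive (intervalIntegrable_indicator_greenTrace hlam) 0

theorem greenPrim_eq (lam : ℝ) {t : ℝ} (ht : 0 ≤ t) :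
    greenPrim lam t = ∫ x in (0 : ℝ)..t, greenTrace lam 0 x := by
  rw [greenPrim, intervalIntegral.integral_of_le ht, intervalIntegral.integral_of_le ht]
  refine setIntegral_congr_fun measurableSet_Ioc fun x hx => ?_
  exact Set.indicator_of_mem (show x ∈ Set.Ioi 0 from hx.1) _

theorem halfSeminorm_greenPrim_lt_top {lam : ℝ} (hlam : 0 < lam) (T : ℝ) :
    halfSeminorm (greenPrim lam) T < ∞ := by
  refine halfSeminorm_lt_top_of_le (C := greenConst lam) fun s t hs hst _ => ?_
  have hi := intervalIntegrable_indicator_greenTrace hlam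
  rw [greenPrim, greenPrim, intervalIntegral.integral_interval_sub_left (hi 0 t) (hi 0 s)]
  have := intervalIntegral.norm_integral_le_of_norm_le_const (a := s) (b := t)
    (f := (Set.Ioi (0 : ℝ)).indicator (greenTrace lam 0))
    (C := greenConst lam * s ^ (-(1 / 4) : ℝ)) fun x hx => by
      rw [Set.uIoc_of_le hst] at hx
      have hx0 : 0 < x := hs.trans hx.1
      rw [Set.indicator_of_mem (show x ∈ Set.Ioi 0 from hx0)]
      refine (norm_greenTrace_le hlam le_rfl hx0.ne').trans ?_
      rw [abs_of_pos hx0]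
      exact mul_le_mul_of_nonneg_left (Real.rpow_le_rpow_of_nonpos hs hx.1.le (by norm_num))
        (greenConst_nonneg lam)
  rwa [abs_of_nonneg (by linarith)] at this

/-! ### Fourier representation of the free evolution -/

/-- The plane wave `e^{2πi ξ·x}`. -/
def planeWave (ξ x : Plane) : ℂ := Complex.exp (((2 * Real.pi * inner ℝ ξ x : ℝ) : ℂ) * Complex.I)

theorem norm_planeWave (ξ x : Plane) : ‖planeWave ξ x‖ = 1 := Complex.norm_exp_ofReal_mul_I _

theorem planeWave_comm (ξ x : Plane) : planeWave ξ x = planeWave x ξ := by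
  rw [planeWave, planeWave, real_inner_comm]

theorem planeWave_add (ξ x y : Plane) : planeWave ξ (x + y) = planeWave ξ x * planeWave ξ y := by
  rw [planeWave, planeWave, planeWave, ← Complex.exp_add, inner_add_right]
  congr 1
  push_cast
  ring

theorem continuous_planeWave {X : Type*} [TopologicalSpace X] {f g : X → Plane}
    (hf : Continuous f) (hg : Continuous g) : Continuous fun x => planeWave (f x) (g x) := by
  unfold planeWave
  fun_prop

theorem fourierInv_eq_integral_planeWave (g : Plane → ℂ) (ξ : Plane) :
    𝓕⁻ g ξ = ∫ x, planeWave x ξ * g x := by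
  rw [Real.fourierInv_eq']
  rfl

theorem ae_eq_of_forall_schwartz {f f' : Plane → ℂ} (hf : LocallyIntegrable f)
    (hf' : LocallyIntegrable f')
    (h : ∀ g : 𝓢(Plane, ℂ), HasCompactSupport g → ∫ x, g x * f x = ∫ x, g x * f' x) :
    f =ᵐ[volume] f' := by
  refine ae_eq_of_integral_contDiff_smul_eq hf hf' fun g hg hc => ?_
  have h1 : HasCompactSupport (Complex.ofRealCLM ∘ g) := hc.comp_left rfl
  have h2 : ContDiff ℝ ((⊤ : ℕ∞) : WithTop ℕ∞) (Complex.ofRealCLM ∘ g) := by fun_prop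
  have := h (h1.toSchwartzMap h2) h1
  simpa [Complex.real_smul] using this

/-- The `L²` inverse transform agrees with that of tempered distributions, which moves onto the test
function. The pointwise formulas for free waves are identified through this pairing. -/
theorem integral_mul_fourierInv_L2 (u : L2Plane) (g : 𝓢(Plane, ℂ)) :
    ∫ x, g x * (𝓕⁻ u : L2Plane) x = ∫ ξ, 𝓕⁻ (g : Plane → ℂ) ξ * u ξ := by
  have h1 : ((𝓕⁻ u : L2Plane) : 𝓢'(Plane, ℂ)) g = (u : 𝓢'(Plane, ℂ)) (𝓕⁻ g) := by
    rw [← Lp.fourierInv_toTemperedDistribution_eq, TemperedDistribution.fourierInv_apply]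
  rw [Lp.toTemperedDistribution_apply, Lp.toTemperedDistribution_apply] at h1
  rw [← SchwartzMap.fourierInv_coe]
  exact h1

theorem integral_fourierInv_mul_toLp {m : Plane → ℂ} (hm : MemLp m 2) (g : Plane → ℂ) :
    ∫ ξ, 𝓕⁻ g ξ * hm.toLp m ξ = ∫ ξ, 𝓕⁻ g ξ * m ξ := by
  refine integral_congr_ae ?_
  filter_upwards [hm.coeFn_toLp] with ξ hξ
  rw [hξ]

/-- Identification of the inverse Fourier transform of an `L²` function by duality. -/
theorem fourierInv_toLp_ae_eq {m Φ : Plane → ℂ} (hm : MemLp m 2) (hΦ : LocallyIntegrable Φ)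
    (h : ∀ g : 𝓢(Plane, ℂ), HasCompactSupport g →
      ∫ ξ, 𝓕⁻ (g : Plane → ℂ) ξ * m ξ = ∫ x, g x * Φ x) :
    (𝓕⁻ (hm.toLp m) : L2Plane) =ᵐ[volume] Φ := by
  refine ae_eq_of_forall_schwartz
    ((Lp.memLp _).locallyIntegrable (by norm_num)) hΦ fun g hg => ?_
  rw [integral_mul_fourierInv_L2, integral_fourierInv_mul_toLp hm, h g hg]

theorem integrable_fourierInv_schwartz (g : 𝓢(Plane, ℂ)) :
    Integrable (𝓕⁻ (g : Plane → ℂ)) := by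
  rw [← SchwartzMap.fourierInv_coe]
  exact (𝓕⁻ g).integrable

theorem continuous_integral_planeWave {m : Plane → ℂ} (hm : Integrable m) :
    Continuous fun x => ∫ ξ, planeWave ξ x * m ξ := by
  have h1 : ∀ x, Continuous fun ξ => planeWave ξ x := fun x =>
    continuous_planeWave continuous_id continuous_const
  refine continuous_of_dominated (bound := fun ξ => ‖m ξ‖)
    (fun x => (h1 x).aestronglyMeasurable.mul hm.aestronglyMeasurable)
    (fun x => ae_of_all _ fun ξ => ?_) hm.norm (ae_of_all _ fun ξ => ?_)
  · rw [norm_mul, norm_planeWave, one_mul]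
  · exact (continuous_planeWave continuous_const continuous_id).mul continuous_const

theorem integral_fourierInv_mul {g m : Plane → ℂ} (hg : Integrable g) (hm : Integrable m) :
    ∫ ξ, 𝓕⁻ g ξ * m ξ = ∫ x, g x * ∫ ξ, planeWave ξ x * m ξ := by
  have hi : Integrable (Function.uncurry fun ξ x => planeWave x ξ * g x * m ξ)
      ((volume : Measure Plane).prod volume) := by
    have h1 := (hm.mul_prod hg).bdd_mul (c := 1)
      (continuous_planeWave (continuous_snd (X := Plane) (Y := Plane))
        continuous_fst).aestronglyMeasurable
      (ae_of_all _ fun z => (norm_planeWave z.2 z.1).le)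
    refine h1.congr (ae_of_all _ fun z => ?_)
    simp only [Function.uncurry]
    ring
  calc _ = ∫ ξ, ∫ x, planeWave x ξ * g x * m ξ := by
        refine integral_congr_ae (ae_of_all _ fun ξ => ?_)
        simp only
        rw [fourierInv_eq_integral_planeWave, ← integral_mul_const]
    _ = ∫ x, ∫ ξ, planeWave x ξ * g x * m ξ := integral_integral_swap hi
    _ = _ := by
        refine integral_congr_ae (ae_of_all _ fun x => ?_)
        simp only
        rw [← integral_const_mul]
        refine integral_congr_ae (ae_of_all _ fun ξ => ?_)
        simp only
        rw [planeWave_comm]; ring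

/-- Translation of an inverse Fourier transform. -/
theorem fourierInv_planeWave_mul_ae_eq {m m' : Plane → ℂ} (hm : MemLp m 2) (y : Plane)
    (hm' : MemLp m' 2) (h : ∀ ξ, m' ξ = planeWave ξ (-y) * m ξ) :
    (𝓕⁻ (hm'.toLp m') : L2Plane) =ᵐ[volume]
      fun x => (𝓕⁻ (hm.toLp m) : L2Plane) (x - y) := by
  have hl : MemLp (fun x => (𝓕⁻ (hm.toLp m) : L2Plane) (x - y)) 2 (volume : Measure Plane) :=
    (Lp.memLp _).comp_measurePreserving (measurePreserving_sub_right volume y)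
  refine fourierInv_toLp_ae_eq hm' (hl.locallyIntegrable (by norm_num)) fun g hg => ?_
  have h1 : HasCompactSupport fun x => g (x + y) := hg.comp_homeomorph (Homeomorph.addRight y)
  have h2 : ContDiff ℝ ((⊤ : ℕ∞) : WithTop ℕ∞) fun x => g (x + y) :=
    (g.smooth ⊤).comp (contDiff_id.add contDiff_const)
  have h3 := integral_mul_fourierInv_L2 (hm.toLp m) (h1.toSchwartzMap h2)
  rw [integral_fourierInv_mul_toLp hm] at h3
  have h4 : ∀ ξ, 𝓕⁻ (fun x => g (x + y)) ξ = planeWave ξ (-y) * 𝓕⁻ (g : Plane → ℂ) ξ := by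
    intro ξ
    rw [fourierInv_eq_integral_planeWave, fourierInv_eq_integral_planeWave,
      ← integral_add_right_eq_self _ (-y), ← integral_const_mul]
    refine integral_congr_ae (ae_of_all _ fun x => ?_)
    simp only
    rw [neg_add_cancel_right, planeWave_comm, planeWave_add, planeWave_comm x ξ]
    ring
  calc _ = ∫ ξ, 𝓕⁻ (fun x => g (x + y)) ξ * m ξ := by
        refine integral_congr_ae (ae_of_all _ fun ξ => ?_)
        simp only
        rw [h4, h]; ring
    _ = ∫ x, g (x + y) * (𝓕⁻ (hm.toLp m) : L2Plane) x := h3.symm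
    _ = _ := by
        rw [← integral_sub_right_eq_self _ y]
        simp

/-- The free Schrödinger heat kernel at complex time `s + iτ`. -/
def complexHeat (s τ : ℝ) (z : Plane) : ℂ :=
  1 / (4 * Real.pi * ((s : ℂ) + Complex.I * τ)) *
    Complex.exp (-((‖z‖ ^ 2 : ℝ) : ℂ) / (4 * ((s : ℂ) + Complex.I * τ)))

theorem complexTime_ne_zero {s τ : ℝ} (hs : 0 < s) : (s : ℂ) + Complex.I * τ ≠ 0 := by
  intro h
  have := congrArg Complex.re h
  simp at this
  exact hs.ne' this

/-- A Gaussian integral of complex width; the regularisation `s > 0` makes the Schrödinger kernel an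
absolutely convergent integral. -/
theorem integral_planeWave_mul_cexp {s τ : ℝ} (hs : 0 < s) (x y : Plane) :
    ∫ ξ, planeWave ξ x * (planeWave ξ (-y) *
      Complex.exp (-(((s : ℂ) + Complex.I * τ) * psq ξ))) = complexHeat s τ (x - y) := by
  set b : ℂ := 4 * Real.pi ^ 2 * ((s : ℂ) + Complex.I * τ) with hb
  have hpi := Real.pi_pos
  have hbre : 0 < b.re := by
    have : b = ((4 * Real.pi ^ 2 * s : ℝ) : ℂ) + ((4 * Real.pi ^ 2 * τ : ℝ) : ℂ) * Complex.I := by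
      rw [hb]; push_cast; ring
    rw [this, Complex.add_re, Complex.ofReal_re, Complex.re_ofReal_mul, Complex.I_re, mul_zero,
      add_zero]
    positivity
  have h := GaussianFourier.integral_cexp_neg_mul_sq_norm_add hbre (2 * Real.pi * Complex.I) (x - y)
  have e : ∀ ξ, planeWave ξ x * (planeWave ξ (-y) *
      Complex.exp (-(((s : ℂ) + Complex.I * τ) * psq ξ))) =
      Complex.exp (-b * (‖ξ‖ : ℂ) ^ 2 + 2 * Real.pi * Complex.I * (inner ℝ (x - y) ξ : ℝ)) := by
    intro ξ
    rw [← mul_assoc, ← planeWave_add, planeWave, ← Complex.exp_add,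
      show x + -y = x - y from (sub_eq_add_neg x y).symm, real_inner_comm]
    congr 1
    rw [hb, psq]
    push_cast
    ring
  simp_rw [e]
  rw [h, complexHeat]
  have hz := complexTime_ne_zero (τ := τ) hs
  have hpi' : (Real.pi : ℂ) ≠ 0 := by exact_mod_cast hpi.ne'
  have hd : ((Module.finrank ℝ Plane : ℂ) / 2) = 1 := by simp
  rw [hd, Complex.cpow_one, hb]
  congr 1
  · field_simp
  · congr 1
    have hI : Complex.I ^ 2 = -1 := Complex.I_sq
    push_cast
    rw [mul_pow, hI]
    field_simp
    ring

theorem integrable_planeWave_mul_cexp {s : ℝ} (hs : 0 < s) (τ : ℝ) (y : Plane) :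
    Integrable fun ξ => planeWave ξ (-y) * Complex.exp (-(((s : ℂ) + Complex.I * τ) * psq ξ)) := by
  have hpi := Real.pi_pos
  have hg : Integrable fun ξ : Plane => Real.exp (-(s * psq ξ)) := by
    have h0 := GaussianFourier.integrable_cexp_neg_mul_sq_norm_add (V := Plane)
      (b := ((4 * Real.pi ^ 2 * s : ℝ) : ℂ)) (by rw [Complex.ofReal_re]; positivity) 0 0
    have h1 := h0.norm
    refine h1.congr (ae_of_all _ fun ξ => ?_)
    simp only
    rw [Complex.norm_exp]
    congr 1
    simp only [zero_mul, add_zero]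
    rw [← Complex.ofReal_pow, ← Complex.ofReal_neg, ← Complex.ofReal_mul, Complex.ofReal_re, psq]
    ring
  have hc : Continuous fun ξ =>
      planeWave ξ (-y) * Complex.exp (-(((s : ℂ) + Complex.I * τ) * psq ξ)) := by
    have := continuous_psq
    exact (continuous_planeWave continuous_id continuous_const).mul (by fun_prop)
  refine hg.mono' hc.aestronglyMeasurable (ae_of_all _ fun ξ => le_of_eq ?_)
  rw [norm_mul, norm_planeWave, one_mul, Complex.norm_exp]
  congr 1
  simp

/-- `|s + iτ| ≥ τ`, and the exponent has nonpositive real part because `Re 1/(s + iτ) ≥ 0`. The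
bound is uniform in `s`, so at positive times the evolved Green function has no singularity. -/
theorem norm_complexHeat_le {s τ : ℝ} (hs : 0 < s) (hτ : 0 < τ) (z : Plane) :
    ‖complexHeat s τ z‖ ≤ 1 / (4 * Real.pi * τ) := by
  have hpi := Real.pi_pos
  have h1 : τ ≤ ‖(s : ℂ) + Complex.I * τ‖ := by
    have := Complex.abs_im_le_norm ((s : ℂ) + Complex.I * τ)
    simp at this
    exact (le_abs_self _).trans this
  have h2 : ‖Complex.exp (-((‖z‖ ^ 2 : ℝ) : ℂ) / (4 * ((s : ℂ) + Complex.I * τ)))‖ ≤ 1 := by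
    rw [Complex.norm_exp, Real.exp_le_one_iff,
      show -((‖z‖ ^ 2 : ℝ) : ℂ) / (4 * ((s : ℂ) + Complex.I * τ)) =
        ((-(‖z‖ ^ 2 / 4) : ℝ) : ℂ) * ((s : ℂ) + Complex.I * τ)⁻¹ by
          have := complexTime_ne_zero (τ := τ) hs
          push_cast; field_simp,
      Complex.re_ofReal_mul, Complex.inv_re]
    refine mul_nonpos_of_nonpos_of_nonneg (by have := sq_nonneg ‖z‖; linarith) ?_
    refine div_nonneg ?_ (Complex.normSq_nonneg _)
    simp [hs.le]
  rw [complexHeat, norm_mul, norm_div, norm_mul, norm_mul, norm_one]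
  have h3 : ‖(4 : ℂ)‖ = 4 := by simp
  rw [h3, Complex.norm_real, Real.norm_of_nonneg hpi.le]
  calc _ ≤ 1 / (4 * Real.pi * ‖(s : ℂ) + Complex.I * τ‖) * 1 := by gcongr
    _ ≤ _ := by rw [mul_one]; gcongr

/-- The free evolution of the Green function, for positive times. -/
def greenEvolution (lam τ : ℝ) (z : Plane) : ℂ :=
  ∫ s in Set.Ioi (0 : ℝ), (Real.exp (-(lam * s)) : ℂ) * complexHeat s τ z

/-- At the centre the exponential equals `1` and only the prefactor `1/(4π(s + iτ))` survives. -/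
theorem greenEvolution_zero (lam τ : ℝ) :
    greenEvolution lam τ 0 = 1 / (4 * Real.pi) * greenTrace lam 0 τ := by
  rw [greenEvolution, greenTrace, ← integral_const_mul]
  refine setIntegral_congr_fun measurableSet_Ioi fun s hs => ?_
  simp only [complexHeat]
  have := complexTime_ne_zero (τ := τ) hs
  have hpi : (Real.pi : ℂ) ≠ 0 := by exact_mod_cast Real.pi_ne_zero
  simp
  field_simp

theorem integrableOn_exp_neg_mul_Ioi {lam : ℝ} (hlam : 0 < lam) :
    IntegrableOn (fun s => Real.exp (-(lam * s))) (Set.Ioi (0 : ℝ)) := by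
  simpa using exp_neg_integrableOn_Ioi 0 hlam

theorem ContinuousOn.complexHeat {X : Type*} [TopologicalSpace X] {f : X → ℝ} {g : X → Plane}
    {S : Set X} (hf : ContinuousOn f S) (hg : ContinuousOn g S) (h : ∀ x ∈ S, 0 < f x) (τ : ℝ) :
    ContinuousOn (fun x => complexHeat (f x) τ (g x)) S := by
  have hpi : (Real.pi : ℂ) ≠ 0 := by exact_mod_cast Real.pi_ne_zero
  have h0 : ContinuousOn (fun x => (f x : ℂ) + Complex.I * τ) S :=
    (Complex.continuous_ofReal.comp_continuousOn hf).add continuousOn_const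
  have h1 : ContinuousOn (fun x => -((‖g x‖ ^ 2 : ℝ) : ℂ)) S :=
    (Complex.continuous_ofReal.comp_continuousOn (hg.norm.pow 2)).neg
  unfold PointNLS.complexHeat
  refine ContinuousOn.mul (continuousOn_const.div (continuousOn_const.mul h0) fun p hp => ?_)
    (Complex.continuous_exp.comp_continuousOn (h1.div (continuousOn_const.mul h0)
      fun p hp => ?_))
  · exact mul_ne_zero (mul_ne_zero (by norm_num) hpi) (complexTime_ne_zero (h p hp))
  · exact mul_ne_zero (by norm_num) (complexTime_ne_zero (h p hp))

theorem continuous_greenEvolution {lam τ : ℝ} (hlam : 0 < lam) (hτ : 0 < τ) :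
    Continuous (greenEvolution lam τ) := by
  have hm : ∀ z, AEStronglyMeasurable
      (fun s : ℝ => (Real.exp (-(lam * s)) : ℂ) * complexHeat s τ z)
      (volume.restrict (Set.Ioi 0)) := fun z =>
    (ContinuousOn.mul (by fun_prop) (ContinuousOn.complexHeat continuousOn_id continuousOn_const
      (fun s hs => hs) τ)).aestronglyMeasurable measurableSet_Ioi
  refine continuous_of_dominated
    (bound := fun s => Real.exp (-(lam * s)) * (1 / (4 * Real.pi * τ)))
    hm (fun z => ?_) ((integrableOn_exp_neg_mul_Ioi hlam).mul_const _) ?_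
  · refine (ae_restrict_iff' measurableSet_Ioi).2 (ae_of_all _ fun s hs => ?_)
    rw [norm_mul, Complex.norm_real, Real.norm_of_nonneg (Real.exp_pos _).le]
    exact mul_le_mul_of_nonneg_left (norm_complexHeat_le hs hτ z) (Real.exp_pos _).le
  · refine (ae_restrict_iff' measurableSet_Ioi).2 (ae_of_all _ fun s hs => ?_)
    refine continuous_const.mul ?_
    exact continuousOn_univ.1 (ContinuousOn.complexHeat continuousOn_const continuousOn_id
      (fun _ _ => hs) τ)

theorem resolventSymbol_eq_integral {lam : ℝ} (hlam : 0 < lam) (ξ : Plane) :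
    resolventSymbol lam ξ = ∫ s in Set.Ioi (0 : ℝ),
      ((Real.exp (-(lam * s)) * Real.exp (-(s * psq ξ)) : ℝ) : ℂ) := by
  have hp : 0 < psq ξ + lam := by have := psq_nonneg ξ; positivity
  have e : ∀ s : ℝ, Real.exp (-(lam * s)) * Real.exp (-(s * psq ξ)) =
      Real.exp (-(psq ξ + lam) * s) := fun s => by
    rw [← Real.exp_add]; congr 1; ring
  simp_rw [e]
  rw [integral_complex_ofReal, integral_exp_mul_Ioi (by linarith)]
  rw [resolventSymbol]
  congr 1
  rw [← psq]
  simp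
  rw [← neg_div_neg_eq]
  simp [add_comm]

/-- Duality form of the representation of the free evolution of the Green function. -/
theorem integral_fourierInv_mul_resolvent {lam τ : ℝ} (hlam : 0 < lam) (hτ : 0 < τ) (y : Plane)
    {g : Plane → ℂ} (hg : Integrable g) (hgF : Integrable (𝓕⁻ g)) :
    ∫ ξ, 𝓕⁻ g ξ * (planeWave ξ (-y) * freeSymbol τ ξ * resolventSymbol lam ξ) =
      ∫ x, g x * greenEvolution lam τ (x - y) := by
  set k : ℝ → Plane → ℂ := fun s ξ =>
    planeWave ξ (-y) * Complex.exp (-(((s : ℂ) + Complex.I * τ) * psq ξ)) with hk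
  have hexp := integrableOn_exp_neg_mul_Ioi hlam
  have hexpc : IntegrableOn (fun s : ℝ => (Real.exp (-(lam * s)) : ℂ)) (Set.Ioi 0) := hexp.ofReal
  have hkc : Continuous fun p : Plane × ℝ => k p.2 p.1 := by
    have := continuous_psq
    exact (continuous_planeWave continuous_fst continuous_const).mul (by fun_prop)
  have hkn : ∀ (ξ : Plane) (s : ℝ), 0 < s → ‖k s ξ‖ ≤ 1 := by
    intro ξ s hs
    simp only [hk]
    rw [norm_mul, norm_planeWave, one_mul, Complex.norm_exp, Real.exp_le_one_iff]
    have := mul_nonneg hs.le (psq_nonneg ξ)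
    simp
    exact this
  have hpos : ∀ᵐ z : Plane × ℝ ∂((volume : Measure Plane).prod (volume.restrict (Set.Ioi (0 : ℝ)))),
      0 < z.2 := by
    have : ∀ᵐ s ∂(volume.restrict (Set.Ioi (0 : ℝ))), 0 < s :=
      (ae_restrict_iff' measurableSet_Ioi).2 (ae_of_all _ fun s hs => hs)
    exact Measure.quasiMeasurePreserving_snd.ae this
  have hi1 : Integrable (Function.uncurry fun (ξ : Plane) (s : ℝ) =>
      k s ξ * (𝓕⁻ g ξ * (Real.exp (-(lam * s)) : ℂ)))
      ((volume : Measure Plane).prod (volume.restrict (Set.Ioi (0 : ℝ)))) := by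
    refine Integrable.bdd_mul (c := 1)
      (Integrable.mul_prod (f := 𝓕⁻ g) (g := fun s : ℝ => (Real.exp (-(lam * s)) : ℂ)) hgF hexpc)
      hkc.aestronglyMeasurable ?_
    filter_upwards [hpos] with z hz
    exact hkn z.1 z.2 hz
  have hi2 : Integrable (Function.uncurry fun (x : Plane) (s : ℝ) =>
      complexHeat s τ (x - y) * (g x * (Real.exp (-(lam * s)) : ℂ)))
      ((volume : Measure Plane).prod (volume.restrict (Set.Ioi (0 : ℝ)))) := by
    refine Integrable.bdd_mul (c := 1 / (4 * Real.pi * τ))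
      (Integrable.mul_prod (f := g) (g := fun s : ℝ => (Real.exp (-(lam * s)) : ℂ)) hg hexpc)
      ?_ ?_
    · have hm : ((volume : Measure Plane).prod (volume.restrict (Set.Ioi (0 : ℝ)))) =
          ((volume : Measure Plane).prod volume).restrict (Set.univ ×ˢ Set.Ioi (0 : ℝ)) := by
        rw [← Measure.prod_restrict, Measure.restrict_univ]
      rw [hm]
      refine ContinuousOn.aestronglyMeasurable ?_ (MeasurableSet.univ.prod measurableSet_Ioi)
      exact ContinuousOn.complexHeat continuousOn_snd
        (continuousOn_fst.sub continuousOn_const) (fun z hz => hz.2) τ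
    · filter_upwards [hpos] with z hz
      exact norm_complexHeat_le hz hτ _
  -- The symbol `e^{-ip²τ}/(p² + λ)` is a Laplace superposition over `s` of complex heat symbols;
  -- Fubini is applied once on the frequency side and once on the space side.
  calc _ = ∫ ξ, ∫ s in Set.Ioi (0 : ℝ), k s ξ * (𝓕⁻ g ξ * (Real.exp (-(lam * s)) : ℂ)) := by
        refine integral_congr_ae (ae_of_all _ fun ξ => ?_)
        simp only
        rw [resolventSymbol_eq_integral hlam, ← mul_assoc, ← integral_const_mul]
        refine setIntegral_congr_fun measurableSet_Ioi fun s _ => ?_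
        simp only [hk]
        have : Complex.exp (-(((s : ℂ) + Complex.I * τ) * psq ξ)) =
            freeSymbol τ ξ * (Real.exp (-(s * psq ξ)) : ℂ) := by
          rw [freeSymbol_eq, Complex.ofReal_exp, ← Complex.exp_add]
          congr 1
          push_cast
          ring
        rw [this]
        push_cast
        ring
    _ = ∫ s in Set.Ioi (0 : ℝ), ∫ ξ, k s ξ * (𝓕⁻ g ξ * (Real.exp (-(lam * s)) : ℂ)) :=
        integral_integral_swap hi1
    _ = ∫ s in Set.Ioi (0 : ℝ), ∫ x, complexHeat s τ (x - y) *
          (g x * (Real.exp (-(lam * s)) : ℂ)) := by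
        refine setIntegral_congr_fun measurableSet_Ioi fun s hs => ?_
        have h1 : (∫ ξ, k s ξ * (𝓕⁻ g ξ * (Real.exp (-(lam * s)) : ℂ))) =
            (∫ ξ, 𝓕⁻ g ξ * k s ξ) * (Real.exp (-(lam * s)) : ℂ) := by
          rw [← integral_mul_const]
          refine integral_congr_ae (ae_of_all _ fun ξ => ?_)
          simp only
          ring
        have h2 : (∫ x, complexHeat s τ (x - y) * (g x * (Real.exp (-(lam * s)) : ℂ))) =
            (∫ x, g x * complexHeat s τ (x - y)) * (Real.exp (-(lam * s)) : ℂ) := by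
          rw [← integral_mul_const]
          refine integral_congr_ae (ae_of_all _ fun ξ => ?_)
          simp only
          ring
        rw [h1, h2, integral_fourierInv_mul hg (integrable_planeWave_mul_cexp hs τ y)]
        simp_rw [integral_planeWave_mul_cexp hs]
    _ = ∫ x, ∫ s in Set.Ioi (0 : ℝ), complexHeat s τ (x - y) *
          (g x * (Real.exp (-(lam * s)) : ℂ)) := (integral_integral_swap hi2).symm
    _ = _ := by
        refine integral_congr_ae (ae_of_all _ fun x => ?_)
        simp only
        rw [greenEvolution, ← integral_const_mul]
        refine setIntegral_congr_fun measurableSet_Ioi fun s _ => ?_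
        ring

/-- Membership in `H¹` provides an `L²` function equal to `(1 + |ξ|²)^{1/2}` times the transform in
the sense of distributions; testing identifies the two almost everywhere, and `p²` is at most `4π²
(1 + |ξ|²)`. -/
theorem lintegral_psq_mul_fourier_lt_top {φ : L2Plane}
    (hφ : TemperedDistribution.MemSobolev 1 2 (φ : 𝓢'(Plane, ℂ))) :
    ∫⁻ ξ, ENNReal.ofReal (psq ξ) * ‖(𝓕 φ : L2Plane) ξ‖ₑ ^ 2 < ∞ := by
  obtain ⟨f', hf'⟩ := TemperedDistribution.memSobolev_iff_exists_smulLeftCLM_fourier.1 hφ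
  rw [Lp.fourier_toTemperedDistribution_eq] at hf'
  set u : L2Plane := 𝓕 φ with hu
  have htg : Function.HasTemperateGrowth fun x : Plane =>
      (((1 + ‖x‖ ^ 2) ^ ((1 : ℝ) / 2) : ℝ) : ℂ) := by fun_prop
  have hul : LocallyIntegrable (u : Plane → ℂ) := (Lp.memLp u).locallyIntegrable (by norm_num)
  have hl : LocallyIntegrable fun ξ => (((1 + ‖ξ‖ ^ 2) ^ ((1 : ℝ) / 2) : ℝ) : ℂ) * u ξ :=
    hul.continuous_mul htg.1.continuous
  have hae : (fun ξ => (((1 + ‖ξ‖ ^ 2) ^ ((1 : ℝ) / 2) : ℝ) : ℂ) * u ξ) =ᵐ[volume] f' := by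
    refine ae_eq_of_forall_schwartz hl ((Lp.memLp f').locallyIntegrable (by norm_num))
      fun g _ => ?_
    have h1 := congrArg (fun D : 𝓢'(Plane, ℂ) => D g) hf'
    simp only [TemperedDistribution.smulLeftCLM_apply_apply, Lp.toTemperedDistribution_apply] at h1
    rw [show (∫ ξ, g ξ * f' ξ) = ∫ ξ, g ξ • f' ξ from rfl, ← h1]
    refine integral_congr_ae (ae_of_all _ fun ξ => ?_)
    simp only
    rw [SchwartzMap.smulLeftCLM_apply_apply htg, smul_eq_mul, smul_eq_mul]
    ring
  have hf2 : ∫⁻ ξ, ‖f' ξ‖ₑ ^ 2 < ∞ := by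
    have := (Lp.memLp f').2
    rw [eLpNorm_lt_top_iff_lintegral_rpow_enorm_lt_top (by norm_num) (by norm_num)] at this
    simpa using this
  calc _ ≤ ∫⁻ ξ, ENNReal.ofReal (4 * Real.pi ^ 2) * ‖f' ξ‖ₑ ^ 2 := by
        refine lintegral_mono_ae ?_
        filter_upwards [hae] with ξ hξ
        rw [← hξ, enorm_mul, mul_pow, ← mul_assoc]
        refine mul_le_mul' ?_ le_rfl
        rw [← ofReal_norm, Complex.norm_real, Real.norm_of_nonneg (by positivity),
          ← ENNReal.ofReal_pow (by positivity), ← ENNReal.ofReal_mul (by positivity)]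
        refine ENNReal.ofReal_le_ofReal ?_
        rw [← Real.sqrt_eq_rpow, Real.sq_sqrt (by positivity), psq]
        have := sq_nonneg Real.pi
        nlinarith
    _ < ∞ := by
        rw [lintegral_const_mul' _ _ ENNReal.ofReal_ne_top]
        exact ENNReal.mul_lt_top ENNReal.ofReal_lt_top hf2

/-- The smooth part of the trace at `y` of the free evolution, together with the representation of
the whole trace. -/
theorem exists_freeEvolutionAt_eq {lam : ℝ} (hlam : 0 < lam) {y : Plane} {ψ₀ : L2Plane}
    (hψ₀ : ψ₀ ∈ initialData hlam y) : ∃ (m : Plane → ℂ) (q₀ : ℂ), Integrable m ∧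
      ∫⁻ ξ, ENNReal.ofReal (psq ξ) * ‖m ξ‖ₑ ^ 2 < ∞ ∧ ∫⁻ ξ, ‖m ξ‖ₑ ^ 2 < ∞ ∧
      ∀ τ : ℝ, 0 < τ → HasContinuousRep (freePropagator τ ψ₀) ∧
        freeEvolutionAt ψ₀ y τ =
          oscIntegral m τ + q₀ * (1 / (4 * Real.pi) * greenTrace lam 0 τ) := by
  obtain ⟨φ, q, ⟨hφ, hdec⟩, ε, hε, hint⟩ := hψ₀
  set u : L2Plane := 𝓕 φ with hu
  have hu2 : MemLp u 2 := Lp.memLp u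
  -- The weight `1 + p^ε` is at least `1`; only integrability of the transform itself is retained.
  have hu1 : Integrable u := by
    refine hint.mono hu2.1 (ae_of_all _ fun ξ => ?_)
    have h0 : 0 ≤ (2 * Real.pi * ‖ξ‖) ^ ε := by have := Real.pi_pos; positivity
    rw [norm_mul, Complex.norm_real, Real.norm_of_nonneg (by linarith)]
    exact le_mul_of_one_le_left (norm_nonneg _) (by linarith)
  have hwy : ∀ x, Continuous fun ξ : Plane => planeWave ξ x := fun x =>
    continuous_planeWave continuous_id continuous_const
  -- The plane wave puts the evaluation point `y` into the amplitude, so the regular part of the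
  -- trace is `oscIntegral m`.
  set m : Plane → ℂ := fun ξ => planeWave ξ y * u ξ with hm
  have hmn : ∀ ξ, ‖m ξ‖ₑ = ‖u ξ‖ₑ := fun ξ => by
    simp only [hm]
    rw [enorm_mul, ← ofReal_norm, norm_planeWave]; simp
  have hm1 : Integrable m := hu1.bdd_mul (hwy y).aestronglyMeasurable
    (ae_of_all _ fun ξ => (norm_planeWave ξ y).le)
  refine ⟨m, q, hm1, ?_, ?_, ?_⟩
  · simp_rw [hmn]
    exact lintegral_psq_mul_fourier_lt_top hφ
  · simp_rw [hmn]
    have := hu2.2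
    rw [eLpNorm_lt_top_iff_lintegral_rpow_enorm_lt_top (by norm_num) (by norm_num)] at this
    simpa using this
  have hR := memLp_resolventSymbol hlam
  set R' : Plane → ℂ := fun ξ => planeWave ξ (-y) * resolventSymbol lam ξ with hR'
  have hR'2 : MemLp R' 2 := by
    refine hR.mono ((hwy _).aestronglyMeasurable.mul hR.1) (ae_of_all _ fun ξ => ?_)
    simp only [hR']
    rw [norm_mul, norm_planeWave, one_mul]
  have htr := fourierInv_planeWave_mul_ae_eq hR y hR'2 fun ξ => rfl
  have hpi : (Real.pi : ℂ) ≠ 0 := by exact_mod_cast Real.pi_ne_zero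
  have hψ : ψ₀ = φ + q • (𝓕⁻ (hR'2.toLp R') : L2Plane) := by
    refine Lp.ext ?_
    have hmac : (fun x => macdonald hlam (x - y)) =ᵐ[volume]
        fun x => ((2 * Real.pi : ℝ) : ℂ) * (𝓕⁻ (hR.toLp (resolventSymbol lam)) : L2Plane) (x - y) :=
      (measurePreserving_sub_right volume y).quasiMeasurePreserving.ae_eq_comp
        (Lp.coeFn_smul ((2 * Real.pi : ℝ) : ℂ)
          (𝓕⁻ (hR.toLp (resolventSymbol lam)) : L2Plane))
    filter_upwards [hdec, hmac, htr, Lp.coeFn_add φ (q • (𝓕⁻ (hR'2.toLp R') : L2Plane)),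
      Lp.coeFn_smul q (𝓕⁻ (hR'2.toLp R') : L2Plane)] with x h1 h2 h3 h4 h5
    rw [h1, h2, h4, Pi.add_apply, h5, Pi.smul_apply, h3, smul_eq_mul]
    push_cast
    field_simp
  have hFψ : (𝓕 ψ₀ : L2Plane) =ᵐ[volume] fun ξ => u ξ + q * R' ξ := by
    have h1 : (𝓕 ψ₀ : L2Plane) = u + q • hR'2.toLp R' := by
      rw [hψ, FourierTransform.fourier_add, FourierTransform.fourier_smul,
        FourierTransform.fourier_fourierInv_eq]
    rw [h1]
    filter_upwards [Lp.coeFn_add u (q • hR'2.toLp R'), Lp.coeFn_smul q (hR'2.toLp R'),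
      hR'2.coeFn_toLp] with ξ h2 h3 h4
    rw [h2, Pi.add_apply, h3, Pi.smul_apply, h4, smul_eq_mul]
  intro τ hτ
  set n : Plane → ℂ := fun ξ => freeSymbol τ ξ * u ξ + q * (freeSymbol τ ξ * R' ξ) with hn
  have hf2 : ∀ {v : Plane → ℂ}, MemLp v 2 (volume : Measure Plane) →
      MemLp (fun ξ => freeSymbol τ ξ * v ξ) 2 (volume : Measure Plane) := fun {v} hv => by
    refine hv.mono ((continuous_freeSymbol τ).aestronglyMeasurable.mul hv.1)
      (ae_of_all _ fun ξ => ?_)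
    rw [norm_mul, norm_freeSymbol, one_mul]
  have hn2 : MemLp n 2 := (hf2 hu2).add ((hf2 hR'2).const_mul q)
  have hfp : freePropagator τ ψ₀ = 𝓕⁻ (hn2.toLp n) := by
    rw [freePropagator]
    congr 1
    refine Lp.ext ?_
    filter_upwards [Lp.coeFn_lpSMul (r := 2) ((memLp_freeSymbol τ).toLp (freeSymbol τ))
      (𝓕 ψ₀ : L2Plane), (memLp_freeSymbol τ).coeFn_toLp, hFψ, hn2.coeFn_toLp] with ξ h1 h2 h3 h4
    rw [h1, Pi.smul_apply', h2, h3, h4, smul_eq_mul]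
    simp only [hn]
    ring
  have hfu1 := integrable_freeSymbol_mul hu1 τ
  -- The explicit continuous candidate, matched with the `L²` propagator by testing.
  set v : Plane → ℂ := fun x =>
    (∫ ξ, planeWave ξ x * (freeSymbol τ ξ * u ξ)) + q * greenEvolution lam τ (x - y) with hv
  have hvc1 : Continuous fun x => ∫ ξ, planeWave ξ x * (freeSymbol τ ξ * u ξ) :=
    continuous_integral_planeWave hfu1
  have hvc2 : Continuous fun x => q * greenEvolution lam τ (x - y) :=
    continuous_const.mul ((continuous_greenEvolution hlam hτ).comp (by fun_prop))
  have hvc : Continuous v := hvc1.add hvc2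
  have hrep : (freePropagator τ ψ₀ : Plane → ℂ) =ᵐ[volume] v := by
    rw [hfp]
    refine fourierInv_toLp_ae_eq hn2 hvc.locallyIntegrable fun g hg => ?_
    have hgF := integrable_fourierInv_schwartz g
    have hgb : MemLp (𝓕⁻ (g : Plane → ℂ)) 2 := by
      rw [← SchwartzMap.fourierInv_coe]; exact (𝓕⁻ g).memLp 2
    have hi1 : Integrable fun ξ => 𝓕⁻ (g : Plane → ℂ) ξ * (freeSymbol τ ξ * u ξ) :=
      hgb.integrable_mul (hf2 hu2)
    have hi2 : Integrable fun ξ => 𝓕⁻ (g : Plane → ℂ) ξ * (q * (freeSymbol τ ξ * R' ξ)) :=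
      hgb.integrable_mul ((hf2 hR'2).const_mul q)
    have hj : ∀ {w : Plane → ℂ}, Continuous w → Integrable fun x => g x * w x := fun {w} hw =>
      (g.continuous.mul hw).integrable_of_hasCompactSupport hg.mul_right
    have e1 := integral_fourierInv_mul (g.integrable (μ := volume)) hfu1
    have e2 := integral_fourierInv_mul_resolvent hlam hτ y (g.integrable (μ := volume)) hgF
    simp only [hn, hv, mul_add]
    rw [integral_add hi1 hi2, integral_add (hj hvc1) (hj hvc2), e1]
    congr 1
    calc _ = q * ∫ ξ, 𝓕⁻ (g : Plane → ℂ) ξ *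
          (planeWave ξ (-y) * freeSymbol τ ξ * resolventSymbol lam ξ) := by
          rw [← integral_const_mul]
          refine integral_congr_ae (ae_of_all _ fun ξ => ?_)
          simp only [hR']
          ring
      _ = _ := by
          rw [e2, ← integral_const_mul]
          refine integral_congr_ae (ae_of_all _ fun ξ => ?_)
          simp only
          ring
  refine ⟨⟨v, hvc, hrep⟩, ?_⟩
  rw [freeEvolutionAt, pointValue_eq hvc hrep, ← greenEvolution_zero]
  simp only [hv, sub_self]
  congr 1
  refine integral_congr_ae (ae_of_all _ fun ξ => ?_)
  simp only [hm]
  ring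

/-! ### The positive definite form of the Green trace -/

/-- The boundary trace of the Green function in the rotating frame, `e^{-iλt} h(t)`. -/
def eKer (lam t : ℝ) : ℂ := Complex.exp (-(Complex.I * lam * t)) * greenTrace lam 0 t

/-- The Fourier integral `∫ e^{iωt} f(t) dt`. -/
def timeFourier (f : ℝ → ℂ) (ω : ℝ) : ℂ := ∫ t : ℝ, Complex.exp (Complex.I * ω * t) * f t

/-- `∫_{ω > λ} |f^(ω)|² ω⁻¹ dω`. -/
def energy (lam : ℝ) (f : ℝ → ℂ) : ℝ≥0∞ :=
  ∫⁻ ω in Set.Ioi lam, ENNReal.ofReal (1 / ω) * ‖timeFourier f ω‖ₑ ^ 2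

/-- A majorant of the Green trace. -/
def hker (lam t : ℝ) : ℝ≥0∞ :=
  ∫⁻ s in Set.Ioi (0 : ℝ), ‖(Real.exp (-(lam * s)) : ℂ) / ((s : ℂ) + Complex.I * t)‖ₑ

/-- `∬ |f(t)| hker(t - τ) |g(τ)| dt dτ`. -/
def absForm (lam : ℝ) (f g : ℝ → ℂ) : ℝ≥0∞ :=
  ∫⁻ p : ℝ × ℝ, ‖f p.1‖ₑ * hker lam (p.1 - p.2) * ‖g p.2‖ₑ

/-- `∬ conj f(t) e(t - τ) g(τ) dt dτ`. -/
def traceForm (lam : ℝ) (f g : ℝ → ℂ) : ℂ :=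
  ∫ p : ℝ × ℝ, (starRingEnd ℂ) (f p.1) * eKer lam (p.1 - p.2) * g p.2

/-- The rotation moves into the exponent, so that the integrand depends on `s + it` only; this is
what exhibits the kernel as a positive superposition of `e^{-iωt}` over `ω > λ`. -/
theorem eKer_eq (lam t : ℝ) : eKer lam t = ∫ s in Set.Ioi (0 : ℝ),
    Complex.exp (-(lam * ((s : ℂ) + Complex.I * t))) / ((s : ℂ) + Complex.I * t) := by
  rw [eKer, greenTrace, ← integral_const_mul]
  refine setIntegral_congr_fun measurableSet_Ioi fun s _ => ?_
  rw [Complex.ofReal_exp, ← mul_div_assoc, ← Complex.exp_add]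
  congr 2
  push_cast
  ring

theorem norm_eKer (lam t : ℝ) : ‖eKer lam t‖ = ‖greenTrace lam 0 t‖ := by
  rw [eKer, norm_mul, show -(Complex.I * lam * t) = ((-(lam * t) : ℝ) : ℂ) * Complex.I by
    push_cast; ring, Complex.norm_exp_ofReal_mul_I, one_mul]

theorem enorm_eKer_le (lam t : ℝ) : ‖eKer lam t‖ₑ ≤ hker lam t := by
  rw [← ofReal_norm, norm_eKer, ofReal_norm]
  exact enorm_integral_le_lintegral_enorm _

theorem stronglyMeasurable_eKer (lam : ℝ) : StronglyMeasurable (eKer lam) :=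
  (by fun_prop : Continuous fun t : ℝ =>
    Complex.exp (-(Complex.I * lam * t))).stronglyMeasurable.mul
    (stronglyMeasurable_greenTrace lam 0)

theorem eKer_neg (lam t : ℝ) : eKer lam (-t) = (starRingEnd ℂ) (eKer lam t) := by
  rw [eKer, eKer, map_mul, ← Complex.exp_conj, greenTrace_neg]
  congr 2
  simp

theorem norm_cexp_I_mul (ω t : ℝ) : ‖Complex.exp (Complex.I * ω * t)‖ = 1 := by
  rw [mul_assoc, ← Complex.ofReal_mul, Complex.norm_exp_I_mul_ofReal]

theorem continuous_timeFourier {f : ℝ → ℂ} (hf : Integrable f) : Continuous (timeFourier f) := by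
  have h1 : ∀ ω : ℝ, Continuous fun t : ℝ => Complex.exp (Complex.I * ω * t) := fun ω => by
    fun_prop
  refine continuous_of_dominated (bound := fun t => ‖f t‖)
    (fun ω => (h1 ω).aestronglyMeasurable.mul hf.1)
    (fun ω => ae_of_all _ fun t => ?_) hf.norm (ae_of_all _ fun t => ?_)
  · rw [norm_mul, norm_cexp_I_mul, one_mul]
  · fun_prop

theorem conj_timeFourier (f : ℝ → ℂ) (ω : ℝ) : (starRingEnd ℂ) (timeFourier f ω) =
    ∫ t : ℝ, Complex.exp (-(Complex.I * ω * t)) * (starRingEnd ℂ) (f t) := by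
  rw [timeFourier, ← integral_conj]
  refine integral_congr_ae (ae_of_all _ fun t => ?_)
  simp only [map_mul]
  rw [← Complex.exp_conj]
  simp

/-- The form at fixed `s`, in frequency space. -/
theorem integral_mul_exp_div {lam s : ℝ} (hs : 0 < s) {f g : ℝ → ℂ} (hf : Integrable f)
    (hg : Integrable g) :
    ∫ p : ℝ × ℝ, (starRingEnd ℂ) (f p.1) * (Complex.exp (-(lam * ((s : ℂ) +
      Complex.I * (p.1 - p.2 : ℝ)))) / ((s : ℂ) + Complex.I * (p.1 - p.2 : ℝ))) * g p.2 =
    ∫ ω in Set.Ioi lam, (Real.exp (-(ω * s)) : ℂ) *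
      ((starRingEnd ℂ) (timeFourier f ω) * timeFourier g ω) := by
  have hfc : Integrable fun t => (starRingEnd ℂ) (f t) :=
    (Complex.conjCLE : ℂ →L[ℝ] ℂ).integrable_comp hf
  have hexp : IntegrableOn (fun ω : ℝ => (Real.exp (-(ω * s)) : ℂ)) (Set.Ioi lam) := by
    have := (integrableOn_exp_mul_Ioi (a := -s) (by linarith) lam)
    refine Integrable.ofReal (this.congr_fun (fun ω _ => ?_) measurableSet_Ioi)
    simp only
    congr 1; ring
  set k : ℝ × ℝ → ℝ → ℂ := fun p ω =>
    Complex.exp (-(Complex.I * ω * (p.1 - p.2 : ℝ))) *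
      (((starRingEnd ℂ) (f p.1) * g p.2) * (Real.exp (-(ω * s)) : ℂ)) with hk
  have hki : Integrable (Function.uncurry k)
      (((volume : Measure ℝ).prod volume).prod (volume.restrict (Set.Ioi lam))) := by
    have h1 : Integrable (fun p : ℝ × ℝ => (starRingEnd ℂ) (f p.1) * g p.2)
        ((volume : Measure ℝ).prod volume) := hfc.mul_prod hg
    have h2 := Integrable.mul_prod (g := fun ω : ℝ => (Real.exp (-(ω * s)) : ℂ)) h1 hexp
    refine Integrable.bdd_mul (c := 1) h2 (Continuous.aestronglyMeasurable ?_)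
      (ae_of_all _ fun z => ?_)
    · fun_prop
    · rw [show -(Complex.I * (z.2 : ℂ) * ((z.1.1 - z.1.2 : ℝ) : ℂ)) =
        Complex.I * (z.2 : ℂ) * ((-(z.1.1 - z.1.2) : ℝ) : ℂ) by push_cast; ring, norm_cexp_I_mul]
  calc _ = ∫ p : ℝ × ℝ, ∫ ω in Set.Ioi lam, k p ω := by
        refine integral_congr_ae (ae_of_all _ fun p => ?_)
        simp only
        set z : ℂ := (s : ℂ) + Complex.I * (p.1 - p.2 : ℝ) with hz
        have hzr : (-z).re < 0 := by rw [hz]; simpa using hs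
        -- `e^{-λz}/z = ∫_λ^∞ e^{-ωz} dω` for `z = s + i(t - τ)`, whose real part is positive.
        have h := integral_exp_mul_complex_Ioi hzr lam
        have h2 : ∀ ω : ℝ, k p ω = ((starRingEnd ℂ) (f p.1) * g p.2) * Complex.exp (-z * ω) := by
          intro ω
          simp only [hk]
          rw [mul_left_comm, Complex.ofReal_exp, ← Complex.exp_add]
          congr 2
          rw [hz]; push_cast; ring
        simp_rw [h2]
        rw [integral_const_mul, h, neg_div_neg_eq, show -z * (lam : ℂ) = -(lam * z) by ring]
        ring
    _ = ∫ ω in Set.Ioi lam, ∫ p : ℝ × ℝ, k p ω := integral_integral_swap hki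
    _ = _ := by
        refine setIntegral_congr_fun measurableSet_Ioi fun ω _ => ?_
        rw [conj_timeFourier, timeFourier]
        have h := integral_prod_mul (μ := (volume : Measure ℝ)) (ν := (volume : Measure ℝ))
          (fun t => Complex.exp (-(Complex.I * ω * t)) * (starRingEnd ℂ) (f t))
          (fun t => Complex.exp (Complex.I * ω * t) * g t)
        rw [← h, ← integral_const_mul, Measure.volume_eq_prod]
        refine integral_congr_ae (ae_of_all _ fun p => ?_)
        simp only [hk]
        have : Complex.exp (-(Complex.I * ω * (p.1 - p.2 : ℝ))) =
            Complex.exp (-(Complex.I * ω * p.1)) * Complex.exp (Complex.I * ω * p.2) := by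
          rw [← Complex.exp_add]; congr 1; push_cast; ring
        rw [this]; ring

theorem enorm_cexp_div_eq (lam s t : ℝ) :
    ‖Complex.exp (-(lam * ((s : ℂ) + Complex.I * t))) / ((s : ℂ) + Complex.I * t)‖ₑ =
      ‖(Real.exp (-(lam * s)) : ℂ) / ((s : ℂ) + Complex.I * t)‖ₑ := by
  rw [← ofReal_norm, ← ofReal_norm, norm_div, norm_div, Complex.norm_exp, Complex.norm_real,
    Real.norm_of_nonneg (Real.exp_pos _).le]
  congr 3
  simp

theorem measurable_uncurry_exp_div (lam : ℝ) : Measurable fun z : ℝ × ℝ =>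
    Complex.exp (-(lam * ((z.2 : ℂ) + Complex.I * z.1))) / ((z.2 : ℂ) + Complex.I * z.1) := by
  have h : Measurable fun z : ℝ × ℝ => (z.2 : ℂ) + Complex.I * z.1 := by fun_prop
  exact (Complex.measurable_exp.comp (h.const_mul _).neg).div h

theorem measurable_hker (lam : ℝ) : Measurable (hker lam) := by
  unfold hker
  simp_rw [← enorm_cexp_div_eq]
  exact Measurable.lintegral_prod_right' (measurable_uncurry_exp_div lam).enorm

/-- Frequency representation of the form. -/
theorem traceForm_eq {lam : ℝ} {f g : ℝ → ℂ} (hf : Integrable f) (hg : Integrable g)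
    (hfg : absForm lam f g < ∞) :
    IntegrableOn (fun s : ℝ => ∫ ω in Set.Ioi lam, (Real.exp (-(ω * s)) : ℂ) *
      ((starRingEnd ℂ) (timeFourier f ω) * timeFourier g ω)) (Set.Ioi 0) ∧
    traceForm lam f g = ∫ s in Set.Ioi (0 : ℝ), ∫ ω in Set.Ioi lam, (Real.exp (-(ω * s)) : ℂ) *
      ((starRingEnd ℂ) (timeFourier f ω) * timeFourier g ω) := by
  set K : ℝ × ℝ → ℝ → ℂ := fun p s => (starRingEnd ℂ) (f p.1) * (Complex.exp (-(lam * ((s : ℂ) +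
      Complex.I * (p.1 - p.2 : ℝ)))) / ((s : ℂ) + Complex.I * (p.1 - p.2 : ℝ))) * g p.2 with hK
  have hmeas : AEStronglyMeasurable (Function.uncurry K)
      (((volume : Measure ℝ).prod volume).prod (volume.restrict (Set.Ioi (0 : ℝ)))) := by
    have h1 : AEStronglyMeasurable (fun p : ℝ × ℝ => (starRingEnd ℂ) (f p.1))
        ((volume : Measure ℝ).prod volume) :=
      (Complex.continuous_conj.comp_aestronglyMeasurable hf.1).comp_fst
    have h2 : AEStronglyMeasurable (fun p : ℝ × ℝ => g p.2)
        ((volume : Measure ℝ).prod volume) := hg.1.comp_snd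
    have h3 : Measurable fun z : (ℝ × ℝ) × ℝ => ((z.1.1 - z.1.2, z.2) : ℝ × ℝ) := by fun_prop
    exact (h1.comp_fst.mul ((measurable_uncurry_exp_div lam).comp h3).aestronglyMeasurable).mul
      h2.comp_fst
  have hKi : Integrable (Function.uncurry K)
      (((volume : Measure ℝ).prod volume).prod (volume.restrict (Set.Ioi (0 : ℝ)))) := by
    refine ⟨hmeas, ?_⟩
    rw [HasFiniteIntegral, lintegral_prod _ hmeas.enorm]
    refine lt_of_le_of_lt (le_of_eq ?_) hfg
    rw [absForm, Measure.volume_eq_prod]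
    refine lintegral_congr fun p => ?_
    simp only [Function.uncurry, hK, enorm_mul, enorm_cexp_div_eq]
    rw [lintegral_mul_const' _ _ (by simp), lintegral_const_mul' _ _ (by simp), hker]
    congr 2
    rw [← ofReal_norm, RCLike.norm_conj, ofReal_norm]
  have hinner : ∀ s ∈ Set.Ioi (0 : ℝ), ∫ p : ℝ × ℝ, K p s = ∫ ω in Set.Ioi lam,
      (Real.exp (-(ω * s)) : ℂ) * ((starRingEnd ℂ) (timeFourier f ω) * timeFourier g ω) :=
    fun s hs => integral_mul_exp_div hs hf hg
  constructor
  · have := hKi.integral_prod_right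
    exact IntegrableOn.congr_fun (f := fun s => ∫ p : ℝ × ℝ, K p s) this hinner measurableSet_Ioi
  · rw [← setIntegral_congr_fun measurableSet_Ioi hinner]
    rw [traceForm, Measure.volume_eq_prod, ← integral_integral_swap hKi]
    refine integral_congr_ae (ae_of_all _ fun p => ?_)
    simp only [hK]
    rw [integral_mul_const, integral_const_mul, eKer_eq]

theorem lintegral_exp_neg_mul_Ioi {ω : ℝ} (hω : 0 < ω) :
    ∫⁻ s in Set.Ioi (0 : ℝ), ENNReal.ofReal (Real.exp (-(ω * s))) = ENNReal.ofReal (1 / ω) := by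
  rw [← ofReal_integral_eq_lintegral_ofReal (integrableOn_exp_neg_mul_Ioi hω)
    (ae_of_all _ fun s => (Real.exp_pos _).le)]
  congr 1
  have := integral_exp_mul_Ioi (a := -ω) (by linarith) 0
  simp_rw [← neg_mul]
  rw [this]
  simp

theorem lintegral_lintegral_exp_mul {lam : ℝ} (hlam : 0 < lam) {F : ℝ → ℝ≥0∞}
    (hF : Measurable F) :
    ∫⁻ s in Set.Ioi (0 : ℝ), ∫⁻ ω in Set.Ioi lam, ENNReal.ofReal (Real.exp (-(ω * s))) * F ω =
      ∫⁻ ω in Set.Ioi lam, ENNReal.ofReal (1 / ω) * F ω := by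
  rw [lintegral_lintegral_swap]
  · refine setLIntegral_congr_fun measurableSet_Ioi fun ω hω => ?_
    rw [lintegral_mul_const _ (by fun_prop), lintegral_exp_neg_mul_Ioi (hlam.trans hω)]
  · exact ((by fun_prop : Measurable fun z : ℝ × ℝ =>
      ENNReal.ofReal (Real.exp (-(z.2 * z.1)))).mul (hF.comp measurable_snd)).aemeasurable

/-- Positivity: the diagonal of the form is the energy. -/
theorem traceForm_self {lam : ℝ} (hlam : 0 < lam) {f : ℝ → ℂ} (hf : Integrable f)
    (hff : absForm lam f f < ∞) :
    energy lam f < ∞ ∧ traceForm lam f f = ((energy lam f).toReal : ℂ) := by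
  obtain ⟨h1, h2⟩ := traceForm_eq hf hf hff
  have hcont := continuous_timeFourier hf
  have e : ∀ s : ℝ, (∫ ω in Set.Ioi lam, (Real.exp (-(ω * s)) : ℂ) *
      ((starRingEnd ℂ) (timeFourier f ω) * timeFourier f ω)) =
      ((∫ ω in Set.Ioi lam, Real.exp (-(ω * s)) * ‖timeFourier f ω‖ ^ 2 : ℝ) : ℂ) := by
    intro s
    rw [← integral_complex_ofReal]
    refine setIntegral_congr_fun measurableSet_Ioi fun ω _ => ?_
    rw [Complex.conj_mul']
    push_cast
    ring
  simp_rw [e] at h1 h2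
  have hb : Integrable (fun t => ‖f t‖) := hf.norm
  have hbd : ∀ ω, ‖timeFourier f ω‖ ≤ ∫ t, ‖f t‖ := fun ω => by
    refine (norm_integral_le_integral_norm _).trans (le_of_eq ?_)
    refine integral_congr_ae (ae_of_all _ fun t => ?_)
    simp only
    rw [norm_mul, norm_cexp_I_mul, one_mul]
  have hinti : ∀ s : ℝ, 0 < s → IntegrableOn
      (fun ω => Real.exp (-(ω * s)) * ‖timeFourier f ω‖ ^ 2) (Set.Ioi lam) := by
    intro s hs
    have h3 := (integrableOn_exp_mul_Ioi (a := -s) (by linarith) lam)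
    have h4 : IntegrableOn (fun ω => Real.exp (-(ω * s))) (Set.Ioi lam) :=
      h3.congr_fun (fun ω _ => by simp only; congr 1; ring) measurableSet_Ioi
    refine h4.mul_bdd (c := (∫ t, ‖f t‖) ^ 2) (hcont.norm.pow 2).aestronglyMeasurable
      (ae_of_all _ fun ω => ?_)
    rw [norm_pow, norm_norm]
    exact pow_le_pow_left₀ (norm_nonneg _) (hbd ω) 2
  have h1r : IntegrableOn (fun s : ℝ => ∫ ω in Set.Ioi lam,
      Real.exp (-(ω * s)) * ‖timeFourier f ω‖ ^ 2) (Set.Ioi 0) := by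
    have h5 := Integrable.re h1
    exact h5
  have hnn : ∀ s : ℝ, 0 ≤ ∫ ω in Set.Ioi lam, Real.exp (-(ω * s)) * ‖timeFourier f ω‖ ^ 2 :=
    fun s => integral_nonneg fun ω => by positivity
  have hE : energy lam f = ENNReal.ofReal (∫ s in Set.Ioi (0 : ℝ), ∫ ω in Set.Ioi lam,
      Real.exp (-(ω * s)) * ‖timeFourier f ω‖ ^ 2) := by
    rw [energy, ← lintegral_lintegral_exp_mul hlam (hcont.measurable.enorm.pow_const 2),
      ofReal_integral_eq_lintegral_ofReal h1r (ae_of_all _ hnn)]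
    refine setLIntegral_congr_fun measurableSet_Ioi fun s hs => ?_
    rw [ofReal_integral_eq_lintegral_ofReal (hinti s hs) (ae_of_all _ fun ω => by positivity)]
    refine lintegral_congr fun ω => ?_
    rw [ENNReal.ofReal_mul (Real.exp_pos _).le, ENNReal.ofReal_pow (norm_nonneg _), ofReal_norm]
  constructor
  · rw [hE]; exact ENNReal.ofReal_lt_top
  · rw [h2, hE, ENNReal.toReal_ofReal (integral_nonneg hnn), integral_complex_ofReal]

theorem ennreal_two_mul_mul_le {θ : ℝ} (hθ : 0 < θ) (a b : ℂ) {c : ℝ} (hc : 0 < c) :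
    2 * (‖a‖ₑ * ‖b‖ₑ) ≤ ENNReal.ofReal (θ⁻¹ * c) * ‖a‖ₑ ^ 2 + ENNReal.ofReal (θ * c⁻¹) * ‖b‖ₑ ^ 2 := by
  simp only [← ofReal_norm]
  rw [← ENNReal.ofReal_pow (norm_nonneg _), ← ENNReal.ofReal_pow (norm_nonneg _),
    ← ENNReal.ofReal_mul (norm_nonneg _), ← ENNReal.ofReal_mul (by positivity),
    ← ENNReal.ofReal_mul (by positivity), ← ENNReal.ofReal_add (by positivity) (by positivity),
    show (2 : ℝ≥0∞) = ENNReal.ofReal 2 by simp, ← ENNReal.ofReal_mul (by norm_num)]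
  refine ENNReal.ofReal_le_ofReal ?_
  have h := sq_nonneg (c * ‖a‖ - θ * ‖b‖)
  have hcθ : 0 < c * θ := mul_pos hc hθ
  have e : θ⁻¹ * c * ‖a‖ ^ 2 + θ * c⁻¹ * ‖b‖ ^ 2 - 2 * (‖a‖ * ‖b‖) =
      (c * ‖a‖ - θ * ‖b‖) ^ 2 / (c * θ) := by
    field_simp
    ring
  have : 0 ≤ (c * ‖a‖ - θ * ‖b‖) ^ 2 / (c * θ) := by positivity
  linarith

/-- Cauchy–Schwarz for the form, in additive form. -/
theorem two_mul_norm_traceForm_le {lam : ℝ} (hlam : 0 < lam) {f g : ℝ → ℂ} (hf : Integrable f)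
    (hg : Integrable g) (hfg : absForm lam f g < ∞) (hfE : energy lam f < ∞)
    (hgE : energy lam g < ∞) {θ : ℝ} (hθ : 0 < θ) :
    2 * ‖traceForm lam f g‖ ≤ θ⁻¹ * (energy lam f).toReal + θ * (energy lam g).toReal := by
  have hfc := continuous_timeFourier hf
  have hgc := continuous_timeFourier hg
  have h1 : 2 * ‖traceForm lam f g‖ₑ ≤
      ENNReal.ofReal θ⁻¹ * energy lam f + ENNReal.ofReal θ * energy lam g := by
    rw [(traceForm_eq hf hg hfg).2]
    calc _ ≤ 2 * ∫⁻ s in Set.Ioi (0 : ℝ), ∫⁻ ω in Set.Ioi lam,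
          ENNReal.ofReal (Real.exp (-(ω * s))) * (‖timeFourier f ω‖ₑ * ‖timeFourier g ω‖ₑ) := by
          refine mul_le_mul' le_rfl ((enorm_integral_le_lintegral_enorm _).trans
            (lintegral_mono fun s => (enorm_integral_le_lintegral_enorm _).trans
              (lintegral_mono fun ω => le_of_eq ?_)))
          rw [enorm_mul, enorm_mul]
          congr 2
          · rw [← ofReal_norm, Complex.norm_real, Real.norm_of_nonneg (Real.exp_pos _).le]
          · rw [← ofReal_norm, RCLike.norm_conj, ofReal_norm]
      _ = ∫⁻ ω in Set.Ioi lam, ENNReal.ofReal (1 / ω) *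
          (2 * (‖timeFourier f ω‖ₑ * ‖timeFourier g ω‖ₑ)) := by
          rw [lintegral_lintegral_exp_mul hlam (F := fun ω => ‖timeFourier f ω‖ₑ * ‖timeFourier g ω‖ₑ)
            (hfc.measurable.enorm.mul hgc.measurable.enorm),
            ← lintegral_const_mul' _ _ (by simp)]
          refine lintegral_congr fun ω => ?_
          ring
      _ ≤ ∫⁻ ω in Set.Ioi lam, (ENNReal.ofReal θ⁻¹ *
          (ENNReal.ofReal (1 / ω) * ‖timeFourier f ω‖ₑ ^ 2) +
          ENNReal.ofReal θ * (ENNReal.ofReal (1 / ω) * ‖timeFourier g ω‖ₑ ^ 2)) := by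
          refine lintegral_mono fun ω => ?_
          have := ennreal_two_mul_mul_le hθ (timeFourier f ω) (timeFourier g ω) one_pos
          rw [mul_one, inv_one, mul_one] at this
          calc _ ≤ ENNReal.ofReal (1 / ω) * _ := mul_le_mul' le_rfl this
            _ = _ := by ring
      _ = _ := by
          rw [lintegral_add_left, lintegral_const_mul' _ _ ENNReal.ofReal_ne_top,
            lintegral_const_mul' _ _ ENNReal.ofReal_ne_top]
          · rfl
          · exact ((by fun_prop : Measurable fun ω : ℝ => ENNReal.ofReal (1 / ω)).mul
              (hfc.measurable.enorm.pow_const 2)).const_mul _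
  have h2 := ENNReal.toReal_mono (by
    exact ENNReal.add_ne_top.2 ⟨ENNReal.mul_ne_top ENNReal.ofReal_ne_top hfE.ne,
      ENNReal.mul_ne_top ENNReal.ofReal_ne_top hgE.ne⟩) h1
  rwa [ENNReal.toReal_add (ENNReal.mul_ne_top ENNReal.ofReal_ne_top hfE.ne)
      (ENNReal.mul_ne_top ENNReal.ofReal_ne_top hgE.ne), ENNReal.toReal_mul, ENNReal.toReal_mul,
    ENNReal.toReal_mul, ENNReal.toReal_ofReal (inv_pos.2 hθ).le, ENNReal.toReal_ofReal hθ.le,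
    ENNReal.toReal_ofNat, toReal_enorm] at h2

/-- Pairing of a finite energy function with the trace of a free wave. -/
theorem two_mul_norm_integral_conj_mul_oscIntegral_le {lam : ℝ} (hlam : 0 < lam) {f : ℝ → ℂ}
    (hf : Integrable f) (hfE : energy lam f < ∞) {m : Plane → ℂ} (hm : Integrable m)
    (hm2 : ∫⁻ ξ, ENNReal.ofReal (lam + psq ξ) * ‖m ξ‖ₑ ^ 2 < ∞) (x : ℝ) {θ : ℝ} (hθ : 0 < θ) :
    2 * ‖∫ t, (starRingEnd ℂ) (f t) *
      (Complex.exp (-(Complex.I * lam * (t + x : ℝ))) * oscIntegral m (t + x))‖ ≤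
      θ⁻¹ * (∫⁻ ξ, ENNReal.ofReal (lam + psq ξ) * ‖m ξ‖ₑ ^ 2).toReal +
        θ * (energy lam f).toReal := by
  have hfc := continuous_timeFourier hf
  have hpsq := continuous_psq
  have hfcj : Integrable fun t => (starRingEnd ℂ) (f t) :=
    (Complex.conjCLE : ℂ →L[ℝ] ℂ).integrable_comp hf
  set k : ℝ → Plane → ℂ := fun t ξ =>
    Complex.exp (Complex.I * ((-(lam + psq ξ) : ℝ) : ℂ) * (t + x : ℝ)) *
      ((starRingEnd ℂ) (f t) * m ξ) with hk
  have hki : Integrable (Function.uncurry k) ((volume : Measure ℝ).prod volume) := by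
    have h2 := Integrable.mul_prod hfcj hm
    refine Integrable.bdd_mul (c := 1) h2 (Continuous.aestronglyMeasurable ?_)
      (ae_of_all _ fun z => (norm_cexp_I_mul _ _).le)
    fun_prop
  -- Fubini: each `ξ` tests `f` at the frequency `ω = λ + p²`.
  have e1 : (∫ t, (starRingEnd ℂ) (f t) *
      (Complex.exp (-(Complex.I * lam * (t + x : ℝ))) * oscIntegral m (t + x))) =
      ∫ ξ, Complex.exp (Complex.I * ((-(lam + psq ξ) : ℝ) : ℂ) * x) * m ξ *
        (starRingEnd ℂ) (timeFourier f (lam + psq ξ)) := by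
    calc _ = ∫ t, ∫ ξ, k t ξ := by
          refine integral_congr_ae (ae_of_all _ fun t => ?_)
          simp only
          rw [oscIntegral, ← integral_const_mul, ← integral_const_mul]
          refine integral_congr_ae (ae_of_all _ fun ξ => ?_)
          simp only [hk]
          have : Complex.exp (Complex.I * ((-(lam + psq ξ) : ℝ) : ℂ) * (t + x : ℝ)) =
              Complex.exp (-(Complex.I * lam * (t + x : ℝ))) * freeSymbol (t + x) ξ := by
            rw [freeSymbol_eq, ← Complex.exp_add]; congr 1; push_cast; ring
          rw [this]; ring
      _ = ∫ ξ, ∫ t, k t ξ := integral_integral_swap hki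
      _ = _ := by
          refine integral_congr_ae (ae_of_all _ fun ξ => ?_)
          simp only
          rw [conj_timeFourier, ← integral_const_mul]
          refine integral_congr_ae (ae_of_all _ fun t => ?_)
          simp only [hk]
          have : Complex.exp (Complex.I * ((-(lam + psq ξ) : ℝ) : ℂ) * (t + x : ℝ)) =
              Complex.exp (Complex.I * ((-(lam + psq ξ) : ℝ) : ℂ) * x) *
              Complex.exp (-(Complex.I * (lam + psq ξ : ℝ) * t)) := by
            rw [← Complex.exp_add]; congr 1; push_cast; ring
          rw [this]; ring
  -- Since `p²` has constant density, the integral is `1/(4π)` times the energy, and the factor is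
  -- discarded. So the weight `λ + p²` on the data is dual to the weight `1/ω` of the energy.
  have hen : ∫⁻ ξ, ENNReal.ofReal (lam + psq ξ)⁻¹ * ‖timeFourier f (lam + psq ξ)‖ₑ ^ 2 ≤
      energy lam f := by
    have hg : Measurable fun r : ℝ =>
        ENNReal.ofReal (lam + r)⁻¹ * ‖timeFourier f (lam + r)‖ₑ ^ 2 :=
      (by fun_prop : Measurable fun r : ℝ => ENNReal.ofReal (lam + r)⁻¹).mul
        ((hfc.measurable.comp (measurable_const.add measurable_id)).enorm.pow_const 2)
    rw [lintegral_comp_psq (g := fun r : ℝ =>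
      ENNReal.ofReal (lam + r)⁻¹ * ‖timeFourier f (lam + r)‖ₑ ^ 2) hg]
    have h1 : ENNReal.ofReal (1 / (4 * Real.pi)) ≤ 1 := by
      rw [← ENNReal.ofReal_one]
      refine ENNReal.ofReal_le_ofReal ?_
      rw [div_le_one (by positivity)]
      linarith [Real.pi_gt_three]
    calc _ ≤ 1 * ∫⁻ r in Set.Ici (0 : ℝ),
          ENNReal.ofReal (lam + r)⁻¹ * ‖timeFourier f (lam + r)‖ₑ ^ 2 := mul_le_mul' h1 le_rfl
      _ = _ := by
          rw [one_mul, energy, ← lintegral_indicator measurableSet_Ici,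
            ← lintegral_indicator measurableSet_Ioi,
            ← lintegral_add_left_eq_self ((Set.Ioi lam).indicator _) lam]
          refine lintegral_congr_ae ?_
          have : ∀ᵐ r : ℝ, r ≠ 0 := by simp [ae_iff]
          filter_upwards [this] with r hr
          by_cases h : 0 < r
          · rw [Set.indicator_of_mem (show r ∈ Set.Ici 0 from h.le),
              Set.indicator_of_mem (show lam + r ∈ Set.Ioi lam by simpa using h), one_div]
          · have h' : r < 0 := lt_of_le_of_ne (not_lt.1 h) hr
            rw [Set.indicator_of_notMem (by simpa using h'),
              Set.indicator_of_notMem (by simpa using h)]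
  have hmm : AEMeasurable (fun ξ => ‖m ξ‖ₑ ^ 2) := hm.aestronglyMeasurable.enorm.pow_const 2
  have h1 : 2 * ‖∫ t, (starRingEnd ℂ) (f t) *
      (Complex.exp (-(Complex.I * lam * (t + x : ℝ))) * oscIntegral m (t + x))‖ₑ ≤
      ENNReal.ofReal θ⁻¹ * (∫⁻ ξ, ENNReal.ofReal (lam + psq ξ) * ‖m ξ‖ₑ ^ 2) +
        ENNReal.ofReal θ * energy lam f := by
    rw [e1]
    calc _ ≤ 2 * ∫⁻ ξ, ‖m ξ‖ₑ * ‖timeFourier f (lam + psq ξ)‖ₑ := by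
          refine mul_le_mul' le_rfl ((enorm_integral_le_lintegral_enorm _).trans
            (lintegral_mono fun ξ => le_of_eq ?_))
          rw [enorm_mul, enorm_mul, ← ofReal_norm (Complex.exp _), norm_cexp_I_mul,
            ← ofReal_norm ((starRingEnd ℂ) _), RCLike.norm_conj, ofReal_norm]
          simp
      _ = ∫⁻ ξ, 2 * (‖m ξ‖ₑ * ‖timeFourier f (lam + psq ξ)‖ₑ) :=
          (lintegral_const_mul' _ _ (by simp)).symm
      _ ≤ ∫⁻ ξ, (ENNReal.ofReal θ⁻¹ * (ENNReal.ofReal (lam + psq ξ) * ‖m ξ‖ₑ ^ 2) +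
            ENNReal.ofReal θ * (ENNReal.ofReal (lam + psq ξ)⁻¹ *
              ‖timeFourier f (lam + psq ξ)‖ₑ ^ 2)) := by
          refine lintegral_mono fun ξ => ?_
          have hc : 0 < lam + psq ξ := by have := psq_nonneg ξ; linarith
          have := ennreal_two_mul_mul_le hθ (m ξ) (timeFourier f (lam + psq ξ)) hc
          rwa [ENNReal.ofReal_mul (inv_pos.2 hθ).le, ENNReal.ofReal_mul hθ.le, mul_assoc,
            mul_assoc] at this
      _ ≤ _ := by
          rw [lintegral_add_left', lintegral_const_mul' _ _ ENNReal.ofReal_ne_top,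
            lintegral_const_mul' _ _ ENNReal.ofReal_ne_top]
          · exact add_le_add le_rfl (mul_le_mul' le_rfl hen)
          · exact ((by fun_prop : Measurable fun ξ =>
              ENNReal.ofReal (lam + psq ξ)).aemeasurable.mul hmm).const_mul _
  have h2 := ENNReal.toReal_mono (by
    exact ENNReal.add_ne_top.2 ⟨ENNReal.mul_ne_top ENNReal.ofReal_ne_top hm2.ne,
      ENNReal.mul_ne_top ENNReal.ofReal_ne_top hfE.ne⟩) h1
  rwa [ENNReal.toReal_add (ENNReal.mul_ne_top ENNReal.ofReal_ne_top hm2.ne)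
      (ENNReal.mul_ne_top ENNReal.ofReal_ne_top hfE.ne), ENNReal.toReal_mul, ENNReal.toReal_mul,
    ENNReal.toReal_mul, ENNReal.toReal_ofReal (inv_pos.2 hθ).le, ENNReal.toReal_ofReal hθ.le,
    ENNReal.toReal_ofNat, toReal_enorm] at h2

theorem hker_neg (lam t : ℝ) : hker lam (-t) = hker lam t := by
  unfold hker
  refine lintegral_congr fun s => ?_
  rw [← ofReal_norm, ← ofReal_norm, norm_div, norm_div]
  congr 2
  rw [← RCLike.norm_conj]
  congr 1
  simp

theorem integrable_traceForm_integrand {lam : ℝ} {f g : ℝ → ℂ}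
    (hf : AEStronglyMeasurable f) (hg : AEStronglyMeasurable g) (hfg : absForm lam f g < ∞) :
    Integrable (fun p : ℝ × ℝ => (starRingEnd ℂ) (f p.1) * eKer lam (p.1 - p.2) * g p.2)
      ((volume : Measure ℝ).prod volume) := by
  have h1 : AEStronglyMeasurable (fun p : ℝ × ℝ => (starRingEnd ℂ) (f p.1))
      ((volume : Measure ℝ).prod volume) :=
    (Complex.continuous_conj.comp_aestronglyMeasurable hf).comp_fst
  have h2 : AEStronglyMeasurable (fun p : ℝ × ℝ => g p.2)
      ((volume : Measure ℝ).prod volume) := hg.comp_snd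
  have h3 : StronglyMeasurable fun p : ℝ × ℝ => eKer lam (p.1 - p.2) :=
    (stronglyMeasurable_eKer lam).comp_measurable (by fun_prop)
  refine ⟨(h1.mul h3.aestronglyMeasurable).mul h2, ?_⟩
  rw [HasFiniteIntegral]
  refine lt_of_le_of_lt (lintegral_mono fun p => ?_) hfg
  rw [enorm_mul, enorm_mul, ← ofReal_norm ((starRingEnd ℂ) _), RCLike.norm_conj, ofReal_norm]
  exact mul_le_mul' (mul_le_mul' le_rfl (enorm_eKer_le _ _)) le_rfl

/-- The diagonal of the form in causal form. -/
theorem traceForm_self_re {lam : ℝ} {f : ℝ → ℂ} (hf : AEStronglyMeasurable f)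
    (hff : absForm lam f f < ∞) : (traceForm lam f f).re =
      2 * (∫ t, (starRingEnd ℂ) (f t) * ∫ τ in Set.Iio t, eKer lam (t - τ) * f τ).re := by
  set Φ : ℝ × ℝ → ℂ := fun p => (starRingEnd ℂ) (f p.1) * eKer lam (p.1 - p.2) * f p.2 with hΦ
  have hi : Integrable Φ ((volume : Measure ℝ).prod volume) :=
    integrable_traceForm_integrand hf hf hff
  -- The kernel is Hermitian, so the anticausal half of the double integral is the conjugate of the
  -- causal half.
  have hsym : ∀ t τ, Φ (τ, t) = (starRingEnd ℂ) (Φ (t, τ)) := fun t τ => by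
    simp only [hΦ, map_mul, Complex.conj_conj]
    rw [← eKer_neg, neg_sub]
    ring
  have hS : MeasurableSet {p : ℝ × ℝ | p.2 < p.1} := measurableSet_lt measurable_snd measurable_fst
  set X : ℂ := ∫ t, ∫ τ in Set.Iio t, Φ (t, τ) with hX
  have h1 : ∫ p in {p : ℝ × ℝ | p.2 < p.1}, Φ p ∂((volume : Measure ℝ).prod volume) = X := by
    rw [← integral_indicator hS, integral_prod _ (hi.indicator hS)]
    refine integral_congr_ae (ae_of_all _ fun t => ?_)
    simp only
    rw [← integral_indicator measurableSet_Iio]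
    rfl
  have h2 : ∫ p in {p : ℝ × ℝ | p.2 < p.1}ᶜ, Φ p ∂((volume : Measure ℝ).prod volume) =
      (starRingEnd ℂ) X := by
    rw [← integral_indicator hS.compl, integral_prod_symm _ (hi.indicator hS.compl), hX,
      ← integral_conj]
    refine integral_congr_ae (ae_of_all _ fun t => ?_)
    simp only
    rw [← integral_conj, ← integral_Iic_eq_integral_Iio, ← integral_indicator measurableSet_Iic]
    refine integral_congr_ae (ae_of_all _ fun τ => ?_)
    simp only [Set.indicator, Set.mem_compl_iff, Set.mem_ofPred_eq, not_lt, Set.mem_Iic]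
    rw [hsym]
  have h3 : traceForm lam f f = X + (starRingEnd ℂ) X := by
    rw [← h2]
    nth_rewrite 1 [← h1]
    exact (integral_add_compl hS hi).symm
  have h4 : X = ∫ t, (starRingEnd ℂ) (f t) * ∫ τ in Set.Iio t, eKer lam (t - τ) * f τ := by
    rw [hX]
    refine integral_congr_ae (ae_of_all _ fun t => ?_)
    simp only [hΦ]
    rw [← integral_const_mul]
    refine integral_congr_ae (ae_of_all _ fun τ => ?_)
    simp only
    ring
  rw [h3, ← h4, Complex.add_re, Complex.conj_re]
  ring

/-! ### Absolute convergence of the form -/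

theorem hker_le {lam : ℝ} (hlam : 0 < lam) {t : ℝ} (ht : t ≠ 0) :
    hker lam t ≤ ENNReal.ofReal (greenConst lam * |t| ^ (-(1 / 4) : ℝ)) := by
  have hi := integrableOn_greenConst hlam
  calc hker lam t ≤ ∫⁻ s in Set.Ioi (0 : ℝ), ENNReal.ofReal
        (|t| ^ (-(1 / 4) : ℝ) * (s ^ ((1 / 4 : ℝ) - 1) * Real.exp (-(lam * s)))) := by
        refine setLIntegral_mono' measurableSet_Ioi fun s hs => ?_
        rw [← ofReal_norm]
        exact ENNReal.ofReal_le_ofReal (norm_greenTrace_integrand_le hs ht)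
    _ = _ := by
        rw [← ofReal_integral_eq_lintegral_ofReal (hi.const_mul _), integral_const_mul, mul_comm]
        · rfl
        · refine (ae_restrict_iff' measurableSet_Ioi).2 (ae_of_all _ fun s hs => ?_)
          have hs0 : 0 < s := hs
          positivity

theorem lintegral_hker_lt_top {lam : ℝ} (hlam : 0 < lam) (R : ℝ) :
    ∫⁻ t in Set.Ioo (-R) R, hker lam t < ∞ := by
  have h1 : IntegrableOn (fun t : ℝ => greenConst lam * t ^ (-(1 / 4) : ℝ)) (Set.Ioo 0 |R|) :=
    (((intervalIntegrable_iff_integrableOn_Ioo_of_le (abs_nonneg R)).1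
      (intervalIntegral.intervalIntegrable_rpow' (show (-1 : ℝ) < -(1 / 4) by norm_num)))).const_mul _
  have h2 : ∫⁻ t, (Set.Ioo 0 |R|).indicator (hker lam) t < ∞ := by
    rw [lintegral_indicator measurableSet_Ioo]
    refine lt_of_le_of_lt (setLIntegral_mono' measurableSet_Ioo fun t ht => ?_) h1.lintegral_lt_top
    have := hker_le hlam ht.1.ne'
    rwa [abs_of_pos ht.1] at this
  have h3 : ∫⁻ t, (Set.Ioo 0 |R|).indicator (hker lam) (-t) < ∞ := by
    rwa [lintegral_neg_eq_self]
  have hm : Measurable ((Set.Ioo 0 |R|).indicator (hker lam)) :=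
    (measurable_hker lam).indicator measurableSet_Ioo
  refine lt_of_le_of_lt ?_ (ENNReal.add_lt_top.2 ⟨h2, h3⟩)
  rw [← lintegral_add_left hm, ← lintegral_indicator measurableSet_Ioo]
  refine lintegral_mono_ae ?_
  have : ∀ᵐ r : ℝ, r ≠ 0 := by simp [ae_iff]
  filter_upwards [this] with t ht
  by_cases h : t ∈ Set.Ioo (-R) R
  · rw [Set.indicator_of_mem h]
    have hR : R ≤ |R| := le_abs_self R
    rcases lt_or_gt_of_ne ht with h0 | h0
    · have : -t ∈ Set.Ioo 0 |R| := ⟨by linarith, by linarith [h.1]⟩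
      rw [Set.indicator_of_mem this, hker_neg]
      exact le_add_self
    · have : t ∈ Set.Ioo 0 |R| := ⟨h0, by linarith [h.2]⟩
      rw [Set.indicator_of_mem this]
      exact le_self_add
  · rw [Set.indicator_of_notMem h]
    exact zero_le

/-- On a common bounded support only a bounded window of `hker` is seen, and it is integrable. The
asymmetric hypotheses fit the later use: a restart kernel that is merely integrable against bounded
difference quotients. -/
theorem absForm_lt_top {lam : ℝ} (hlam : 0 < lam) {f g : ℝ → ℂ} {b c A : ℝ} (hf : Integrable f)
    (hfs : ∀ t ∉ Set.Ioo b c, f t = 0) (hgs : ∀ t ∉ Set.Ioo b c, g t = 0)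
    (hg : AEStronglyMeasurable g) (hA : ∀ t, ‖g t‖ ≤ A) : absForm lam f g < ∞ := by
  set I := ∫⁻ t in Set.Ioo (-(c - b)) (c - b), hker lam t with hI
  have hIt : I < ∞ := lintegral_hker_lt_top hlam _
  have hm : AEMeasurable (fun p : ℝ × ℝ => ‖f p.1‖ₑ * hker lam (p.1 - p.2) * ‖g p.2‖ₑ)
      ((volume : Measure ℝ).prod volume) :=
    (hf.1.comp_fst.enorm.mul ((measurable_hker lam).comp (by fun_prop)).aemeasurable).mul
      hg.comp_snd.enorm
  have hin : ∀ t, ∫⁻ τ, ‖f t‖ₑ * hker lam (t - τ) * ‖g τ‖ₑ ≤ ‖f t‖ₑ * (I * ENNReal.ofReal A) := by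
    intro t
    by_cases ht : t ∈ Set.Ioo b c
    · calc _ ≤ ∫⁻ τ, ‖f t‖ₑ * ((Set.Ioo (-(c - b)) (c - b)).indicator (hker lam) (t - τ) *
            ENNReal.ofReal A) := by
            refine lintegral_mono fun τ => ?_
            rw [mul_assoc]
            refine mul_le_mul' le_rfl ?_
            by_cases hτ : τ ∈ Set.Ioo b c
            · rw [Set.indicator_of_mem (by
                constructor <;> linarith [ht.1, ht.2, hτ.1, hτ.2])]
              refine mul_le_mul' le_rfl ?_
              rw [← ofReal_norm]
              exact ENNReal.ofReal_le_ofReal (hA τ)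
            · rw [hgs τ hτ]; simp
        _ = _ := by
            have hm2 : Measurable ((Set.Ioo (-(c - b)) (c - b)).indicator (hker lam)) :=
              (measurable_hker lam).indicator measurableSet_Ioo
            rw [lintegral_const_mul' _ _ (by simp), lintegral_mul_const' _ _ ENNReal.ofReal_ne_top,
              lintegral_sub_left_eq_self (fun x =>
                (Set.Ioo (-(c - b)) (c - b)).indicator (hker lam) x) t,
              lintegral_indicator measurableSet_Ioo]
    · rw [hfs t ht]; simp
  rw [absForm, Measure.volume_eq_prod, lintegral_prod _ hm]
  refine lt_of_le_of_lt (lintegral_mono hin) ?_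
  rw [lintegral_mul_const'' _ hf.1.enorm]
  exact ENNReal.mul_lt_top hf.2 (ENNReal.mul_lt_top hIt ENNReal.ofReal_lt_top)

theorem absForm_comp_sub_left (lam c : ℝ) {f g : ℝ → ℂ} (hf : Measurable f) (hg : Measurable g)
    (h : ∀ t, ‖g t‖ = ‖f (c - t)‖) : absForm lam g g = absForm lam f f := by
  have hm : ∀ {v : ℝ → ℂ}, Measurable v → Measurable fun p : ℝ × ℝ =>
      ‖v p.1‖ₑ * hker lam (p.1 - p.2) * ‖v p.2‖ₑ := fun {v} hv =>
    ((hv.comp measurable_fst).enorm.mul ((measurable_hker lam).comp (by fun_prop))).mul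
      (hv.comp measurable_snd).enorm
  rw [absForm, absForm, Measure.volume_eq_prod, lintegral_prod _ (hm hf).aemeasurable,
    lintegral_prod _ (hm hg).aemeasurable]
  have he : ∀ t, ‖g t‖ₑ = ‖f (c - t)‖ₑ := fun t => by rw [← ofReal_norm, h, ofReal_norm]
  rw [← lintegral_sub_left_eq_self (fun t => ∫⁻ τ, ‖f t‖ₑ * hker lam (t - τ) * ‖f τ‖ₑ) c]
  refine lintegral_congr fun t => ?_
  rw [← lintegral_sub_left_eq_self (fun τ => ‖f (c - t)‖ₑ * hker lam (c - t - τ) * ‖f τ‖ₑ) c]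
  refine lintegral_congr fun τ => ?_
  rw [he, he, ← hker_neg lam (t - τ)]
  congr 3
  ring

theorem absForm_self_le {lam : ℝ} {f : ℝ → ℂ} (hf : Measurable f) : absForm lam f f ≤
    2 * ∫⁻ t, ‖f t‖ₑ * ∫⁻ τ in Set.Iio t, hker lam (t - τ) * ‖f τ‖ₑ := by
  set Φ : ℝ × ℝ → ℝ≥0∞ := fun p => ‖f p.1‖ₑ * hker lam (p.1 - p.2) * ‖f p.2‖ₑ with hΦ
  have hm : Measurable Φ := ((hf.comp measurable_fst).enorm.mul
    ((measurable_hker lam).comp (by fun_prop))).mul (hf.comp measurable_snd).enorm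
  have hS : MeasurableSet {p : ℝ × ℝ | p.2 < p.1} := measurableSet_lt measurable_snd measurable_fst
  have hsym : ∀ t τ, Φ (τ, t) = Φ (t, τ) := fun t τ => by
    simp only [hΦ]
    rw [← hker_neg, neg_sub]
    ring
  set X := ∫⁻ t, ‖f t‖ₑ * ∫⁻ τ in Set.Iio t, hker lam (t - τ) * ‖f τ‖ₑ with hX
  have hXe : X = ∫⁻ t, ∫⁻ τ in Set.Iio t, Φ (t, τ) := by
    refine lintegral_congr fun t => ?_
    rw [← lintegral_const_mul' _ _ (by simp)]
    refine lintegral_congr fun τ => ?_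
    simp only [hΦ]
    ring
  have h1 : ∫⁻ p in {p : ℝ × ℝ | p.2 < p.1}, Φ p ∂((volume : Measure ℝ).prod volume) = X := by
    rw [← lintegral_indicator hS, lintegral_prod _ (hm.indicator hS).aemeasurable, hXe]
    refine lintegral_congr fun t => ?_
    rw [← lintegral_indicator measurableSet_Iio]
    rfl
  have h2 : ∫⁻ p in {p : ℝ × ℝ | p.2 < p.1}ᶜ, Φ p ∂((volume : Measure ℝ).prod volume) = X := by
    rw [← lintegral_indicator hS.compl, lintegral_prod_symm _ (hm.indicator hS.compl).aemeasurable,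
      hXe]
    refine lintegral_congr fun t => ?_
    rw [← restrict_Iio_eq_restrict_Iic.symm, ← lintegral_indicator measurableSet_Iic]
    refine lintegral_congr fun τ => ?_
    simp only [Set.indicator, Set.mem_compl_iff, Set.mem_ofPred_eq, not_lt, Set.mem_Iic]
    rw [hsym]
  rw [absForm, Measure.volume_eq_prod, ← lintegral_add_compl Φ hS, h1, h2, two_mul]

/-- The power bound on `hker` is too weak against the restart kernel, which is barely integrable at
`0`. The logarithm is recovered from `|s + it| ≥ (s + t)/2`: the range `s ≤ 1` gives `log((1 +
t)/t)` and the tail gives `1/λ`. -/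
theorem hker_le_log {lam : ℝ} (hlam : 0 < lam) {t : ℝ} (ht : 0 < t) (ht1 : t < 1) :
    hker lam t ≤ ENNReal.ofReal (2 * (Real.log 2 + 1 / lam - Real.log t)) := by
  have hn : ∀ s : ℝ, 0 < s → ‖(Real.exp (-(lam * s)) : ℂ) / ((s : ℂ) + Complex.I * t)‖ ≤
      2 * (Real.exp (-(lam * s)) * (s + t)⁻¹) := by
    intro s hs
    have h1 : (s + t) / 2 ≤ ‖(s : ℂ) + Complex.I * t‖ := by
      have h2 := Complex.abs_re_le_norm ((s : ℂ) + Complex.I * t)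
      have h3 := Complex.abs_im_le_norm ((s : ℂ) + Complex.I * t)
      simp at h2 h3
      rw [abs_of_pos hs] at h2
      rw [abs_of_pos ht] at h3
      linarith
    rw [norm_div, Complex.norm_real, Real.norm_of_nonneg (Real.exp_pos _).le]
    calc _ ≤ Real.exp (-(lam * s)) / ((s + t) / 2) := by gcongr
      _ = _ := by field_simp
  have hA : ∫⁻ s in Set.Ioc (0 : ℝ) 1,
      ‖(Real.exp (-(lam * s)) : ℂ) / ((s : ℂ) + Complex.I * t)‖ₑ ≤
      ENNReal.ofReal (2 * (Real.log 2 - Real.log t)) := by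
    have hi : IntervalIntegrable (fun s : ℝ => (s + t)⁻¹) volume 0 1 := by
      refine ContinuousOn.intervalIntegrable (ContinuousOn.inv₀ (by fun_prop) fun s hs => ?_)
      rw [Set.uIcc_of_le zero_le_one] at hs
      have := hs.1
      positivity
    have hv : ∫ s in (0 : ℝ)..1, (s + t)⁻¹ = Real.log (1 + t) - Real.log t := by
      rw [intervalIntegral.integral_comp_add_right (fun x => x⁻¹), zero_add,
        integral_inv_of_pos ht (by positivity), Real.log_div (by positivity) ht.ne']
    calc _ ≤ ∫⁻ s in Set.Ioc (0 : ℝ) 1, ENNReal.ofReal (2 * (s + t)⁻¹) := by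
          refine setLIntegral_mono' measurableSet_Ioc fun s hs => ?_
          rw [← ofReal_norm]
          refine ENNReal.ofReal_le_ofReal ((hn s hs.1).trans ?_)
          have hs0 := hs.1
          have : Real.exp (-(lam * s)) ≤ 1 := Real.exp_le_one_iff.2 (by
            have := mul_pos hlam hs0; linarith)
          have h5 : 0 ≤ (s + t)⁻¹ := by positivity
          nlinarith
      _ = ENNReal.ofReal (2 * (Real.log (1 + t) - Real.log t)) := by
          rw [← ofReal_integral_eq_lintegral_ofReal (hi.1.const_mul 2), integral_const_mul,
            ← intervalIntegral.integral_of_le zero_le_one, hv]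
          refine (ae_restrict_iff' measurableSet_Ioc).2 (ae_of_all _ fun s hs => ?_)
          have := hs.1
          positivity
      _ ≤ _ := by
          refine ENNReal.ofReal_le_ofReal ?_
          have := Real.log_le_log (by positivity : 0 < 1 + t) (by linarith : 1 + t ≤ 2)
          linarith
  have hB : ∫⁻ s in Set.Ioi (1 : ℝ),
      ‖(Real.exp (-(lam * s)) : ℂ) / ((s : ℂ) + Complex.I * t)‖ₑ ≤
      ENNReal.ofReal (2 * (1 / lam)) := by
    calc _ ≤ ∫⁻ s in Set.Ioi (1 : ℝ), ENNReal.ofReal 2 *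
          ENNReal.ofReal (Real.exp (-(lam * s))) := by
          refine setLIntegral_mono' measurableSet_Ioi fun s hs => ?_
          have hs1 : 1 < s := hs
          rw [← ofReal_norm, ← ENNReal.ofReal_mul (by norm_num)]
          refine ENNReal.ofReal_le_ofReal ((hn s (by linarith)).trans ?_)
          have : (s + t)⁻¹ ≤ 1 := inv_le_one_of_one_le₀ (by linarith)
          have := Real.exp_pos (-(lam * s))
          nlinarith
      _ ≤ ENNReal.ofReal 2 * ∫⁻ s in Set.Ioi (0 : ℝ), ENNReal.ofReal (Real.exp (-(lam * s))) := by
          rw [lintegral_const_mul' _ _ ENNReal.ofReal_ne_top]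
          refine mul_le_mul' le_rfl (lintegral_mono_set (Set.Ioi_subset_Ioi zero_le_one))
      _ = _ := by
          rw [lintegral_exp_neg_mul_Ioi hlam, ← ENNReal.ofReal_mul (by norm_num)]
  have hlog2 : 0 < Real.log 2 := Real.log_pos (by norm_num)
  have hlogt : Real.log t < 0 := Real.log_neg ht ht1
  calc hker lam t ≤ ∫⁻ s in Set.Ioc (0 : ℝ) 1 ∪ Set.Ioi 1,
        ‖(Real.exp (-(lam * s)) : ℂ) / ((s : ℂ) + Complex.I * t)‖ₑ := by
        refine lintegral_mono_set fun s hs => ?_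
        rcases le_or_gt s 1 with h | h
        · exact Or.inl ⟨hs, h⟩
        · exact Or.inr h
    _ ≤ _ := lintegral_union_le _ _ _
    _ ≤ _ := add_le_add hA hB
    _ = _ := by
        rw [← ENNReal.ofReal_add (by linarith) (by positivity)]
        congr 1
        ring

/-- The kernel inverting the convolution with `eKer`. -/
def restartKernel (lam : ℝ) (c : ℂ) (t : ℝ) : ℂ :=
  Complex.exp (-(Complex.I * lam * t)) * volterraCexp c t

theorem norm_cexp_neg_I_mul (lam t : ℝ) : ‖Complex.exp (-(Complex.I * lam * t))‖ = 1 := by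
  rw [show -(Complex.I * lam * t) = Complex.I * lam * ((-t : ℝ) : ℂ) by push_cast; ring,
    norm_cexp_I_mul]

theorem norm_restartKernel_le (lam : ℝ) (c : ℂ) {t : ℝ} (ht : 0 < t) :
    ‖restartKernel lam c t‖ ≤ volterraExp c.re t := by
  rw [restartKernel, norm_mul, norm_cexp_neg_I_mul, one_mul]
  exact norm_volterraCexp_le c ht

theorem stronglyMeasurable_restartKernel (lam : ℝ) (c : ℂ) :
    StronglyMeasurable (restartKernel lam c) :=
  (by fun_prop : Continuous fun t : ℝ =>
    Complex.exp (-(Complex.I * lam * t))).stronglyMeasurable.mul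
    (stronglyMeasurable_volterraCexp c)

theorem isLocKernel_restartKernel (lam : ℝ) (c : ℂ) : IsLocKernel (restartKernel lam c) :=
  (isLocKernel_volterraCexp c).mono (stronglyMeasurable_restartKernel lam c).aestronglyMeasurable
    fun t _ => by rw [restartKernel, norm_mul, norm_cexp_neg_I_mul, one_mul]

theorem isLocKernel_eKer {lam : ℝ} (hlam : 0 < lam) : IsLocKernel (eKer lam) :=
  (isLocKernel_greenTrace hlam).mono (stronglyMeasurable_eKer lam).aestronglyMeasurable
    fun t _ => (norm_eKer lam t).le

theorem cconv_cexp_mul (lam : ℝ) (f g : ℝ → ℂ) (t : ℝ) :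
    cconv (fun x => Complex.exp (-(Complex.I * lam * x)) * f x)
      (fun x => Complex.exp (-(Complex.I * lam * x)) * g x) t =
      Complex.exp (-(Complex.I * lam * t)) * cconv f g t := by
  rw [cconv, cconv, ← intervalIntegral.integral_const_mul]
  refine intervalIntegral.integral_congr fun τ _ => ?_
  have : Complex.exp (-(Complex.I * lam * t)) = Complex.exp (-(Complex.I * lam * (t - τ : ℝ))) *
      Complex.exp (-(Complex.I * lam * τ)) := by
    rw [← Complex.exp_add]; congr 1; push_cast; ring
  rw [this]; ring

/-- Convolving the decomposition of the Green trace with `volterraCexp (-r₀)`, the Sonine identity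
gives `Y = 1 + iλ ∫ Y`, whence `Y(t) = e^{iλt}`; the rotation factors cancel it. -/
theorem cconv_restartKernel_eKer {lam : ℝ} (hlam : 0 < lam) {r₀ : ℂ}
    (hr : ∀ t > 0, greenTrace lam 0 t = logKernel (-r₀) t + Complex.I * lam *
      ∫ x in (0 : ℝ)..t, greenTrace lam 0 x) {t : ℝ} (ht : 0 < t) :
    cconv (restartKernel lam (-r₀)) (eKer lam) t = 1 := by
  set V := volterraCexp (-r₀) with hV
  set h := greenTrace lam 0 with hh
  have hVk := isLocKernel_volterraCexp (-r₀)
  have hhk := isLocKernel_greenTrace hlam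
  have hJk := isLocKernel_logKernel (-r₀)
  set Y := cconv V h with hY
  have hYi : ∀ T, IntegrableOn Y (Set.Ioo 0 T) := fun T => integrableOn_cconv (hVk.int T) (hhk.int T)
  have h1k : IsLocKernel fun _ : ℝ => (1 : ℂ) := IsLocKernel.of_continuous continuous_const
  have hprim : ∀ f : ℝ → ℂ, ∀ x, cconv f (fun _ => 1) x = ∫ y in (0 : ℝ)..x, f y := fun f x => by
    rw [cconv_comm, cconv]; simp
  have hPk : IsLocKernel fun x => ∫ y in (0 : ℝ)..x, h y := by
    refine (IsLocKernel.of_continuous (continuous_greenPrim hlam)).mono ?_ fun x hx => ?_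
    · refine (continuous_greenPrim hlam).aestronglyMeasurable.congr ?_
      refine (ae_restrict_iff' measurableSet_Ioi).2 (ae_of_all _ fun x hx => ?_)
      exact greenPrim_eq lam (le_of_lt hx)
    · rw [greenPrim_eq lam hx.le]
  have hYeq : ∀ x > 0, Y x = 1 + Complex.I * lam * ∫ y in (0 : ℝ)..x, Y y := by
    intro x hx
    have e1 : Y x = cconv V (fun z => logKernel (-r₀) z + Complex.I * lam *
        ∫ y in (0 : ℝ)..z, h y) x := cconv_congr_right hx.le fun z hz => hr z hz.1
    have e2 : cconv V (fun z => logKernel (-r₀) z + Complex.I * lam * ∫ y in (0 : ℝ)..z, h y) x =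
        cconv V (logKernel (-r₀)) x + Complex.I * lam * cconv V (fun z => ∫ y in (0 : ℝ)..z, h y) x := by
      rw [cconv, cconv, cconv, ← intervalIntegral.integral_const_mul,
        ← intervalIntegral.integral_add (hVk.intervalIntegrable_mul hJk hx)
          ((hVk.intervalIntegrable_mul hPk hx).const_mul _)]
      refine intervalIntegral.integral_congr fun z _ => ?_
      ring
    have e3 : cconv V (fun z => ∫ y in (0 : ℝ)..z, h y) x = ∫ y in (0 : ℝ)..x, Y y := by
      rw [← hprim Y, hY, cconv_assoc (C := 1) hx (hVk.int x) (hhk.int x)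
        aestronglyMeasurable_const (fun _ _ => by simp)]
      congr 1
      funext z
      rw [hprim]
    rw [e1, e2, e3, cconv_volterraCexp_logKernel (-r₀) hx]
  have hYc : ContinuousOn (fun x => 1 + Complex.I * lam * ∫ y in (0 : ℝ)..x, Y y) (Set.Icc 0 t) := by
    have hii : IntegrableOn Y (Set.uIcc 0 t) := by
      rw [Set.uIcc_of_le ht.le, integrableOn_Icc_iff_integrableOn_Ioo]
      exact hYi t
    have := intervalIntegral.continuousOn_primitive_interval hii
    rw [Set.uIcc_of_le ht.le] at this
    exact continuousOn_const.add (continuousOn_const.mul this)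
  have hder : ∀ x ∈ Set.Ioo 0 t, HasDerivAt (fun x : ℝ => Complex.exp (-(Complex.I * lam * x)) *
      (1 + Complex.I * lam * ∫ y in (0 : ℝ)..x, Y y)) 0 x := by
    intro x hx
    have hYcx : ContinuousAt Y x := by
      have h1 : ContinuousAt (fun x => 1 + Complex.I * lam * ∫ y in (0 : ℝ)..x, Y y) x :=
        hYc.continuousAt (Icc_mem_nhds hx.1 hx.2)
      refine h1.congr ?_
      filter_upwards [Ioi_mem_nhds hx.1] with z hz
      exact (hYeq z hz).symm
    have hiY : IntervalIntegrable Y volume 0 x := by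
      rw [intervalIntegrable_iff_integrableOn_Ioo_of_le hx.1.le]; exact hYi x
    have hmY : StronglyMeasurableAtFilter Y (𝓝 x) := by
      refine ⟨Set.Ioo 0 t, Ioo_mem_nhds hx.1 hx.2, (hYi t).aestronglyMeasurable⟩
    have d1 := intervalIntegral.integral_hasDerivAt_right hiY hmY hYcx
    have d2 : HasDerivAt (fun x : ℝ => Complex.exp (-(Complex.I * lam * x)))
        (Complex.exp (-(Complex.I * lam * x)) * (-(Complex.I * lam))) x := by
      have : HasDerivAt (fun x : ℝ => -(Complex.I * lam * (x : ℂ))) (-(Complex.I * lam * 1)) x :=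
        (Complex.ofRealCLM.hasDerivAt.const_mul (Complex.I * lam)).neg
      simpa using this.cexp
    refine (d2.mul ((d1.const_mul (Complex.I * lam)).const_add 1)).congr_deriv ?_
    rw [hYeq x hx.1]
    ring
  have hconst : Complex.exp (-(Complex.I * lam * t)) *
      (1 + Complex.I * lam * ∫ y in (0 : ℝ)..t, Y y) = 1 := by
    have hc : ContinuousOn (fun x : ℝ => Complex.exp (-(Complex.I * lam * x)) *
        (1 + Complex.I * lam * ∫ y in (0 : ℝ)..x, Y y)) (Set.Icc 0 t) :=
      (by fun_prop : Continuous fun x : ℝ =>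
        Complex.exp (-(Complex.I * lam * x))).continuousOn.mul hYc
    have := intervalIntegral.integral_eq_sub_of_hasDerivAt_of_le ht.le hc hder (by simp)
    simp at this
    rw [eq_comm, sub_eq_zero] at this
    simpa using this
  have e := cconv_cexp_mul lam V h t
  rw [show cconv (restartKernel lam (-r₀)) (eKer lam) t =
    cconv (fun x => Complex.exp (-(Complex.I * lam * x)) * V x)
      (fun x => Complex.exp (-(Complex.I * lam * x)) * h x) t from rfl, e,
    show cconv V h t = Y t from rfl, hYeq t ht, hconst]

/-! ### Smallness of the energy of the restart kernel -/

theorem integral_volterraExp_nonneg (x : ℝ) {t : ℝ} (ht : 0 ≤ t) :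
    0 ≤ ∫ τ in (0 : ℝ)..t, volterraExp x τ :=
  intervalIntegral.integral_nonneg_of_ae_restrict ht
    ((ae_restrict_iff' measurableSet_Icc).2 (by
      have : ∀ᵐ r : ℝ, r ≠ 0 := by simp [ae_iff]
      filter_upwards [this] with τ hτ h
      exact (volterraExp_pos x (lt_of_le_of_ne h.1 hτ.symm)).le))

theorem integral_volterraExp_mono (x : ℝ) {s t : ℝ} (hs : 0 ≤ s) (hst : s ≤ t) :
    ∫ τ in (0 : ℝ)..s, volterraExp x τ ≤ ∫ τ in (0 : ℝ)..t, volterraExp x τ := by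
  rw [intervalIntegral.integral_of_le hs, intervalIntegral.integral_of_le (hs.trans hst),
    integral_Ioc_eq_integral_Ioo, integral_Ioc_eq_integral_Ioo]
  refine setIntegral_mono_set (integrableOn_volterraExp x t) ?_
    (Set.Ioo_subset_Ioo_right hst).eventuallyLE
  exact (ae_restrict_iff' measurableSet_Ioo).2
    (ae_of_all _ fun τ hτ => (volterraExp_pos x hτ.1).le)

/-- Convolution of the log kernel majorising `hker` with the Volterra function stays bounded. -/
theorem lintegral_hker_mul_volterraExp_le {lam : ℝ} (hlam : 0 < lam) (x : ℝ) :
    ∃ C : ℝ, 0 ≤ C ∧ ∀ t, 0 < t → t < 1 →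
      ∫⁻ τ in Set.Ioo 0 t, hker lam (t - τ) * ENNReal.ofReal (volterraExp x τ) ≤
        ENNReal.ofReal C := by
  -- For this `x'` the logarithmic majorant of `hker` is exactly `2 logKernel x'`. Replacing `x'` by
  -- `x` costs a constant, after which the Sonine identity evaluates the convolution to `2` plus a
  -- multiple of the mass of the Volterra function.
  set x' : ℝ := -Real.eulerMascheroniConstant - Real.log 2 - 1 / lam with hx'
  refine ⟨2 * (1 + |x - x'| * ∫ τ in (0 : ℝ)..1, volterraExp x τ), ?_, fun t ht ht1 => ?_⟩
  · have := integral_volterraExp_nonneg x zero_le_one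
    positivity
  set F : ℝ → ℝ := fun τ => 2 * (Real.log 2 + 1 / lam - Real.log (t - τ)) * volterraExp x τ with hF
  have hlog2 : 0 < Real.log 2 := Real.log_pos (by norm_num)
  have hl : (0 : ℝ) < 1 / lam := by positivity
  have hlog : ∀ τ ∈ Set.Ioo 0 t, 0 ≤ 2 * (Real.log 2 + 1 / lam - Real.log (t - τ)) := by
    intro τ hτ
    have : Real.log (t - τ) ≤ 0 := Real.log_nonpos (by linarith [hτ.2]) (by linarith [hτ.1])
    linarith
  have hVk := isLocKernel_volterraCexp (x : ℂ)
  have hFc : ∀ τ, (F τ : ℂ) = 2 * (logKernel (x : ℂ) (t - τ) * volterraCexp (x : ℂ) τ) +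
      2 * (x - x') * volterraCexp (x : ℂ) τ := by
    intro τ
    simp only [hF, logKernel, volterraCexp_ofReal, hx']
    push_cast
    ring
  have hi1 := (isLocKernel_logKernel (x : ℂ)).intervalIntegrable_mul hVk ht
  have hi2 := hVk.intervalIntegrable le_rfl ht.le
  have hFi : IntervalIntegrable (fun τ => (F τ : ℂ)) volume 0 t := by
    simp only [hFc]
    exact (hi1.const_mul _).add (hi2.const_mul _)
  have hFr : IntegrableOn F (Set.Ioo 0 t) := by
    have := ((intervalIntegrable_iff_integrableOn_Ioo_of_le ht.le).1 hFi).re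
    exact this
  have hval : ((∫ τ in (0 : ℝ)..t, F τ : ℝ) : ℂ) =
      ((2 + 2 * (x - x') * ∫ τ in (0 : ℝ)..t, volterraExp x τ : ℝ) : ℂ) := by
    rw [← intervalIntegral.integral_ofReal]
    simp only [hFc]
    rw [intervalIntegral.integral_add (hi1.const_mul _) (hi2.const_mul _),
      intervalIntegral.integral_const_mul, intervalIntegral.integral_const_mul]
    have e1 := cconv_volterraCexp_logKernel (x : ℂ) ht
    rw [cconv_comm, cconv] at e1
    rw [e1]
    simp only [volterraCexp_ofReal]
    rw [intervalIntegral.integral_ofReal]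
    push_cast
    ring
  have hval' := Complex.ofReal_injective hval
  calc ∫⁻ τ in Set.Ioo 0 t, hker lam (t - τ) * ENNReal.ofReal (volterraExp x τ)
      ≤ ∫⁻ τ in Set.Ioo 0 t, ENNReal.ofReal (F τ) := by
        refine setLIntegral_mono' measurableSet_Ioo fun τ hτ => ?_
        rw [hF, ENNReal.ofReal_mul (hlog τ hτ)]
        exact mul_le_mul' (hker_le_log hlam (by linarith [hτ.2]) (by linarith [hτ.1])) le_rfl
    _ = ENNReal.ofReal (∫ τ in (0 : ℝ)..t, F τ) := by
        rw [← ofReal_integral_eq_lintegral_ofReal hFr, intervalIntegral.integral_of_le ht.le,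
          integral_Ioc_eq_integral_Ioo]
        exact (ae_restrict_iff' measurableSet_Ioo).2 (ae_of_all _ fun τ hτ =>
          mul_nonneg (hlog τ hτ) (volterraExp_pos x hτ.1).le)
    _ ≤ _ := by
        refine ENNReal.ofReal_le_ofReal ?_
        rw [hval']
        have h1 := integral_volterraExp_nonneg x ht.le
        have h2 := integral_volterraExp_mono x ht.le ht1.le
        have h3 := le_abs_self (x - x')
        have h4 := abs_nonneg (x - x')
        nlinarith [mul_le_mul h3 h2 h1 h4]

/-- The reflected restart kernel on `(a, a + s)`. -/
def restartBlock (lam : ℝ) (c : ℂ) (a s : ℝ) : ℝ → ℂ :=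
  (Set.Ioo a (a + s)).indicator fun t => (starRingEnd ℂ) (restartKernel lam c (a + s - t))

theorem measurable_restartBlock (lam : ℝ) (c : ℂ) (a s : ℝ) :
    Measurable (restartBlock lam c a s) :=
  (Complex.continuous_conj.measurable.comp
    ((stronglyMeasurable_restartKernel lam c).measurable.comp (by fun_prop))).indicator
    measurableSet_Ioo

theorem norm_restartBlock (lam : ℝ) (c : ℂ) (a s t : ℝ) : ‖restartBlock lam c a s t‖ =
    ‖(Set.Ioo 0 s).indicator (restartKernel lam c) (a + s - t)‖ := by
  by_cases h : t ∈ Set.Ioo a (a + s)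
  · have h' : a + s - t ∈ Set.Ioo 0 s := ⟨by linarith [h.2], by linarith [h.1]⟩
    rw [restartBlock, Set.indicator_of_mem h, Set.indicator_of_mem h', RCLike.norm_conj]
  · have h' : a + s - t ∉ Set.Ioo 0 s := fun h' => h ⟨by linarith [h'.2], by linarith [h'.1]⟩
    rw [restartBlock, Set.indicator_of_notMem h, Set.indicator_of_notMem h', norm_zero]

theorem integrable_indicator_restartKernel (lam : ℝ) (c : ℂ) (s : ℝ) :
    Integrable ((Set.Ioo 0 s).indicator (restartKernel lam c)) :=
  (integrable_indicator_iff measurableSet_Ioo).2 ((isLocKernel_restartKernel lam c).int s)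

theorem integrable_restartBlock (lam : ℝ) (c : ℂ) (a s : ℝ) :
    Integrable (restartBlock lam c a s) := by
  have h := (integrable_indicator_restartKernel lam c s).comp_sub_left (a + s)
  refine h.mono (measurable_restartBlock lam c a s).aestronglyMeasurable (ae_of_all _ fun t => ?_)
  rw [norm_restartBlock]

theorem integral_norm_restartKernel_le (lam : ℝ) (c : ℂ) {s : ℝ} (hs : 0 ≤ s) :
    ∫ t in (0 : ℝ)..s, ‖restartKernel lam c t‖ ≤ ∫ t in (0 : ℝ)..s, volterraExp c.re t := by
  rw [intervalIntegral.integral_of_le hs, intervalIntegral.integral_of_le hs,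
    integral_Ioc_eq_integral_Ioo, integral_Ioc_eq_integral_Ioo]
  exact setIntegral_mono_on ((isLocKernel_restartKernel lam c).int s).norm
    (integrableOn_volterraExp c.re s) measurableSet_Ioo
    fun t ht => norm_restartKernel_le lam c ht.1

/-- The restart block has small energy. -/
theorem energy_restartBlock_le {lam : ℝ} (hlam : 0 < lam) (c : ℂ) : ∃ C : ℝ, 0 ≤ C ∧
    ∀ a s : ℝ, 0 < s → s < 1 →
      energy lam (restartBlock lam c a s) < ∞ ∧ (energy lam (restartBlock lam c a s)).toReal ≤
        C * ∫ t in (0 : ℝ)..s, volterraExp c.re t := by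
  obtain ⟨C, hC0, hC⟩ := lintegral_hker_mul_volterraExp_le hlam c.re
  refine ⟨2 * C, by positivity, fun a s hs hs1 => ?_⟩
  set V := volterraExp c.re with hV
  set f := (Set.Ioo 0 s).indicator (restartKernel lam c) with hf
  have hfm : Measurable f :=
    (stronglyMeasurable_restartKernel lam c).measurable.indicator measurableSet_Ioo
  have hV0 : 0 ≤ ∫ t in (0 : ℝ)..s, V t := integral_volterraExp_nonneg c.re hs.le
  have hfle : ∀ t ∈ Set.Ioo 0 s, ‖f t‖ₑ ≤ ENNReal.ofReal (V t) := by
    intro t ht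
    rw [hf, Set.indicator_of_mem ht, ← ofReal_norm]
    exact ENNReal.ofReal_le_ofReal (norm_restartKernel_le lam c ht.1)
  have hf0 : ∀ t ∉ Set.Ioo 0 s, f t = 0 := fun t ht => Set.indicator_of_notMem ht _
  have hin : ∀ t ∈ Set.Ioo 0 s, ∫⁻ τ in Set.Iio t, hker lam (t - τ) * ‖f τ‖ₑ ≤
      ENNReal.ofReal C := by
    intro t ht
    refine le_trans ?_ (hC t ht.1 (ht.2.trans hs1))
    rw [← lintegral_indicator measurableSet_Iio, ← lintegral_indicator measurableSet_Ioo]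
    refine lintegral_mono fun τ => ?_
    by_cases h1 : τ ∈ Set.Ioo 0 t
    · rw [Set.indicator_of_mem (show τ ∈ Set.Iio t from h1.2), Set.indicator_of_mem h1]
      exact mul_le_mul' le_rfl (hfle τ ⟨h1.1, h1.2.trans ht.2⟩)
    · by_cases h2 : τ ∈ Set.Iio t
      · rw [Set.indicator_of_mem h2, hf0 τ fun h => h1 ⟨h.1, h2⟩]
        simp
      · rw [Set.indicator_of_notMem h2]
        exact zero_le
  -- Reflection leaves the absolute form unchanged because `hker` is even. In the causal half the
  -- inner integral is at most `C`, and what remains is the mass of the kernel near the origin.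
  have habs : absForm lam (restartBlock lam c a s) (restartBlock lam c a s) ≤
      ENNReal.ofReal (2 * C * ∫ t in (0 : ℝ)..s, V t) := by
    rw [absForm_comp_sub_left lam (a + s) hfm (measurable_restartBlock lam c a s)
      (norm_restartBlock lam c a s)]
    calc absForm lam f f ≤ 2 * ∫⁻ t, ‖f t‖ₑ * ∫⁻ τ in Set.Iio t, hker lam (t - τ) * ‖f τ‖ₑ :=
          absForm_self_le hfm
      _ ≤ 2 * ∫⁻ t in Set.Ioo 0 s, ENNReal.ofReal (V t) * ENNReal.ofReal C := by
          rw [← lintegral_indicator measurableSet_Ioo]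
          refine mul_le_mul' le_rfl (lintegral_mono fun t => ?_)
          by_cases ht : t ∈ Set.Ioo 0 s
          · rw [Set.indicator_of_mem ht]
            exact mul_le_mul' (hfle t ht) (hin t ht)
          · rw [hf0 t ht]
            simp
      _ = _ := by
          rw [lintegral_mul_const' _ _ ENNReal.ofReal_ne_top,
            ← ofReal_integral_eq_lintegral_ofReal (integrableOn_volterraExp c.re s)
              ((ae_restrict_iff' measurableSet_Ioo).2
                (ae_of_all _ fun τ hτ => (volterraExp_pos c.re hτ.1).le)),
            ← integral_Ioc_eq_integral_Ioo, ← intervalIntegral.integral_of_le hs.le,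
            show (2 : ℝ≥0∞) = ENNReal.ofReal 2 by simp, ← ENNReal.ofReal_mul hV0,
            ← ENNReal.ofReal_mul (by norm_num)]
          congr 1
          ring
  have hlt := lt_of_le_of_lt habs ENNReal.ofReal_lt_top
  have hi := integrable_restartBlock lam c a s
  obtain ⟨h1, h2⟩ := traceForm_self hlam hi hlt
  refine ⟨h1, ?_⟩
  have h3 : ‖traceForm lam (restartBlock lam c a s) (restartBlock lam c a s)‖ₑ ≤
      absForm lam (restartBlock lam c a s) (restartBlock lam c a s) := by
    refine (enorm_integral_le_lintegral_enorm _).trans (lintegral_mono fun p => ?_)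
    rw [enorm_mul, enorm_mul, ← ofReal_norm ((starRingEnd ℂ) _), RCLike.norm_conj, ofReal_norm]
    exact mul_le_mul' (mul_le_mul' le_rfl (enorm_eKer_le _ _)) le_rfl
  have h4 := h3.trans habs
  rw [h2, ← ofReal_norm, Complex.norm_real, Real.norm_of_nonneg ENNReal.toReal_nonneg] at h4
  exact (ENNReal.ofReal_le_ofReal_iff (by positivity)).1 h4

/-- The integral of the Volterra function near the origin is small. -/
theorem tendsto_integral_volterraExp (x : ℝ) :
    Tendsto (fun s => ∫ t in (0 : ℝ)..s, volterraExp x t) (𝓝[>] 0) (𝓝 0) := by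
  have hii : IntegrableOn (volterraExp x) (Set.uIcc 0 1) := by
    rw [Set.uIcc_of_le zero_le_one, integrableOn_Icc_iff_integrableOn_Ioo]
    exact integrableOn_volterraExp x 1
  have h := intervalIntegral.continuousOn_primitive_interval hii 0 (by simp)
  rw [Set.uIcc_of_le zero_le_one] at h
  have h2 := h.tendsto
  rw [intervalIntegral.integral_same] at h2
  refine h2.mono_left ?_
  rw [← nhdsWithin_Ioo_eq_nhdsGT (zero_lt_one (α := ℝ))]
  exact nhdsWithin_mono _ Set.Ioo_subset_Icc_self

/-! ### The equation in the rotating frame -/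

theorem cconv_one_left (f : ℝ → ℂ) (t : ℝ) : cconv (fun _ => 1) f t = ∫ x in (0 : ℝ)..t, f x := by
  simp [cconv]

theorem cconv_one_left_assoc {f g : ℝ → ℂ} {t : ℝ} (ht : 0 < t) (hf : IsLocKernel f)
    (hg : Continuous g) :
    cconv (fun x => ∫ y in (0 : ℝ)..x, f y) g t = ∫ x in (0 : ℝ)..t, cconv f g x := by
  obtain ⟨C, hC⟩ := isCompact_Icc.exists_bound_of_continuousOn (s := Set.Icc 0 t) hg.continuousOn
  rw [← cconv_one_left (cconv f g), ← cconv_assoc ht (IsLocKernel.of_continuous continuous_const |>.int t)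
    (hf.int t) hg.aestronglyMeasurable fun x hx => hC x (Set.Ioo_subset_Icc_self hx)]
  congr 1
  funext x
  rw [cconv_one_left]

/-- The Sonine identity: convolution with the logarithm turns Volterra integrals into plain
primitives. -/
theorem cconv_logKernel_volterraOp {G : ℝ → ℂ} (hG : Continuous G) {t : ℝ} (ht : 0 < t) :
    cconv (logKernel 0) (volterraOp G) t = ∫ x in (0 : ℝ)..t, G x := by
  obtain ⟨C, hC⟩ := isCompact_Icc.exists_bound_of_continuousOn (s := Set.Icc 0 t) hG.continuousOn
  have e : cconv (logKernel 0) (volterraOp G) t = cconv (logKernel 0) (cconv volterraK G) t := rfl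
  rw [e, ← cconv_assoc ht ((isLocKernel_logKernel 0).int t) (isLocKernel_volterraK.int t)
    hG.aestronglyMeasurable fun x hx => hC x (Set.Ioo_subset_Icc_self hx), ← cconv_one_left G]
  refine cconv_congr_left ht.le fun x hx => ?_
  rw [cconv_comm, volterraK_eq, cconv_volterraCexp_logKernel 0 hx.1]

/-- The charge equation inverted against the trace of the Green function. -/
theorem cconv_greenTrace_sub {lam : ℝ} (hlam : 0 < lam) {r₀ : ℂ}
    (hr : ∀ t > 0, greenTrace lam 0 t = logKernel (-r₀) t + Complex.I * lam *
      ∫ x in (0 : ℝ)..t, greenTrace lam 0 x) {q S : ℝ → ℂ} (hq : Continuous q) (hS : Continuous S)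
    {q₀ : ℂ} {b : ℝ}
    (heq : ∀ t ∈ Set.Icc 0 b, q t = q₀ + volterraOp (fun τ => S τ - r₀ * (q τ - q₀) +
      Complex.I * lam * q₀ * greenPrim lam τ) t) {t : ℝ} (ht : t ∈ Set.Icc 0 b) :
    cconv (greenTrace lam 0) (fun τ => q τ - q₀) t = ∫ x in (0 : ℝ)..t, (S x + Complex.I * lam *
      (cconv (greenTrace lam 0) (fun τ => q τ - q₀) x + q₀ * greenPrim lam x)) := by
  rcases eq_or_lt_of_le ht.1 with h0 | h0
  · rw [← h0]; simp [cconv]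
  set h := greenTrace lam 0 with hh
  set D : ℝ → ℂ := fun τ => q τ - q₀ with hD
  have hDc : Continuous D := by fun_prop
  have hDk := IsLocKernel.of_continuous hDc
  have hP := continuous_greenPrim hlam
  have hhk := isLocKernel_greenTrace hlam
  have hLk := isLocKernel_logKernel 0
  have hPk := IsLocKernel.of_continuous hP
  have hG : Continuous fun τ => S τ - r₀ * (q τ - q₀) + Complex.I * lam * q₀ * greenPrim lam τ := by
    fun_prop
  have e1 : cconv (logKernel 0) D t = ∫ x in (0 : ℝ)..t, (S x - r₀ * (q x - q₀) +
      Complex.I * lam * q₀ * greenPrim lam x) := by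
    rw [← cconv_logKernel_volterraOp hG h0]
    refine cconv_congr_right h0.le fun x hx => ?_
    simp only [hD]
    rw [heq x ⟨hx.1.le, hx.2.le.trans ht.2⟩, add_sub_cancel_left]
  -- The Green trace is `logKernel 0 + r₀` plus `iλ` times its primitive; the constant `r₀` cancels
  -- the term `-r₀ (q - q₀)` placed in the forcing.
  have e2 : cconv h D t = cconv (logKernel 0) D t + r₀ * (∫ x in (0 : ℝ)..t, D x) +
      Complex.I * lam * cconv (greenPrim lam) D t := by
    rw [← cconv_one_left, cconv, cconv, cconv, cconv, ← intervalIntegral.integral_const_mul,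
      ← intervalIntegral.integral_const_mul, ← intervalIntegral.integral_add
      (hLk.intervalIntegrable_mul hDk h0) (Continuous.intervalIntegrable (by fun_prop) _ _),
      ← intervalIntegral.integral_add ((hLk.intervalIntegrable_mul hDk h0).add
        (Continuous.intervalIntegrable (by fun_prop) _ _))
        (Continuous.intervalIntegrable (by fun_prop) _ _)]
    rw [intervalIntegral.integral_of_le h0.le, intervalIntegral.integral_of_le h0.le,
      integral_Ioc_eq_integral_Ioo, integral_Ioc_eq_integral_Ioo]
    refine setIntegral_congr_fun measurableSet_Ioo fun x hx => ?_
    have hx' : 0 < t - x := by linarith [hx.2]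
    rw [hr _ hx', greenPrim_eq lam hx'.le]
    simp only [logKernel]
    ring
  have e3 : cconv (greenPrim lam) D t = ∫ x in (0 : ℝ)..t, cconv h D x := by
    rw [← cconv_one_left_assoc h0 hhk hDc]
    exact cconv_congr_left h0.le fun x hx => greenPrim_eq lam hx.1.le
  have hYc : IntervalIntegrable (cconv h D) volume 0 t := by
    rw [intervalIntegrable_iff_integrableOn_Ioo_of_le h0.le]
    exact integrableOn_cconv (hhk.int t) (hDk.int t)
  rw [e2, e1, e3, ← intervalIntegral.integral_const_mul, ← intervalIntegral.integral_const_mul,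
    ← intervalIntegral.integral_add (Continuous.intervalIntegrable (by fun_prop) _ _)
      (Continuous.intervalIntegrable (by fun_prop) _ _), ← intervalIntegral.integral_add
      (Continuous.intervalIntegrable (by fun_prop) _ _) (hYc.const_mul _)]
  refine intervalIntegral.integral_congr fun x _ => ?_
  simp only [hD]
  ring

theorem hasDerivAt_cexp_neg_I_mul (lam x : ℝ) :
    HasDerivAt (fun x : ℝ => Complex.exp (-(Complex.I * lam * x)))
      (Complex.exp (-(Complex.I * lam * x)) * (-(Complex.I * lam))) x := by
  have : HasDerivAt (fun x : ℝ => -(Complex.I * lam * (x : ℂ))) (-(Complex.I * lam * 1)) x :=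
    (Complex.ofRealCLM.hasDerivAt.const_mul (Complex.I * lam)).neg
  simpa using this.cexp

theorem continuousOn_greenTrace {lam : ℝ} (hlam : 0 < lam) :
    ContinuousOn (greenTrace lam 0) (Set.Ioi 0) := fun _ hx =>
  (hasDerivAt_greenTrace hlam hx).continuousAt.continuousWithinAt

/-- The charge equation in the rotating frame. -/
theorem cconv_eKer_sub {lam : ℝ} (hlam : 0 < lam) {r₀ : ℂ}
    (hr : ∀ t > 0, greenTrace lam 0 t = logKernel (-r₀) t + Complex.I * lam *
      ∫ x in (0 : ℝ)..t, greenTrace lam 0 x) {q S : ℝ → ℂ} (hq : Continuous q) (hS : Continuous S)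
    {q₀ : ℂ} {b : ℝ}
    (heq : ∀ t ∈ Set.Icc 0 b, q t = q₀ + volterraOp (fun τ => S τ - r₀ * (q τ - q₀) +
      Complex.I * lam * q₀ * greenPrim lam τ) t) {t : ℝ} (ht : t ∈ Set.Icc 0 b) :
    cconv (eKer lam) (fun τ => Complex.exp (-(Complex.I * lam * τ)) * q τ - q₀) t =
      ∫ x in (0 : ℝ)..t, Complex.exp (-(Complex.I * lam * x)) * S x := by
  set h := greenTrace lam 0 with hh
  set D : ℝ → ℂ := fun τ => q τ - q₀ with hD
  set Y := cconv h D with hY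
  set ε : ℝ → ℂ := fun x => Complex.exp (-(Complex.I * lam * x)) with hε
  have hεc : Continuous ε := by simp only [hε]; fun_prop
  have hDc : Continuous D := by fun_prop
  have hhk := isLocKernel_greenTrace hlam
  have hek := isLocKernel_eKer hlam
  have hPc := continuous_greenPrim hlam
  have hYc : ContinuousOn Y (Set.Icc 0 b) := continuousOn_cconv (hhk.int b) hDc.continuousOn
  set R : ℝ → ℂ := fun x => S x + Complex.I * lam * (Y x + q₀ * greenPrim lam x) with hR
  have hRc : ContinuousOn R (Set.Icc 0 b) :=
    hS.continuousOn.add (continuousOn_const.mul (hYc.add (continuous_const.mul hPc).continuousOn))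
  have hYeq : ∀ x ∈ Set.Icc 0 b, Y x = ∫ z in (0 : ℝ)..x, R z := fun x hx =>
    cconv_greenTrace_sub hlam hr hq hS heq hx
  rcases eq_or_lt_of_le ht.1 with h0 | h0
  · rw [← h0]; simp [cconv]
  -- decompose the left-hand side
  have e1 : cconv (eKer lam) (fun τ => ε τ * q τ - q₀) t =
      ε t * (Y t + q₀ * greenPrim lam t) - q₀ * ∫ x in (0 : ℝ)..t, eKer lam x := by
    have c1 : cconv (eKer lam) (fun τ => ε τ * D τ) t = ε t * Y t := cconv_cexp_mul lam h D t
    have c2 : cconv (eKer lam) (fun τ => ε τ * 1) t = ε t * greenPrim lam t := by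
      rw [show cconv (eKer lam) (fun τ => ε τ * 1) t = ε t * cconv h (fun _ => 1) t from
        cconv_cexp_mul lam h (fun _ => 1) t, cconv_comm, cconv_one_left, greenPrim_eq lam h0.le]
    have c3 : cconv (eKer lam) (fun _ => 1) t = ∫ x in (0 : ℝ)..t, eKer lam x := by
      rw [cconv_comm, cconv_one_left]
    have k1 : IsLocKernel fun τ => ε τ * D τ := IsLocKernel.of_continuous (by fun_prop)
    have k2 : IsLocKernel fun τ => ε τ * 1 := IsLocKernel.of_continuous (by fun_prop)
    have k3 : IsLocKernel fun _ : ℝ => (1 : ℂ) := IsLocKernel.of_continuous continuous_const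
    have j1 := hek.intervalIntegrable_mul k1 h0
    have j2 := hek.intervalIntegrable_mul k2 h0
    have j3 := hek.intervalIntegrable_mul k3 h0
    calc _ = cconv (eKer lam) (fun τ => ε τ * D τ) t + q₀ * cconv (eKer lam) (fun τ => ε τ * 1) t
          - q₀ * cconv (eKer lam) (fun _ => 1) t := by
          rw [cconv, cconv, cconv, cconv, ← intervalIntegral.integral_const_mul,
            ← intervalIntegral.integral_const_mul,
            ← intervalIntegral.integral_add j1 (j2.const_mul _),
            ← intervalIntegral.integral_sub (j1.add (j2.const_mul _)) (j3.const_mul _)]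
          refine intervalIntegral.integral_congr fun x _ => ?_
          simp only [hD]
          ring
      _ = _ := by rw [c1, c2, c3]; ring
  -- `Z` is the left-hand side as a function of its endpoint. In `Z'` the derivative of the rotation
  -- cancels the `iλ` terms of `R`, and `q₀ ε h` cancels `q₀ eKer`, leaving the forcing alone.
  set Z : ℝ → ℂ := fun x => ε x * ((∫ z in (0 : ℝ)..x, R z) + q₀ * greenPrim lam x) -
    q₀ * ∫ z in (0 : ℝ)..x, eKer lam z with hZ
  have hZc : ContinuousOn Z (Set.Icc 0 t) := by
    have hsub : Set.Icc 0 t ⊆ Set.Icc 0 b := Set.Icc_subset_Icc_right ht.2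
    have c1 : ContinuousOn (fun x => ∫ z in (0 : ℝ)..x, eKer lam z) (Set.Icc 0 t) := by
      have hii : IntegrableOn (eKer lam) (Set.uIcc 0 t) := by
        rw [Set.uIcc_of_le ht.1, integrableOn_Icc_iff_integrableOn_Ioo]
        exact hek.int t
      have := intervalIntegral.continuousOn_primitive_interval hii
      rwa [Set.uIcc_of_le ht.1] at this
    have c2 : ContinuousOn (fun x => ∫ z in (0 : ℝ)..x, R z) (Set.Icc 0 t) :=
      (hYc.mono hsub).congr fun x hx => (hYeq x (hsub hx)).symm
    exact (hεc.continuousOn.mul (c2.add (continuous_const.mul hPc).continuousOn)).sub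
      (continuousOn_const.mul c1)
  have hder : ∀ x ∈ Set.Ioo 0 t, HasDerivAt Z (ε x * S x) x := by
    intro x hx
    have hxb : Set.Icc 0 b ∈ 𝓝 x := Icc_mem_nhds hx.1 (hx.2.trans_le ht.2)
    have hRi : IntervalIntegrable R volume 0 x := by
      refine (hRc.mono ?_).intervalIntegrable
      rw [Set.uIcc_of_le hx.1.le]
      exact Set.Icc_subset_Icc_right (hx.2.le.trans ht.2)
    have d1 : HasDerivAt (fun x => ∫ z in (0 : ℝ)..x, R z) (R x) x :=
      intervalIntegral.integral_hasDerivAt_right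
        hRi
        ⟨Set.Icc 0 b, hxb, hRc.aestronglyMeasurable measurableSet_Icc⟩ (hRc.continuousAt hxb)
    have hcx : ContinuousAt h x :=
      (continuousOn_greenTrace hlam).continuousAt (Ioi_mem_nhds hx.1)
    have d2 : HasDerivAt (greenPrim lam) (h x) x := by
      have := intervalIntegral.integral_hasDerivAt_right (hhk.intervalIntegrable le_rfl hx.1.le)
        ⟨Set.Ioi 0, Ioi_mem_nhds hx.1, hhk.meas⟩ hcx
      refine this.congr_of_eventuallyEq ?_
      filter_upwards [Ioi_mem_nhds hx.1] with z hz
      exact greenPrim_eq lam (le_of_lt hz)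
    have d3 : HasDerivAt (fun x => ∫ z in (0 : ℝ)..x, eKer lam z) (eKer lam x) x :=
      intervalIntegral.integral_hasDerivAt_right (hek.intervalIntegrable le_rfl hx.1.le)
        ⟨Set.Ioi 0, Ioi_mem_nhds hx.1, hek.meas⟩ (hεc.continuousAt.mul hcx)
    refine (((hasDerivAt_cexp_neg_I_mul lam x).mul (d1.add (d2.const_mul q₀))).sub
      (d3.const_mul q₀)).congr_deriv ?_
    simp only [Pi.add_apply]
    rw [show eKer lam x = ε x * h x from rfl, ← hYeq x ⟨hx.1.le, hx.2.le.trans ht.2⟩]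
    simp only [hR, hε]
    ring
  have hint := intervalIntegral.integral_eq_sub_of_hasDerivAt_of_le ht.1 hZc hder
    (Continuous.intervalIntegrable (hεc.mul hS) _ _)
  rw [e1, hYeq t ht, hint]
  simp [hZ, greenPrim_eq lam le_rfl]

/-! ### Energy of difference quotients -/

/-- Convolution with `eKer` over the whole past. -/
def causal (lam : ℝ) (f : ℝ → ℂ) (t : ℝ) : ℂ := ∫ τ in Set.Iio t, eKer lam (t - τ) * f τ

/-- The difference quotient of step `k` on `(-k, c)`. -/
def diffQuot (P : ℝ → ℂ) (k c : ℝ) : ℝ → ℂ :=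
  (Set.Ioo (-k) c).indicator fun t => (P (t + k) - P t) / k

theorem integrableOn_eKer_mul {lam : ℝ} (hlam : 0 < lam) {P : ℝ → ℂ} (hP : Continuous P)
    (hP0 : ∀ t ≤ 0, P t = 0) (t : ℝ) :
    IntegrableOn (fun τ => eKer lam (t - τ) * P τ) (Set.Iio t) := by
  rcases le_or_gt t 0 with ht | ht
  · refine (integrableOn_zero).congr_fun (fun τ hτ => ?_) measurableSet_Iio
    rw [hP0 τ ((le_of_lt hτ).trans ht), mul_zero]
  · have h := (isLocKernel_eKer hlam).intervalIntegrable_mul (IsLocKernel.of_continuous hP) ht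
    rw [intervalIntegrable_iff_integrableOn_Ioo_of_le ht.le] at h
    refine h.of_forall_sdiff_eq_zero measurableSet_Iio fun τ hτ => ?_
    rw [hP0 τ (not_lt.1 fun h0 => hτ.2 ⟨h0, hτ.1⟩), mul_zero]

theorem causal_eq_cconv (lam : ℝ) {P : ℝ → ℂ} (hP0 : ∀ t ≤ 0, P t = 0) {t : ℝ} (ht : 0 ≤ t) :
    causal lam P t = cconv (eKer lam) P t := by
  rw [causal, cconv, intervalIntegral.integral_of_le ht, integral_Ioc_eq_integral_Ioo]
  refine setIntegral_eq_of_subset_of_forall_sdiff_eq_zero measurableSet_Iio (fun x hx => hx.2)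
    fun x hx => ?_
  rw [hP0 x (not_lt.1 fun h => hx.2 ⟨h, hx.1⟩), mul_zero]

theorem causal_eq_zero (lam : ℝ) {P : ℝ → ℂ} (hP0 : ∀ t ≤ 0, P t = 0) {t : ℝ} (ht : t ≤ 0) :
    causal lam P t = 0 := by
  rw [causal, setIntegral_eq_zero_of_forall_eq_zero]
  intro x hx
  rw [hP0 x ((le_of_lt hx).trans ht), mul_zero]

theorem integral_Iio_comp_add (F : ℝ → ℂ) (t k : ℝ) :
    ∫ τ in Set.Iio t, F (τ + k) = ∫ τ in Set.Iio (t + k), F τ := by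
  rw [← integral_indicator measurableSet_Iio, ← integral_indicator measurableSet_Iio,
    ← integral_add_right_eq_self ((Set.Iio (t + k)).indicator F) k]
  refine integral_congr_ae (ae_of_all _ fun τ => ?_)
  simp only [Set.indicator, Set.mem_Iio, add_lt_add_iff_right]

theorem integrableOn_Iio_comp_add {F : ℝ → ℂ} {t k : ℝ} (h : IntegrableOn F (Set.Iio (t + k))) :
    IntegrableOn (fun τ => F (τ + k)) (Set.Iio t) := by
  rw [← integrable_indicator_iff measurableSet_Iio] at h ⊢
  refine (h.comp_add_right k).congr (ae_of_all _ fun τ => ?_)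
  simp only [Set.indicator, Set.mem_Iio, add_lt_add_iff_right]

/-- Convolution commutes with translation. Since `P` vanishes at nonpositive times the cutoff at
`-k` loses nothing, and the cutoff at `c` is invisible to the past of `t ≤ c`. -/
theorem causal_diffQuot {lam : ℝ} (hlam : 0 < lam) {P : ℝ → ℂ} (hP : Continuous P)
    (hP0 : ∀ t ≤ 0, P t = 0) {k : ℝ} (hk : 0 < k) {c t : ℝ} (ht : t ≤ c) :
    causal lam (diffQuot P k c) t = (causal lam P (t + k) - causal lam P t) / k := by
  have e : ∀ τ : ℝ, t + k - (τ + k) = t - τ := fun τ => by ring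
  have h1 := integrableOn_Iio_comp_add (integrableOn_eKer_mul hlam hP hP0 (t + k))
  have h2 := integral_Iio_comp_add (fun τ => eKer lam (t + k - τ) * P τ) t k
  simp only [e] at h1 h2
  rw [causal, causal, causal, ← h2, ← integral_sub h1 (integrableOn_eKer_mul hlam hP hP0 t),
    ← integral_div]
  refine setIntegral_congr_fun measurableSet_Iio fun τ hτ => ?_
  by_cases h : -k < τ
  · rw [diffQuot, Set.indicator_of_mem (show τ ∈ Set.Ioo (-k) c from ⟨h, lt_of_lt_of_le hτ ht⟩)]
    ring
  · rw [diffQuot, Set.indicator_of_notMem fun h' => h h'.1, hP0 τ (by linarith),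
      hP0 (τ + k) (by linarith)]
    simp

theorem measurable_diffQuot {P : ℝ → ℂ} (hP : Continuous P) (k c : ℝ) :
    Measurable (diffQuot P k c) :=
  (by fun_prop : Continuous fun t => (P (t + k) - P t) / k).measurable.indicator measurableSet_Ioo

theorem exists_norm_diffQuot_le {P : ℝ → ℂ} (hP : Continuous P) (k c : ℝ) :
    ∃ A, ∀ t, ‖diffQuot P k c t‖ ≤ A := by
  obtain ⟨A, hA⟩ := isCompact_Icc.exists_bound_of_continuousOn (s := Set.Icc (-k) c)
    (by fun_prop : Continuous fun t => (P (t + k) - P t) / (k : ℂ)).continuousOn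
  refine ⟨max A 0, fun t => ?_⟩
  by_cases h : t ∈ Set.Ioo (-k) c
  · rw [diffQuot, Set.indicator_of_mem h]
    exact (hA t (Set.Ioo_subset_Icc_self h)).trans (le_max_left _ _)
  · rw [diffQuot, Set.indicator_of_notMem h, norm_zero]
    exact le_max_right _ _

theorem integrable_diffQuot {P : ℝ → ℂ} (hP : Continuous P) (k c : ℝ) :
    Integrable (diffQuot P k c) :=
  (integrable_indicator_iff measurableSet_Ioo).2 (((by fun_prop :
    Continuous fun t => (P (t + k) - P t) / (k : ℂ)).integrableOn_Icc).mono_set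
    Set.Ioo_subset_Icc_self)

theorem integral_conj_diffQuot_mul (P F : ℝ → ℂ) {k c : ℝ} (hkc : -k ≤ c) :
    ∫ t, (starRingEnd ℂ) (diffQuot P k c t) * F t =
      ∫ t in (-k)..c, (starRingEnd ℂ) ((P (t + k) - P t) / k) * F t := by
  rw [intervalIntegral.integral_of_le hkc, integral_Ioc_eq_integral_Ioo,
    ← integral_indicator measurableSet_Ioo]
  refine integral_congr_ae (ae_of_all _ fun t => ?_)
  by_cases h : t ∈ Set.Ioo (-k) c
  · simp [diffQuot, Set.indicator_of_mem h]
  · simp [diffQuot, Set.indicator_of_notMem h]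

/-- The discrete counterpart of `2 Re ∫ conj(P') (e ∗ P')`: the positive form on the difference
quotient, written causally so that the equation can be inserted. -/
theorem energy_diffQuot {lam : ℝ} (hlam : 0 < lam) {P : ℝ → ℂ} (hP : Continuous P)
    (hP0 : ∀ t ≤ 0, P t = 0) {k c : ℝ} (hk : 0 < k) (hc : 0 ≤ c) :
    energy lam (diffQuot P k c) < ∞ ∧ (energy lam (diffQuot P k c)).toReal =
      2 * (∫ t in (-k)..c, (starRingEnd ℂ) ((P (t + k) - P t) / k) *
        ((causal lam P (t + k) - causal lam P t) / k)).re := by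
  have hi := integrable_diffQuot hP k c
  obtain ⟨A, hA⟩ := exists_norm_diffQuot_le hP k c
  have h0 : ∀ t ∉ Set.Ioo (-k) c, diffQuot P k c t = 0 := fun t ht => Set.indicator_of_notMem ht _
  have habs := absForm_lt_top hlam hi h0 h0 hi.aestronglyMeasurable hA
  obtain ⟨h1, h2⟩ := traceForm_self hlam hi habs
  refine ⟨h1, ?_⟩
  have h3 := traceForm_self_re hi.aestronglyMeasurable habs
  rw [h2, Complex.ofReal_re] at h3
  rw [h3, ← integral_conj_diffQuot_mul P _ (by linarith)]
  congr 2
  refine integral_congr_ae (ae_of_all _ fun t => ?_)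
  by_cases h : t ∈ Set.Ioo (-k) c
  · simp only
    rw [← causal_diffQuot hlam hP hP0 hk h.2.le]
    rfl
  · simp [h0 t h]

/-- Arbitrarily small steps at which the modulus of continuity in `L²` is controlled. -/
theorem exists_small_step {u : ℝ → ℂ} {b : ℝ} (hb : 0 < b)
    (h : halfSeminorm u b < ∞) {ε δ : ℝ} (hε : 0 < ε) (hδ : 0 < δ) :
    ∃ k ∈ Set.Ioo 0 δ, diffSq u b k ≤ ENNReal.ofReal (ε * k) ∧
      ∫⁻ x in Set.Ioo 0 k, diffSq u b x ≤ ENNReal.ofReal (ε * k ^ 2) := by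
  obtain ⟨η, hη, hsmall⟩ := exists_pos_setLIntegral_lt_of_measure_lt h.ne
    (ENNReal.ofReal_pos.2 (half_pos hε)).ne'
  obtain ⟨η', hη', hηle⟩ : ∃ η' : ℝ, 0 < η' ∧ ENNReal.ofReal η' < η := by
    rcases eq_or_ne η ∞ with rfl | hne
    · exact ⟨1, one_pos, ENNReal.ofReal_lt_top⟩
    · have := ENNReal.toReal_pos hη.ne' hne
      exact ⟨η.toReal / 2, by positivity, (ENNReal.ofReal_lt_iff_lt_toReal (by positivity) hne).2
        (by linarith)⟩
  set d := min (min δ b) η' with hd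
  have hd0 : 0 < d := lt_min (lt_min hδ hb) hη'
  have hdδ : d ≤ δ := (min_le_left _ _).trans (min_le_left _ _)
  have hdb : d ≤ b := (min_le_left _ _).trans (min_le_right _ _)
  have hI : ∫⁻ x in Set.Ioo 0 d, ENNReal.ofReal (1 / x ^ 2) * diffSq u b x <
      ENNReal.ofReal (ε / 2) := by
    have := hsmall (Set.Ioo 0 d) (by
      refine lt_of_le_of_lt (Measure.restrict_apply_le _ _) ?_
      rw [Real.volume_Ioo, sub_zero]
      exact lt_of_le_of_lt (ENNReal.ofReal_le_ofReal (min_le_right _ _)) hηle)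
    rwa [Measure.restrict_restrict measurableSet_Ioo,
      Set.inter_eq_left.2 (Set.Ioo_subset_Ioo_right hdb)] at this
  -- The second bound holds for every small `k`, because `x^{-2} ≥ k^{-2}` on `(0, k)`. If the first
  -- failed throughout `(d/2, d)`, the weighted integral there would be at least `ε/2`, contrary to
  -- the choice of `d`.
  by_contra! hcon
  have hsecond : ∀ k ∈ Set.Ioo 0 d, ∫⁻ x in Set.Ioo 0 k, diffSq u b x ≤
      ENNReal.ofReal (ε * k ^ 2) := by
    intro k hk
    have hk0 := hk.1
    calc ∫⁻ x in Set.Ioo 0 k, diffSq u b x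
        ≤ ∫⁻ x in Set.Ioo 0 k, ENNReal.ofReal (k ^ 2) *
          (ENNReal.ofReal (1 / x ^ 2) * diffSq u b x) := by
          refine setLIntegral_mono' measurableSet_Ioo fun x hx => ?_
          have hx0 := hx.1
          rw [← mul_assoc, ← ENNReal.ofReal_mul (by positivity)]
          refine le_mul_of_one_le_left zero_le ?_
          rw [ENNReal.one_le_ofReal, mul_one_div, one_le_div (by positivity)]
          exact pow_le_pow_left₀ hx0.le hx.2.le 2
      _ = ENNReal.ofReal (k ^ 2) * ∫⁻ x in Set.Ioo 0 k, ENNReal.ofReal (1 / x ^ 2) * diffSq u b x :=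
          lintegral_const_mul' _ _ ENNReal.ofReal_ne_top
      _ ≤ ENNReal.ofReal (k ^ 2) * ENNReal.ofReal (ε / 2) :=
          mul_le_mul' le_rfl ((lintegral_mono_set (Set.Ioo_subset_Ioo_right hk.2.le)).trans hI.le)
      _ ≤ _ := by
          rw [← ENNReal.ofReal_mul (by positivity)]
          exact ENNReal.ofReal_le_ofReal (by nlinarith [sq_nonneg k])
  have hfirst : ∀ k ∈ Set.Ioo (d / 2) d, ENNReal.ofReal (ε / d) ≤
      ENNReal.ofReal (1 / k ^ 2) * diffSq u b k := by
    intro k hk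
    have hk0 : 0 < k := by linarith [hk.1]
    have hk' : k ∈ Set.Ioo 0 d := ⟨hk0, hk.2⟩
    have h1 : ENNReal.ofReal (ε * k) ≤ diffSq u b k := by
      by_contra h1
      exact (hcon k ⟨hk0, hk.2.trans_le hdδ⟩ (not_le.1 h1).le).not_ge (hsecond k hk')
    refine le_trans ?_ (mul_le_mul' le_rfl h1)
    rw [← ENNReal.ofReal_mul (by positivity)]
    refine ENNReal.ofReal_le_ofReal ?_
    rw [show 1 / k ^ 2 * (ε * k) = ε / k by field_simp]
    exact div_le_div_of_nonneg_left hε.le hk0 hk.2.le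
  refine hI.not_ge ?_
  calc ENNReal.ofReal (ε / 2) = ∫⁻ x in Set.Ioo (d / 2) d, ENNReal.ofReal (ε / d) := by
        rw [setLIntegral_const, Real.volume_Ioo, ← ENNReal.ofReal_mul (by positivity)]
        congr 1
        field_simp
        ring
    _ ≤ ∫⁻ x in Set.Ioo (d / 2) d, ENNReal.ofReal (1 / x ^ 2) * diffSq u b x :=
        setLIntegral_mono' measurableSet_Ioo hfirst
    _ ≤ _ := lintegral_mono_set (Set.Ioo_subset_Ioo_left (by positivity))

/-- Forcing terms controlled by the energy. -/
def IsEnergyBounded (lam A : ℝ) (S : ℝ → ℂ) : Prop :=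
  ∀ f : ℝ → ℂ, Integrable f → energy lam f < ∞ → ∀ x : ℝ,
    2 * ‖∫ t, (starRingEnd ℂ) (f t) * S (t + x)‖ ≤ A + (energy lam f).toReal / 2

/-- `G` is a potential of the field `w`, up to errors that are quadratic on bounded sets. -/
def IsPotential (w : ℂ → ℂ) (G : ℂ → ℝ) : Prop :=
  ∀ K : ℝ, ∃ L : ℝ, 0 ≤ L ∧ ∀ z z' z'' : ℂ, ‖z‖ ≤ K → ‖z'‖ ≤ K → ‖z''‖ ≤ K →
    G z' - G z - ((starRingEnd ℂ) (z' - z) * w z'').re ≤ L * (‖z'' - z‖ ^ 2 + ‖z' - z‖ ^ 2)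

/-- A solution on `[0, b]` of the charge equation in the rotating frame, extended by a constant to
negative times. -/
structure IsRotatingSolution (lam : ℝ) (S : ℝ → ℂ) (w : ℂ → ℂ) (b : ℝ) (u : ℝ → ℂ) : Prop where
  cont : Continuous u
  const : ∀ t ≤ 0, u t = u 0
  eq : ∀ t ∈ Set.Icc 0 b, cconv (eKer lam) (fun τ => u τ - u 0) t =
    ∫ x in (0 : ℝ)..t, (S x - w (u x))

theorem diffQuot_sub_const (u : ℝ → ℂ) (z : ℂ) (k c : ℝ) :
    diffQuot (fun t => u t - z) k c = diffQuot u k c := by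
  simp [diffQuot]

theorem IsRotatingSolution.causal_eq {lam : ℝ} {S : ℝ → ℂ} {w : ℂ → ℂ} {b : ℝ} {u : ℝ → ℂ}
    (h : IsRotatingSolution lam S w b u) {t : ℝ} (ht : t ≤ b) :
    causal lam (fun τ => u τ - u 0) t = ∫ x in (0 : ℝ)..(max t 0), (S x - w (u x)) := by
  have h0 : ∀ t ≤ 0, u t - u 0 = 0 := fun t ht => by rw [h.const t ht, sub_self]
  rcases le_total t 0 with h1 | h1
  · rw [causal_eq_zero lam h0 h1, max_eq_right h1, intervalIntegral.integral_same]
  · rw [causal_eq_cconv lam h0 h1, max_eq_left h1, h.eq t ⟨h1, ht⟩]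

/-- Passing from the causal difference quotient to the average of the integrand. -/
theorem norm_causal_sub_average_le {H : ℝ → ℂ} (hH : Continuous H) {D : ℝ → ℂ} (hD : Continuous D)
    {k c B η : ℝ} (hk : 0 < k) (hc : 0 ≤ c) (hB : ∀ t ∈ Set.Icc (-k) 0, ‖H t‖ ≤ B)
    (hη : ∀ t ∈ Set.Icc (-k) 0, ‖D t‖ ≤ η / k) :
    ‖(∫ t in (-k)..c, (starRingEnd ℂ) (D t) * (((∫ x in (0 : ℝ)..(max (t + k) 0), H x) -
      ∫ x in (0 : ℝ)..(max t 0), H x) / k)) -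
      ∫ t in (-k)..c, (starRingEnd ℂ) (D t) * ((∫ x in (0 : ℝ)..k, H (t + x)) / k)‖ ≤ η * B := by
  set Q : ℝ → ℂ := fun t => ∫ x in (0 : ℝ)..(max t 0), H x with hQ
  have hprim : Continuous fun t => ∫ x in (0 : ℝ)..t, H x :=
    intervalIntegral.continuous_primitive (fun a b => hH.intervalIntegrable a b) 0
  have hQc : Continuous Q := hprim.comp (by fun_prop)
  have havg : ∀ t, ∫ x in (0 : ℝ)..k, H (t + x) =
      (∫ x in (0 : ℝ)..(t + k), H x) - ∫ x in (0 : ℝ)..t, H x := fun t => by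
    rw [intervalIntegral.integral_comp_add_left, add_zero,
      intervalIntegral.integral_interval_sub_left (hH.intervalIntegrable _ _)
      (hH.intervalIntegrable _ _)]
  have hac : Continuous fun t => ∫ x in (0 : ℝ)..k, H (t + x) := by
    simp only [havg]
    exact (hprim.comp (by fun_prop)).sub hprim
  set e : ℝ → ℂ := fun t => (starRingEnd ℂ) (D t) *
    ((Q (t + k) - Q t) / k - (∫ x in (0 : ℝ)..k, H (t + x)) / k) with he
  have hDc : Continuous fun t => (starRingEnd ℂ) (D t) := Complex.continuous_conj.comp hD
  have hec : Continuous e := by fun_prop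
  have hB0 : 0 ≤ B := (norm_nonneg _).trans (hB 0 ⟨by linarith, le_rfl⟩)
  rw [← intervalIntegral.integral_sub (Continuous.intervalIntegrable (by fun_prop) _ _)
    (Continuous.intervalIntegrable (by fun_prop) _ _)]
  simp only [← mul_sub]
  rw [show (∫ t in (-k)..c, (starRingEnd ℂ) (D t) *
    ((Q (t + k) - Q t) / k - (∫ x in (0 : ℝ)..k, H (t + x)) / k)) = ∫ t in (-k)..c, e t from rfl,
    ← intervalIntegral.integral_add_adjacent_intervals (hec.intervalIntegrable (-k) 0)
    (hec.intervalIntegrable 0 c)]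
  -- For `t ≥ 0` the two expressions coincide. The discrepancy lives on `(-k, 0)`, of length `k`,
  -- where the quotient is at most `η/k` and the averages of `H` differ by at most `B`.
  have h2 : ∫ t in (0 : ℝ)..c, e t = 0 := by
    rw [intervalIntegral.integral_congr (g := fun _ => 0)]
    · simp
    · intro t ht
      rw [Set.uIcc_of_le hc] at ht
      simp only [he, hQ]
      rw [max_eq_left ht.1, max_eq_left (by linarith [ht.1]), havg, sub_self, mul_zero]
  rw [h2, add_zero]
  have h3 : ∀ t ∈ Set.uIoc (-k) 0, ‖e t‖ ≤ η / k * B := by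
    intro t ht
    rw [Set.uIoc_of_le (by linarith)] at ht
    have ht' : t ∈ Set.Icc (-k) 0 := ⟨ht.1.le, ht.2⟩
    have e1 : (Q (t + k) - Q t) / k - (∫ x in (0 : ℝ)..k, H (t + x)) / k =
        (∫ x in (0 : ℝ)..t, H x) / k := by
      simp only [hQ]
      rw [havg, max_eq_right ht.2, max_eq_left (by linarith [ht.1]), intervalIntegral.integral_same]
      ring
    simp only [he]
    rw [e1, norm_mul, RCLike.norm_conj]
    refine mul_le_mul (hη t ht') ?_ (norm_nonneg _) ((norm_nonneg _).trans (hη t ht'))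
    have e2 : ‖∫ x in (0 : ℝ)..t, H x‖ ≤ B * |t - 0| := by
      refine intervalIntegral.norm_integral_le_of_norm_le_const fun x hx => hB x ?_
      rw [Set.uIoc_of_ge ht.2] at hx
      exact ⟨by linarith [hx.1, ht.1], hx.2⟩
    rw [sub_zero, abs_of_nonpos ht.2] at e2
    rw [norm_div, Complex.norm_real, Real.norm_of_nonneg hk.le, div_le_iff₀ hk]
    exact e2.trans (mul_le_mul_of_nonneg_left (by linarith [ht.1]) hB0)
  have h4 := intervalIntegral.norm_integral_le_of_norm_le_const h3
  rw [zero_sub, neg_neg, abs_of_pos hk] at h4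
  refine h4.trans (le_of_eq ?_)
  field_simp

/-- Fubini, so that the potential inequality can be applied to each shift `x ∈ [0, k]` separately.
-/
theorem integral_conj_mul_average {H D : ℝ → ℂ} (hH : Continuous H) (hD : Continuous D)
    (k c : ℝ) :
    ∫ t in (-k)..c, (starRingEnd ℂ) (D t) * ((∫ x in (0 : ℝ)..k, H (t + x)) / k) =
      (∫ x in (0 : ℝ)..k, ∫ t in (-k)..c, (starRingEnd ℂ) (D t) * H (t + x)) / k := by
  have hDc : Continuous fun t => (starRingEnd ℂ) (D t) := Complex.continuous_conj.comp hD
  rw [← intervalIntegral_intervalIntegral_swap (F := fun t x => (starRingEnd ℂ) (D t) * H (t + x)),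
    ← intervalIntegral.integral_div]
  · refine intervalIntegral.integral_congr fun t _ => ?_
    rw [intervalIntegral.integral_const_mul, mul_div_assoc]
  · have hc : Continuous (Function.uncurry fun t x => (starRingEnd ℂ) (D t) * H (t + x)) := by
      unfold Function.uncurry
      exact (hDc.comp continuous_fst).mul (hH.comp (by fun_prop))
    exact (hc.continuousOn.integrableOn_compact (isCompact_uIcc.prod isCompact_uIcc)).mono_set
      (Set.prod_mono (Set.uIoc_subset_uIcc (a := -k) (b := c))
        (Set.uIoc_subset_uIcc (a := 0) (b := k)))

theorem integral_shift_sub (g : ℝ → ℝ) (hg : Continuous g) (k c : ℝ) :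
    ∫ t in (-k)..c, (g (t + k) - g t) =
      (∫ t in c..(c + k), g t) - ∫ t in (-k)..0, g t := by
  have hi : ∀ a b, IntervalIntegrable g volume a b := fun a b => hg.intervalIntegrable a b
  rw [intervalIntegral.integral_sub (Continuous.intervalIntegrable (by fun_prop) _ _) (hi _ _),
    intervalIntegral.integral_comp_add_right, neg_add_cancel,
    ← intervalIntegral.integral_add_adjacent_intervals (hi 0 c) (hi c (c + k)),
    ← intervalIntegral.integral_add_adjacent_intervals (hi (-k) 0) (hi 0 c)]
  ring

/-- The contribution of a single shift. -/
theorem re_integral_conj_mul_shift_le {lam A : ℝ} {S : ℝ → ℂ} (hS : Continuous S)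
    (hSE : IsEnergyBounded lam A S) {w : ℂ → ℂ} (hw : Continuous w) {G : ℂ → ℝ} (hG : Continuous G)
    {u : ℝ → ℂ} (hu : Continuous u) {k c L x : ℝ} (hk : 0 < k) (hc : 0 ≤ c) (h0 : ∀ t ≤ 0, u t = u 0)
    (hL : ∀ t ∈ Set.Icc (-k) c, G (u (t + k)) - G (u t) -
      ((starRingEnd ℂ) (u (t + k) - u t) * w (u (t + x))).re ≤
        L * (‖u (t + x) - u t‖ ^ 2 + ‖u (t + k) - u t‖ ^ 2))
    (hE : energy lam (diffQuot u k c) < ∞) :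
    2 * (∫ t in (-k)..c, (starRingEnd ℂ) ((u (t + k) - u t) / k) *
      (S (t + x) - w (u (t + x)))).re ≤
      A + (energy lam (diffQuot u k c)).toReal / 2 -
        2 / k * (∫ t in c..(c + k), G (u t)) + 2 * G (u 0) +
        2 * L / k * ((∫ t in (-k)..c, ‖u (t + x) - u t‖ ^ 2) +
          ∫ t in (-k)..c, ‖u (t + k) - u t‖ ^ 2) := by
  have hkc : -k ≤ c := by linarith
  have hDc : Continuous fun t => (starRingEnd ℂ) ((u (t + k) - u t) / k) :=
    Complex.continuous_conj.comp (by fun_prop)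
  have h1 := hSE _ (integrable_diffQuot hu k c) hE x
  rw [integral_conj_diffQuot_mul u (fun t => S (t + x)) hkc] at h1
  -- The increments of `G(u)` telescope to integrals next to `c` and to the left of `0`, where `u`
  -- is constant.
  have h2 : ∫ t in (-k)..c, (G (u (t + k)) - G (u t)) =
      (∫ t in c..(c + k), G (u t)) - k * G (u 0) := by
    rw [integral_shift_sub (fun t => G (u t)) (by fun_prop)]
    congr 1
    rw [intervalIntegral.integral_congr (g := fun _ => G (u 0))]
    · simp
    · intro t ht
      rw [Set.uIcc_of_le (by linarith)] at ht
      simp only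
      rw [h0 t ht.2]
  have h3 : (∫ t in (-k)..c, (starRingEnd ℂ) ((u (t + k) - u t) / k) * w (u (t + x))).re =
      ∫ t in (-k)..c, ((starRingEnd ℂ) (u (t + k) - u t) * w (u (t + x))).re / k := by
    rw [← Complex.reCLM_apply, ← ContinuousLinearMap.intervalIntegral_comp_comm]
    · refine intervalIntegral.integral_congr fun t _ => ?_
      simp only [Complex.reCLM_apply]
      rw [map_div₀, Complex.conj_ofReal, div_mul_eq_mul_div, Complex.div_ofReal_re]
    · exact Continuous.intervalIntegrable (by fun_prop) _ _
  have hcc : Continuous fun t => (starRingEnd ℂ) (u (t + k) - u t) :=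
    Complex.continuous_conj.comp (by fun_prop)
  have hre : Continuous fun t => ((starRingEnd ℂ) (u (t + k) - u t) * w (u (t + x))).re :=
    Complex.continuous_re.comp (by fun_prop)
  have h4 : (∫ t in (-k)..c, (G (u (t + k)) - G (u t))) -
      ∫ t in (-k)..c, ((starRingEnd ℂ) (u (t + k) - u t) * w (u (t + x))).re ≤
      L * ((∫ t in (-k)..c, ‖u (t + x) - u t‖ ^ 2) + ∫ t in (-k)..c, ‖u (t + k) - u t‖ ^ 2) := by
    rw [← intervalIntegral.integral_add (Continuous.intervalIntegrable (by fun_prop) _ _)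
      (Continuous.intervalIntegrable (by fun_prop) _ _), ← intervalIntegral.integral_const_mul,
      ← intervalIntegral.integral_sub (Continuous.intervalIntegrable (by fun_prop) _ _)
      (hre.intervalIntegrable _ _)]
    exact intervalIntegral.integral_mono_on hkc (Continuous.intervalIntegrable (by fun_prop) _ _)
      (Continuous.intervalIntegrable (by fun_prop) _ _) hL
  have h5 : (∫ t in (-k)..c, (starRingEnd ℂ) ((u (t + k) - u t) / k) *
      (S (t + x) - w (u (t + x)))).re =
      (∫ t in (-k)..c, (starRingEnd ℂ) ((u (t + k) - u t) / k) * S (t + x)).re -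
      (∫ t in (-k)..c, ((starRingEnd ℂ) (u (t + k) - u t) * w (u (t + x))).re) / k := by
    simp only [mul_sub]
    rw [intervalIntegral.integral_sub (Continuous.intervalIntegrable (by fun_prop) _ _)
      (Continuous.intervalIntegrable (by fun_prop) _ _), Complex.sub_re, h3,
      intervalIntegral.integral_div]
  have h6 := Complex.re_le_norm
    (∫ t in (-k)..c, (starRingEnd ℂ) ((u (t + k) - u t) / k) * S (t + x))
  rw [h2] at h4
  rw [h5]
  set I := ∫ t in (-k)..c, ((starRingEnd ℂ) (u (t + k) - u t) * w (u (t + x))).re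
  set D := (∫ t in (-k)..c, ‖u (t + x) - u t‖ ^ 2) + ∫ t in (-k)..c, ‖u (t + k) - u t‖ ^ 2
  set J := ∫ t in c..(c + k), G (u t)
  have h7 : -(2 / k * I) ≤ -(2 / k * J) + 2 * G (u 0) + 2 * L / k * D := by
    have : 2 / k * (J - k * G (u 0) - I) ≤ 2 / k * (L * D) :=
      mul_le_mul_of_nonneg_left h4 (by positivity)
    have e1 : 2 / k * (J - k * G (u 0) - I) = 2 / k * J - 2 * G (u 0) - 2 / k * I := by field_simp
    have e2 : 2 / k * (L * D) = 2 * L / k * D := by ring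
    linarith
  have h8 : 2 * (I / k) = 2 / k * I := by ring
  linarith

theorem ofReal_integral_sq_shift_le {u : ℝ → ℂ} (hu : Continuous u) (h0 : ∀ t ≤ 0, u t = u 0)
    {k c b x η : ℝ} (hk : 0 < k) (hc : 0 ≤ c) (hckb : c + k ≤ b) (hx : x ∈ Set.Icc 0 k)
    (hη : ∀ t ∈ Set.Icc 0 k, ‖u t - u 0‖ ≤ η) :
    ENNReal.ofReal (∫ t in (-k)..c, ‖u (t + x) - u t‖ ^ 2) ≤
      ENNReal.ofReal (k * η ^ 2) + diffSq u b x := by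
  have hcont : Continuous fun t => ‖u (t + x) - u t‖ ^ 2 := by fun_prop
  rw [← intervalIntegral.integral_add_adjacent_intervals (hcont.intervalIntegrable (-k) 0)
    (hcont.intervalIntegrable 0 c)]
  refine ENNReal.ofReal_add_le.trans (add_le_add (ENNReal.ofReal_le_ofReal ?_) ?_)
  · have hη0 : 0 ≤ η := (norm_nonneg _).trans (hη 0 ⟨le_rfl, hk.le⟩)
    have h1 : ∀ t ∈ Set.uIoc (-k) 0, ‖‖u (t + x) - u t‖ ^ 2‖ ≤ η ^ 2 := by
      intro t ht
      rw [Set.uIoc_of_le (by linarith)] at ht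
      rw [Real.norm_of_nonneg (by positivity), h0 t ht.2]
      refine pow_le_pow_left₀ (norm_nonneg _) ?_ 2
      rcases le_total (t + x) 0 with h | h
      · rw [h0 _ h, sub_self, norm_zero]
        exact hη0
      · exact hη _ ⟨h, by linarith [hx.2, ht.2]⟩
    have h2 := (le_abs_self _).trans (intervalIntegral.norm_integral_le_of_norm_le_const h1)
    rw [zero_sub, neg_neg, abs_of_pos hk] at h2
    linarith
  · rw [intervalIntegral.integral_of_le hc, integral_Ioc_eq_integral_Ioo,
      ofReal_integral_eq_lintegral_ofReal (hcont.integrableOn_Icc.mono_set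
        Set.Ioo_subset_Icc_self) (ae_of_all _ fun t => by positivity), diffSq]
    refine le_trans (lintegral_mono_set (Set.Ioo_subset_Ioo_right
      (show c ≤ b - x by linarith [hx.2]))) (lintegral_mono fun t => ?_)
    rw [ENNReal.ofReal_pow (norm_nonneg _), ofReal_norm]

/-- The quadratic errors of the potential inequality, at the full step and on average over smaller
shifts, are at most `k (η² + ε)`, so they remain small after division by `k`. Negative times are
handled by continuity at `0`, positive ones by the `L²` modulus. -/
theorem average_sq_shift_le {u : ℝ → ℂ} (hu : Continuous u) (h0 : ∀ t ≤ 0, u t = u 0)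
    {k c b η ε : ℝ} (hk : 0 < k) (hc : 0 ≤ c) (hckb : c + k ≤ b) (hε : 0 ≤ ε)
    (hη : ∀ t ∈ Set.Icc 0 k, ‖u t - u 0‖ ≤ η) (h1 : diffSq u b k ≤ ENNReal.ofReal (ε * k))
    (h2 : ∫⁻ x in Set.Ioo 0 k, diffSq u b x ≤ ENNReal.ofReal (ε * k ^ 2)) :
    (∫ t in (-k)..c, ‖u (t + k) - u t‖ ^ 2) ≤ k * (η ^ 2 + ε) ∧
      (∫ x in (0 : ℝ)..k, ∫ t in (-k)..c, ‖u (t + x) - u t‖ ^ 2) ≤ k ^ 2 * (η ^ 2 + ε) := by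
  have hle := fun x hx => ofReal_integral_sq_shift_le hu h0 (x := x) hk hc hckb hx hη
  constructor
  · have h3 := (hle k ⟨hk.le, le_rfl⟩).trans (add_le_add le_rfl h1)
    rw [← ENNReal.ofReal_add (by positivity) (by positivity)] at h3
    have := (ENNReal.ofReal_le_ofReal_iff (by positivity)).1 h3
    linarith
  · set d : ℝ → ℝ := fun x => ∫ t in (-k)..c, ‖u (t + x) - u t‖ ^ 2 with hd
    have hdc : Continuous d := by
      refine intervalIntegral.continuous_parametric_intervalIntegral_of_continuous' ?_ _ _
      unfold Function.uncurry
      fun_prop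
    have hd0 : ∀ x, 0 ≤ d x := fun x => intervalIntegral.integral_nonneg (by linarith)
      fun t _ => by positivity
    have h3 : ENNReal.ofReal (∫ x in (0 : ℝ)..k, d x) ≤ ENNReal.ofReal (k ^ 2 * (η ^ 2 + ε)) := by
      rw [intervalIntegral.integral_of_le hk.le, integral_Ioc_eq_integral_Ioo,
        ofReal_integral_eq_lintegral_ofReal (hdc.integrableOn_Icc.mono_set
          Set.Ioo_subset_Icc_self) (ae_of_all _ hd0)]
      calc _ ≤ ∫⁻ x in Set.Ioo 0 k, (ENNReal.ofReal (k * η ^ 2) + diffSq u b x) :=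
            setLIntegral_mono' measurableSet_Ioo fun x hx => hle x ⟨hx.1.le, hx.2.le⟩
        _ ≤ ENNReal.ofReal (k * η ^ 2) * ENNReal.ofReal k + ENNReal.ofReal (ε * k ^ 2) := by
            rw [lintegral_add_left measurable_const, setLIntegral_const, Real.volume_Ioo, sub_zero]
            exact add_le_add le_rfl h2
        _ = _ := by
            rw [← ENNReal.ofReal_mul (by positivity), ← ENNReal.ofReal_add (by positivity)
              (by positivity)]
            congr 1
            ring
    exact (ENNReal.ofReal_le_ofReal_iff (by positivity)).1 h3

/-- The energy identity at the level of difference quotients. The pairing with `S` returns at most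
half of the energy, which is absorbed; `w` contributes the increment of its potential. So `u` enters
through its values at `c` and `0`, its size in between appearing only in terms multiplied by `η` or
`ε`. -/
theorem energy_diffQuot_le_of_small {lam A : ℝ} (hlam : 0 < lam) {S : ℝ → ℂ} (hS : Continuous S)
    (hSE : IsEnergyBounded lam A S) {w : ℂ → ℂ} (hw : Continuous w) {G : ℂ → ℝ} (hG : Continuous G)
    {b : ℝ} {u : ℝ → ℂ} (h : IsRotatingSolution lam S w b u) {k c B L η ε : ℝ} (hk : 0 < k)
    (hc : 0 ≤ c) (hckb : c + k ≤ b) (hε : 0 ≤ ε) (hL0 : 0 ≤ L)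
    (hB : ∀ t ∈ Set.Icc (-k) 0, ‖S t - w (u t)‖ ≤ B)
    (hη : ∀ t ∈ Set.Icc 0 k, ‖u t - u 0‖ ≤ η)
    (hL : ∀ x ∈ Set.Icc 0 k, ∀ t ∈ Set.Icc (-k) c, G (u (t + k)) - G (u t) -
      ((starRingEnd ℂ) (u (t + k) - u t) * w (u (t + x))).re ≤
        L * (‖u (t + x) - u t‖ ^ 2 + ‖u (t + k) - u t‖ ^ 2))
    (hGc : ∀ t ∈ Set.Icc c (c + k), G (u c) - 1 / 16 ≤ G (u t))
    (h1 : diffSq u b k ≤ ENNReal.ofReal (ε * k))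
    (h2 : ∫⁻ x in Set.Ioo 0 k, diffSq u b x ≤ ENNReal.ofReal (ε * k ^ 2)) :
    energy lam (diffQuot u k c) < ∞ ∧ (energy lam (diffQuot u k c)).toReal / 2 ≤
      A + 2 * |G (u c)| + 2 * |G (u 0)| + 1 / 8 + 2 * (η * B) + 4 * L * (η ^ 2 + ε) := by
  have hu := h.cont
  have hkc : -k ≤ c := by linarith
  set P : ℝ → ℂ := fun t => u t - u 0 with hP
  set H : ℝ → ℂ := fun t => S t - w (u t) with hH
  have hHc : Continuous H := by fun_prop
  set D : ℝ → ℂ := fun t => (u (t + k) - u t) / k with hD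
  have hDc : Continuous D := by fun_prop
  have hDcc : Continuous fun t => (starRingEnd ℂ) (D t) := Complex.continuous_conj.comp hDc
  obtain ⟨hE1, hE2⟩ := energy_diffQuot hlam (P := P) (by fun_prop)
    (fun t ht => by simp only [hP]; rw [h.const t ht, sub_self]) hk hc
  rw [diffQuot_sub_const] at hE1 hE2
  refine ⟨hE1, ?_⟩
  set E := (energy lam (diffQuot u k c)).toReal with hE
  have e1 : ∫ t in (-k)..c, (starRingEnd ℂ) ((P (t + k) - P t) / k) *
      ((causal lam P (t + k) - causal lam P t) / k) =
      ∫ t in (-k)..c, (starRingEnd ℂ) (D t) * (((∫ x in (0 : ℝ)..(max (t + k) 0), H x) -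
      ∫ x in (0 : ℝ)..(max t 0), H x) / k) := by
    refine intervalIntegral.integral_congr fun t ht => ?_
    rw [Set.uIcc_of_le hkc] at ht
    simp only [hP, hD]
    rw [h.causal_eq (by linarith [ht.2]), h.causal_eq (by linarith [ht.2]), sub_sub_sub_cancel_right]
  have hηD : ∀ t ∈ Set.Icc (-k) 0, ‖D t‖ ≤ η / k := by
    intro t ht
    simp only [hD]
    rw [h.const t ht.2, norm_div, Complex.norm_real, Real.norm_of_nonneg hk.le]
    gcongr
    exact hη _ ⟨by linarith [ht.1], by linarith [ht.2]⟩
  have e2 := norm_causal_sub_average_le hHc hDc hk hc hB hηD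
  rw [← e1, integral_conj_mul_average hHc hDc] at e2
  set X := ∫ t in (-k)..c, (starRingEnd ℂ) ((P (t + k) - P t) / k) *
      ((causal lam P (t + k) - causal lam P t) / k) with hX
  set Ψ : ℝ → ℂ := fun x => ∫ t in (-k)..c, (starRingEnd ℂ) (D t) * H (t + x) with hΨ
  have hΨc : Continuous Ψ := by
    refine intervalIntegral.continuous_parametric_intervalIntegral_of_continuous' ?_ _ _
    unfold Function.uncurry
    exact (hDcc.comp continuous_snd).mul (hHc.comp (by fun_prop))
  set d : ℝ → ℝ := fun x => ∫ t in (-k)..c, ‖u (t + x) - u t‖ ^ 2 with hd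
  have hdc : Continuous d := by
    refine intervalIntegral.continuous_parametric_intervalIntegral_of_continuous' ?_ _ _
    unfold Function.uncurry
    fun_prop
  set J := ∫ t in c..(c + k), G (u t) with hJ
  obtain ⟨hd1, hd2⟩ := average_sq_shift_le hu h.const hk hc hckb hε hη h1 h2
  have e3 : ∀ x ∈ Set.Icc 0 k, 2 * (Ψ x).re ≤ A + E / 2 - 2 / k * J + 2 * G (u 0) +
      2 * L / k * (d x + d k) := fun x hx =>
    re_integral_conj_mul_shift_le hS hSE hw hG hu hk hc h.const (hL x hx) hE1
  have e4 : ((∫ x in (0 : ℝ)..k, Ψ x) / k).re = (∫ x in (0 : ℝ)..k, (Ψ x).re) / k := by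
    rw [Complex.div_ofReal_re]
    congr 1
    have := (Complex.reCLM.intervalIntegral_comp_comm (hΨc.intervalIntegrable (μ := volume) 0 k))
    simpa using this.symm
  have e5 : 2 * ∫ x in (0 : ℝ)..k, (Ψ x).re ≤
      k * (A + E / 2 - 2 / k * J + 2 * G (u 0) + 2 * L / k * d k) +
        2 * L / k * ∫ x in (0 : ℝ)..k, d x := by
    have hΨr : Continuous fun x => (Ψ x).re := Complex.continuous_re.comp hΨc
    calc 2 * ∫ x in (0 : ℝ)..k, (Ψ x).re = ∫ x in (0 : ℝ)..k, 2 * (Ψ x).re := by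
          rw [intervalIntegral.integral_const_mul]
      _ ≤ ∫ x in (0 : ℝ)..k, ((A + E / 2 - 2 / k * J + 2 * G (u 0) + 2 * L / k * d k) +
          2 * L / k * d x) := by
          refine intervalIntegral.integral_mono_on hk.le
            (Continuous.intervalIntegrable (by fun_prop) _ _)
            (Continuous.intervalIntegrable (by fun_prop) _ _) fun x hx => ?_
          have := e3 x hx
          linarith
      _ = _ := by
          rw [intervalIntegral.integral_add (Continuous.intervalIntegrable (by fun_prop) _ _)
            (Continuous.intervalIntegrable (by fun_prop) _ _), intervalIntegral.integral_const,
            intervalIntegral.integral_const_mul, sub_zero, smul_eq_mul]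
  have hJle : k * (G (u c) - 1 / 16) ≤ J := by
    have := intervalIntegral.integral_mono_on (f := fun _ => G (u c) - 1 / 16)
      (g := fun t => G (u t)) (a := c) (b := c + k) (μ := volume) (by linarith)
      (Continuous.intervalIntegrable (by fun_prop) _ _)
      (Continuous.intervalIntegrable (by fun_prop) _ _) hGc
    rwa [intervalIntegral.integral_const, add_sub_cancel_left, smul_eq_mul] at this
  have e6 : X.re ≤ ((∫ x in (0 : ℝ)..k, Ψ x) / k).re + η * B := by
    have := (Complex.re_le_norm _).trans e2
    rw [Complex.sub_re] at this
    linarith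
  rw [e4] at e6
  set Y := ∫ x in (0 : ℝ)..k, (Ψ x).re with hY
  have e7 : 2 * (Y / k) ≤ A + E / 2 - 2 * (G (u c) - 1 / 16) + 2 * G (u 0) +
      4 * L * (η ^ 2 + ε) := by
    have f1 : 2 / k * J ≥ 2 * (G (u c) - 1 / 16) := by
      calc 2 / k * J ≥ 2 / k * (k * (G (u c) - 1 / 16)) :=
            mul_le_mul_of_nonneg_left hJle (by positivity)
        _ = _ := by field_simp
    have f2 : 2 * L / k * d k ≤ 2 * L * (η ^ 2 + ε) := by
      calc 2 * L / k * d k ≤ 2 * L / k * (k * (η ^ 2 + ε)) :=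
            mul_le_mul_of_nonneg_left hd1 (by positivity)
        _ = _ := by field_simp
    have f3 : 2 * L / k * ∫ x in (0 : ℝ)..k, d x ≤ k * (2 * L * (η ^ 2 + ε)) := by
      calc _ ≤ 2 * L / k * (k ^ 2 * (η ^ 2 + ε)) :=
            mul_le_mul_of_nonneg_left hd2 (by positivity)
        _ = _ := by field_simp
    have f4 : 2 * Y ≤ k * (A + E / 2 - 2 * (G (u c) - 1 / 16) + 2 * G (u 0) +
        4 * L * (η ^ 2 + ε)) := by
      have : k * (A + E / 2 - 2 / k * J + 2 * G (u 0) + 2 * L / k * d k) ≤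
          k * (A + E / 2 - 2 * (G (u c) - 1 / 16) + 2 * G (u 0) + 2 * L * (η ^ 2 + ε)) :=
        mul_le_mul_of_nonneg_left (by linarith) hk.le
      linarith
    rw [← mul_div_assoc, div_le_iff₀ hk]
    linarith
  have g1 := neg_abs_le (G (u c))
  have g2 := le_abs_self (G (u 0))
  linarith

/-- The energy of difference quotients is bounded by the current size of the solution, for
arbitrarily small steps. -/
theorem exists_energy_diffQuot_le {lam A : ℝ} (hlam : 0 < lam) {S : ℝ → ℂ} (hS : Continuous S)
    (hSE : IsEnergyBounded lam A S) {w : ℂ → ℂ} (hw : Continuous w) {G : ℂ → ℝ} (hG : Continuous G)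
    (hGp : IsPotential w G) {b : ℝ} {u : ℝ → ℂ} (h : IsRotatingSolution lam S w b u)
    (hu2 : halfSeminorm u b < ∞) {c : ℝ} (hc : 0 ≤ c) (hcb : c < b) {δ : ℝ} (hδ : 0 < δ) :
    ∃ k ∈ Set.Ioo 0 δ, energy lam (diffQuot u k c) < ∞ ∧
      (energy lam (diffQuot u k c)).toReal ≤
        2 * A + 4 * |G (u c)| + 4 * |G (u 0)| + 1 := by
  have hu := h.cont
  obtain ⟨K, hK⟩ := isCompact_Icc.exists_bound_of_continuousOn (s := Set.Icc (-1) b) hu.continuousOn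
  obtain ⟨L, hL0, hL⟩ := hGp K
  obtain ⟨B, hB⟩ := isCompact_Icc.exists_bound_of_continuousOn (s := Set.Icc (-1 : ℝ) 0)
    (by fun_prop : Continuous fun t => S t - w (u t)).continuousOn
  have hB0 : 0 ≤ B := (norm_nonneg _).trans (hB 0 (by simp))
  -- `B` and `L` depend on the size of `u` over the whole interval; `η` is so small that their
  -- contribution, at most `2ηB + 8ηL`, stays below `1/8`, and they disappear from the conclusion.
  set η : ℝ := 1 / (16 * (B + 4 * L + 1)) with hη
  have hη0 : 0 < η := by positivity
  have hη1 : η * (16 * (B + 4 * L + 1)) = 1 := by rw [hη]; field_simp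
  obtain ⟨δ₁, hδ₁, h1⟩ := Metric.continuousAt_iff.1 (hu.continuousAt (x := (0 : ℝ))) η hη0
  obtain ⟨δ₂, hδ₂, h2⟩ := Metric.continuousAt_iff.1 ((hG.comp hu).continuousAt (x := c)) (1 / 16)
    (by norm_num)
  obtain ⟨k, hk, hk1, hk2⟩ := exists_small_step (hc.trans_lt hcb) hu2 hη0
    (show 0 < min (min δ 1) (min (min δ₁ δ₂) (b - c)) from
      lt_min (lt_min hδ one_pos) (lt_min (lt_min hδ₁ hδ₂) (by linarith)))
  have hk0 := hk.1
  have hkm := hk.2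
  simp only [lt_min_iff] at hkm
  obtain ⟨⟨hkδ, hkk⟩, ⟨hkδ₁, hkδ₂⟩, hkb⟩ := hkm
  obtain ⟨g1, g2⟩ := energy_diffQuot_le_of_small hlam hS hSE hw hG h hk0 hc (by linarith) hη0.le hL0
    (fun t ht => hB t ⟨by linarith [ht.1], ht.2⟩)
    (fun t ht => by
      rw [← dist_eq_norm]
      exact (h1 (by rw [Real.dist_eq, sub_zero, abs_of_nonneg ht.1]; linarith [ht.2])).le)
    (fun x hx t ht => hL _ _ _ (hK _ ⟨by linarith [ht.1], by linarith [ht.2]⟩)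
      (hK _ ⟨by linarith [ht.1], by linarith [ht.2]⟩)
      (hK _ ⟨by linarith [ht.1, hx.1], by linarith [ht.2, hx.2]⟩))
    (fun t ht => by
      have := h2 (show dist t c < δ₂ by
        rw [Real.dist_eq, abs_of_nonneg (by linarith [ht.1])]; linarith [ht.2])
      rw [Real.dist_eq] at this
      have := (abs_lt.1 this).1
      simp only [Function.comp] at this
      linarith) hk1 hk2
  refine ⟨k, ⟨hk0, hkδ⟩, g1, ?_⟩
  have hη2 : η ≤ 1 := by
    rw [hη, div_le_one (by positivity)]
    linarith
  have f1 : 4 * L * (η ^ 2 + η) ≤ 8 * (L * η) := by nlinarith [mul_nonneg hL0 hη0.le]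
  have f2 : 0 ≤ L * η := by positivity
  have f3 : 0 ≤ B * η := by positivity
  nlinarith

/-! ### Restarting the equation at a later time -/

theorem exists_average_sub_le {u : ℝ → ℂ} (hu : Continuous u) (c : ℝ) {ε : ℝ} (hε : 0 < ε) :
    ∃ δ > 0, ∀ k ∈ Set.Ioo 0 δ, ‖(∫ t in c..(c + k), u t) / k - u c‖ ≤ ε := by
  obtain ⟨δ, hδ, h⟩ := Metric.continuousAt_iff.1 (hu.continuousAt (x := c)) ε hε
  refine ⟨δ, hδ, fun k hk => ?_⟩
  have hk0 : (k : ℂ) ≠ 0 := Complex.ofReal_ne_zero.2 hk.1.ne'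
  have e : (∫ t in c..(c + k), u t) / k - u c = (∫ t in c..(c + k), (u t - u c)) / k := by
    rw [intervalIntegral.integral_sub (hu.intervalIntegrable _ _)
      (continuous_const.intervalIntegrable _ _), intervalIntegral.integral_const,
      add_sub_cancel_left, Complex.real_smul, sub_div, mul_div_cancel_left₀ _ hk0]
  have h2 : ‖∫ t in c..(c + k), (u t - u c)‖ ≤ ε * |c + k - c| := by
    refine intervalIntegral.norm_integral_le_of_norm_le_const fun t ht => ?_
    rw [Set.uIoc_of_le (by linarith [hk.1])] at ht
    rw [← dist_eq_norm]
    exact (h (by rw [Real.dist_eq, abs_of_pos (by linarith [ht.1])]; linarith [ht.2, hk.2])).le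
  rw [add_sub_cancel_left, abs_of_pos hk.1] at h2
  rw [e, norm_div, Complex.norm_real, Real.norm_of_nonneg hk.1.le, div_le_iff₀ hk.1]
  exact h2

theorem integrableOn_eKer_mul_diffQuot {lam : ℝ} (hlam : 0 < lam) {P : ℝ → ℂ} (hP : Continuous P)
    (hP0 : ∀ t ≤ 0, P t = 0) {k : ℝ} (hk : 0 < k) {c t : ℝ} (ht : t ≤ c) :
    IntegrableOn (fun τ => eKer lam (t - τ) * diffQuot P k c τ) (Set.Iio t) := by
  have e : ∀ τ : ℝ, t + k - (τ + k) = t - τ := fun τ => by ring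
  have h1 := integrableOn_Iio_comp_add (integrableOn_eKer_mul hlam hP hP0 (t + k))
  simp only [e] at h1
  refine IntegrableOn.congr_fun ((h1.sub (integrableOn_eKer_mul hlam hP hP0 t)).div_const (k : ℂ))
    (fun τ hτ => ?_) measurableSet_Iio
  simp only [Pi.sub_apply]
  by_cases h : -k < τ
  · rw [diffQuot, Set.indicator_of_mem (show τ ∈ Set.Ioo (-k) c from ⟨h, lt_of_lt_of_le hτ ht⟩)]
    ring
  · rw [diffQuot, Set.indicator_of_notMem fun h' => h h'.1, hP0 τ (by linarith),
      hP0 (τ + k) (by linarith)]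
    simp

/-- Splitting the past at time `a`. -/
theorem causal_diffQuot_split {lam : ℝ} (hlam : 0 < lam) {P : ℝ → ℂ} (hP : Continuous P)
    (hP0 : ∀ t ≤ 0, P t = 0) {k : ℝ} (hk : 0 < k) {a c t : ℝ} (ha : 0 ≤ a) (hat : a ≤ t)
    (ht : t ≤ c) :
    causal lam (diffQuot P k c) t = (∫ τ, eKer lam (t - τ) * diffQuot P k a τ) +
      cconv (eKer lam) (fun x => (P (a + x + k) - P (a + x)) / k) (t - a) := by
  have hi := integrableOn_eKer_mul_diffQuot hlam hP hP0 hk ht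
  have hU : Set.Iio t = Set.Iio a ∪ Set.Ico a t := (Set.Iio_union_Ico_eq_Iio hat).symm
  rw [causal]
  rw [hU] at hi ⊢
  rw [setIntegral_union ((Set.Iio_disjoint_Ici le_rfl).mono_right Set.Ico_subset_Ici_self)
    measurableSet_Ico (hi.mono_set Set.subset_union_left) (hi.mono_set Set.subset_union_right)]
  congr 1
  · rw [← integral_indicator measurableSet_Iio]
    refine integral_congr_ae (ae_of_all _ fun τ => ?_)
    by_cases h : τ < a
    · simp only
      rw [Set.indicator_of_mem (show τ ∈ Set.Iio a from h)]
      by_cases h' : -k < τ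
      · rw [diffQuot, diffQuot, Set.indicator_of_mem (show τ ∈ Set.Ioo (-k) a from ⟨h', h⟩),
          Set.indicator_of_mem (show τ ∈ Set.Ioo (-k) c from ⟨h', by linarith⟩)]
      · rw [diffQuot, diffQuot, Set.indicator_of_notMem fun h1 => h' h1.1,
          Set.indicator_of_notMem fun h1 => h' h1.1]
    · simp only
      rw [Set.indicator_of_notMem (show τ ∉ Set.Iio a from h), diffQuot, Set.indicator_of_notMem fun h1 => h h1.2, mul_zero]
  · rw [cconv, integral_Ico_eq_integral_Ioc, ← intervalIntegral.integral_of_le hat]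
    have := intervalIntegral.integral_comp_add_left (a := 0) (b := t - a)
      (fun τ => eKer lam (t - τ) * ((P (τ + k) - P τ) / k)) a
    rw [add_zero, add_sub_cancel] at this
    have e : ∀ x : ℝ, t - a - x = t - (a + x) := fun x => by ring
    simp only [e]
    rw [this, intervalIntegral.integral_of_le hat, intervalIntegral.integral_of_le hat,
      integral_Ioc_eq_integral_Ioo, integral_Ioc_eq_integral_Ioo]
    refine setIntegral_congr_fun measurableSet_Ioo fun τ hτ => ?_
    rw [diffQuot, Set.indicator_of_mem (show τ ∈ Set.Ioo (-k) c from
      ⟨by linarith [hτ.1], by linarith [hτ.2]⟩)]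

theorem absForm_restartBlock_lt_top {lam : ℝ} (hlam : 0 < lam) (c : ℂ) {P : ℝ → ℂ}
    (hP : Continuous P) {k a s : ℝ} (hk : 0 < k) (ha : 0 ≤ a) (hs : 0 < s) :
    absForm lam (restartBlock lam c a s) (diffQuot P k a) < ∞ := by
  obtain ⟨A, hA⟩ := exists_norm_diffQuot_le hP k a
  refine absForm_lt_top (b := -k) (c := a + s) hlam (integrable_restartBlock lam c a s)
    (fun t ht => ?_) (fun t ht => ?_) (integrable_diffQuot hP k a).aestronglyMeasurable hA
  · exact Set.indicator_of_notMem (fun h => ht ⟨by linarith [h.1], h.2⟩) _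
  · exact Set.indicator_of_notMem (fun h => ht ⟨h.1, by linarith [h.2]⟩) _

/-- The conjugation and reflection in `restartBlock` are made for this: the form against the past is
the restart kernel convolved with the memory term, evaluated at `a + s`. -/
theorem traceForm_restartBlock {lam : ℝ} (hlam : 0 < lam) (c : ℂ) {P : ℝ → ℂ}
    (hP : Continuous P) {k a s : ℝ} (hk : 0 < k) (ha : 0 ≤ a) (hs : 0 < s) :
    traceForm lam (restartBlock lam c a s) (diffQuot P k a) =
      ∫ t in a..(a + s), restartKernel lam c (a + s - t) *
        ∫ τ, eKer lam (t - τ) * diffQuot P k a τ := by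
  have hi := integrable_traceForm_integrand (measurable_restartBlock lam c a s).aestronglyMeasurable
    (measurable_diffQuot hP k a).aestronglyMeasurable (absForm_restartBlock_lt_top hlam c hP hk ha hs)
  rw [traceForm, Measure.volume_eq_prod, integral_prod _ hi,
    intervalIntegral.integral_of_le (by linarith), integral_Ioc_eq_integral_Ioo,
    ← integral_indicator measurableSet_Ioo]
  refine integral_congr_ae (ae_of_all _ fun t => ?_)
  by_cases h : t ∈ Set.Ioo a (a + s)
  · simp only [restartBlock, Set.indicator_of_mem h, Complex.conj_conj]
    rw [← integral_const_mul]
    simp only [mul_assoc]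
  · simp [restartBlock, Set.indicator_of_notMem h]

/-- The increment of the solution in terms of its recent past and the restart kernel. -/
theorem restart_identity {lam : ℝ} (hlam : 0 < lam) {r₀ : ℂ}
    (hr : ∀ t > 0, greenTrace lam 0 t = logKernel (-r₀) t + Complex.I * lam *
      ∫ x in (0 : ℝ)..t, greenTrace lam 0 x) {P : ℝ → ℂ} (hP : Continuous P)
    (hP0 : ∀ t ≤ 0, P t = 0) {k a s : ℝ} (hk : 0 < k) (ha : 0 ≤ a) (hs : 0 < s)
    {R : ℝ → ℂ} (hR : Continuous R)
    (hRP : ∀ t ∈ Set.Ioo a (a + s), causal lam (diffQuot P k (a + s)) t = R t) :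
    ∫ x in (0 : ℝ)..s, (P (a + x + k) - P (a + x)) / k =
      (∫ t in a..(a + s), restartKernel lam (-r₀) (a + s - t) * R t) -
        traceForm lam (restartBlock lam (-r₀) a s) (diffQuot P k a) := by
  set D : ℝ → ℂ := fun x => (P (a + x + k) - P (a + x)) / k with hD
  have hDc : Continuous D := by fun_prop
  set I := restartKernel lam (-r₀) with hI
  have hIk : IsLocKernel I := isLocKernel_restartKernel lam (-r₀)
  have hek := isLocKernel_eKer hlam
  have has : a ≤ a + s := by linarith
  obtain ⟨C, hC⟩ := isCompact_Icc.exists_bound_of_continuousOn (s := Set.Icc 0 s) hDc.continuousOn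
  -- The restart kernel inverts `eKer` up to one integration, so it recovers the increment from the
  -- part of the causal convolution that starts at `a`.
  have e1 : cconv I (cconv (eKer lam) D) s = ∫ x in (0 : ℝ)..s, D x := by
    rw [← cconv_assoc hs (hIk.int s) (hek.int s) hDc.aestronglyMeasurable
      fun x hx => hC x (Set.Ioo_subset_Icc_self hx), ← cconv_one_left]
    exact cconv_congr_left hs.le fun x hx => cconv_restartKernel_eKer hlam hr hx.1
  have e2 : cconv I (cconv (eKer lam) D) s =
      ∫ t in a..(a + s), I (a + s - t) * cconv (eKer lam) D (t - a) := by
    have := intervalIntegral.integral_comp_add_left (a := 0) (b := s)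
      (fun t => I (a + s - t) * cconv (eKer lam) D (t - a)) a
    rw [add_zero] at this
    rw [← this, cconv]
    refine intervalIntegral.integral_congr fun x _ => ?_
    rw [add_sub_add_left_eq_sub, add_sub_cancel_left]
  have hIi : IntervalIntegrable (fun t => I (a + s - t)) volume a (a + s) := by
    have := (hIk.intervalIntegrable le_rfl hs.le).comp_sub_left (a + s)
    rw [sub_zero, add_sub_cancel_right] at this
    exact this.symm
  have hcc : ContinuousOn (fun t => cconv (eKer lam) D (t - a)) (Set.uIcc a (a + s)) := by
    rw [Set.uIcc_of_le has]
    exact (continuousOn_cconv (hek.int s) hDc.continuousOn).comp (by fun_prop)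
      fun t ht => ⟨by linarith [ht.1], by linarith [ht.2]⟩
  have hIR : IntervalIntegrable (fun t => I (a + s - t) * (R t - cconv (eKer lam) D (t - a)))
      volume a (a + s) := hIi.mul_continuousOn (hR.continuousOn.sub hcc)
  rw [traceForm_restartBlock hlam (-r₀) hP hk ha hs, ← e1, e2, eq_sub_iff_add_eq']
  rw [show (∫ t in a..(a + s), I (a + s - t) * R t) = ∫ t in a..(a + s), (I (a + s - t) *
    (R t - cconv (eKer lam) D (t - a)) + I (a + s - t) * cconv (eKer lam) D (t - a)) by
      refine intervalIntegral.integral_congr fun t _ => ?_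
      ring, intervalIntegral.integral_add hIR (hIi.mul_continuousOn hcc)]
  congr 1
  rw [intervalIntegral.integral_of_le has, intervalIntegral.integral_of_le has,
    integral_Ioc_eq_integral_Ioo, integral_Ioc_eq_integral_Ioo]
  refine setIntegral_congr_fun measurableSet_Ioo fun t ht => ?_
  rw [← hRP t ht, causal_diffQuot_split hlam hP hP0 hk ha ht.1.le ht.2.le, add_sub_cancel_right]

/-- Telescoping: the integral of a difference quotient is a difference of averages over windows of
length `k`, which tend to the endpoint values. -/
theorem integral_shift_sub_complex {g : ℝ → ℂ} (hg : Continuous g) (k a s : ℝ) :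
    ∫ x in (0 : ℝ)..s, (g (a + x + k) - g (a + x)) / k =
      (∫ t in (a + s)..(a + s + k), g t) / k - (∫ t in a..(a + k), g t) / k := by
  have hi : ∀ a b, IntervalIntegrable g volume a b := fun a b => hg.intervalIntegrable a b
  have h1 : ∫ x in (0 : ℝ)..s, g (a + x + k) = ∫ t in (a + k)..(a + s + k), g t := by
    have := intervalIntegral.integral_comp_add_left (a := 0) (b := s) g (a + k)
    rw [add_zero, add_right_comm a k s] at this
    rw [← this]
    refine intervalIntegral.integral_congr fun x _ => ?_
    rw [add_right_comm]
  have h2 : ∫ x in (0 : ℝ)..s, g (a + x) = ∫ t in a..(a + s), g t := by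
    rw [intervalIntegral.integral_comp_add_left, add_zero]
  rw [intervalIntegral.integral_div, intervalIntegral.integral_sub
    (Continuous.intervalIntegrable (by fun_prop) _ _)
    (Continuous.intervalIntegrable (by fun_prop) _ _), h1, h2, ← sub_div,
    ← intervalIntegral.integral_add_adjacent_intervals (hi (a + k) (a + s)) (hi (a + s) (a + s + k)),
    ← intervalIntegral.integral_add_adjacent_intervals (hi a (a + k)) (hi (a + k) (a + s))]
  congr 1
  ring

theorem norm_integral_restartKernel_mul_le (lam : ℝ) (c : ℂ) {a s B : ℝ} (hs : 0 ≤ s) (hB0 : 0 ≤ B)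
    {R : ℝ → ℂ} (hB : ∀ t ∈ Set.Ioo a (a + s), ‖R t‖ ≤ B) :
    ‖∫ t in a..(a + s), restartKernel lam c (a + s - t) * R t‖ ≤
      B * ∫ t in (0 : ℝ)..s, volterraExp c.re t := by
  have has : a ≤ a + s := by linarith
  have h1 := (isLocKernel_restartKernel lam c).intervalIntegrable le_rfl hs
  have h2 : IntervalIntegrable (fun t => restartKernel lam c (a + s - t)) volume a (a + s) := by
    have := h1.comp_sub_left (a + s)
    rw [sub_zero, add_sub_cancel_right] at this
    exact this.symm
  calc _ ≤ ∫ t in a..(a + s), ‖restartKernel lam c (a + s - t)‖ * B := by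
        rw [intervalIntegral.integral_of_le has, intervalIntegral.integral_of_le has,
          integral_Ioc_eq_integral_Ioo, integral_Ioc_eq_integral_Ioo]
        refine norm_integral_le_of_norm_le
          (((intervalIntegrable_iff_integrableOn_Ioo_of_le has).1 h2).norm.mul_const B) ?_
        refine (ae_restrict_iff' measurableSet_Ioo).2 (ae_of_all _ fun t ht => ?_)
        rw [norm_mul]
        exact mul_le_mul_of_nonneg_left (hB t ht) (norm_nonneg _)
    _ = B * ∫ t in (0 : ℝ)..s, ‖restartKernel lam c t‖ := by
        rw [intervalIntegral.integral_mul_const, intervalIntegral.integral_comp_sub_left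
          (fun t => ‖restartKernel lam c t‖), sub_self, add_sub_cancel_left, mul_comm]
    _ ≤ _ := mul_le_mul_of_nonneg_left (integral_norm_restartKernel_le lam c hs) hB0

/-- Quantitative continuity of the solution after time `a`, in terms of its size at time `a`. -/
theorem norm_sub_le_of_restart {lam A : ℝ} (hlam : 0 < lam) {r₀ : ℂ}
    (hr : ∀ t > 0, greenTrace lam 0 t = logKernel (-r₀) t + Complex.I * lam *
      ∫ x in (0 : ℝ)..t, greenTrace lam 0 x) {S : ℝ → ℂ} (hS : Continuous S)
    (hSE : IsEnergyBounded lam A S) {w : ℂ → ℂ} (hw : Continuous w) {G : ℂ → ℝ} (hG : Continuous G)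
    (hGp : IsPotential w G) {C : ℝ} (hC : ∀ a s : ℝ, 0 < s → s < 1 →
      energy lam (restartBlock lam (-r₀) a s) < ∞ ∧
        (energy lam (restartBlock lam (-r₀) a s)).toReal ≤
          C * ∫ t in (0 : ℝ)..s, volterraExp (-r₀).re t)
    {b : ℝ} {u : ℝ → ℂ} (h : IsRotatingSolution lam S w b u) (hu2 : halfSeminorm u b < ∞)
    {a s s' B θ : ℝ} (ha : 0 ≤ a) (hs : 0 < s) (hs1 : s < 1) (hss' : s < s') (hsb : a + s' ≤ b)
    (hB : ∀ t ∈ Set.Icc a (a + s'), ‖S t - w (u t)‖ ≤ B) (hθ : 0 < θ) :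
    ‖u (a + s) - u a‖ ≤ B * (∫ t in (0 : ℝ)..s, volterraExp (-r₀).re t) +
      (θ⁻¹ * (C * ∫ t in (0 : ℝ)..s, volterraExp (-r₀).re t) +
        θ * (2 * A + 4 * |G (u a)| + 4 * |G (u 0)| + 1)) / 2 := by
  have hu := h.cont
  set V := ∫ t in (0 : ℝ)..s, volterraExp (-r₀).re t with hV
  have hB0 : 0 ≤ B := (norm_nonneg _).trans (hB a ⟨le_rfl, by linarith⟩)
  set H : ℝ → ℂ := fun t => S t - w (u t) with hH
  have hHc : Continuous H := by fun_prop
  set P : ℝ → ℂ := fun t => u t - u 0 with hP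
  have hPc : Continuous P := by fun_prop
  have hP0 : ∀ t ≤ 0, P t = 0 := fun t ht => by simp only [hP]; rw [h.const t ht, sub_self]
  -- The step `k` may be taken arbitrarily small with an energy bound independent of `k`; only the
  -- replacement of averages of `u` by values costs `ε`.
  refine le_of_forall_pos_le_add fun ε hε => ?_
  obtain ⟨δ₁, hδ₁, h1⟩ := exists_average_sub_le hu (a + s) (half_pos hε)
  obtain ⟨δ₂, hδ₂, h2⟩ := exists_average_sub_le hu a (half_pos hε)
  obtain ⟨k, hk, hk1, hk2⟩ := exists_energy_diffQuot_le hlam hS hSE hw hG hGp h hu2 ha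
    (show a < b by linarith) (show 0 < min (min δ₁ δ₂) (s' - s) from
      lt_min (lt_min hδ₁ hδ₂) (by linarith))
  have hk0 := hk.1
  have hkm := hk.2
  simp only [lt_min_iff] at hkm
  obtain ⟨⟨hkδ₁, hkδ₂⟩, hks⟩ := hkm
  set R : ℝ → ℂ := fun t => ((∫ x in (0 : ℝ)..(max (t + k) 0), H x) -
    ∫ x in (0 : ℝ)..(max t 0), H x) / k with hR
  have hprim : Continuous fun t => ∫ x in (0 : ℝ)..t, H x :=
    intervalIntegral.continuous_primitive (fun a b => hHc.intervalIntegrable a b) 0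
  have hRc : Continuous R :=
    ((hprim.comp (by fun_prop)).sub (hprim.comp (by fun_prop))).div_const _
  have hRP : ∀ t ∈ Set.Ioo a (a + s), causal lam (diffQuot P k (a + s)) t = R t := fun t ht => by
    rw [causal_diffQuot hlam hPc hP0 hk0 ht.2.le, h.causal_eq (by linarith [ht.2]),
      h.causal_eq (by linarith [ht.2])]
  have hRB : ∀ t ∈ Set.Ioo a (a + s), ‖R t‖ ≤ B := by
    intro t ht
    have ht0 : 0 ≤ t := ha.trans ht.1.le
    have e : R t = (∫ x in t..(t + k), H x) / k := by
      simp only [hR]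
      rw [max_eq_left ht0, max_eq_left (by linarith), intervalIntegral.integral_interval_sub_left
        (hHc.intervalIntegrable _ _) (hHc.intervalIntegrable _ _)]
    have h3 : ‖∫ x in t..(t + k), H x‖ ≤ B * |t + k - t| := by
      refine intervalIntegral.norm_integral_le_of_norm_le_const fun x hx => hB x ?_
      rw [Set.uIoc_of_le (by linarith)] at hx
      exact ⟨by linarith [ht.1, hx.1], by linarith [ht.2, hx.2]⟩
    rw [add_sub_cancel_left, abs_of_pos hk0] at h3
    rw [e, norm_div, Complex.norm_real, Real.norm_of_nonneg hk0.le, div_le_iff₀ hk0]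
    exact h3
  have hid := restart_identity hlam hr hPc hP0 hk0 ha hs hRc hRP
  have hPu : ∀ x : ℝ, (P (a + x + k) - P (a + x)) / (k : ℂ) = (u (a + x + k) - u (a + x)) / k :=
    fun x => by simp only [hP, sub_sub_sub_cancel_right]
  simp only [hPu] at hid
  rw [integral_shift_sub_complex hu] at hid
  obtain ⟨g1, g2⟩ := hC a s hs hs1
  have hf : diffQuot P k a = diffQuot u k a := diffQuot_sub_const u _ k a
  have h4 := two_mul_norm_traceForm_le hlam (integrable_restartBlock lam (-r₀) a s)
    (integrable_diffQuot hPc k a) (absForm_restartBlock_lt_top hlam (-r₀) hPc hk0 ha hs) g1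
    (by rwa [hf]) hθ
  have h5 := norm_integral_restartKernel_mul_le lam (-r₀) hs.le hB0 hRB
  set X := (∫ t in (a + s)..(a + s + k), u t) / (k : ℂ) with hX
  set Y := (∫ t in a..(a + k), u t) / (k : ℂ) with hY
  have h6 : ‖u (a + s) - u a‖ ≤ ‖X - Y‖ + ε := by
    have e : u (a + s) - u a = (X - Y) - (X - u (a + s)) + (Y - u a) := by ring
    have := h1 k ⟨hk0, hkδ₁⟩
    have := h2 k ⟨hk0, hkδ₂⟩
    rw [e]
    refine (norm_add_le _ _).trans ?_
    have := norm_sub_le (X - Y) (X - u (a + s))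
    linarith
  rw [hid] at h6
  rw [hf] at h4 h6
  have h7 := norm_sub_le (∫ t in a..(a + s), restartKernel lam (-r₀) (a + s - t) * R t)
    (traceForm lam (restartBlock lam (-r₀) a s) (diffQuot u k a))
  have h8 : θ⁻¹ * (energy lam (restartBlock lam (-r₀) a s)).toReal ≤ θ⁻¹ * (C * V) :=
    mul_le_mul_of_nonneg_left g2 (by positivity)
  have h9 : θ * (energy lam (diffQuot u k a)).toReal ≤
      θ * (2 * A + 4 * |G (u a)| + 4 * |G (u 0)| + 1) :=
    mul_le_mul_of_nonneg_left hk2 hθ.le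
  linarith

/-- A first time at which a continuous function reaches a higher level. -/
theorem exists_first_level {f : ℝ → ℝ} {a t K : ℝ} (hat : a ≤ t) (hf : ContinuousOn f (Set.Icc a t))
    (ha : f a < K) (ht : K < f t) :
    ∃ c ∈ Set.Ioo a t, f c = K ∧ ∀ x ∈ Set.Icc a c, f x ≤ K := by
  set E : Set ℝ := Set.Icc a t ∩ f ⁻¹' {K} with hE
  have hEc : IsCompact E := isCompact_Icc.of_isClosed_subset
    (hf.preimage_isClosed_of_isClosed isClosed_Icc isClosed_singleton) Set.inter_subset_left
  have hne : ∀ x ∈ Set.Icc a t, K < f x → ∃ y ∈ Set.Icc a x, f y = K := fun x hx h =>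
    intermediate_value_Icc hx.1 (hf.mono (Set.Icc_subset_Icc_right hx.2)) ⟨ha.le, h.le⟩
  obtain ⟨y, hy, hyK⟩ := hne t ⟨hat, le_rfl⟩ ht
  have hmem := hEc.sInf_mem ⟨y, hy, hyK⟩
  have hcK : f (sInf E) = K := hmem.2
  refine ⟨sInf E, ⟨lt_of_le_of_ne hmem.1.1 fun h => ?_, lt_of_le_of_ne hmem.1.2 fun h => ?_⟩, hcK,
    fun x hx => ?_⟩
  · rw [← h] at hcK; linarith
  · rw [h] at hcK; linarith
  · by_contra! hlt
    obtain ⟨z, hz, hzK⟩ := hne x ⟨hx.1, hx.2.trans hmem.1.2⟩ hlt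
    have h1 : sInf E ≤ z := csInf_le hEc.bddBelow ⟨⟨hz.1, hz.2.trans (hx.2.trans hmem.1.2)⟩, hzK⟩
    have h2 : z = x := le_antisymm hz.2 (hx.2.trans h1)
    rw [← h2, hzK] at hlt
    exact lt_irrefl _ hlt

/-- A solution that does not tend to infinity in norm at a finite time is bounded before it. -/
theorem exists_bound_of_frequently {lam A : ℝ} (hlam : 0 < lam) {r₀ : ℂ}
    (hr : ∀ t > 0, greenTrace lam 0 t = logKernel (-r₀) t + Complex.I * lam *
      ∫ x in (0 : ℝ)..t, greenTrace lam 0 x) {S : ℝ → ℂ} (hS : Continuous S)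
    (hSE : IsEnergyBounded lam A S) {w : ℂ → ℂ} (hw : Continuous w) {G : ℂ → ℝ} (hG : Continuous G)
    (hGp : IsPotential w G) {T : ℝ} (hT : 0 < T) {v : ℝ → ℂ} (hv : ContinuousOn v (Set.Ico 0 T))
    (hsol : ∀ b ∈ Set.Ioo 0 T, ∃ u, IsRotatingSolution lam S w b u ∧ halfSeminorm u b < ∞ ∧
      Set.EqOn u v (Set.Icc 0 b))
    {K : ℝ} (hK : ∃ᶠ t in 𝓝[<] T, ‖v t‖ ≤ K) : ∃ M, ∀ t ∈ Set.Ico 0 T, ‖v t‖ ≤ M := by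
  obtain ⟨C, -, hC⟩ := energy_restartBlock_le hlam (-r₀)
  obtain ⟨g, hg⟩ := (isCompact_closedBall (0 : ℂ) K).exists_bound_of_continuousOn hG.continuousOn
  obtain ⟨B₁, hB₁⟩ := isCompact_Icc.exists_bound_of_continuousOn (s := Set.Icc 0 T) hS.continuousOn
  obtain ⟨B₂, hB₂⟩ :=
    (isCompact_closedBall (0 : ℂ) (K + 2)).exists_bound_of_continuousOn hw.continuousOn
  -- `M` bounds the energy of the past at any restart time `a` with `‖v a‖ ≤ K`. With `θ = 1/(2M)`
  -- that energy contributes at most `1/4` to the increment, and a short time span makes the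
  -- remaining terms less than `1/4`.
  set M := |2 * A| + 4 * |g| + 4 * |G (v 0)| + 1 with hM
  have hM0 : 0 < M := by positivity
  set θ := 1 / (2 * M) with hθ
  have hθ0 : 0 < θ := by positivity
  have hθM : θ * M = 1 / 2 := by rw [hθ]; field_simp
  have hev : ∀ᶠ s in 𝓝[>] (0 : ℝ), (B₁ + B₂ + θ⁻¹ * C / 2) *
      (∫ t in (0 : ℝ)..s, volterraExp (-r₀).re t) < 1 / 4 := by
    have := (tendsto_integral_volterraExp (-r₀).re).const_mul (B₁ + B₂ + θ⁻¹ * C / 2)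
    rw [mul_zero] at this
    exact this.eventually_lt_const (by norm_num)
  obtain ⟨s₁, hs₁, hsmall⟩ := mem_nhdsGT_iff_exists_Ioo_subset.1 hev
  have hs₁0 : 0 < s₁ := hs₁
  set s₀ := min s₁ 1 with hs₀
  have hs₀0 : 0 < s₀ := lt_min hs₁0 one_pos
  obtain ⟨a, haK, ha⟩ := (hK.and_eventually
    (Ioo_mem_nhdsLT (show max (T - s₀) 0 < T from max_lt (by linarith) hT))).exists
  have ha0 : 0 < a := (le_max_right _ _).trans_lt ha.1
  have haT : a < T := ha.2
  have has₀ : T - a < s₀ := by linarith [(le_max_left (T - s₀) 0).trans_lt ha.1]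
  -- Up to the first time `c` at which the norm reaches `K + 1`, the constants do not depend on `c`,
  -- and the increment from `a` to `c` comes out below `1`, a contradiction.
  have hclaim : ∀ t ∈ Set.Ico a T, ‖v t‖ ≤ K + 1 := by
    intro t ht
    by_contra! hlt
    obtain ⟨c, hc, hcK, hcle⟩ := exists_first_level (f := fun x => ‖v x‖) ht.1
      (hv.norm.mono fun x hx => ⟨ha0.le.trans hx.1, hx.2.trans_lt ht.2⟩)
      (show ‖v a‖ < K + 1 by linarith) hlt
    have hcT : c < T := hc.2.trans ht.2
    have hca : ContinuousAt v c := hv.continuousAt (Ico_mem_nhds (ha0.trans hc.1) hcT)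
    obtain ⟨δ, hδ, hcd⟩ := Metric.continuousAt_iff.1 hca 1 one_pos
    -- Difference quotients look slightly past `c`; on this extra room the norm stays below `K + 2`,
    -- the radius used for the bound on `w`.
    set η := min δ (T - c) / 2 with hη
    have hη0 : 0 < η := half_pos (lt_min hδ (by linarith))
    have hηδ : η < δ := by
      have := min_le_left δ (T - c)
      linarith
    have hηT : c + η < T := by
      have := min_le_right δ (T - c)
      linarith
    obtain ⟨u, hu, hu2, huv⟩ := hsol (c + η) ⟨by linarith [hc.1], hηT⟩
    have hua : u a = v a := huv ⟨ha0.le, by linarith [hc.1]⟩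
    have huc : u c = v c := huv ⟨by linarith [hc.1], by linarith⟩
    have hu0 : u 0 = v 0 := huv ⟨le_rfl, by linarith [hc.1]⟩
    have hs : 0 < c - a := by linarith [hc.1]
    have hbound : ∀ x ∈ Set.Icc a (a + (c - a + η)), ‖S x - w (u x)‖ ≤ B₁ + B₂ := by
      intro x hx
      have hx2 : x ≤ c + η := by linarith [hx.2]
      have hxu : ‖u x‖ ≤ K + 2 := by
        rw [huv ⟨by linarith [hx.1], hx2⟩]
        rcases le_total x c with h | h
        · have := hcle x ⟨hx.1, h⟩
          linarith
        · have h3 := hcd (show dist x c < δ by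
            rw [Real.dist_eq, abs_of_nonneg (by linarith)]; linarith)
          rw [dist_eq_norm] at h3
          have h4 := norm_sub_norm_le (v x) (v c)
          linarith
      refine (norm_sub_le _ _).trans (add_le_add (hB₁ x ⟨by linarith [hx.1], by linarith⟩)
        (hB₂ _ (by simpa using hxu)))
    have hstep := norm_sub_le_of_restart (a := a) (s := c - a) (s' := c - a + η) (B := B₁ + B₂)
      (θ := θ) hlam hr hS hSE hw hG hGp hC hu hu2 ha0.le hs
      (by linarith [min_le_right s₁ 1]) (by linarith) (by linarith) hbound hθ0
    rw [add_sub_cancel, hua, huc, hu0] at hstep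
    have hV := hsmall (show c - a ∈ Set.Ioo 0 s₁ from ⟨hs, by linarith [min_le_left s₁ 1]⟩)
    simp only [Set.mem_ofPred_eq] at hV
    have hGa : |G (v a)| ≤ |g| := by
      have := hg (v a) (by simpa using haK)
      rw [Real.norm_eq_abs] at this
      exact this.trans (le_abs_self g)
    have h5 : θ * (2 * A + 4 * |G (v a)| + 4 * |G (v 0)| + 1) ≤ 1 / 2 := by
      rw [← hθM]
      exact mul_le_mul_of_nonneg_left (by linarith [le_abs_self (2 * A)]) hθ0.le
    have h6 := norm_sub_norm_le (v c) (v a)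
    set V := ∫ t in (0 : ℝ)..(c - a), volterraExp (-r₀).re t
    have h7 : (B₁ + B₂ + θ⁻¹ * C / 2) * V = (B₁ + B₂) * V + θ⁻¹ * (C * V) / 2 := by ring
    linarith
  obtain ⟨M₁, hM₁⟩ := isCompact_Icc.exists_bound_of_continuousOn (s := Set.Icc 0 a)
    (hv.mono fun x hx => ⟨hx.1, hx.2.trans_lt haT⟩)
  refine ⟨max M₁ (K + 1), fun t ht => ?_⟩
  rcases le_total t a with h | h
  · exact (hM₁ t ⟨ht.1, h⟩).trans (le_max_left _ _)
  · exact (hclaim t ⟨h, ht.2⟩).trans (le_max_right _ _)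

/-! ### The power nonlinearity and its potential -/

theorem abs_rpow_sub_rpow_le {p M x y : ℝ} (hp : 1 ≤ p) (hx : x ∈ Set.Icc 0 M)
    (hy : y ∈ Set.Icc 0 M) : |x ^ p - y ^ p| ≤ p * M ^ (p - 1) * |x - y| := by
  have h := (convex_Icc (0 : ℝ) M).norm_image_sub_le_of_norm_hasDerivWithin_le
    (f := fun x : ℝ => x ^ p) (f' := fun x => p * x ^ (p - 1)) (C := p * M ^ (p - 1))
    (fun z _ => (Real.hasDerivAt_rpow_const (Or.inr hp)).hasDerivWithinAt)
    (fun z hz => by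
      have := Real.rpow_nonneg hz.1 (p - 1)
      rw [Real.norm_of_nonneg (by positivity)]
      exact mul_le_mul_of_nonneg_left (Real.rpow_le_rpow hz.1 hz.2 (by linarith)) (by linarith))
    hy hx
  simpa [Real.norm_eq_abs] using h

/-- Since `2σ ≥ 1`, the factor `|z|^{2σ}` is a differentiable function of `|z|` with locally bounded
derivative; the product with `z` is then estimated termwise. -/
theorem isLipschitzOnBounded_powerNonlinearity {σ : ℝ} (hσ : 1 / 2 ≤ σ) :
    IsLipschitzOnBounded (powerNonlinearity σ) := by
  intro M'
  set M := max M' 0 with hM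
  have hM0 : 0 ≤ M := le_max_right _ _
  refine ⟨M ^ (2 * σ) + 2 * σ * M ^ (2 * σ - 1) * M, by positivity, fun z w hz hw => ?_⟩
  have hz' : ‖z‖ ≤ M := hz.trans (le_max_left _ _)
  have hw' : ‖w‖ ≤ M := hw.trans (le_max_left _ _)
  have e : powerNonlinearity σ z - powerNonlinearity σ w =
      ((‖z‖ ^ (2 * σ) : ℝ) : ℂ) * (z - w) +
        ((‖z‖ ^ (2 * σ) - ‖w‖ ^ (2 * σ) : ℝ) : ℂ) * w := by
    simp only [powerNonlinearity]
    push_cast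
    ring
  have h1 := abs_rpow_sub_rpow_le (p := 2 * σ) (M := M) (by linarith) ⟨norm_nonneg z, hz'⟩
    ⟨norm_nonneg w, hw'⟩
  have h2 := abs_norm_sub_norm_le z w
  have h3 : ‖z‖ ^ (2 * σ) ≤ M ^ (2 * σ) := Real.rpow_le_rpow (norm_nonneg _) hz' (by linarith)
  rw [e]
  refine (norm_add_le _ _).trans ?_
  rw [norm_mul, norm_mul, Complex.norm_real, Complex.norm_real, Real.norm_of_nonneg
    (Real.rpow_nonneg (norm_nonneg _) _), Real.norm_eq_abs, add_mul]
  refine add_le_add (mul_le_mul_of_nonneg_right h3 (norm_nonneg _)) ?_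
  calc |‖z‖ ^ (2 * σ) - ‖w‖ ^ (2 * σ)| * ‖w‖ ≤ 2 * σ * M ^ (2 * σ - 1) * ‖z - w‖ * M := by
        refine mul_le_mul (h1.trans (mul_le_mul_of_nonneg_left h2 ?_)) hw' (norm_nonneg _) ?_ <;>
          positivity
    _ = _ := by ring

theorem IsLipschitzOnBounded.const_mul_add {W : ℂ → ℂ} (hW : IsLipschitzOnBounded W) (c d : ℂ) :
    IsLipschitzOnBounded fun z => c * W z + d * z := by
  intro M
  obtain ⟨L, hL0, hL⟩ := hW M
  refine ⟨‖c‖ * L + ‖d‖, by positivity, fun z w hz hw => ?_⟩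
  rw [show c * W z + d * z - (c * W w + d * w) = c * (W z - W w) + d * (z - w) by ring]
  refine (norm_add_le _ _).trans ?_
  rw [norm_mul, norm_mul, add_mul, mul_assoc]
  gcongr
  exact hL z w hz hw

/-- The potential of `c |z|^(2σ) z + d z`. -/
def powerPotential (σ c d : ℝ) (z : ℂ) : ℝ :=
  c / (2 * (σ + 1)) * Complex.normSq z ^ (σ + 1) + d / 2 * Complex.normSq z

theorem continuous_powerPotential {σ : ℝ} (hσ : 1 / 2 ≤ σ) (c d : ℝ) :
    Continuous (powerPotential σ c d) := by
  unfold powerPotential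
  have h := Complex.continuous_normSq
  exact (continuous_const.mul (h.rpow_const fun _ => Or.inr (by linarith))).add
    (continuous_const.mul h)

/-- The mean value theorem on the segment from `z` to `z'`: subtracting the linear pairing with `w
z''` leaves the derivative `Re conj(z' - z) (w(p s) - w(z''))`, which is quadratic by the Lipschitz
bound, the segment staying in the ball. -/
theorem isPotential_powerPotential {σ : ℝ} (hσ : 1 / 2 ≤ σ) (c d : ℝ) :
    IsPotential (fun z => (c : ℂ) * powerNonlinearity σ z + (d : ℂ) * z)
      (powerPotential σ c d) := by
  intro K
  obtain ⟨L, hL0, hL⟩ :=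
    (isLipschitzOnBounded_powerNonlinearity hσ).const_mul_add (c : ℂ) (d : ℂ) K
  refine ⟨2 * L, by positivity, fun z z' z'' hz hz' hz'' => ?_⟩
  set w : ℂ → ℂ := fun z => (c : ℂ) * powerNonlinearity σ z + (d : ℂ) * z with hw
  set Δ := z' - z with hΔ
  set p : ℝ → ℂ := fun s => z + s * Δ with hp
  have hN : ∀ s, HasDerivAt (fun s => Complex.normSq (p s)) (2 * ((starRingEnd ℂ) Δ * p s).re) s := by
    intro s
    have e : (fun s => Complex.normSq (p s)) = fun s : ℝ => (z.re + s * Δ.re) * (z.re + s * Δ.re) +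
        (z.im + s * Δ.im) * (z.im + s * Δ.im) := by
      funext s
      simp [Complex.normSq_apply, hp]
    rw [e]
    have h1 : HasDerivAt (fun s : ℝ => z.re + s * Δ.re) Δ.re s := by
      simpa using ((hasDerivAt_id s).mul_const Δ.re).const_add z.re
    have h2 : HasDerivAt (fun s : ℝ => z.im + s * Δ.im) Δ.im s := by
      simpa using ((hasDerivAt_id s).mul_const Δ.im).const_add z.im
    refine ((h1.mul h1).add (h2.mul h2)).congr_deriv ?_
    simp [hp]
    ring
  set φ : ℝ → ℝ := fun s => powerPotential σ c d (p s) - s * ((starRingEnd ℂ) Δ * w z'').re with hφ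
  have hφ' : ∀ s, HasDerivAt φ (((starRingEnd ℂ) Δ * (w (p s) - w z'')).re) s := by
    intro s
    have h1 := ((hN s).rpow_const (p := σ + 1) (Or.inr (by linarith))).const_mul (c / (2 * (σ + 1)))
    have h2 := (hN s).const_mul (d / 2)
    refine ((h1.add h2).sub ((hasDerivAt_id s).mul_const _)).congr_deriv ?_
    have e1 : Complex.normSq (p s) ^ (σ + 1 - 1) = ‖p s‖ ^ (2 * σ) := by
      rw [Complex.normSq_eq_norm_sq, add_sub_cancel_right, Real.rpow_mul (norm_nonneg _),
        Real.rpow_two]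
    have e2 : ((starRingEnd ℂ) Δ * w (p s)).re =
        (c * ‖p s‖ ^ (2 * σ) + d) * ((starRingEnd ℂ) Δ * p s).re := by
      rw [← Complex.re_ofReal_mul]
      congr 1
      simp only [hw, powerNonlinearity]
      push_cast
      ring
    have hσ0 : σ + 1 ≠ 0 := by linarith
    rw [e1, mul_sub, Complex.sub_re, e2]
    field_simp
  have hK : ∀ s ∈ Set.Icc (0 : ℝ) 1, ‖p s‖ ≤ K := by
    intro s hs
    have e : p s = ((1 - s : ℝ) : ℂ) * z + (s : ℂ) * z' := by
      simp only [hp, hΔ]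
      push_cast
      ring
    rw [e]
    refine (norm_add_le _ _).trans ?_
    rw [norm_mul, norm_mul, Complex.norm_real, Complex.norm_real, Real.norm_of_nonneg hs.1,
      Real.norm_of_nonneg (by linarith [hs.2])]
    nlinarith [hs.1, hs.2]
  have hbd : ∀ s ∈ Set.Ioo (0 : ℝ) 1, ((starRingEnd ℂ) Δ * (w (p s) - w z'')).re ≤
      2 * L * (‖z'' - z‖ ^ 2 + ‖Δ‖ ^ 2) := by
    intro s hs
    refine (Complex.re_le_norm _).trans ?_
    rw [norm_mul, RCLike.norm_conj]
    have h1 := hL _ _ (hK s ⟨hs.1.le, hs.2.le⟩) hz''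
    have h2 : ‖p s - z''‖ ≤ ‖Δ‖ + ‖z'' - z‖ := by
      rw [show p s - z'' = (s : ℂ) * Δ - (z'' - z) by simp only [hp]; ring]
      refine (norm_sub_le _ _).trans (add_le_add ?_ le_rfl)
      rw [norm_mul, Complex.norm_real, Real.norm_of_nonneg hs.1.le]
      exact mul_le_of_le_one_left (norm_nonneg _) hs.2.le
    have h3 : ‖w (p s) - w z''‖ ≤ L * (‖Δ‖ + ‖z'' - z‖) :=
      h1.trans (mul_le_mul_of_nonneg_left h2 hL0)
    calc ‖Δ‖ * ‖w (p s) - w z''‖ ≤ ‖Δ‖ * (L * (‖Δ‖ + ‖z'' - z‖)) :=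
          mul_le_mul_of_nonneg_left h3 (norm_nonneg _)
      _ = L * (‖Δ‖ ^ 2 + ‖Δ‖ * ‖z'' - z‖) := by ring
      _ ≤ L * (2 * (‖z'' - z‖ ^ 2 + ‖Δ‖ ^ 2)) := by
          refine mul_le_mul_of_nonneg_left ?_ hL0
          nlinarith [sq_nonneg (‖Δ‖ - ‖z'' - z‖), sq_nonneg ‖Δ‖, sq_nonneg ‖z'' - z‖]
      _ = _ := by ring
  obtain ⟨s, hs, hslope⟩ := exists_hasDerivAt_eq_slope φ _ zero_lt_one
    (fun s _ => (hφ' s).continuousAt.continuousWithinAt) fun s _ => hφ' s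
  have h1 := hbd s hs
  rw [hslope] at h1
  have e0 : φ 0 = powerPotential σ c d z := by simp [hφ, hp]
  have e1 : φ 1 = powerPotential σ c d z' - ((starRingEnd ℂ) Δ * w z'').re := by
    simp only [hφ, hp, Complex.ofReal_one, one_mul]
    rw [show z + Δ = z' by simp only [hΔ]; ring]
  rw [e0, e1, sub_zero, div_one] at h1
  linarith

/-! ### Regularity and forcing in the rotating frame -/

theorem halfSeminorm_const_lt_top (c : ℂ) (T : ℝ) : halfSeminorm (fun _ => c) T < ∞ :=
  halfSeminorm_lt_top_of_le (C := 0) fun s t _ _ _ => by simp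

theorem halfSeminorm_ofReal_lt_top (T : ℝ) : halfSeminorm (fun t => (t : ℂ)) T < ∞ := by
  refine halfSeminorm_lt_top_of_le (C := T ^ (1 / 4 : ℝ)) fun s t hs hst htT => ?_
  rw [← Complex.ofReal_sub, Complex.norm_real, Real.norm_of_nonneg (by linarith)]
  refine le_mul_of_one_le_left (by linarith) ?_
  rw [Real.rpow_neg hs.le, ← div_eq_mul_inv, one_le_div (Real.rpow_pos_of_pos hs _)]
  exact Real.rpow_le_rpow hs.le (hst.trans htT) (by norm_num)

theorem norm_cexp_neg_I_mul_sub_le (lam s t : ℝ) :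
    ‖Complex.exp (-(Complex.I * lam * t)) - Complex.exp (-(Complex.I * lam * s))‖ ≤
      |lam| * |t - s| := by
  have h := (convex_univ (𝕜 := ℝ) (E := ℝ)).norm_image_sub_le_of_norm_hasDerivWithin_le
    (C := |lam|) (fun x _ => (hasDerivAt_cexp_neg_I_mul lam x).hasDerivWithinAt)
    (fun x _ => by
      rw [norm_mul, norm_cexp_neg_I_mul, one_mul, norm_neg, norm_mul, Complex.norm_I, one_mul,
        Complex.norm_real, Real.norm_eq_abs])
    (Set.mem_univ s) (Set.mem_univ t)
  simpa [Real.norm_eq_abs] using h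

/-- The rotation is Lipschitz and `q` is bounded, so the rotation adds to an increment at most a
multiple of the step, that is, of the increment of `t ↦ t`. -/
theorem halfSeminorm_cexp_mul_lt_top {q u : ℝ → ℂ} (hq : Continuous q) {lam T : ℝ}
    (hu : ∀ t ∈ Set.Icc 0 T, u t = Complex.exp (-(Complex.I * lam * t)) * q t)
    (h : halfSeminorm q T < ∞) : halfSeminorm u T < ∞ := by
  obtain ⟨M, hM⟩ := isCompact_Icc.exists_bound_of_continuousOn (s := Set.Icc 0 T) hq.continuousOn
  set c : ℝ≥0∞ := ENNReal.ofReal (|lam| * M) with hc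
  have hct : c ≠ ∞ := ENNReal.ofReal_ne_top
  refine halfSeminorm_lt_top_of_diffSq_le (C := 4 + 4 * c ^ 2) hq
    (ENNReal.add_ne_top.2 ⟨by norm_num, ENNReal.mul_ne_top (by norm_num) (ENNReal.pow_ne_top hct)⟩)
    (fun k hk => ?_) h (halfSeminorm_ofReal_lt_top T)
  have hm1 : Measurable fun s => ‖q (s + k) - q s‖ₑ ^ 2 :=
    (by fun_prop : Continuous fun s => q (s + k) - q s).measurable.enorm.pow_const 2
  simp only [diffSq]
  rw [← lintegral_add_left hm1, ← lintegral_const_mul' _ _ (ENNReal.add_ne_top.2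
    ⟨by norm_num, ENNReal.mul_ne_top (by norm_num) (ENNReal.pow_ne_top hct)⟩)]
  refine setLIntegral_mono' measurableSet_Ioo fun s hs => ?_
  have hs0 : s ∈ Set.Icc 0 T := ⟨hs.1.le, by linarith [hs.2, hk.1]⟩
  have hs1 : s + k ∈ Set.Icc 0 T := ⟨by linarith [hs.1, hk.1], by linarith [hs.2]⟩
  have hle : ‖u (s + k) - u s‖ₑ ≤ ‖q (s + k) - q s‖ₑ + c * ‖((s + k : ℝ) : ℂ) - (s : ℂ)‖ₑ := by
    have h1 : ‖u (s + k) - u s‖ ≤ ‖q (s + k) - q s‖ + |lam| * M * ‖((s + k : ℝ) : ℂ) - (s : ℂ)‖ := by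
      rw [hu _ hs1, hu _ hs0, ← Complex.ofReal_sub, Complex.norm_real, Real.norm_eq_abs]
      set e1 := Complex.exp (-(Complex.I * lam * (s + k : ℝ))) with he1
      set e2 := Complex.exp (-(Complex.I * lam * s)) with he2
      rw [show e1 * q (s + k) - e2 * q s = e1 * (q (s + k) - q s) + (e1 - e2) * q s by ring]
      refine (norm_add_le _ _).trans (add_le_add ?_ ?_)
      · rw [norm_mul, he1, norm_cexp_neg_I_mul, one_mul]
      · rw [norm_mul]
        calc _ ≤ |lam| * |s + k - s| * M :=
              mul_le_mul (norm_cexp_neg_I_mul_sub_le lam s (s + k)) (hM s hs0) (norm_nonneg _)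
                (by positivity)
          _ = _ := by ring
    have hM0 : 0 ≤ M := (norm_nonneg _).trans (hM s hs0)
    simp only [← ofReal_norm, hc]
    rw [← ENNReal.ofReal_mul (by positivity), ← ENNReal.ofReal_add (by positivity) (by positivity)]
    exact ENNReal.ofReal_le_ofReal h1
  refine (pow_le_pow_left' hle 2).trans ((ennreal_add_sq_le _ _).trans ?_)
  rw [mul_pow, mul_add, add_mul, add_mul]
  refine add_le_add le_self_add ?_
  rw [← mul_assoc]
  exact le_add_self

theorem isEnergyBounded_oscIntegral {lam : ℝ} (hlam : 0 < lam) {m : Plane → ℂ} (hm : Integrable m)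
    (hm2 : ∫⁻ ξ, ENNReal.ofReal (lam + psq ξ) * ‖m ξ‖ₑ ^ 2 < ∞) {c : ℝ} (hc : 0 < c) :
    IsEnergyBounded lam (c * (2 * c * (∫⁻ ξ, ENNReal.ofReal (lam + psq ξ) * ‖m ξ‖ₑ ^ 2).toReal))
      fun t => c * (Complex.exp (-(Complex.I * lam * t)) * oscIntegral m t) := by
  intro f hf hfE x
  -- The choice `θ = 1/(2c)` leaves, after scaling by `c`, half of the energy, the share that can be
  -- absorbed.
  have h := two_mul_norm_integral_conj_mul_oscIntegral_le hlam hf hfE hm hm2 x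
    (θ := 1 / (2 * c)) (by positivity)
  simp only [mul_left_comm _ (c : ℂ)]
  rw [integral_const_mul, norm_mul, Complex.norm_real, Real.norm_of_nonneg hc.le]
  have h2 := mul_le_mul_of_nonneg_left h hc.le
  have e : c * (1 / (2 * c) * (energy lam f).toReal) = (energy lam f).toReal / 2 := by field_simp
  rw [mul_add, e, one_div, inv_inv] at h2
  linarith

/-! ### The charge equation -/

/-- The forcing term of the charge equation after removal of its singular part. -/
def chargeForcing (lam : ℝ) (m : Plane → ℂ) (q₀ r₀ : ℂ) (τ : ℝ) : ℂ :=
  4 * Real.pi * oscIntegral m τ + q₀ * (r₀ + Complex.I * lam * greenPrim lam τ)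

/-- The vector field of the charge equation. -/
def chargeField (β₀ σ : ℝ) (z : ℂ) : ℂ := 4 * Real.pi * β₀ * powerNonlinearity σ z + kappa * z

theorem continuous_chargeForcing {lam : ℝ} (hlam : 0 < lam) {m : Plane → ℂ} (hm : Integrable m)
    (q₀ r₀ : ℂ) : Continuous (chargeForcing lam m q₀ r₀) := by
  have h1 := continuous_oscIntegral hm
  have h2 := continuous_greenPrim hlam
  unfold chargeForcing
  fun_prop

theorem halfSeminorm_chargeForcing_lt_top {lam : ℝ} (hlam : 0 < lam) {m : Plane → ℂ}
    (hm : Integrable m) (h2 : ∫⁻ ξ, ENNReal.ofReal (psq ξ) * ‖m ξ‖ₑ ^ 2 < ∞) (q₀ r₀ : ℂ) (T : ℝ) :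
    halfSeminorm (chargeForcing lam m q₀ r₀) T < ∞ := by
  have e : chargeForcing lam m q₀ r₀ = fun t => 4 * Real.pi * oscIntegral m t +
      (q₀ * r₀ + q₀ * (Complex.I * lam) * greenPrim lam t) := by
    funext t
    rw [chargeForcing]
    ring
  have h1 := continuous_oscIntegral hm
  rw [e]
  exact halfSeminorm_add_lt_top (by fun_prop)
    (halfSeminorm_const_mul_lt_top _ (halfSeminorm_oscIntegral_lt_top hm h2 T))
    (halfSeminorm_add_lt_top continuous_const (halfSeminorm_const_lt_top _ T)
      (halfSeminorm_const_mul_lt_top _ (halfSeminorm_greenPrim_lt_top hlam T)))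

theorem isLipschitzOnBounded_chargeField (β₀ : ℝ) {σ : ℝ} (hσ : 1 / 2 ≤ σ) :
    IsLipschitzOnBounded (chargeField β₀ σ) :=
  (isLipschitzOnBounded_powerNonlinearity hσ).const_mul_add _ _

/-- The value at `t` of a function on `[0, b]` extended by constants. -/
def clampExtend (b : ℝ) (q : ℝ → ℂ) (t : ℝ) : ℂ := q (max 0 (min t b))

theorem continuous_clampExtend {b : ℝ} (hb : 0 ≤ b) {q : ℝ → ℂ} (hq : ContinuousOn q (Set.Icc 0 b)) :
    Continuous (clampExtend b q) :=
  hq.comp_continuous (by fun_prop) fun _ => ⟨le_max_left _ _, max_le hb (min_le_right _ _)⟩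

theorem clampExtend_eq {b : ℝ} (q : ℝ → ℂ) {t : ℝ} (ht : t ∈ Set.Icc 0 b) :
    clampExtend b q t = q t := by
  rw [clampExtend, min_eq_left ht.2, max_eq_right ht.1]

theorem clampExtend_of_nonpos {b : ℝ} (hb : 0 ≤ b) (q : ℝ → ℂ) {t : ℝ} (ht : t ≤ 0) :
    clampExtend b q t = q 0 := by
  rw [clampExtend, min_eq_left (ht.trans hb), max_eq_left ht]

theorem volterraOp_congr {f g : ℝ → ℂ} {t : ℝ} (ht : 0 ≤ t) (h : ∀ x ∈ Set.Ioo 0 t, f x = g x) :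
    volterraOp f t = volterraOp g t :=
  cconv_congr_right (f := volterraK) ht h

/-- Solutions of the regularised equation, in convolution form. -/
theorem IsVolterraSolution.clampExtend_eq_add {lam β₀ σ : ℝ} (hlam : 0 < lam) (hσ : 1 / 2 ≤ σ)
    {m : Plane → ℂ} (hm : Integrable m) {q₀ r₀ : ℂ} {b : ℝ} (hb : 0 ≤ b) {q : ℝ → ℂ}
    (hq : IsVolterraSolution (fun t => q₀ + volterraOp (chargeForcing lam m q₀ r₀) t)
      (chargeField β₀ σ) b q) : ∀ t ∈ Set.Icc 0 b, clampExtend b q t = q₀ +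
        volterraOp (fun τ => chargeForcing lam m q₀ r₀ τ - chargeField β₀ σ (clampExtend b q τ)) t := by
  intro t ht
  have hc := continuous_clampExtend hb hq.cont
  have hW := (isLipschitzOnBounded_chargeField β₀ hσ).continuous
  rw [clampExtend_eq q ht, hq.eq t ht, volterraOp_sub
    (g' := fun τ => chargeField β₀ σ (clampExtend b q τ)) ht.1
    (continuous_chargeForcing hlam hm q₀ r₀).continuousOn (hW.comp hc).continuousOn, add_sub_assoc]
  congr 2
  refine volterraOp_congr ht.1 fun x hx => ?_
  rw [clampExtend_eq q ⟨hx.1.le, hx.2.le.trans ht.2⟩]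

theorem IsVolterraSolution.halfSeminorm_lt_top {lam β₀ σ : ℝ} (hlam : 0 < lam) (hσ : 1 / 2 ≤ σ)
    {m : Plane → ℂ} (hm : Integrable m) (h2 : ∫⁻ ξ, ENNReal.ofReal (psq ξ) * ‖m ξ‖ₑ ^ 2 < ∞)
    {q₀ r₀ : ℂ} {b : ℝ} (hb : 0 < b) {q : ℝ → ℂ}
    (hq : IsVolterraSolution (fun t => q₀ + volterraOp (chargeForcing lam m q₀ r₀) t)
      (chargeField β₀ σ) b q) : halfSeminorm (clampExtend b q) b < ∞ := by
  have hc := continuous_clampExtend hb.le hq.cont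
  have hlip := isLipschitzOnBounded_chargeField β₀ hσ
  obtain ⟨M, hM⟩ := isCompact_Icc.exists_bound_of_continuousOn (s := Set.Icc 0 b) hc.continuousOn
  obtain ⟨L, hL0, hL⟩ := hlip M
  refine halfSeminorm_lt_top_of_volterra (continuous_chargeForcing hlam hm q₀ r₀) hc
    ((continuous_chargeForcing hlam hm q₀ r₀).sub (hlip.continuous.comp hc)) hb hL0
    (fun u hu v hv => ?_) (hq.clampExtend_eq_add hlam hσ hm hb.le)
    (halfSeminorm_chargeForcing_lt_top hlam hm h2 q₀ r₀ b)
  simp only [Pi.sub_apply, Function.comp]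
  rw [sub_sub_sub_comm]
  exact (norm_sub_le _ _).trans (add_le_add le_rfl (hL _ _ (hM u hu) (hM v hv)))

theorem powerNonlinearity_mul {σ : ℝ} {e : ℂ} (he : ‖e‖ = 1) (z : ℂ) :
    powerNonlinearity σ (e * z) = e * powerNonlinearity σ z := by
  rw [powerNonlinearity, powerNonlinearity, norm_mul, he, one_mul, mul_left_comm]

/-- The same value as the imaginary part of `r₀`, so `kappa - r₀` is real and the linear part of the
rotating field is a gradient. -/
theorem kappa_im : kappa.im = -(Real.pi / 2) := by
  have e : kappa = ((-2 * (Real.log 2 - Real.eulerMascheroniConstant) : ℝ) : ℂ) +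
      ((-(Real.pi / 2) : ℝ) : ℂ) * Complex.I := by
    rw [kappa]
    push_cast
    ring
  rw [e, Complex.add_im, Complex.ofReal_im, Complex.im_ofReal_mul, Complex.I_im]
  ring

/-- Passage to the rotating frame. -/
theorem IsVolterraSolution.isRotatingSolution {lam β₀ σ : ℝ} (hlam : 0 < lam) (hσ : 1 / 2 ≤ σ)
    {m : Plane → ℂ} (hm : Integrable m) {q₀ r₀ : ℂ} (hri : r₀.im = -(Real.pi / 2))
    (hr : ∀ t > 0, greenTrace lam 0 t = logKernel (-r₀) t + Complex.I * lam *
      ∫ x in (0 : ℝ)..t, greenTrace lam 0 x) {b : ℝ} (hb : 0 ≤ b) {q : ℝ → ℂ}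
    (hq : IsVolterraSolution (fun t => q₀ + volterraOp (chargeForcing lam m q₀ r₀) t)
      (chargeField β₀ σ) b q) :
    IsRotatingSolution lam
      (fun t => (4 * Real.pi : ℝ) * (Complex.exp (-(Complex.I * lam * t)) * oscIntegral m t))
      (fun z => ((4 * Real.pi * β₀ : ℝ) : ℂ) * powerNonlinearity σ z + ((kappa - r₀).re : ℂ) * z) b
      (fun t => Complex.exp (-(Complex.I * lam * (max t 0 : ℝ))) * clampExtend b q t) := by
  have hc := continuous_clampExtend hb hq.cont
  have hpc := (isLipschitzOnBounded_powerNonlinearity hσ).continuous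
  have hoc := continuous_oscIntegral hm
  have hϑ : ((kappa - r₀).re : ℂ) = kappa - r₀ := by
    refine Complex.ext (by simp) ?_
    rw [Complex.ofReal_im, Complex.sub_im, kappa_im, hri, sub_self]
  have hsol := hq.clampExtend_eq_add hlam hσ hm hb
  have hq0 : clampExtend b q 0 = q₀ := by
    rw [hsol 0 ⟨le_rfl, hb⟩]
    simp [volterraOp]
  refine ⟨by fun_prop, fun t ht => ?_, fun t ht => ?_⟩
  · simp only [max_eq_right ht, max_self]
    rw [clampExtend_of_nonpos hb q ht, clampExtend_of_nonpos hb q le_rfl]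
  · set N : ℝ → ℂ := fun τ => 4 * Real.pi * oscIntegral m τ -
      (4 * Real.pi * β₀ * powerNonlinearity σ (clampExtend b q τ) +
        (kappa - r₀) * clampExtend b q τ) with hN
    have hNc : Continuous N := by fun_prop
    have heq : ∀ t ∈ Set.Icc 0 b, clampExtend b q t = q₀ + volterraOp (fun τ => N τ -
        r₀ * (clampExtend b q τ - q₀) + Complex.I * lam * q₀ * greenPrim lam τ) t := by
      intro t ht
      refine (hsol t ht).trans ?_
      congr 2
      funext τ
      simp only [chargeForcing, chargeField, hN]
      ring
    have hmain := cconv_eKer_sub hlam hr hc hNc heq ht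
    simp only [max_self, Complex.ofReal_zero, mul_zero, neg_zero, Complex.exp_zero, one_mul, hq0]
    refine (cconv_congr_right ht.1 fun x hx => ?_).trans (hmain.trans
      (intervalIntegral.integral_congr fun x hx => ?_))
    · simp only [max_eq_left hx.1.le]
    · rw [Set.uIcc_of_le ht.1] at hx
      simp only [max_eq_left hx.1, hN]
      rw [powerNonlinearity_mul (norm_cexp_neg_I_mul lam x), hϑ]
      push_cast
      ring

/-- The charge equation is equivalent to its regularised form. -/
theorem charge_eq_iff {lam β₀ σ : ℝ} (hlam : 0 < lam) (hσ : 1 / 2 ≤ σ) {y : Plane} {ψ₀ : L2Plane}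
    {m : Plane → ℂ} (hm : Integrable m) {q₀ r₀ : ℂ}
    (hr : ∀ t > 0, greenTrace lam 0 t = logKernel (-r₀) t + Complex.I * lam *
      ∫ x in (0 : ℝ)..t, greenTrace lam 0 x)
    (hfree : ∀ τ > 0, freeEvolutionAt ψ₀ y τ =
      oscIntegral m τ + q₀ * (1 / (4 * Real.pi) * greenTrace lam 0 τ)) {t : ℝ} (ht : 0 < t)
    {q : ℝ → ℂ} (hq : ContinuousOn q (Set.Icc 0 t)) :
    q t + 4 * (Real.pi : ℂ) * (β₀ : ℂ) * volterraOp (fun τ => powerNonlinearity σ (q τ)) t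
        + kappa * volterraOp q t = 4 * (Real.pi : ℂ) * volterraOp (freeEvolutionAt ψ₀ y) t ↔
      q t = q₀ + volterraOp (chargeForcing lam m q₀ r₀) t -
        volterraOp (fun τ => chargeField β₀ σ (q τ)) t := by
  have hpc := (isLipschitzOnBounded_powerNonlinearity hσ).continuous
  have hgc := continuous_chargeForcing hlam hm q₀ r₀
  have e1 : volterraOp (fun τ => chargeField β₀ σ (q τ)) t =
      4 * (Real.pi : ℂ) * (β₀ : ℂ) * volterraOp (fun τ => powerNonlinearity σ (q τ)) t +
        kappa * volterraOp q t := by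
    have i1 := intervalIntegrable_volterra (g := fun τ => powerNonlinearity σ (q τ)) ht.le
      (hpc.comp_continuousOn hq)
    have i2 := intervalIntegrable_volterra ht.le hq
    simp only [volterraOp_eq_cconv, cconv]
    rw [← intervalIntegral.integral_const_mul, ← intervalIntegral.integral_const_mul,
      ← intervalIntegral.integral_add (i1.const_mul _) (i2.const_mul _)]
    refine intervalIntegral.integral_congr fun x _ => ?_
    simp only [chargeField]
    ring
  -- By the Sonine identity the logarithmic singularity of the free evolution integrates to the
  -- constant `q₀`; what is left, `r₀` plus `iλ` times the primitive of the Green trace, is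
  -- continuous and joins the forcing.
  have e2 : 4 * (Real.pi : ℂ) * volterraOp (freeEvolutionAt ψ₀ y) t =
      q₀ + volterraOp (chargeForcing lam m q₀ r₀) t := by
    have hs := cconv_volterraCexp_logKernel 0 ht
    rw [← volterraK_eq] at hs
    have i1 := isLocKernel_volterraK.intervalIntegrable_mul (isLocKernel_logKernel 0) ht
    have i2 := intervalIntegrable_volterra ht.le hgc.continuousOn
    rw [show q₀ + volterraOp (chargeForcing lam m q₀ r₀) t =
      q₀ * cconv volterraK (logKernel 0) t + volterraOp (chargeForcing lam m q₀ r₀) t by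
        rw [hs, mul_one], volterraOp_congr ht.le fun x hx => hfree x hx.1]
    simp only [volterraOp_eq_cconv, cconv]
    rw [← intervalIntegral.integral_const_mul, ← intervalIntegral.integral_const_mul,
      ← intervalIntegral.integral_add (i1.const_mul _) i2, intervalIntegral.integral_of_le ht.le,
      intervalIntegral.integral_of_le ht.le, integral_Ioc_eq_integral_Ioo,
      integral_Ioc_eq_integral_Ioo]
    refine setIntegral_congr_fun measurableSet_Ioo fun x hx => ?_
    have hpi : (Real.pi : ℂ) ≠ 0 := Complex.ofReal_ne_zero.2 Real.pi_ne_zero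
    simp only [chargeForcing]
    rw [hr x hx.1, greenPrim_eq lam hx.1.le]
    simp only [logKernel]
    field_simp
    ring
  rw [e1, e2, add_assoc]
  exact eq_sub_iff_add_eq.symm

theorem isChargeSolution_of_isVolterraSolution {lam β₀ σ : ℝ} (hlam : 0 < lam) (hσ : 1 / 2 ≤ σ)
    {y : Plane} {ψ₀ : L2Plane} {m : Plane → ℂ} (hm : Integrable m) {q₀ r₀ : ℂ}
    (hr : ∀ t > 0, greenTrace lam 0 t = logKernel (-r₀) t + Complex.I * lam *
      ∫ x in (0 : ℝ)..t, greenTrace lam 0 x)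
    (hfree : ∀ τ > 0, freeEvolutionAt ψ₀ y τ =
      oscIntegral m τ + q₀ * (1 / (4 * Real.pi) * greenTrace lam 0 τ)) {T : EReal} {q : ℝ → ℂ}
    (hq : ∀ b : ℝ, (b : EReal) < T → IsVolterraSolution
      (fun t => q₀ + volterraOp (chargeForcing lam m q₀ r₀) t) (chargeField β₀ σ) b q) :
    IsChargeSolution β₀ σ y ψ₀ T q := by
  constructor
  · intro t ht
    obtain ⟨b, htb, hbT⟩ := EReal.lt_iff_exists_real_btwn.1 ht.2
    have htb' : t < b := EReal.coe_lt_coe_iff.1 htb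
    refine ((hq b hbT).cont t ⟨ht.1, htb'.le⟩).mono_of_mem_nhdsWithin ?_
    filter_upwards [self_mem_nhdsWithin, mem_nhdsWithin_of_mem_nhds (Iio_mem_nhds htb')] with x h1 h2
    exact ⟨h1.1, le_of_lt h2⟩
  · intro t ht ht0
    have h := hq t ht.2
    exact (charge_eq_iff hlam hσ hm hr hfree ht0 h.cont).2 (h.eq t ⟨ht0.le, le_rfl⟩)

/-- The charge equation is required at positive times only; both sides of the regularised equation
are continuous on `[0, b]`, so it extends to `t = 0` by density. -/
theorem IsChargeSolution.isVolterraSolution {lam β₀ σ : ℝ} (hlam : 0 < lam) (hσ : 1 / 2 ≤ σ)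
    {y : Plane} {ψ₀ : L2Plane} {m : Plane → ℂ} (hm : Integrable m) {q₀ r₀ : ℂ}
    (hr : ∀ t > 0, greenTrace lam 0 t = logKernel (-r₀) t + Complex.I * lam *
      ∫ x in (0 : ℝ)..t, greenTrace lam 0 x)
    (hfree : ∀ τ > 0, freeEvolutionAt ψ₀ y τ =
      oscIntegral m τ + q₀ * (1 / (4 * Real.pi) * greenTrace lam 0 τ)) {T : EReal} {q : ℝ → ℂ}
    (hq : IsChargeSolution β₀ σ y ψ₀ T q) {b : ℝ} (hb : 0 < b) (hbT : (b : EReal) < T) :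
    IsVolterraSolution (fun t => q₀ + volterraOp (chargeForcing lam m q₀ r₀) t)
      (chargeField β₀ σ) b q := by
  have hsub : Set.Icc 0 b ⊆ timeInterval T := fun t ht =>
    ⟨ht.1, lt_of_le_of_lt (EReal.coe_le_coe_iff.2 ht.2) hbT⟩
  have hcont : ContinuousOn q (Set.Icc 0 b) := hq.1.mono hsub
  have hW := (isLipschitzOnBounded_chargeField β₀ hσ).continuous
  have hpos : ∀ t ∈ Set.Ioc 0 b, q t = q₀ + volterraOp (chargeForcing lam m q₀ r₀) t -
      volterraOp (fun τ => chargeField β₀ σ (q τ)) t := fun t ht =>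
    (charge_eq_iff hlam hσ hm hr hfree ht.1 (hcont.mono (Set.Icc_subset_Icc_right ht.2))).1
      (hq.2 t (hsub ⟨ht.1.le, ht.2⟩) ht.1)
  have hRc : ContinuousOn (fun t => q₀ + volterraOp (chargeForcing lam m q₀ r₀) t -
      volterraOp (fun τ => chargeField β₀ σ (q τ)) t) (Set.Icc 0 b) :=
    (continuousOn_const.add (continuousOn_volterraOp
      (continuous_chargeForcing hlam hm q₀ r₀).continuousOn)).sub
      (continuousOn_volterraOp (hW.comp_continuousOn hcont))
  refine ⟨hcont, fun t ht => ?_⟩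
  have hcl : Set.Icc 0 b ⊆ closure (Set.Ioc 0 b) := by rw [closure_Ioc hb.ne]
  exact Set.EqOn.of_subset_closure (fun t ht => hpos t ht) hcont hRc Set.Ioc_subset_Icc_self hcl ht

theorem isLocKernel_freeEvolutionAt {lam : ℝ} (hlam : 0 < lam) {y : Plane} {ψ₀ : L2Plane}
    {m : Plane → ℂ} (hm : Integrable m) {q₀ : ℂ} (hfree : ∀ τ > 0, freeEvolutionAt ψ₀ y τ =
      oscIntegral m τ + q₀ * (1 / (4 * Real.pi) * greenTrace lam 0 τ)) :
    IsLocKernel (freeEvolutionAt ψ₀ y) := by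
  have h := (IsLocKernel.of_continuous (continuous_oscIntegral hm)).add
    (((isLocKernel_greenTrace hlam).const_mul (1 / (4 * Real.pi))).const_mul q₀)
  exact h.mono (h.meas.congr ((ae_restrict_iff' measurableSet_Ioi).2
    (ae_of_all _ fun t ht => (hfree t ht).symm))) fun t ht => by rw [hfree t ht]

theorem MemHFrac.congr {ν a b : ℝ} {f g : ℝ → ℂ} (hf : MemHFrac ν a b f)
    (h : Set.EqOn f g (Set.Ioo a b)) : MemHFrac ν a b g := by
  refine ⟨hf.1.ae_eq ((ae_restrict_iff' measurableSet_Ioo).2 (ae_of_all _ h)),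
    lt_of_le_of_lt (le_of_eq ?_) hf.2⟩
  refine setLIntegral_congr_fun measurableSet_Ioo fun t ht => ?_
  refine setLIntegral_congr_fun measurableSet_Ioo fun s hs => ?_
  rw [h ht, h hs]

/-- If `|q|` does not tend to infinity, it lies below some `K` at times accumulating at `T`, and the
energy argument in the rotating frame then bounds it on all of `[0, T)`. -/
theorem tendsto_norm_atTop_of_unbounded {lam β₀ σ : ℝ} (hlam : 0 < lam) (hσ : 1 / 2 ≤ σ)
    {m : Plane → ℂ} (hm : Integrable m) (h2 : ∫⁻ ξ, ENNReal.ofReal (psq ξ) * ‖m ξ‖ₑ ^ 2 < ∞)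
    (h3 : ∫⁻ ξ, ‖m ξ‖ₑ ^ 2 < ∞) {q₀ r₀ : ℂ} (hri : r₀.im = -(Real.pi / 2))
    (hr : ∀ t > 0, greenTrace lam 0 t = logKernel (-r₀) t + Complex.I * lam *
      ∫ x in (0 : ℝ)..t, greenTrace lam 0 x) {T : ℝ} (hT : 0 < T) {q : ℝ → ℂ}
    (hq : ∀ b < T, IsVolterraSolution
      (fun t => q₀ + volterraOp (chargeForcing lam m q₀ r₀) t) (chargeField β₀ σ) b q)
    (hunb : ¬ ∃ M, ∀ t ∈ Set.Ico 0 T, ‖q t‖ ≤ M) : Tendsto (fun t => ‖q t‖) (𝓝[<] T) atTop := by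
  by_contra hcon
  rw [tendsto_atTop] at hcon
  push Not at hcon
  obtain ⟨K, hK⟩ := hcon
  have hm2 : ∫⁻ ξ, ENNReal.ofReal (lam + psq ξ) * ‖m ξ‖ₑ ^ 2 < ∞ := by
    refine lt_of_le_of_lt (lintegral_mono fun ξ => mul_le_mul' ENNReal.ofReal_add_le le_rfl) ?_
    simp only [add_mul]
    have hmeas : AEMeasurable (fun ξ => ENNReal.ofReal lam * ‖m ξ‖ₑ ^ 2) :=
      (hm.aestronglyMeasurable.enorm.pow_const 2).const_mul _
    rw [lintegral_add_left' hmeas, lintegral_const_mul' _ _ ENNReal.ofReal_ne_top]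
    exact ENNReal.add_lt_top.2 ⟨ENNReal.mul_lt_top ENNReal.ofReal_lt_top h3, h2⟩
  have hoc := continuous_oscIntegral hm
  have hpc := (isLipschitzOnBounded_powerNonlinearity hσ).continuous
  have hqc : ContinuousOn q (Set.Ico 0 T) := fun t ht => by
    obtain ⟨b, htb, hbT⟩ := exists_between ht.2
    refine ((hq b hbT).cont t ⟨ht.1, htb.le⟩).mono_of_mem_nhdsWithin ?_
    filter_upwards [self_mem_nhdsWithin, mem_nhdsWithin_of_mem_nhds (Iio_mem_nhds htb)] with x h1 h2
    exact ⟨h1.1, le_of_lt h2⟩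
  set v : ℝ → ℂ := fun t => Complex.exp (-(Complex.I * lam * t)) * q t with hv
  have hvn : ∀ t, ‖v t‖ = ‖q t‖ := fun t => by
    simp only [hv]
    rw [norm_mul, norm_cexp_neg_I_mul, one_mul]
  have hvc : ContinuousOn v (Set.Ico 0 T) := (by fun_prop : Continuous fun t : ℝ =>
    Complex.exp (-(Complex.I * lam * t))).continuousOn.mul hqc
  obtain ⟨M, hM⟩ := exists_bound_of_frequently hlam hr
    (S := fun t => (4 * Real.pi : ℝ) * (Complex.exp (-(Complex.I * lam * t)) * oscIntegral m t))
    (by fun_prop) (isEnergyBounded_oscIntegral hlam hm hm2 (by positivity))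
    (w := fun z => ((4 * Real.pi * β₀ : ℝ) : ℂ) * powerNonlinearity σ z + ((kappa - r₀).re : ℂ) * z)
    (by fun_prop) (continuous_powerPotential hσ _ _) (isPotential_powerPotential hσ _ _) hT hvc
    (fun b hb => by
      have hsol := hq b hb.2
      have hrot := hsol.isRotatingSolution hlam hσ hm hri hr hb.1.le
      have heq : ∀ t ∈ Set.Icc 0 b, Complex.exp (-(Complex.I * lam * (max t 0 : ℝ))) *
          clampExtend b q t = Complex.exp (-(Complex.I * lam * t)) * clampExtend b q t :=
        fun t ht => by rw [max_eq_left ht.1]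
      refine ⟨_, hrot, halfSeminorm_cexp_mul_lt_top (continuous_clampExtend hb.1.le hsol.cont) heq
        (hsol.halfSeminorm_lt_top hlam hσ hm h2 hb.1), fun t ht => ?_⟩
      simp only [hv]
      rw [heq t ht, clampExtend_eq q ht])
    (K := K) (hK.mono fun t ht => by rw [hvn]; exact le_of_lt ht)
  exact hunb ⟨M, fun t ht => by rw [← hvn]; exact hM t ht⟩

end PointNLS

end

/-! ### The main theorem -/

theorem mainTheorem5 (β₀ σ : ℝ) (hσ : 1 / 2 ≤ σ) (y : PointNLS.Plane)
    {lam : ℝ} (hlam : 0 < lam) (ψ₀ : PointNLS.L2Plane)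
    (hψ₀ : ψ₀ ∈ PointNLS.initialData hlam y) :
    -- the right-hand side of the charge equation is well defined
    (∀ τ : ℝ, 0 < τ → PointNLS.HasContinuousRep (PointNLS.freePropagator τ ψ₀)) ∧
    (∀ t : ℝ, 0 < t → IntervalIntegrable
      (fun τ => (PointNLS.volterraKernel (t - τ) : ℂ) * PointNLS.freeEvolutionAt ψ₀ y τ)
      volume 0 t) ∧
    ∃ (Tstar : EReal) (q : ℝ → ℂ), 0 < Tstar ∧
      -- existence on `[0, Tstar)`
      PointNLS.IsChargeSolution β₀ σ y ψ₀ Tstar q ∧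
      -- uniqueness and maximality
      (∀ (T : EReal) (q' : ℝ → ℂ), 0 < T → PointNLS.IsChargeSolution β₀ σ y ψ₀ T q' →
        T ≤ Tstar ∧ Set.EqOn q' q (PointNLS.timeInterval T)) ∧
      -- blow-up alternative
      (Tstar = ⊤ ∨ ∃ T : ℝ, Tstar = (T : EReal) ∧
        Tendsto (fun t => ‖q t‖) (𝓝[<] T) atTop) ∧
      -- Sobolev regularity on every shorter interval
      (∀ T : ℝ, 0 < T → (T : EReal) < Tstar → PointNLS.MemHFrac (1 / 2) 0 T q) := by

  obtain ⟨m, q₀, hm, h2, h3, hrep⟩ := PointNLS.exists_freeEvolutionAt_eq hlam hψ₀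
  obtain ⟨r₀, hri, hr⟩ := PointNLS.exists_greenTrace_eq hlam
  have hfree := fun τ hτ => (hrep τ hτ).2
  obtain ⟨Tstar, q, hT0, hsol, huniq, hunb⟩ := PointNLS.exists_maximal_isVolterraSolution
    (F := fun t => q₀ + PointNLS.volterraOp (PointNLS.chargeForcing lam m q₀ r₀) t)
    (W := PointNLS.chargeField β₀ σ)
    (fun t ht => by
      have h := (continuousOn_const (c := q₀)).add (PointNLS.continuousOn_volterraOp (T := t + 1)
        (PointNLS.continuous_chargeForcing hlam hm q₀ r₀).continuousOn)
      refine (h t ⟨ht, by linarith⟩).mono_of_mem_nhdsWithin ?_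
      filter_upwards [self_mem_nhdsWithin, mem_nhdsWithin_of_mem_nhds (Iio_mem_nhds (lt_add_one t))]
        with x h1 h2
      exact ⟨h1, le_of_lt h2⟩)
    (PointNLS.isLipschitzOnBounded_chargeField β₀ hσ)
  refine ⟨fun τ hτ => (hrep τ hτ).1, fun t ht =>
    PointNLS.isLocKernel_volterraK.intervalIntegrable_mul
      (PointNLS.isLocKernel_freeEvolutionAt hlam hm hfree) ht, Tstar, q, hT0,
    PointNLS.isChargeSolution_of_isVolterraSolution hlam hσ hm hr hfree hsol,
    fun T q' hT hq' => ?_, ?_, fun T hT hTs => ?_⟩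
  · have hV := fun (b : ℝ) (hb : 0 < b) (hbT : (b : EReal) < T) =>
      huniq b q' hb.le (hq'.isVolterraSolution hlam hσ hm hr hfree hb hbT)
    refine ⟨le_of_not_gt fun hlt => ?_, fun t ht => ?_⟩
    · obtain ⟨b, h1, h2⟩ := EReal.lt_iff_exists_real_btwn.1 hlt
      have hb : 0 < b := EReal.coe_pos.1 (hT0.trans h1)
      exact lt_asymm h1 (hV b hb h2).1
    · obtain ⟨b, h1, h2⟩ := EReal.lt_iff_exists_real_btwn.1 ht.2
      have htb : t < b := EReal.coe_lt_coe_iff.1 h1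
      exact (hV b (ht.1.trans_lt htb) h2).2 ⟨ht.1, htb.le⟩
  · rcases eq_or_ne Tstar ⊤ with h | h
    · exact Or.inl h
    · have hbot : Tstar ≠ ⊥ := (lt_of_le_of_lt bot_le hT0).ne'
      have hTr : Tstar = (Tstar.toReal : EReal) := (EReal.coe_toReal h hbot).symm
      refine Or.inr ⟨Tstar.toReal, hTr, ?_⟩
      refine PointNLS.tendsto_norm_atTop_of_unbounded hlam hσ hm h2 h3 hri hr
        (EReal.coe_pos.1 (hTr ▸ hT0)) (fun b hb => hsol b ?_) (hunb _ hTr)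
      rw [hTr]
      exact EReal.coe_lt_coe_iff.2 hb
  · have hs := hsol T hTs
    exact (PointNLS.memHFrac_of_halfSeminorm_lt_top
      (PointNLS.continuous_clampExtend hT.le hs.cont)
      (hs.halfSeminorm_lt_top hlam hσ hm h2 hT)).congr fun t ht =>
        PointNLS.clampExtend_eq q ⟨ht.1.le, ht.2.le⟩
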